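/- **Setting.** Fix an autoregression order $p\ge 0$, a period $T\ge 1$, constants $a,b^{(1)},b^{(2)},\nu>0$, an integer $M\ge 0$ and $d>0$ with $M\le 1/d$. A relative changepoint configuration is $\boldsymbol\lambda=(\lambda_1,\dots,\lambda_m)$; put $\lambda_0=0$, $\lambda_{m+1}=1$. Let $\boldsymbol\Lambda$ be the set of all $\boldsymbol\lambda$ with $0\le m\le M$ and $\lambda_r-\lambda_{r-1}\ge d$ for $r=1,\dots,m+1$. For sample size $N$ put $\tau_0=1$, $\tau_r=\lfloor\lambda_rN\rfloor$ ($1\le r\le m$), $\tau_{m+1}=N+1$; time $t$ is in regime $r$ if $\tau_{r-1}\le t<\tau_r$, and in season $v(t)=t-T\lfloor (t-1)/T\rfloor$. Let $\mathbf A\in\mathbb R^{N\times T}$ be the matrix of season indicators and $\mathbf D\in\mathbb R^{N\times m}$ the matrix of indicators of the regimes $2,\dots,m+1$. **True model.** Let $(Z_t)_{t\in\mathbb Z}$ be iid with mean $0$ and variance $(\sigma^2)^0\in(0,\infty)$, and let $(\epsilon_t)$ be a causal AR($p$) process, $\epsilon_t=\sum_{j=1}^p\phi^0_j\epsilon_{t-j}+Z_t$.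 Let $\boldsymbol\lambda^0$ have $m^0\le M$ changepoints with $\lambda^0_r-\lambda^0_{r-1}>d$ for $r=1,\dots,m^0+1$, and let $\boldsymbol\mu^0=(\mu^0_2,\dots,\mu^0_{m^0+1})$, $\mu^0_1=0$, with $\mu^0_r\ne\mu^0_{r+1}$ for $1\le r\le m^0$. For each $N$ the data are $X_t=s^0_{v(t)}+\mu^0_{r^0(t)}+\epsilon_t$, $t=1,\dots,N$, where $r^0(t)$ is the regime of $t$ under $\boldsymbol\lambda^0$. **Estimators for a given $\boldsymbol\lambda$.** Let $\epsilon^{\rm ols}$ be the residual of the orthogonal projection of $\mathbf X_{1:N}$ onto the column space of $[\mathbf A|\mathbf D]$, $\hat\gamma(h)=N^{-1}\sum_{t=h+1}^N\epsilon^{\rm ols}_t\epsilon^{\rm ols}_{t-h}$, and let $\hat{\boldsymbol\phi}=\hat{\boldsymbol\Gamma}_p^{-1}(\hat\gamma(1),\dots,\hat\gamma(p))'$ be the Yule–Walker estimator, where $\hat{\boldsymbol\Gamma}_p$ is the $p\times p$ matrix with entries $\hat\gamma(|i-j|)$. For a vector or matrix $\mathbf F$ with rows $1,\dots,N$ write $\widehat{\mathbf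 F}=\mathbf F_{(p+1):N}-\sum_{j=1}^p\hat\phi_j\mathbf F_{(p+1-j):(N-j)}$; this defines $\widehat{\mathbf X},\widehat{\mathbf A},\widehat{\mathbf D}$. Put $\widehat{\mathbf B}=\mathbf I-\widehat{\mathbf D}(\widehat{\mathbf D}'\widehat{\mathbf D}+\mathbf I_m/\nu)^{-1}\widehat{\mathbf D}'$ and $$\hat{\mathbf s}=(\widehat{\mathbf A}'\widehat{\mathbf B}\widehat{\mathbf A})^{-1}\widehat{\mathbf A}'\widehat{\mathbf B}\widehat{\mathbf X},\qquad \hat\sigma^2=\tfrac1{N-p}\widehat{\mathbf X}'\{\widehat{\mathbf B}-\widehat{\mathbf B}\widehat{\mathbf A}(\widehat{\mathbf A}'\widehat{\mathbf B}\widehat{\mathbf A})^{-1}\widehat{\mathbf A}'\widehat{\mathbf B}\}\widehat{\mathbf X}.$$ Let $\hat{\boldsymbol\mu}$ be the posterior mean of $\boldsymbol\mu$ under the prior $\mathrm N(\mathbf 0,\nu\sigma^2\mathbf I_m)$ and the Gaussian AR likelihood of $\mathbf X_{(p+1):N}$ given $\mathbf X_{1:p}$, evaluated at $\boldsymbol\phi=\hat{\boldsymbol\phi}$,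 $\mathbf s=\hat{\mathbf s}$, $\sigma^2=\hat\sigma^2$. **Estimated configuration.** For each $N$ let a set of documented times in $\{p+1,\dots,N\}$ be given; let $N^{(2)}$ be its size, $N^{(1)}=N-p-N^{(2)}$, and let $m^{(2)}$, $m^{(1)}$ be the numbers of changepoints $\tau_1,\dots,\tau_m$ that are documented, respectively undocumented. Let $\hat{\boldsymbol\lambda}_N$ (with $\hat m_N$ changepoints) be any minimizer over $\boldsymbol\Lambda$ of $$\mathrm{BMDL}(\boldsymbol\lambda)=\tfrac{N-p}2\log\hat\sigma^2+\tfrac m2\log\nu+\tfrac12\log\big|\widehat{\mathbf D}'\widehat{\mathbf D}+\mathbf I_m/\nu\big|-\sum_{k=1}^2\log\{\Gamma(a+m^{(k)})\Gamma(b^{(k)}+N^{(k)}-m^{(k)})\}.$$ **Theorem.** Let $\hat{\boldsymbol\phi}_N,\hat{\mathbf s}_N,\hat\sigma^2_N,\hat{\boldsymbol\mu}_N$ be the above estimators for $\boldsymbol\lambda=\hat{\boldsymbol\lambda}_N$. Then (whenever $\hat\sigma^2_N>0$) $$\hat{\boldsymbol\mu}_N=\big(\widehat{\mathbf D}'\widehat{\mathbf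 D}+\mathbf I_{\hat m_N}/\nu\big)^{-1}\widehat{\mathbf D}'\big(\widehat{\mathbf X}-\widehat{\mathbf A}\hat{\mathbf s}_N\big),$$ and as $N\to\infty$, in probability, $$\hat{\boldsymbol\mu}_N\to\boldsymbol\mu^0,\qquad \hat{\mathbf s}_N\to\mathbf s^0,\qquad \hat\sigma^2_N\to(\sigma^2)^0,\qquad \hat{\boldsymbol\phi}_N\to\boldsymbol\phi^0,$$ where the first convergence means that for every $\delta>0$ the probability that $\hat m_N=m^0$ and $|\hat\mu_{N,r}-\mu^0_r|<\delta$ for all $r=2,\dots,m^0+1$ tends to $1$. -/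

import Mathlib

open MeasureTheory ProbabilityTheory Filter Topology
open scoped Matrix

noncomputable section

namespace BMDL

/-! ### Relative changepoint configurations -/

/-- A relative changepoint configuration: `m` relative locations `loc 0, ..., loc (m - 1)`
(the numbers `λ_1, ..., λ_m`). The order and range constraints are imposed by `admissible`. -/
structure Config where
  /-- the number of changepoints -/
  m : ℕ
  /-- the relative changepoint locations -/
  loc : Fin m → ℝ

/-- `λ_r` for `r = 0, ..., m + 1`, with the conventions `λ_0 = 0` and `λ_{m+1} = 1`. -/
def Config.edge (c : Config) (r : ℕ) : ℝ :=
  if r = 0 then 0 else if h : r - 1 < c.m then c.loc ⟨r - 1, h⟩ else 1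

/-- `τ_r` for `r = 0, ..., m + 1` and sample size `N`: `τ_r = ⌊λ_r N⌋` for `1 ≤ r ≤ m`,
with the conventions `τ_0 = 1` and `τ_{m+1} = N + 1`. -/
def Config.tau (c : Config) (N r : ℕ) : ℕ :=
  if r = 0 then 1 else if h : r - 1 < c.m then ⌊c.loc ⟨r - 1, h⟩ * N⌋₊ else N + 1

/-- The set `Λ` of candidate configurations: at most `M` changepoints, and
`λ_r - λ_{r-1} ≥ d` for `r = 1, ..., m + 1`. -/
def admissible (M : ℕ) (d : ℝ) : Set Config :=
  {c | c.m ≤ M ∧ ∀ r ≤ c.m, d ≤ c.edge (r + 1) - c.edge r}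

/-! ### Design matrices; times `t` are natural numbers starting at `1` -/

/-- The season `v(t) = t - T ⌊(t - 1) / T⌋ ∈ {1, ..., T}` of time `t ≥ 1`. -/
def season (T t : ℕ) : ℕ := t - T * ((t - 1) / T)

/-- Entry of the seasonal indicator matrix `A` (column `v : Fin T` is season `v + 1`). -/
def seasonInd (T t : ℕ) (v : Fin T) : ℝ := if season T t = (v : ℕ) + 1 then 1 else 0

/-- Entry of the regime indicator matrix `D` (column `k : Fin m` is regime `k + 2`; regime `r`
is `τ_{r-1} ≤ t < τ_r`). The first regime has no column, as its mean is zero. -/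
def regimeInd (c : Config) (N t : ℕ) (k : Fin c.m) : ℝ :=
  if c.tau N ((k : ℕ) + 1) ≤ t ∧ t < c.tau N ((k : ℕ) + 2) then 1 else 0

/-- The mean of regime `r + 1`, where `μ = (μ_2, ..., μ_{m+1})` and `μ_1 = 0`. -/
def regimeMean {m : ℕ} (μ : Fin m → ℝ) (r : ℕ) : ℝ :=
  if r = 0 then 0 else if h : r - 1 < m then μ ⟨r - 1, h⟩ else 0

/-- The observation at time `t`, in a sample of size `N`, under the model
`X = A s + D μ + ε`. -/
def obs {T : ℕ} (c : Config) (s : Fin T → ℝ) (μ : Fin c.m → ℝ) (ε : ℕ → ℝ) (N t : ℕ) : ℝ :=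
  ∑ v, seasonInd T t v * s v + ∑ k, regimeInd c N t k * μ k + ε t

/-- `(Z_t)` is an iid sequence with mean zero and variance `σsq`. -/
structure IsIIDNoise {Ω : Type*} [MeasurableSpace Ω] (P : Measure Ω) (Z : ℤ → Ω → ℝ)
    (σsq : ℝ) : Prop where
  measurable : ∀ t, Measurable (Z t)
  indep : iIndepFun Z P
  identDistrib : ∀ t, IdentDistrib (Z t) (Z 0) P P
  memLp : MemLp (Z 0) 2 P
  mean : ∫ ω, Z 0 ω ∂P = 0
  variance : variance (Z 0) P = σsq

/-- `(ε_t)` is a causal AR(p) process with coefficients `φ` driven by `(Z_t)`: it solves the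
autoregression, and it is a moving average of the present and past noise with absolutely
summable weights. -/
structure IsCausalAR {Ω : Type*} [MeasurableSpace Ω] (P : Measure Ω) {p : ℕ} (φ : Fin p → ℝ)
    (Z ε : ℤ → Ω → ℝ) : Prop where
  autoregression : ∀ t, ∀ᵐ ω ∂P, ε t ω = ∑ j : Fin p, φ j * ε (t - ((j : ℤ) + 1)) ω + Z t ω
  causal : ∃ ψ : ℕ → ℝ, Summable (fun j => |ψ j|) ∧
    ∀ t, ∀ᵐ ω ∂P, HasSum (fun j : ℕ => ψ j * Z (t - (j : ℤ)) ω) (ε t ω)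

/-! ### Ordinary least squares residuals and the Yule-Walker estimator.
Here `x` is the data sequence; only `x 1, ..., x N` enter. -/

/-- The block matrix `[A | D]`, whose row `i` belongs to time `i + 1`. -/
def design (T N : ℕ) (c : Config) : Matrix (Fin N) (Fin T ⊕ Fin c.m) ℝ :=
  Matrix.of fun i => Sum.elim (seasonInd T ((i : ℕ) + 1)) (regimeInd c N ((i : ℕ) + 1))

/-- The ordinary least squares residuals `(I - 𝒫_{[A | D]}) X`; entry `i` belongs to time
`i + 1`. -/
def olsResidual (T N : ℕ) (c : Config) (x : ℕ → ℝ) : EuclideanSpace ℝ (Fin N) :=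
  let y : EuclideanSpace ℝ (Fin N) := WithLp.toLp 2 fun i : Fin N => x ((i : ℕ) + 1)
  y - (LinearMap.range (Matrix.toEuclideanLin (design T N c))).starProjection y

/-- The sample autocovariance `N⁻¹ ∑_{t=h+1}^N e_t e_{t-h}` of the residuals at lag `h`. -/
def sampleAcov (T N : ℕ) (c : Config) (x : ℕ → ℝ) (h : ℕ) : ℝ :=
  (N : ℝ)⁻¹ * ∑ i : Fin (N - h),
    olsResidual T N c x ⟨(i : ℕ) + h, by omega⟩ * olsResidual T N c x ⟨(i : ℕ), by omega⟩

/-- The Yule-Walker estimator of the autoregression coefficients under configuration `c`. -/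
def yuleWalker (p T N : ℕ) (c : Config) (x : ℕ → ℝ) : Fin p → ℝ :=
  (Matrix.of fun i j : Fin p =>
      sampleAcov T N c x (((i : ℤ) - (j : ℤ)).natAbs) : Matrix (Fin p) (Fin p) ℝ)⁻¹
    *ᵥ fun i : Fin p => sampleAcov T N c x ((i : ℕ) + 1)

/-! ### Quantities filtered with an autoregression coefficient vector `φ`.
Row `i : Fin (N - p)` belongs to time `p + 1 + i`. -/

/-- `F_t - ∑_{j=1}^p φ_j F_{t-j}`. -/
def arFilter {p : ℕ} (φ : Fin p → ℝ) (F : ℕ → ℝ) (t : ℕ) : ℝ :=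
  F t - ∑ j : Fin p, φ j * F (t - ((j : ℕ) + 1))

/-- The filtered data vector. -/
def filtX {p : ℕ} (N : ℕ) (φ : Fin p → ℝ) (x : ℕ → ℝ) : Fin (N - p) → ℝ :=
  fun i => arFilter φ x (p + 1 + (i : ℕ))

/-- The filtered seasonal matrix. -/
def filtA {p : ℕ} (T N : ℕ) (φ : Fin p → ℝ) : Matrix (Fin (N - p)) (Fin T) ℝ :=
  Matrix.of fun i v => arFilter φ (fun t => seasonInd T t v) (p + 1 + (i : ℕ))

/-- The filtered regime matrix. -/
def filtD {p : ℕ} (N : ℕ) (c : Config) (φ : Fin p → ℝ) : Matrix (Fin (N - p)) (Fin c.m) ℝ :=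
  Matrix.of fun i k => arFilter φ (fun t => regimeInd c N t k) (p + 1 + (i : ℕ))

/-- `D' D + I_m / ν` for the filtered regime matrix. -/
def ridgeGram {p : ℕ} (ν : ℝ) (N : ℕ) (c : Config) (φ : Fin p → ℝ) :
    Matrix (Fin c.m) (Fin c.m) ℝ :=
  (filtD N c φ)ᵀ * filtD N c φ + ν⁻¹ • (1 : Matrix (Fin c.m) (Fin c.m) ℝ)

/-- `B = I - D (D' D + I_m / ν)⁻¹ D'`. -/
def matB {p : ℕ} (ν : ℝ) (N : ℕ) (c : Config) (φ : Fin p → ℝ) :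
    Matrix (Fin (N - p)) (Fin (N - p)) ℝ :=
  1 - filtD N c φ * (ridgeGram ν N c φ)⁻¹ * (filtD N c φ)ᵀ

/-- The estimator `(A' B A)⁻¹ A' B X` of the seasonal means. -/
def seasonEst {p : ℕ} (ν : ℝ) (T N : ℕ) (c : Config) (φ : Fin p → ℝ) (x : ℕ → ℝ) :
    Fin T → ℝ :=
  ((filtA T N φ)ᵀ * matB ν N c φ * filtA T N φ)⁻¹
    *ᵥ (((filtA T N φ)ᵀ * matB ν N c φ) *ᵥ filtX N φ x)

/-- The estimator `(N - p)⁻¹ X' {B - B A (A' B A)⁻¹ A' B} X` of the noise variance. -/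
def varEst {p : ℕ} (ν : ℝ) (T N : ℕ) (c : Config) (φ : Fin p → ℝ) (x : ℕ → ℝ) : ℝ :=
  ((N : ℝ) - (p : ℝ))⁻¹ * (filtX N φ x ⬝ᵥ
    ((matB ν N c φ - matB ν N c φ * filtA T N φ *
        ((filtA T N φ)ᵀ * matB ν N c φ * filtA T N φ)⁻¹ * (filtA T N φ)ᵀ * matB ν N c φ)
      *ᵥ filtX N φ x))

/-- The closed form `(D' D + I_m / ν)⁻¹ D' (X - A s)`. -/
def ridgeMean {p T : ℕ} (ν : ℝ) (N : ℕ) (c : Config) (φ : Fin p → ℝ) (s : Fin T → ℝ)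
    (x : ℕ → ℝ) : Fin c.m → ℝ :=
  (ridgeGram ν N c φ)⁻¹ *ᵥ ((filtD N c φ)ᵀ *ᵥ (filtX N φ x - filtA T N φ *ᵥ s))

/-! ### The posterior mean of the regime means -/

/-- The Gaussian likelihood of `X_{p+1}, ..., X_N` given `X_1, ..., X_p`. -/
def likelihood {p T : ℕ} (N : ℕ) (c : Config) (φ : Fin p → ℝ) (s : Fin T → ℝ) (σsq : ℝ)
    (x : ℕ → ℝ) (μ : Fin c.m → ℝ) : ℝ :=
  let z := filtX N φ x - filtA T N φ *ᵥ s - filtD N c φ *ᵥ μ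
  (2 * Real.pi * σsq) ^ (-((N : ℝ) - (p : ℝ)) / 2) * Real.exp (-(z ⬝ᵥ z) / (2 * σsq))

/-- The density of the prior `N(0, ν σ² I_m)` of the regime means. -/
def priorDensity {m : ℕ} (ν σsq : ℝ) (μ : Fin m → ℝ) : ℝ :=
  (2 * Real.pi * (ν * σsq)) ^ (-(m : ℝ) / 2) * Real.exp (-(μ ⬝ᵥ μ) / (2 * (ν * σsq)))

/-- The posterior mean of the regime means given the data, `s`, `σ²`, `φ` and the
configuration, by Bayes' formula. -/
def posteriorMean {p T : ℕ} (ν : ℝ) (N : ℕ) (c : Config) (φ : Fin p → ℝ) (s : Fin T → ℝ)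
    (σsq : ℝ) (x : ℕ → ℝ) : Fin c.m → ℝ := fun k =>
  (∫ μ : Fin c.m → ℝ, μ k * (likelihood N c φ s σsq x μ * priorDensity ν σsq μ)) /
    ∫ μ : Fin c.m → ℝ, likelihood N c φ s σsq x μ * priorDensity ν σsq μ

/-! ### The BMDL objective -/

/-- The number of documented times in `{p + 1, ..., N}`; `doc` is the set of times listed in
the metadata. -/
def numDoc (p N : ℕ) (doc : Finset ℕ) : ℕ := (doc ∩ Finset.Icc (p + 1) N).card

/-- The number of documented changepoints. -/
def cpDoc (N : ℕ) (doc : Finset ℕ) (c : Config) : ℕ :=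
  (Finset.univ.filter fun k : Fin c.m => c.tau N ((k : ℕ) + 1) ∈ doc).card

/-- The number of undocumented changepoints. -/
def cpUndoc (N : ℕ) (doc : Finset ℕ) (c : Config) : ℕ :=
  (Finset.univ.filter fun k : Fin c.m => c.tau N ((k : ℕ) + 1) ∉ doc).card

/-- The Bayesian minimum description length of configuration `c`. The hyper-parameters of the
Beta-Binomial priors are `(a, b₁)` for undocumented and `(a, b₂)` for documented times. -/
def bmdl (p T : ℕ) (a b₁ b₂ ν : ℝ) (N : ℕ) (doc : Finset ℕ) (x : ℕ → ℝ) (c : Config) : ℝ :=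
  let φ : Fin p → ℝ := yuleWalker p T N c x
  ((N : ℝ) - (p : ℝ)) / 2 * Real.log (varEst ν T N c φ x)
    + (c.m : ℝ) / 2 * Real.log ν
    + 1 / 2 * Real.log (ridgeGram ν N c φ).det
    - (Real.log (Real.Gamma (a + (cpUndoc N doc c : ℝ)) *
          Real.Gamma (b₁ + ((N : ℝ) - (p : ℝ) - (numDoc p N doc : ℝ)) - (cpUndoc N doc c : ℝ)))
      + Real.log (Real.Gamma (a + (cpDoc N doc c : ℝ)) *
          Real.Gamma (b₂ + (numDoc p N doc : ℝ) - (cpDoc N doc c : ℝ))))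

/-- `c` minimizes the BMDL over the candidate set. -/
def IsBMDLMin (p T : ℕ) (a b₁ b₂ ν : ℝ) (M : ℕ) (d : ℝ) (N : ℕ) (doc : Finset ℕ) (x : ℕ → ℝ)
    (c : Config) : Prop :=
  c ∈ admissible M d ∧
    ∀ c' ∈ admissible M d, bmdl p T a b₁ b₂ ν N doc x c ≤ bmdl p T a b₁ b₂ ν N doc x c'

/-! ### The plug-in estimators under configuration `c` -/

/-- The estimator of the seasonal means, with the Yule-Walker estimator plugged in. -/
def seasonHat (p : ℕ) (ν : ℝ) (T N : ℕ) (c : Config) (x : ℕ → ℝ) : Fin T → ℝ :=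
  seasonEst ν T N c (yuleWalker p T N c x) x

/-- The estimator of the noise variance, with the Yule-Walker estimator plugged in. -/
def varHat (p : ℕ) (ν : ℝ) (T N : ℕ) (c : Config) (x : ℕ → ℝ) : ℝ :=
  varEst ν T N c (yuleWalker p T N c x) x

/-- The estimator of the regime means: the posterior mean given the plug-in estimators. -/
def meanHat (p : ℕ) (ν : ℝ) (T N : ℕ) (c : Config) (x : ℕ → ℝ) : Fin c.m → ℝ :=
  posteriorMean ν N c (yuleWalker p T N c x) (seasonHat p ν T N c x) (varHat p ν T N c x) x

end BMDL

end

set_option linter.unusedSectionVars false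

noncomputable section

namespace BMDL

open Asymptotics

/-! ### Ridge regression -/

section Ridge

variable {n m T : Type*} [Fintype n] [Fintype m] [Fintype T] [DecidableEq n] [DecidableEq m]
  [DecidableEq T]

/-! Write n for the sample size. The estimators are penalized least squares in disguise. By
`profile_eq_penSS` and `varEst_mul_eq`, (n - p) times the variance estimate is the penalized
conditional sum of squares at the fitted coefficients, and completing the square makes the posterior
mean the ridge solution (`posteriorMean_eq_ridgeMean`). The objective is therefore (n - p)/2 times
the log of a residual sum of squares, plus (m/2) log n + O(1) from the determinant, plus a Gamma
part that loses at most a constant when changepoints are deleted.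

Randomness enters only through the properties collected in `Regular`. Convergence in probability is
convergence along `probFilter`, the filter of events whose probability tends to one, and convergence
along a filter may be tested on the finer ultrafilters. There bounded quantities have limits, so
`consistency` is a deterministic argument about one ultrafilter. Sums linear in the noise are O(√n)
in probability, hence o(√(n log n)); this makes coefficient errors o(√(log n / n)), and the product
of the two scales is log n, the order of the penalty.

No true changepoint is missed. For any well-spaced configuration the least squares residuals are
noise plus a bounded function nearly orthogonal to it, so the sample autocovariances dominate those
of the noise. A limit of Yule-Walker estimators thus solves positive definite Toeplitz equations,
and its filter does not annihilate constants (`arOne_ywSol_ne_zero`, `exists_yuleWalker_tendsto`).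
The residual sum of squares of a minimizer exceeds that of the true innovations by at most o(√(n log
n)) (`ssr_minimizer_le`), while from below it is the filtered noise plus the filtered misfit of the
mean (`ssr_lower`). Hence the limit is the true coefficient vector and the squared misfit is o(√(n
log n)) (`wellFitting_consistent`). A jump cannot be absorbed by a periodic function, so a fitted
changepoint lies within o(√(n log n)) of every true one (`missed_changepoint`,
`exists_near_changepoint`).

No changepoint is superfluous. Suppose the minimizer has more changepoints than the truth, and keep
only those near true ones. The full and the reduced configuration both describe the data as a mean
function plus the same noise and the same misfit g, whose total mass is o(√(n log n)). Relative to e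
+ g the errors of both fits, including both Yule-Walker estimators, enter the residual sums of
squares only to second order, so these sums differ by o(log n) (`Ref.gls`, `Ref.ssr_sub`). The
deleted changepoints save at least (1/2) log n - O(1), which contradicts minimality. The two
configurations therefore agree, and `Ref.gls` shows that the coefficients converge.

The probabilistic half shows that a causal autoregression is regular: laws of large numbers in mean
for moving averages, Doob's maximal inequality for the noise, and inversion of the autoregressive
filter by the moving average weights (`IsMovingAverage.regular`). -/

lemma dotProduct_mulVec_transpose (A : Matrix n m ℝ) (u : n → ℝ) (w : m → ℝ) :
    u ⬝ᵥ (A *ᵥ w) = (Aᵀ *ᵥ u) ⬝ᵥ w := by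
  rw [Matrix.dotProduct_mulVec, Matrix.mulVec_transpose]

lemma mulVec_dotProduct_transpose (A : Matrix n m ℝ) (w : m → ℝ) (u : n → ℝ) :
    (A *ᵥ w) ⬝ᵥ u = w ⬝ᵥ (Aᵀ *ᵥ u) := by
  rw [dotProduct_comm, dotProduct_mulVec_transpose, dotProduct_comm]

lemma dotProduct_self_nonneg' (u : n → ℝ) : 0 ≤ u ⬝ᵥ u :=
  Finset.sum_nonneg fun i _ => mul_self_nonneg (u i)

/-- `D' D + I / ν`. -/
def gramR (ν : ℝ) (D : Matrix n m ℝ) : Matrix m m ℝ := Dᵀ * D + ν⁻¹ • (1 : Matrix m m ℝ)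

lemma gramR_transpose (ν : ℝ) (D : Matrix n m ℝ) : (gramR ν D)ᵀ = gramR ν D := by
  simp [gramR, Matrix.transpose_mul]

lemma gramR_mulVec (ν : ℝ) (D : Matrix n m ℝ) (w : m → ℝ) :
    gramR ν D *ᵥ w = Dᵀ *ᵥ (D *ᵥ w) + ν⁻¹ • w := by
  simp [gramR, Matrix.add_mulVec, Matrix.smul_mulVec]

lemma gramR_quad (ν : ℝ) (D : Matrix n m ℝ) (w : m → ℝ) :
    w ⬝ᵥ (gramR ν D *ᵥ w) = (D *ᵥ w) ⬝ᵥ (D *ᵥ w) + ν⁻¹ * (w ⬝ᵥ w) := by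
  rw [gramR_mulVec, dotProduct_add, dotProduct_smul, smul_eq_mul, dotProduct_mulVec_transpose,
    Matrix.transpose_transpose]

lemma gramR_posDef {ν : ℝ} (hν : 0 < ν) (D : Matrix n m ℝ) : (gramR ν D).PosDef := by
  refine Matrix.PosDef.of_dotProduct_mulVec_pos ?_ fun w hw => ?_
  · rw [Matrix.IsHermitian, Matrix.conjTranspose_eq_transpose_of_trivial, gramR_transpose]
  · rw [star_trivial, gramR_quad]
    have h1 := dotProduct_self_nonneg' (D *ᵥ w)
    have h2 : 0 < w ⬝ᵥ w := by
      refine lt_of_le_of_ne (dotProduct_self_nonneg' w) fun h => hw ?_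
      exact dotProduct_self_eq_zero.1 h.symm
    have : 0 < ν⁻¹ * (w ⬝ᵥ w) := mul_pos (inv_pos.2 hν) h2
    linarith

lemma gramR_det_pos {ν : ℝ} (hν : 0 < ν) (D : Matrix n m ℝ) : 0 < (gramR ν D).det :=
  (gramR_posDef hν D).det_pos

lemma gramR_mul_inv {ν : ℝ} (hν : 0 < ν) (D : Matrix n m ℝ) : gramR ν D * (gramR ν D)⁻¹ = 1 :=
  Matrix.mul_nonsing_inv _ (gramR_det_pos hν D).ne'.isUnit

/-- The ridge regression coefficients of `y` on `D`. -/
def ridgeCoef (ν : ℝ) (D : Matrix n m ℝ) (y : n → ℝ) : m → ℝ := (gramR ν D)⁻¹ *ᵥ (Dᵀ *ᵥ y)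

/-- `I - D (D' D + I / ν)⁻¹ D'`. -/
def ridgeB (ν : ℝ) (D : Matrix n m ℝ) : Matrix n n ℝ := 1 - D * (gramR ν D)⁻¹ * Dᵀ

lemma ridgeB_transpose (ν : ℝ) (D : Matrix n m ℝ) : (ridgeB ν D)ᵀ = ridgeB ν D := by
  simp [ridgeB, Matrix.transpose_mul, Matrix.transpose_nonsing_inv, gramR_transpose,
    Matrix.mul_assoc]

lemma ridgeB_mulVec (ν : ℝ) (D : Matrix n m ℝ) (y : n → ℝ) :
    ridgeB ν D *ᵥ y = y - D *ᵥ ridgeCoef ν D y := by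
  simp [ridgeB, ridgeCoef, Matrix.sub_mulVec, Matrix.mulVec_mulVec, Matrix.mul_assoc]

lemma transpose_mulVec_ridge_resid {ν : ℝ} (hν : 0 < ν) (D : Matrix n m ℝ) (y : n → ℝ) :
    Dᵀ *ᵥ (y - D *ᵥ ridgeCoef ν D y) = ν⁻¹ • ridgeCoef ν D y := by
  have h : gramR ν D *ᵥ ridgeCoef ν D y = Dᵀ *ᵥ y := by
    rw [ridgeCoef, Matrix.mulVec_mulVec, gramR_mul_inv hν, Matrix.one_mulVec]
  rw [gramR_mulVec] at h
  rw [Matrix.mulVec_sub, ← h]; abel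

/-- Unlike in ordinary least squares, the residual is not orthogonal to the fit: by the ridge normal
equations their product is exactly the penalty. This identifies the quadratic form of B with the
minimal value of the ridge objective. -/
lemma ridgeB_quad {ν : ℝ} (hν : 0 < ν) (D : Matrix n m ℝ) (y : n → ℝ) :
    y ⬝ᵥ (ridgeB ν D *ᵥ y) = (y - D *ᵥ ridgeCoef ν D y) ⬝ᵥ (y - D *ᵥ ridgeCoef ν D y)
      + ν⁻¹ * (ridgeCoef ν D y ⬝ᵥ ridgeCoef ν D y) := by
  rw [ridgeB_mulVec]
  set μ := ridgeCoef ν D y with hμ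
  have h := transpose_mulVec_ridge_resid hν D y
  rw [← hμ] at h
  have h2 : (y - D *ᵥ μ) ⬝ᵥ (D *ᵥ μ) = ν⁻¹ * (μ ⬝ᵥ μ) := by
    rw [dotProduct_mulVec_transpose, h, smul_dotProduct, smul_eq_mul]
  rw [← h2, ← dotProduct_add, dotProduct_comm]
  congr 1; abel

/-- `A' B A`. -/
def normalG (ν : ℝ) (A : Matrix n T ℝ) (D : Matrix n m ℝ) : Matrix T T ℝ := Aᵀ * ridgeB ν D * A

/-- The generalized least squares coefficients `(A' B A)⁻¹ A' B y`. -/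
def glsCoef (ν : ℝ) (A : Matrix n T ℝ) (D : Matrix n m ℝ) (y : n → ℝ) : T → ℝ :=
  (normalG ν A D)⁻¹ *ᵥ ((Aᵀ * ridgeB ν D) *ᵥ y)

/-- The penalized residual sum of squares. -/
def penSS (ν : ℝ) (A : Matrix n T ℝ) (D : Matrix n m ℝ) (y : n → ℝ) (s : T → ℝ) (μ : m → ℝ) : ℝ :=
  (y - A *ᵥ s - D *ᵥ μ) ⬝ᵥ (y - A *ᵥ s - D *ᵥ μ) + ν⁻¹ * (μ ⬝ᵥ μ)

/-- The profile form is the penalized residual sum of squares at the fitted coefficients, even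
if `A' B A` is singular. -/
lemma profile_eq_penSS {ν : ℝ} (hν : 0 < ν) (A : Matrix n T ℝ) (D : Matrix n m ℝ) (y : n → ℝ) :
    y ⬝ᵥ ((ridgeB ν D - ridgeB ν D * A * (normalG ν A D)⁻¹ * Aᵀ * ridgeB ν D) *ᵥ y)
      = penSS ν A D y (glsCoef ν A D y) (ridgeCoef ν D (y - A *ᵥ glsCoef ν A D y)) := by
  rw [penSS, ← ridgeB_quad hν D]
  set B := ridgeB ν D with hB
  set s := glsCoef ν A D y with hs
  have hBt : Bᵀ = B := ridgeB_transpose ν D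
  have e1 : (B * A * (normalG ν A D)⁻¹ * Aᵀ * B) *ᵥ y = B *ᵥ (A *ᵥ s) := by
    simp [hs, glsCoef, Matrix.mulVec_mulVec, Matrix.mul_assoc, hB]
  have e2 : normalG ν A D *ᵥ s = Aᵀ *ᵥ (B *ᵥ (A *ᵥ s)) := by
    simp [normalG, Matrix.mulVec_mulVec, Matrix.mul_assoc, hB]
  -- The normal equations are needed only after pairing with `s`. In this form they survive a
  -- singular matrix, whose inverse is 0 by convention, since then `s = 0`.
  have e3 : s ⬝ᵥ (normalG ν A D *ᵥ s) = s ⬝ᵥ (Aᵀ *ᵥ (B *ᵥ y)) := by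
    by_cases hG : IsUnit (normalG ν A D).det
    · have : normalG ν A D *ᵥ s = Aᵀ *ᵥ (B *ᵥ y) := by
        rw [hs, glsCoef, Matrix.mulVec_mulVec, Matrix.mul_nonsing_inv _ hG, Matrix.one_mulVec,
          Matrix.mulVec_mulVec]
      rw [this]
    · have : s = 0 := by
        rw [hs, glsCoef, Matrix.nonsing_inv_apply_not_isUnit _ hG, Matrix.zero_mulVec]
      rw [this, zero_dotProduct, zero_dotProduct]
  have e4 : (A *ᵥ s) ⬝ᵥ (B *ᵥ y) = s ⬝ᵥ (Aᵀ *ᵥ (B *ᵥ y)) := by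
    rw [mulVec_dotProduct_transpose]
  have e5 : (A *ᵥ s) ⬝ᵥ (B *ᵥ (A *ᵥ s)) = s ⬝ᵥ (normalG ν A D *ᵥ s) := by
    rw [e2, mulVec_dotProduct_transpose]
  have e6 : y ⬝ᵥ (B *ᵥ (A *ᵥ s)) = (A *ᵥ s) ⬝ᵥ (B *ᵥ y) := by
    rw [dotProduct_mulVec_transpose, hBt, dotProduct_comm]
  rw [Matrix.sub_mulVec, e1, Matrix.mulVec_sub, dotProduct_sub, sub_dotProduct, dotProduct_sub,
    dotProduct_sub, e6, e4, e5, e3]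
  ring

/-- If `A' B A` is invertible, the penalized residual sum of squares is minimal at the fitted
coefficients, with the exact excess elsewhere. -/
lemma penSS_eq_add {ν : ℝ} (hν : 0 < ν) (A : Matrix n T ℝ) (D : Matrix n m ℝ) (y : n → ℝ)
    (hG : IsUnit (normalG ν A D).det) (u : T → ℝ) (w : m → ℝ) :
    let s := glsCoef ν A D y
    let μ := ridgeCoef ν D (y - A *ᵥ s)
    penSS ν A D y (s + u) (μ + w) = penSS ν A D y s μ
      + ((A *ᵥ u + D *ᵥ w) ⬝ᵥ (A *ᵥ u + D *ᵥ w) + ν⁻¹ * (w ⬝ᵥ w)) := by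
  intro s μ
  set r := y - A *ᵥ s - D *ᵥ μ with hr
  have hD : Dᵀ *ᵥ r = ν⁻¹ • μ := transpose_mulVec_ridge_resid hν D (y - A *ᵥ s)
  -- The normal equations for the unpenalized block. For the penalized block the residual has
  -- product ν⁻¹ μ·w with `D w`, which cancels against the mixed term in the expansion of the
  -- penalty, so that no linear term is left.
  have hA : Aᵀ *ᵥ r = 0 := by
    have h1 : r = ridgeB ν D *ᵥ (y - A *ᵥ s) := by rw [ridgeB_mulVec]
    rw [h1, Matrix.mulVec_sub, Matrix.mulVec_sub, sub_eq_zero]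
    have : normalG ν A D *ᵥ s = (Aᵀ * ridgeB ν D) *ᵥ y := by
      simp only [s]
      rw [glsCoef, Matrix.mulVec_mulVec, Matrix.mul_nonsing_inv _ hG, Matrix.one_mulVec]
    rw [Matrix.mulVec_mulVec, ← this]
    simp [normalG, Matrix.mulVec_mulVec, Matrix.mul_assoc]
  have e1 : y - A *ᵥ (s + u) - D *ᵥ (μ + w) = r - (A *ᵥ u + D *ᵥ w) := by
    rw [hr, Matrix.mulVec_add, Matrix.mulVec_add]; abel
  have e2 : r ⬝ᵥ (A *ᵥ u + D *ᵥ w) = ν⁻¹ * (μ ⬝ᵥ w) := by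
    rw [dotProduct_add, dotProduct_mulVec_transpose, hA, dotProduct_mulVec_transpose, hD,
      zero_dotProduct, smul_dotProduct, smul_eq_mul, zero_add]
  rw [penSS, penSS, e1, ← hr]
  generalize A *ᵥ u + D *ᵥ w = q at e2 ⊢
  clear_value r
  rw [sub_dotProduct, dotProduct_sub, dotProduct_sub,
    dotProduct_comm q r, e2, add_dotProduct, dotProduct_add, dotProduct_add,
    dotProduct_comm w μ]
  ring

/-- If A'BA kills `u`, then both squares in `ridgeB_quad` for `A u` vanish. The penalty forces the
ridge coefficient to be 0, and the residual is then `A u` itself. No independence between the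
columns of A and D is required. -/
lemma normalG_isUnit {ν : ℝ} (hν : 0 < ν) (A : Matrix n T ℝ) (D : Matrix n m ℝ)
    (hA : ∀ u, A *ᵥ u = 0 → u = 0) : IsUnit (normalG ν A D).det := by
  rw [isUnit_iff_ne_zero, Ne, ← Matrix.exists_mulVec_eq_zero_iff]
  rintro ⟨u, hu, h⟩
  apply hu
  have h1 : (A *ᵥ u) ⬝ᵥ (ridgeB ν D *ᵥ (A *ᵥ u)) = 0 := by
    have : u ⬝ᵥ (normalG ν A D *ᵥ u) = 0 := by rw [h, dotProduct_zero]
    rw [← this, normalG, ← Matrix.mulVec_mulVec, ← Matrix.mulVec_mulVec,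
      dotProduct_mulVec_transpose Aᵀ, Matrix.transpose_transpose]
  rw [ridgeB_quad hν] at h1
  set μ := ridgeCoef ν D (A *ᵥ u)
  have p1 := dotProduct_self_nonneg' (A *ᵥ u - D *ᵥ μ)
  have p2 := dotProduct_self_nonneg' μ
  have p3 : 0 < ν⁻¹ := inv_pos.2 hν
  have p4 := mul_nonneg p3.le p2
  have h2 : μ ⬝ᵥ μ = 0 := by
    rcases mul_eq_zero.1 (le_antisymm (by linarith : ν⁻¹ * (μ ⬝ᵥ μ) ≤ 0) p4) with h | h
    · exact absurd h p3.ne'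
    · exact h
  have h3 : A *ᵥ u - D *ᵥ μ = 0 := dotProduct_self_eq_zero.1 (by linarith)
  rw [dotProduct_self_eq_zero.1 h2, Matrix.mulVec_zero, sub_zero] at h3
  exact hA u h3

end Ridge

/-! ### The posterior mean -/

section Posterior

variable {m : ℕ}

lemma integrable_exp_neg_dotProduct {b : ℝ} (hb : 0 < b) :
    Integrable fun μ : Fin m → ℝ => Real.exp (-b * (μ ⬝ᵥ μ)) := by
  have : (fun μ : Fin m → ℝ => Real.exp (-b * (μ ⬝ᵥ μ)))
      = fun μ => ∏ i, Real.exp (-b * (μ i) ^ 2) := by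
    funext μ
    rw [← Real.exp_sum, dotProduct, Finset.mul_sum]
    congr 1
    exact Finset.sum_congr rfl fun i _ => by ring
  rw [this]
  exact Integrable.fintype_prod fun _ => integrable_exp_neg_mul_sq hb

/-- After translation by `μ0` the coordinate splits into an odd function, whose integral against the
even `f` is 0, and the constant `μ0 k`. The Gaussian bound is there for integrability only. -/
lemma integral_exp_shift_ratio {f : (Fin m → ℝ) → ℝ} {b : ℝ} (hb : 0 < b) (hf : Continuous f)
    (hpos : ∀ μ, 0 < f μ) (heven : ∀ μ, f (-μ) = f μ)
    (hbd : ∀ μ, f μ ≤ Real.exp (-b * (μ ⬝ᵥ μ))) (μ0 : Fin m → ℝ) (k : Fin m) :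
    (∫ μ, μ k * f (μ - μ0)) / ∫ μ, f (μ - μ0) = μ0 k := by
  have hi : Integrable f := by
    refine (integrable_exp_neg_dotProduct hb).mono' hf.aestronglyMeasurable ?_
    exact Eventually.of_forall fun μ => by rw [Real.norm_of_nonneg (hpos μ).le]; exact hbd μ
  have hik : Integrable fun μ : Fin m → ℝ => μ k * f μ := by
    have h2 : 0 < b / 2 := by positivity
    have h := (integrable_exp_neg_dotProduct (m := m) h2).const_mul (1 + 2 / b)
    refine h.mono' (((continuous_apply k).mul hf).aestronglyMeasurable) ?_
    refine Eventually.of_forall fun μ => ?_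
    rw [norm_mul, Real.norm_of_nonneg (hpos μ).le, Real.norm_eq_abs]
    have hk : (μ k) ^ 2 ≤ μ ⬝ᵥ μ := by
      rw [sq]
      exact Finset.single_le_sum (f := fun i => μ i * μ i) (fun i _ => mul_self_nonneg (μ i))
        (Finset.mem_univ k)
    have hq : 0 ≤ μ ⬝ᵥ μ := dotProduct_self_nonneg' μ
    have h1 : |μ k| ≤ 1 + μ ⬝ᵥ μ := by
      have := sq_abs (μ k); nlinarith [sq_nonneg (|μ k| - 1), abs_nonneg (μ k)]
    -- Half of the Gaussian exponent is spent on absorbing the polynomial factor.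
    have h3 : 1 + μ ⬝ᵥ μ ≤ (1 + 2 / b) * Real.exp (b / 2 * (μ ⬝ᵥ μ)) := by
      have := Real.add_one_le_exp (b / 2 * (μ ⬝ᵥ μ))
      have h4 : (1 : ℝ) ≤ Real.exp (b / 2 * (μ ⬝ᵥ μ)) := Real.one_le_exp (by positivity)
      have h5 : 2 / b * (b / 2 * (μ ⬝ᵥ μ) + 1) ≤ 2 / b * Real.exp (b / 2 * (μ ⬝ᵥ μ)) :=
        mul_le_mul_of_nonneg_left this (by positivity)
      have h6 : 2 / b * (b / 2 * (μ ⬝ᵥ μ) + 1) = μ ⬝ᵥ μ + 2 / b := by field_simp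
      have : 0 < 2 / b := by positivity
      linarith
    calc |μ k| * f μ ≤ (1 + μ ⬝ᵥ μ) * Real.exp (-b * (μ ⬝ᵥ μ)) :=
          mul_le_mul h1 (hbd μ) (hpos μ).le (by linarith)
      _ ≤ (1 + 2 / b) * Real.exp (b / 2 * (μ ⬝ᵥ μ)) * Real.exp (-b * (μ ⬝ᵥ μ)) :=
          mul_le_mul_of_nonneg_right h3 (Real.exp_pos _).le
      _ = _ := by rw [mul_assoc, ← Real.exp_add]; ring_nf
  have hodd : ∫ μ : Fin m → ℝ, μ k * f μ = 0 := by
    have h := integral_neg_eq_self (fun μ : Fin m → ℝ => μ k * f μ) volume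
    have h' : (fun μ : Fin m → ℝ => (-μ) k * f (-μ)) = fun μ => -(μ k * f μ) := by
      funext μ; rw [heven, Pi.neg_apply]; ring
    rw [h', integral_neg] at h
    linarith
  have hposI : 0 < ∫ μ : Fin m → ℝ, f μ := by
    rw [integral_pos_iff_support_of_nonneg (fun μ => (hpos μ).le) hi]
    have : Function.support f = Set.univ := by
      ext μ; simp [(hpos μ).ne']
    rw [this]
    exact isOpen_univ.measure_pos volume Set.univ_nonempty
  have e1 : ∫ μ : Fin m → ℝ, f (μ - μ0) = ∫ μ, f μ := integral_sub_right_eq_self f μ0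
  have e2 : ∫ μ : Fin m → ℝ, μ k * f (μ - μ0) = μ0 k * ∫ μ, f μ := by
    have h := integral_sub_right_eq_self (μ := volume)
      (fun μ : Fin m → ℝ => (μ + μ0) k * f μ) μ0
    simp only [sub_add_cancel] at h
    rw [h]
    simp only [Pi.add_apply, add_mul]
    rw [integral_add hik (hi.const_mul _), hodd, zero_add, integral_const_mul]
  rw [e1, e2, mul_div_assoc, div_self hposI.ne', mul_one]

/-- Completing the square around the ridge coefficient: the linear terms cancel by the ridge normal
equations, so likelihood times prior is a constant times an even function of `μ - μ0`. -/
lemma posteriorMean_eq_ridgeMean {p T : ℕ} {ν : ℝ} (hν : 0 < ν) (N : ℕ) (c : Config)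
    (φ : Fin p → ℝ) (s : Fin T → ℝ) {σsq : ℝ} (hσ : 0 < σsq) (x : ℕ → ℝ) :
    posteriorMean ν N c φ s σsq x = ridgeMean ν N c φ s x := by
  funext k
  set D := filtD N c φ with hD
  set y := filtX N φ x - filtA T N φ *ᵥ s with hy
  set μ0 := ridgeCoef ν D y with hμ0
  have hR : ridgeMean ν N c φ s x = μ0 := rfl
  rw [hR]
  set K : ℝ := (2 * Real.pi * σsq) ^ (-((N : ℝ) - (p : ℝ)) / 2)
    * (2 * Real.pi * (ν * σsq)) ^ (-(c.m : ℝ) / 2)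
    * Real.exp (-((y - D *ᵥ μ0) ⬝ᵥ (y - D *ᵥ μ0) + ν⁻¹ * (μ0 ⬝ᵥ μ0)) / (2 * σsq)) with hK
  have hKpos : 0 < K := by
    have := Real.pi_pos
    positivity
  set f : (Fin c.m → ℝ) → ℝ := fun w =>
    Real.exp (-((D *ᵥ w) ⬝ᵥ (D *ᵥ w) + ν⁻¹ * (w ⬝ᵥ w)) / (2 * σsq)) with hf
  have key : ∀ μ, likelihood N c φ s σsq x μ * priorDensity ν σsq μ = K * f (μ - μ0) := by
    intro μ
    have e : (y - D *ᵥ μ) ⬝ᵥ (y - D *ᵥ μ) + ν⁻¹ * (μ ⬝ᵥ μ)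
        = ((y - D *ᵥ μ0) ⬝ᵥ (y - D *ᵥ μ0) + ν⁻¹ * (μ0 ⬝ᵥ μ0))
          + ((D *ᵥ (μ - μ0)) ⬝ᵥ (D *ᵥ (μ - μ0)) + ν⁻¹ * ((μ - μ0) ⬝ᵥ (μ - μ0))) := by
      have h := transpose_mulVec_ridge_resid hν D y
      rw [← hμ0] at h
      set r := y - D *ᵥ μ0 with hr
      obtain ⟨w, rfl⟩ : ∃ w, μ = μ0 + w := ⟨μ - μ0, by simp⟩
      have e1 : y - D *ᵥ (μ0 + w) = r - D *ᵥ w := by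
        simp only [r]; rw [Matrix.mulVec_add]; abel
      have e2 : r ⬝ᵥ (D *ᵥ w) = ν⁻¹ * (μ0 ⬝ᵥ w) := by
        rw [dotProduct_mulVec_transpose, h, smul_dotProduct, smul_eq_mul]
      rw [e1, add_sub_cancel_left]
      clear_value r
      rw [sub_dotProduct, dotProduct_sub, dotProduct_sub,
        dotProduct_comm (D *ᵥ w) r, e2, add_dotProduct, dotProduct_add, dotProduct_add,
        dotProduct_comm w μ0]
      ring
    have e3 : likelihood N c φ s σsq x μ * priorDensity ν σsq μ
        = (2 * Real.pi * σsq) ^ (-((N : ℝ) - (p : ℝ)) / 2)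
          * (2 * Real.pi * (ν * σsq)) ^ (-(c.m : ℝ) / 2)
          * Real.exp (-((y - D *ᵥ μ) ⬝ᵥ (y - D *ᵥ μ) + ν⁻¹ * (μ ⬝ᵥ μ)) / (2 * σsq)) := by
      have : -((y - D *ᵥ μ) ⬝ᵥ (y - D *ᵥ μ) + ν⁻¹ * (μ ⬝ᵥ μ)) / (2 * σsq)
          = -((y - D *ᵥ μ) ⬝ᵥ (y - D *ᵥ μ)) / (2 * σsq) + -(μ ⬝ᵥ μ) / (2 * (ν * σsq)) := by
        field_simp
        ring
      rw [this, Real.exp_add]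
      simp only [likelihood, priorDensity, hy, hD]
      ring
    rw [e3, e, hK, hf]
    simp only
    rw [mul_assoc _ (Real.exp _) (Real.exp _), ← Real.exp_add]
    congr 2
    ring
  have hb : 0 < ν⁻¹ / (2 * σsq) := by positivity
  have main := integral_exp_shift_ratio (f := f) hb
    (by
      simp only [hf]
      refine Real.continuous_exp.comp ?_
      have c1 : Continuous fun w : Fin c.m → ℝ => D *ᵥ w :=
        Continuous.matrix_mulVec continuous_const continuous_id
      exact (((c1.dotProduct c1).add (continuous_const.mul
        (continuous_id.dotProduct continuous_id))).neg).div_const _)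
    (fun _ => Real.exp_pos _)
    (fun w => by simp only [hf, Matrix.mulVec_neg, neg_dotProduct, dotProduct_neg, neg_neg])
    (fun w => by
      simp only [hf]
      apply Real.exp_le_exp.2
      have := dotProduct_self_nonneg' (D *ᵥ w)
      rw [neg_mul, neg_div, neg_le_neg_iff, div_mul_eq_mul_div]
      gcongr
      linarith) μ0 k
  simp only [posteriorMean, key]
  rw [integral_const_mul, ← main]
  have : ∀ μ : Fin c.m → ℝ, μ k * (K * f (μ - μ0)) = K * (μ k * f (μ - μ0)) := fun μ => by ring
  simp only [this]
  rw [integral_const_mul, mul_div_mul_left _ _ hKpos.ne']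

end Posterior

/-! ### Fitted mean functions and window sums -/

/-- The times `p + 1, ..., N`. -/
def win (p N : ℕ) : Finset ℕ := Finset.Ico (p + 1) (N + 1)

lemma mem_win {p N t : ℕ} : t ∈ win p N ↔ p + 1 ≤ t ∧ t ≤ N := by
  simp [win]

lemma sum_fin_eq_sum_win (p N : ℕ) (F : ℕ → ℝ) :
    ∑ i : Fin (N - p), F (p + 1 + (i : ℕ)) = ∑ t ∈ win p N, F t := by
  rw [win, Finset.sum_Ico_eq_sum_range, Nat.add_sub_add_right,
    Finset.sum_range (fun i => F (p + 1 + i))]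

/-- The seasonal mean function. -/
def seasonFn {T : ℕ} (s : Fin T → ℝ) (t : ℕ) : ℝ := ∑ v, seasonInd T t v * s v

/-- The regime mean function. -/
def regimeFn (c : Config) (N : ℕ) (μ : Fin c.m → ℝ) (t : ℕ) : ℝ := ∑ k, regimeInd c N t k * μ k

/-- The mean function with seasonal means `s` and regime means `μ`. -/
def fitFn {T : ℕ} (c : Config) (N : ℕ) (s : Fin T → ℝ) (μ : Fin c.m → ℝ) (t : ℕ) : ℝ :=
  seasonFn s t + regimeFn c N μ t

lemma obs_eq {T : ℕ} (c : Config) (s : Fin T → ℝ) (μ : Fin c.m → ℝ) (ε : ℕ → ℝ) (N t : ℕ) :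
    obs c s μ ε N t = fitFn c N s μ t + ε t := rfl

lemma seasonFn_sub {T : ℕ} (s s' : Fin T → ℝ) (t : ℕ) :
    seasonFn (s - s') t = seasonFn s t - seasonFn s' t := by
  simp [seasonFn, mul_sub, Finset.sum_sub_distrib]

lemma fitFn_sub {T : ℕ} (c : Config) (N : ℕ) (s s' : Fin T → ℝ) (μ μ' : Fin c.m → ℝ) (t : ℕ) :
    fitFn c N (s - s') (μ - μ') t = fitFn c N s μ t - fitFn c N s' μ' t := by
  simp only [fitFn, seasonFn, regimeFn, Pi.sub_apply, mul_sub, Finset.sum_sub_distrib]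
  ring

/-! ### The autoregressive filter -/

/-- The coefficient vector `(1, -φ₁, ..., -φ_p)`. -/
def arVec {p : ℕ} (φ : Fin p → ℝ) : Fin (p + 1) → ℝ := Fin.cons 1 fun j => -φ j

@[simp] lemma arVec_zero {p : ℕ} (φ : Fin p → ℝ) : arVec φ 0 = 1 := rfl

@[simp] lemma arVec_succ {p : ℕ} (φ : Fin p → ℝ) (j : Fin p) : arVec φ j.succ = -φ j := rfl

/-- The value at `1` of the autoregressive polynomial. -/
def arOne {p : ℕ} (φ : Fin p → ℝ) : ℝ := 1 - ∑ j, φ j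

lemma sum_arVec {p : ℕ} (φ : Fin p → ℝ) : ∑ i, arVec φ i = arOne φ := by
  simp [Fin.sum_univ_succ, arOne, sub_eq_add_neg]

lemma arFilter_eq {p : ℕ} (φ : Fin p → ℝ) (F : ℕ → ℝ) (t : ℕ) :
    arFilter φ F t = ∑ i : Fin (p + 1), arVec φ i * F (t - (i : ℕ)) := by
  simp [arFilter, Fin.sum_univ_succ, sub_eq_add_neg]

lemma arFilter_add {p : ℕ} (φ : Fin p → ℝ) (F G : ℕ → ℝ) (t : ℕ) :
    arFilter φ (fun t => F t + G t) t = arFilter φ F t + arFilter φ G t := by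
  simp only [arFilter_eq, mul_add, Finset.sum_add_distrib]

lemma arFilter_sub {p : ℕ} (φ : Fin p → ℝ) (F G : ℕ → ℝ) (t : ℕ) :
    arFilter φ (fun t => F t - G t) t = arFilter φ F t - arFilter φ G t := by
  simp only [arFilter_eq, mul_sub, Finset.sum_sub_distrib]

lemma arFilter_sum {p : ℕ} {ι : Type*} (S : Finset ι) (φ : Fin p → ℝ) (F : ι → ℕ → ℝ) (a : ι → ℝ)
    (t : ℕ) :
    arFilter φ (fun t => ∑ v ∈ S, F v t * a v) t = ∑ v ∈ S, arFilter φ (F v) t * a v := by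
  simp only [arFilter_eq, Finset.mul_sum, Finset.sum_mul]
  rw [Finset.sum_comm]
  exact Finset.sum_congr rfl fun v _ => Finset.sum_congr rfl fun i _ => by ring

lemma arFilter_fitFn {p T : ℕ} (c : Config) (N : ℕ) (φ : Fin p → ℝ) (s : Fin T → ℝ)
    (μ : Fin c.m → ℝ) (t : ℕ) :
    arFilter φ (fitFn c N s μ) t = ∑ v, arFilter φ (fun t => seasonInd T t v) t * s v
      + ∑ k, arFilter φ (fun t => regimeInd c N t k) t * μ k := by
  have h : fitFn c N s μ = fun t => seasonFn s t + regimeFn c N μ t := rfl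
  rw [h, arFilter_add]
  congr 1
  · exact arFilter_sum Finset.univ φ (fun v t => seasonInd T t v) s t
  · exact arFilter_sum Finset.univ φ (fun k t => regimeInd c N t k) μ t

/-- The penalized conditional sum of squares. -/
def crit {p T : ℕ} (ν : ℝ) (N : ℕ) (c : Config) (φ : Fin p → ℝ) (x : ℕ → ℝ) (s : Fin T → ℝ)
    (μ : Fin c.m → ℝ) : ℝ :=
  ∑ t ∈ win p N, arFilter φ (fun t => x t - fitFn c N s μ t) t ^ 2 + ν⁻¹ * ∑ k, μ k ^ 2

lemma filtA_mulVec_add {p T : ℕ} (N : ℕ) (c : Config) (φ : Fin p → ℝ) (s : Fin T → ℝ)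
    (μ : Fin c.m → ℝ) (i : Fin (N - p)) :
    (filtA T N φ *ᵥ s + filtD N c φ *ᵥ μ) i = arFilter φ (fitFn c N s μ) (p + 1 + (i : ℕ)) := by
  rw [arFilter_fitFn]; rfl

lemma dotProduct_filt_eq {p T : ℕ} (N : ℕ) (c : Config) (φ : Fin p → ℝ) (s : Fin T → ℝ)
    (μ : Fin c.m → ℝ) :
    (filtA T N φ *ᵥ s + filtD N c φ *ᵥ μ) ⬝ᵥ (filtA T N φ *ᵥ s + filtD N c φ *ᵥ μ)
      = ∑ t ∈ win p N, arFilter φ (fitFn c N s μ) t ^ 2 := by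
  rw [← sum_fin_eq_sum_win, dotProduct]
  exact Finset.sum_congr rfl fun i _ => by rw [filtA_mulVec_add, sq]

lemma penSS_eq_crit {p T : ℕ} (ν : ℝ) (N : ℕ) (c : Config) (φ : Fin p → ℝ) (x : ℕ → ℝ)
    (s : Fin T → ℝ) (μ : Fin c.m → ℝ) :
    penSS ν (filtA T N φ) (filtD N c φ) (filtX N φ x) s μ = crit ν N c φ x s μ := by
  rw [penSS, crit, ← sum_fin_eq_sum_win]
  congr 1
  · rw [dotProduct]
    refine Finset.sum_congr rfl fun i _ => ?_
    rw [arFilter_sub, sq, ← filtA_mulVec_add]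
    simp only [Pi.sub_apply, Pi.add_apply, filtX]
    ring
  · congr 1
    exact Finset.sum_congr rfl fun k _ => by rw [sq]

/-- The residual sum of squares behind `varEst`. -/
lemma varEst_mul_eq {p T : ℕ} {ν : ℝ} (hν : 0 < ν) {N : ℕ} (hN : p < N) (c : Config)
    (φ : Fin p → ℝ) (x : ℕ → ℝ) :
    ((N : ℝ) - p) * varEst ν T N c φ x
      = crit ν N c φ x (seasonEst ν T N c φ x) (ridgeMean ν N c φ (seasonEst ν T N c φ x) x) := by
  have h : (0 : ℝ) < (N : ℝ) - p := sub_pos.2 (by exact_mod_cast hN)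
  rw [varEst, ← mul_assoc, mul_inv_cancel₀ h.ne', one_mul, ← penSS_eq_crit]
  exact profile_eq_penSS hν (filtA T N φ) (filtD N c φ) (filtX N φ x)

lemma crit_nonneg {p T : ℕ} {ν : ℝ} (hν : 0 < ν) (N : ℕ) (c : Config) (φ : Fin p → ℝ) (x : ℕ → ℝ)
    (s : Fin T → ℝ) (μ : Fin c.m → ℝ) : 0 ≤ crit ν N c φ x s μ :=
  add_nonneg (Finset.sum_nonneg fun _ _ => sq_nonneg _)
    (mul_nonneg (inv_nonneg.2 hν.le) (Finset.sum_nonneg fun _ _ => sq_nonneg _))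

/-- If the filtered seasonal design is injective, the fitted coefficients minimize the penalized
sum of squares, with the exact excess elsewhere. -/
lemma crit_eq_add {p T : ℕ} {ν : ℝ} (hν : 0 < ν) {N : ℕ} (hN : p < N) (c : Config)
    (φ : Fin p → ℝ) (x : ℕ → ℝ)
    (hinj : ∀ u : Fin T → ℝ, (∀ t ∈ win p N, arFilter φ (seasonFn u) t = 0) → u = 0)
    (s : Fin T → ℝ) (μ : Fin c.m → ℝ) :
    crit ν N c φ x s μ = ((N : ℝ) - p) * varEst ν T N c φ x
      + (∑ t ∈ win p N, arFilter φ (fitFn c N (s - seasonEst ν T N c φ x)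
          (μ - ridgeMean ν N c φ (seasonEst ν T N c φ x) x)) t ^ 2
        + ν⁻¹ * ∑ k, (μ k - ridgeMean ν N c φ (seasonEst ν T N c φ x) x k) ^ 2) := by
  rw [varEst_mul_eq hν hN]
  set s' := seasonEst ν T N c φ x with hs'
  set μ' := ridgeMean ν N c φ s' x with hμ'
  have hA : ∀ u, filtA T N φ *ᵥ u = 0 → u = 0 := by
    intro u hu
    refine hinj u fun t ht => ?_
    obtain ⟨h1, h2⟩ := mem_win.1 ht
    have := congrFun hu ⟨t - (p + 1), by omega⟩
    rw [Matrix.mulVec, dotProduct, Pi.zero_apply] at this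
    have e : seasonFn u = fun t => ∑ v ∈ Finset.univ, seasonInd T t v * u v := rfl
    rw [e, arFilter_sum, ← this]
    refine Finset.sum_congr rfl fun v _ => ?_
    simp only [filtA, Matrix.of_apply]
    congr 2
    omega
  have h := penSS_eq_add hν (filtA T N φ) (filtD N c φ) (filtX N φ x)
    (normalG_isUnit hν (filtA T N φ) (filtD N c φ) hA) (s - s') (μ - μ')
  have e1 : glsCoef ν (filtA T N φ) (filtD N c φ) (filtX N φ x) = s' := rfl
  have e2 : ridgeCoef ν (filtD N c φ) (filtX N φ x - filtA T N φ *ᵥ s') = μ' := rfl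
  simp only [e1, e2, add_sub_cancel] at h
  rw [penSS_eq_crit, penSS_eq_crit, dotProduct_filt_eq] at h
  rw [h]
  congr 3
  exact Finset.sum_congr rfl fun k _ => by rw [Pi.sub_apply, sq]

/-! ### Periodicity of seasonal functions -/

lemma season_eq (T t : ℕ) : season T t = t - 1 - T * ((t - 1) / T) + (if t = 0 then 0 else 1) := by
  unfold season
  rcases Nat.eq_zero_or_pos t with rfl | h
  · simp
  · have := Nat.mul_div_le (t - 1) T
    rw [if_neg h.ne']
    omega

lemma seasonFn_eq {T : ℕ} (hT : 0 < T) (s : Fin T → ℝ) {t : ℕ} (ht : 1 ≤ t) :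
    seasonFn s t = s ⟨(t - 1) % T, Nat.mod_lt _ hT⟩ := by
  have h : season T t = (t - 1) % T + 1 := by
    rw [season_eq, if_neg (by omega), Nat.mod_eq_sub]
  rw [seasonFn, Finset.sum_eq_single ⟨(t - 1) % T, Nat.mod_lt _ hT⟩]
  · simp [seasonInd, h]
  · intro v _ hv
    rw [seasonInd, if_neg, zero_mul]
    intro h'
    apply hv
    ext
    simp only
    omega
  · simp

lemma seasonFn_congr {T : ℕ} (hT : 0 < T) (s : Fin T → ℝ) {t t' : ℕ} (ht : 1 ≤ t) (ht' : 1 ≤ t')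
    (h : t ≡ t' [MOD T]) : seasonFn s t = seasonFn s t' := by
  rw [seasonFn_eq hT s ht, seasonFn_eq hT s ht']
  congr 2
  have h' : (t - 1) + 1 ≡ (t' - 1) + 1 [MOD T] := by
    rwa [Nat.sub_add_cancel ht, Nat.sub_add_cancel ht']
  exact Nat.ModEq.add_right_cancel' 1 h'

/-- A function that is `T`-periodic on the times from `p + 1` on. -/
def PeriodicFrom (p T : ℕ) (y : ℕ → ℝ) : Prop :=
  ∀ t t' : ℕ, p + 1 ≤ t → p + 1 ≤ t' → t ≡ t' [MOD T] → y t = y t'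

lemma periodicFrom_seasonFn_lag {p T : ℕ} (hT : 0 < T) (s : Fin T → ℝ) {j : ℕ} (hj : j ≤ p) :
    PeriodicFrom p T fun t => seasonFn s (t - j) := by
  intro t t' ht ht' h
  refine seasonFn_congr hT s (by omega) (by omega) ?_
  have h' : (t - j) + j ≡ (t' - j) + j [MOD T] := by
    rwa [Nat.sub_add_cancel (by omega), Nat.sub_add_cancel (by omega)]
  exact Nat.ModEq.add_right_cancel' j h'

lemma periodicFrom_arFilter_seasonFn {p T : ℕ} (hT : 0 < T) (φ : Fin p → ℝ) (s : Fin T → ℝ) :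
    PeriodicFrom p T (arFilter φ (seasonFn s)) := by
  intro t t' ht ht' h
  rw [arFilter_eq, arFilter_eq]
  refine Finset.sum_congr rfl fun i _ => ?_
  exact congrArg (arVec φ i * ·)
    (periodicFrom_seasonFn_lag hT s (Nat.lt_succ_iff.1 i.2) t t' ht ht' h)

/-- A time from `p + 1` on in season `v + 1`. -/
def repTime (p : ℕ) {T : ℕ} (v : Fin T) : ℕ := (v : ℕ) + 1 + T * (p + 1)

lemma le_repTime (p : ℕ) {T : ℕ} (v : Fin T) : p + 1 ≤ repTime p v := by
  have : p + 1 ≤ T * (p + 1) := Nat.le_mul_of_pos_left _ (Fin.pos v)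
  rw [repTime]; omega

lemma PeriodicFrom.eq_seasonFn {p T : ℕ} (hT : 0 < T) {y : ℕ → ℝ} (hy : PeriodicFrom p T y) {t : ℕ}
    (ht : p + 1 ≤ t) : y t = seasonFn (fun v : Fin T => y (repTime p v)) t := by
  rw [seasonFn_eq hT _ (by omega)]
  refine hy _ _ ht (le_repTime p _) ?_
  simp only [repTime]
  rw [Nat.ModEq, Nat.add_mul_mod_self_left, Nat.mod_add_mod, Nat.sub_add_cancel (by omega)]

/-- A stretch of `n` full periods meets the season of `t₀` exactly `n` times; the other summands are
dropped. -/
lemma PeriodicFrom.mul_sq_le_sum {p T : ℕ} (hT : 0 < T) {y : ℕ → ℝ} (hy : PeriodicFrom p T y)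
    {a b n : ℕ} (ha : p + 1 ≤ a) (hab : a + n * T ≤ b) (κ : ℝ) {t₀ : ℕ} (ht₀ : p + 1 ≤ t₀) :
    n * (y t₀ + κ) ^ 2 ≤ ∑ t ∈ Finset.Ico a b, (y t + κ) ^ 2 := by
  obtain ⟨r, hr, hmod⟩ : ∃ r < T, a + r ≡ t₀ [MOD T] := by
    -- The offset from `a` to the next time in the season of `t₀`; adding `T - a % T` avoids a
    -- truncated subtraction.
    refine ⟨(t₀ + (T - a % T)) % T, Nat.mod_lt _ hT, ?_⟩
    have h1 : a % T ≤ T := (Nat.mod_lt _ hT).le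
    calc a + (t₀ + (T - a % T)) % T ≡ a + (t₀ + (T - a % T)) [MOD T] :=
          (Nat.mod_modEq _ _).add_left a
      _ ≡ a % T + (t₀ + (T - a % T)) [MOD T] := ((Nat.mod_modEq a T).symm).add_right _
      _ = t₀ + T := by omega
      _ ≡ t₀ [MOD T] := by simp [Nat.ModEq]
  have hval : ∀ i, y (a + r + i * T) = y t₀ := fun i => by
    refine hy _ _ (by omega) ht₀ ?_
    have : a + r + i * T ≡ a + r [MOD T] := by simp [Nat.ModEq]
    exact this.trans hmod
  have hinj : Set.InjOn (fun i => a + r + i * T) (Finset.range n : Set ℕ) := by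
    intro i _ j _ hij
    have : i * T = j * T := by simpa using hij
    exact Nat.eq_of_mul_eq_mul_right hT this
  calc (n : ℝ) * (y t₀ + κ) ^ 2
      = ∑ i ∈ Finset.range n, (y (a + r + i * T) + κ) ^ 2 := by simp [hval]
    _ = ∑ t ∈ (Finset.range n).image (fun i => a + r + i * T), (y t + κ) ^ 2 := by
        rw [Finset.sum_image hinj]
    _ ≤ _ := by
        refine Finset.sum_le_sum_of_subset_of_nonneg ?_ fun _ _ _ => sq_nonneg _
        intro t ht
        obtain ⟨i, hi, rfl⟩ := Finset.mem_image.1 ht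
        have hi' := Finset.mem_range.1 hi
        have : i * T + T ≤ n * T := by
          calc i * T + T = (i + 1) * T := by ring
            _ ≤ n * T := Nat.mul_le_mul_right T hi'
        exact Finset.mem_Ico.2 ⟨by omega, by omega⟩

/-! ### Regimes -/

/-- Every regime has at least `ρ` times. -/
def Spaced (c : Config) (N ρ : ℕ) : Prop := ∀ r ≤ c.m, c.tau N r + ρ ≤ c.tau N (r + 1)

@[simp] lemma Config.tau_zero (c : Config) (N : ℕ) : c.tau N 0 = 1 := by simp [Config.tau]

@[simp] lemma Config.tau_last (c : Config) (N : ℕ) : c.tau N (c.m + 1) = N + 1 := by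
  simp [Config.tau]

lemma Spaced.mono {c : Config} {N ρ : ℕ} (h : Spaced c N ρ) {i j : ℕ} (hij : i < j)
    (hj : j ≤ c.m + 1) : c.tau N i + ρ ≤ c.tau N j := by
  induction j with
  | zero => omega
  | succ j ih =>
    have h1 := h j (by omega)
    rcases Nat.lt_succ_iff_lt_or_eq.1 hij with h2 | rfl
    · have := ih h2 (by omega); omega
    · exact h1

lemma Spaced.tau_le {c : Config} {N ρ : ℕ} (h : Spaced c N ρ) {i j : ℕ} (hij : i ≤ j)
    (hj : j ≤ c.m + 1) : c.tau N i ≤ c.tau N j := by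
  rcases hij.eq_or_lt with rfl | h1
  · exact le_rfl
  · have := h.mono h1 hj; omega

lemma Spaced.one_le_tau {c : Config} {N ρ : ℕ} (h : Spaced c N ρ) {j : ℕ} (hj : j ≤ c.m + 1) :
    1 ≤ c.tau N j := by
  simpa using h.tau_le (Nat.zero_le j) hj

lemma Spaced.tau_le_last {c : Config} {N ρ : ℕ} (h : Spaced c N ρ) {j : ℕ} (hj : j ≤ c.m + 1) :
    c.tau N j ≤ N + 1 := by
  simpa using h.tau_le hj le_rfl

lemma Spaced.regimeFn_eq {c : Config} {N ρ : ℕ} (h : Spaced c N ρ) (μ : Fin c.m → ℝ) {r t : ℕ}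
    (hr : r ≤ c.m) (h1 : c.tau N r ≤ t) (h2 : t < c.tau N (r + 1)) :
    regimeFn c N μ t = regimeMean μ r := by
  have key : ∀ k : Fin c.m, regimeInd c N t k = if (k : ℕ) + 1 = r then 1 else 0 := by
    intro k
    have hk := k.2
    rw [regimeInd]
    refine if_congr ⟨fun ⟨h3, h4⟩ => ?_, fun h3 => ?_⟩ rfl rfl
    · by_contra hne
      rcases Nat.lt_or_gt_of_ne hne with h5 | h5
      · have := h.tau_le (i := (k : ℕ) + 2) (j := r) (by omega) (by omega); omega
      · have := h.tau_le (i := r + 1) (j := (k : ℕ) + 1) (by omega) (by omega); omega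
    · subst h3; exact ⟨h1, h2⟩
  simp only [regimeFn, key]
  rcases Nat.eq_zero_or_pos r with rfl | hr0
  · simp [regimeMean]
  · have hr1 : r - 1 < c.m := by omega
    rw [Finset.sum_eq_single ⟨r - 1, hr1⟩]
    · rw [if_pos (by simp only; omega), one_mul, regimeMean, if_neg hr0.ne', dif_pos hr1]
    · intro k _ hk
      rw [if_neg, zero_mul]
      intro h'
      apply hk; ext; simp only; omega
    · simp

lemma Spaced.exists_regime {c : Config} {N ρ : ℕ} (_h : Spaced c N ρ) {t : ℕ} (h1 : 1 ≤ t)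
    (h2 : t ≤ N) : ∃ r ≤ c.m, c.tau N r ≤ t ∧ t < c.tau N (r + 1) := by
  have hex : ∃ r, t < c.tau N (r + 1) := ⟨c.m, by rw [Config.tau_last]; omega⟩
  classical
  refine ⟨Nat.find hex, Nat.find_min' hex (by rw [Config.tau_last]; omega), ?_, Nat.find_spec hex⟩
  rcases Nat.eq_zero_or_pos (Nat.find hex) with h0 | h0
  · rw [h0]; simpa using h1
  · have := Nat.find_min hex (Nat.sub_lt h0 one_pos)
    rw [show Nat.find hex - 1 + 1 = Nat.find hex by omega] at this
    omega

/-- On `p + 1` consecutive times of one regime the filter sees the regime mean only through the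
factor `arOne φ`. For this reason regime means are identifiable only under filters with `arOne φ ≠
0`. -/
lemma arFilter_const_add {p : ℕ} (φ : Fin p → ℝ) (F G : ℕ → ℝ) (κ : ℝ) (t : ℕ)
    (h : ∀ i ≤ p, F (t - i) = G (t - i) + κ) : arFilter φ F t = arFilter φ G t + arOne φ * κ := by
  rw [arFilter_eq, arFilter_eq, ← sum_arVec, Finset.sum_mul, ← Finset.sum_add_distrib]
  refine Finset.sum_congr rfl fun i _ => ?_
  rw [h i (Nat.lt_succ_iff.1 i.2)]; ring

lemma abs_regimeMean_le {m : ℕ} (μ : Fin m → ℝ) {B : ℝ} (hB : 0 ≤ B) (h : ∀ k, |μ k| ≤ B) (r : ℕ) :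
    |regimeMean μ r| ≤ B := by
  unfold regimeMean
  split_ifs with h1 h2
  · simpa using hB
  · exact h _
  · simpa using hB

/-- The filtered mean function dominates its seasonal part. -/
lemma Spaced.mul_season_sq_le {p T : ℕ} (hT : 0 < T) {c : Config} {N ρ n : ℕ} (h : Spaced c N ρ)
    (hn : p + n * T ≤ ρ) (φ : Fin p → ℝ) (s : Fin T → ℝ) (μ : Fin c.m → ℝ) {r t₀ : ℕ}
    (hr : r ≤ c.m) (ht₀ : p + 1 ≤ t₀) :
    n * (arFilter φ (seasonFn s) t₀ + arOne φ * regimeMean μ r) ^ 2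
      ≤ ∑ t ∈ Finset.Ico (c.tau N r + p) (c.tau N (r + 1)), arFilter φ (fitFn c N s μ) t ^ 2 := by
  have h0 := h.one_le_tau (j := r) (by omega)
  have h1 := h r hr
  refine ((periodicFrom_arFilter_seasonFn hT φ s).mul_sq_le_sum hT (a := c.tau N r + p)
    (b := c.tau N (r + 1)) (by omega) (by omega) (arOne φ * regimeMean μ r) ht₀).trans_eq ?_
  refine Finset.sum_congr rfl fun t ht => ?_
  obtain ⟨h2, h3⟩ := Finset.mem_Ico.1 ht
  rw [arFilter_const_add φ (fitFn c N s μ) (seasonFn s) (regimeMean μ r)]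
  intro i hi
  rw [fitFn, h.regimeFn_eq μ hr (by omega) (by omega)]

lemma Spaced.sum_regime_le_sum_win {p : ℕ} {c : Config} {N ρ : ℕ} (h : Spaced c N ρ) {F : ℕ → ℝ}
    (hF : ∀ t, 0 ≤ F t) {r : ℕ} (hr : r ≤ c.m) :
    ∑ t ∈ Finset.Ico (c.tau N r + p) (c.tau N (r + 1)), F t ≤ ∑ t ∈ win p N, F t := by
  refine Finset.sum_le_sum_of_subset_of_nonneg (fun t ht => ?_) fun _ _ _ => hF _
  obtain ⟨h2, h3⟩ := Finset.mem_Ico.1 ht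
  have h0 := h.one_le_tau (j := r) (by omega)
  have h4 := h.tau_le_last (j := r + 1) (by omega)
  exact mem_win.2 ⟨by omega, by omega⟩

/-- The first regime has mean zero, so the seasonal part is visible there alone. -/
lemma Spaced.season_sq_le_sum_win {p T : ℕ} (hT : 0 < T) {c : Config} {N ρ n : ℕ}
    (h : Spaced c N ρ) (hn : p + n * T ≤ ρ) (φ : Fin p → ℝ) (s : Fin T → ℝ) (μ : Fin c.m → ℝ)
    {t₀ : ℕ} (ht₀ : p + 1 ≤ t₀) :
    n * arFilter φ (seasonFn s) t₀ ^ 2 ≤ ∑ t ∈ win p N, arFilter φ (fitFn c N s μ) t ^ 2 := by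
  have h1 := h.mul_season_sq_le hT hn φ s μ (Nat.zero_le c.m) ht₀
  have h2 := h.sum_regime_le_sum_win (p := p) (F := fun t => arFilter φ (fitFn c N s μ) t ^ 2)
    (fun t => sq_nonneg _) (Nat.zero_le c.m)
  have h3 : regimeMean μ 0 = 0 := by simp [regimeMean]
  rw [h3, mul_zero, add_zero] at h1
  exact h1.trans h2

/-- At a fixed season the first regime shows the filtered seasonal value `y`, and the regime of `k`
shows `y` plus the filtered mean. The mean is the difference of the two; the factor 4 is from
squaring a difference and from using the window sum twice. -/
lemma Spaced.mean_sq_le_sum_win {p T : ℕ} (hT : 0 < T) {c : Config} {N ρ n : ℕ}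
    (h : Spaced c N ρ) (hn : p + n * T ≤ ρ) (φ : Fin p → ℝ) (s : Fin T → ℝ) (μ : Fin c.m → ℝ)
    (k : Fin c.m) :
    n * (arOne φ * μ k) ^ 2 ≤ 4 * ∑ t ∈ win p N, arFilter φ (fitFn c N s μ) t ^ 2 := by
  have h1 := h.season_sq_le_sum_win hT hn φ s μ (le_refl (p + 1))
  have h2 := h.mul_season_sq_le hT hn φ s μ (r := (k : ℕ) + 1) (by have := k.2; omega)
    (le_refl (p + 1))
  have h3 := h.sum_regime_le_sum_win (p := p) (F := fun t => arFilter φ (fitFn c N s μ) t ^ 2)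
    (fun t => sq_nonneg _) (r := (k : ℕ) + 1) (by have := k.2; omega)
  have h4 : regimeMean μ ((k : ℕ) + 1) = μ k := by simp [regimeMean]
  rw [h4] at h2
  have h5 := h2.trans h3
  set y := arFilter φ (seasonFn s) (p + 1)
  set a := arOne φ * μ k
  have : (n : ℝ) * a ^ 2 ≤ 2 * (n * y ^ 2) + 2 * (n * (y + a) ^ 2) := by
    have hn0 : (0 : ℝ) ≤ n := Nat.cast_nonneg n
    have : a ^ 2 ≤ 2 * y ^ 2 + 2 * (y + a) ^ 2 := by nlinarith [sq_nonneg (2 * y + a)]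
    nlinarith
  linarith

/-! ### Lagged products -/

/-- `∑_{t = p+1}^N f_{t-i} g_{t-j}`. -/
def lagProd (p N : ℕ) (f g : ℕ → ℝ) (i j : ℕ) : ℝ := ∑ t ∈ win p N, f (t - i) * g (t - j)

lemma lagProd_comm (p N : ℕ) (f g : ℕ → ℝ) (i j : ℕ) :
    lagProd p N f g i j = lagProd p N g f j i := by
  simp only [lagProd, mul_comm]

lemma lagProd_add_left (p N : ℕ) (f f' g : ℕ → ℝ) (i j : ℕ) :
    lagProd p N (fun t => f t + f' t) g i j = lagProd p N f g i j + lagProd p N f' g i j := by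
  simp only [lagProd, add_mul, Finset.sum_add_distrib]

lemma lagProd_add_right (p N : ℕ) (f g g' : ℕ → ℝ) (i j : ℕ) :
    lagProd p N f (fun t => g t + g' t) i j = lagProd p N f g i j + lagProd p N f g' i j := by
  simp only [lagProd, mul_add, Finset.sum_add_distrib]

lemma sum_arFilter_mul {p : ℕ} (N : ℕ) (φ φ' : Fin p → ℝ) (f g : ℕ → ℝ) :
    ∑ t ∈ win p N, arFilter φ f t * arFilter φ' g t
      = ∑ i : Fin (p + 1), ∑ j : Fin (p + 1), arVec φ i * arVec φ' j * lagProd p N f g i j := by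
  simp only [arFilter_eq, Finset.sum_mul_sum]
  rw [Finset.sum_comm]
  refine Finset.sum_congr rfl fun i _ => ?_
  rw [Finset.sum_comm]
  refine Finset.sum_congr rfl fun j _ => ?_
  rw [lagProd, Finset.mul_sum]
  exact Finset.sum_congr rfl fun t _ => by ring

lemma sum_arFilter_sq {p : ℕ} (N : ℕ) (φ : Fin p → ℝ) (f : ℕ → ℝ) :
    ∑ t ∈ win p N, arFilter φ f t ^ 2
      = ∑ i : Fin (p + 1), ∑ j : Fin (p + 1), arVec φ i * arVec φ j * lagProd p N f f i j := by
  rw [← sum_arFilter_mul]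
  exact Finset.sum_congr rfl fun t _ => sq _

/-- The sum of the absolute values of the filter coefficients. -/
def arNorm {p : ℕ} (φ : Fin p → ℝ) : ℝ := ∑ i, |arVec φ i|

lemma arNorm_eq {p : ℕ} (φ : Fin p → ℝ) : arNorm φ = 1 + ∑ j, |φ j| := by
  simp [arNorm, Fin.sum_univ_succ]

lemma one_le_arNorm {p : ℕ} (φ : Fin p → ℝ) : 1 ≤ arNorm φ := by
  rw [arNorm_eq]; linarith [Finset.sum_nonneg fun (j : Fin p) (_ : j ∈ Finset.univ) => abs_nonneg (φ j)]

lemma abs_sum_arVec_mul_le {p : ℕ} (φ : Fin p → ℝ) {a : Fin (p + 1) → ℝ} {B : ℝ}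
    (h : ∀ i, |a i| ≤ B) : |∑ i, arVec φ i * a i| ≤ arNorm φ * B := by
  refine (Finset.abs_sum_le_sum_abs _ _).trans ?_
  rw [arNorm, Finset.sum_mul]
  exact Finset.sum_le_sum fun i _ => by
    rw [abs_mul]; exact mul_le_mul_of_nonneg_left (h i) (abs_nonneg _)

lemma abs_sum_arFilter_mul_le {p N : ℕ} (φ φ' : Fin p → ℝ) {f g : ℕ → ℝ} {B : ℝ}
    (h : ∀ i ≤ p, ∀ j ≤ p, |lagProd p N f g i j| ≤ B) :
    |∑ t ∈ win p N, arFilter φ f t * arFilter φ' g t| ≤ arNorm φ * (arNorm φ' * B) := by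
  rw [sum_arFilter_mul]
  have : ∀ i : Fin (p + 1), |∑ j : Fin (p + 1), arVec φ' j * lagProd p N f g i j|
      ≤ arNorm φ' * B := fun i => abs_sum_arVec_mul_le φ' fun j =>
    h i (Nat.lt_succ_iff.1 i.2) j (Nat.lt_succ_iff.1 j.2)
  convert abs_sum_arVec_mul_le φ this using 2
  refine Finset.sum_congr rfl fun i _ => ?_
  rw [Finset.mul_sum]
  exact Finset.sum_congr rfl fun j _ => by ring

/-- A bound of sup norm against total mass. It serves for products with a misfit, which is bounded
and lives near few changepoints, so that only its total mass is small. -/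
lemma abs_lagProd_le_sum {p N : ℕ} {f g : ℕ → ℝ} {B : ℝ} (hf : ∀ t, 1 ≤ t → t ≤ N → |f t| ≤ B)
    {i j : ℕ} (hi : i ≤ p) (hj : j ≤ p) :
    |lagProd p N f g i j| ≤ B * ∑ t ∈ Finset.Icc 1 N, |g t| := by
  have hB : ∀ t ∈ win p N, |f (t - i) * g (t - j)| ≤ B * |g (t - j)| := fun t ht => by
    obtain ⟨h1, h2⟩ := mem_win.1 ht
    rw [abs_mul]
    exact mul_le_mul_of_nonneg_right (hf _ (by omega) (by omega)) (abs_nonneg _)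
  refine (Finset.abs_sum_le_sum_abs _ _).trans ((Finset.sum_le_sum hB).trans ?_)
  rw [← Finset.mul_sum]
  rcases Nat.eq_zero_or_pos N with rfl | hN
  · simp [win]
  have hB0 : 0 ≤ B := (abs_nonneg _).trans (hf 1 le_rfl hN)
  refine mul_le_mul_of_nonneg_left ?_ hB0
  have hinj : Set.InjOn (fun t => t - j) (win p N : Set ℕ) := by
    intro t ht t' ht' h
    have h1 := (mem_win.1 (Finset.mem_coe.1 ht)).1
    have h2 := (mem_win.1 (Finset.mem_coe.1 ht')).1
    simp only at h
    omega
  rw [← Finset.sum_image (f := fun t => |g t|) hinj]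
  refine Finset.sum_le_sum_of_subset_of_nonneg (fun u hu => ?_) fun _ _ _ => abs_nonneg _
  obtain ⟨t, ht, rfl⟩ := Finset.mem_image.1 hu
  obtain ⟨h1, h2⟩ := mem_win.1 ht
  exact Finset.mem_Icc.2 ⟨by omega, by omega⟩

/-! ### Products of noise and mean functions -/

/-- `Q` bounds the partial sums and the lagged seasonal sums of `e`. -/
structure NoiseBound (p T N : ℕ) (e : ℕ → ℝ) (Q : ℝ) : Prop where
  partialSum : ∀ n ≤ N, |∑ u ∈ Finset.Ico 1 (n + 1), e u| ≤ Q
  seasonal : ∀ i ≤ p, ∀ v : Fin T, |∑ t ∈ win p N, e (t - i) * seasonInd T t v| ≤ Q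

lemma NoiseBound.nonneg {p T N : ℕ} {e : ℕ → ℝ} {Q : ℝ} (h : NoiseBound p T N e Q) : 0 ≤ Q :=
  (abs_nonneg _).trans (h.partialSum 0 (Nat.zero_le _))

lemma NoiseBound.abs_sum_Ico_le {p T N : ℕ} {e : ℕ → ℝ} {Q : ℝ} (h : NoiseBound p T N e Q)
    {a b : ℕ} (ha : 1 ≤ a) (hb : b ≤ N + 1) : |∑ u ∈ Finset.Ico a b, e u| ≤ 2 * Q := by
  rcases Nat.lt_or_ge a b with hab | hab
  · have h1 := h.partialSum (b - 1) (by omega)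
    have h2 := h.partialSum (a - 1) (by omega)
    rw [Nat.sub_add_cancel (by omega)] at h1 h2
    rw [← Finset.sum_Ico_consecutive e ha hab.le] at h1
    rw [abs_le] at *
    constructor <;> linarith [h1.1, h1.2, h2.1, h2.2]
  · rw [Finset.Ico_eq_empty (by omega)]
    simpa using h.nonneg

lemma NoiseBound.abs_sum_mul_periodic_le {p T N : ℕ} (hT : 0 < T) {e : ℕ → ℝ} {Q : ℝ}
    (h : NoiseBound p T N e Q) {y : ℕ → ℝ} (hy : PeriodicFrom p T y) {Y : ℝ}
    (hY : ∀ t, p + 1 ≤ t → |y t| ≤ Y) {i : ℕ} (hi : i ≤ p) :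
    |∑ t ∈ win p N, e (t - i) * y t| ≤ T * Y * Q := by
  have e1 : ∑ t ∈ win p N, e (t - i) * y t
      = ∑ v : Fin T, y (repTime p v) * ∑ t ∈ win p N, e (t - i) * seasonInd T t v := by
    simp only [Finset.mul_sum]
    rw [Finset.sum_comm]
    refine Finset.sum_congr rfl fun t ht => ?_
    rw [hy.eq_seasonFn hT (mem_win.1 ht).1, seasonFn, Finset.mul_sum]
    exact Finset.sum_congr rfl fun v _ => by ring
  rw [e1]
  calc _ ≤ ∑ v : Fin T, |y (repTime p v) * ∑ t ∈ win p N, e (t - i) * seasonInd T t v| :=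
        Finset.abs_sum_le_sum_abs _ _
    _ ≤ ∑ _v : Fin T, Y * Q := Finset.sum_le_sum fun v _ => by
        rw [abs_mul]
        exact mul_le_mul (hY _ (le_repTime p v)) (h.seasonal i hi v) (abs_nonneg _)
          ((abs_nonneg _).trans (hY _ (le_repTime p v)))
    _ = _ := by simp [mul_assoc]

/-- The indicator of a regime selects a contiguous block of the noise, whose sum is a difference of
two partial sums. A bound on all partial sums is therefore uniform in the positions of the
changepoints, which matters because the fitted ones depend on the data. -/
lemma NoiseBound.abs_lagProd_regimeFn_le {p T N : ℕ} {e : ℕ → ℝ} {Q : ℝ}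
    (h : NoiseBound p T N e Q) (c : Config) (μ : Fin c.m → ℝ) {B : ℝ} (hB : ∀ k, |μ k| ≤ B)
    {i j : ℕ} (hi : i ≤ p) (hj : j ≤ p) :
    |lagProd p N e (regimeFn c N μ) i j| ≤ 2 * c.m * B * Q := by
  have key : ∀ k : Fin c.m, |∑ t ∈ win p N, e (t - i) * regimeInd c N (t - j) k| ≤ 2 * Q := by
    intro k
    set a := c.tau N ((k : ℕ) + 1)
    set b := c.tau N ((k : ℕ) + 2)
    have e1 : ∑ t ∈ win p N, e (t - i) * regimeInd c N (t - j) k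
        = ∑ u ∈ Finset.Ico (max (p + 1) (a + j) - i) (min (N + 1) (b + j) - i), e u := by
      have e2 : ∑ t ∈ win p N, e (t - i) * regimeInd c N (t - j) k
          = ∑ t ∈ Finset.Ico (max (p + 1) (a + j)) (min (N + 1) (b + j)), e (t - i) := by
        rw [show Finset.Ico (max (p + 1) (a + j)) (min (N + 1) (b + j))
            = (win p N).filter fun t => a ≤ t - j ∧ t - j < b from ?_]
        · rw [Finset.sum_filter]
          refine Finset.sum_congr rfl fun t _ => ?_
          rw [regimeInd, mul_ite, mul_one, mul_zero]
        · ext t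
          simp only [Finset.mem_Ico, Finset.mem_filter, mem_win]
          omega
      rw [e2]
      refine Finset.sum_bij (fun t _ => t - i) ?_ ?_ ?_ ?_
      · intro t ht
        rw [Finset.mem_Ico] at ht ⊢
        omega
      · intro t ht t' ht' hh
        rw [Finset.mem_Ico] at ht ht'
        omega
      · intro u hu
        rw [Finset.mem_Ico] at hu
        exact ⟨u + i, by rw [Finset.mem_Ico]; omega, by omega⟩
      · intro t _; rfl
    rw [e1]
    exact h.abs_sum_Ico_le (by omega) (by omega)
  have e3 : lagProd p N e (regimeFn c N μ) i j
      = ∑ k, μ k * ∑ t ∈ win p N, e (t - i) * regimeInd c N (t - j) k := by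
    simp only [lagProd, regimeFn, Finset.mul_sum]
    rw [Finset.sum_comm]
    exact Finset.sum_congr rfl fun k _ => Finset.sum_congr rfl fun t _ => by ring
  rw [e3]
  calc _ ≤ ∑ k, |μ k * ∑ t ∈ win p N, e (t - i) * regimeInd c N (t - j) k| :=
        Finset.abs_sum_le_sum_abs _ _
    _ ≤ ∑ _k : Fin c.m, B * (2 * Q) := Finset.sum_le_sum fun k _ => by
        rw [abs_mul]
        exact mul_le_mul (hB k) (key k) (abs_nonneg _) ((abs_nonneg _).trans (hB k))
    _ = _ := by simp; ring

lemma abs_seasonFn_le {T : ℕ} (hT : 0 < T) (s : Fin T → ℝ) {B : ℝ} (hB : ∀ v, |s v| ≤ B) {t : ℕ}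
    (ht : 1 ≤ t) : |seasonFn s t| ≤ B := by
  rw [seasonFn_eq hT s ht]; exact hB _

lemma NoiseBound.abs_lagProd_fitFn_le {p T N : ℕ} (hT : 0 < T) {e : ℕ → ℝ} {Q : ℝ}
    (h : NoiseBound p T N e Q) (c : Config) (s : Fin T → ℝ) (μ : Fin c.m → ℝ) {B : ℝ}
    (hs : ∀ v, |s v| ≤ B) (hμ : ∀ k, |μ k| ≤ B) {i j : ℕ} (hi : i ≤ p) (hj : j ≤ p) :
    |lagProd p N e (fitFn c N s μ) i j| ≤ (T + 2 * c.m) * B * Q := by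
  have e1 : lagProd p N e (fitFn c N s μ) i j
      = ∑ t ∈ win p N, e (t - i) * seasonFn s (t - j) + lagProd p N e (regimeFn c N μ) i j := by
    rw [show fitFn c N s μ = fun t => seasonFn s t + regimeFn c N μ t from rfl, lagProd_add_right]
    rfl
  rw [e1]
  have h1 := h.abs_sum_mul_periodic_le hT (periodicFrom_seasonFn_lag hT s hj)
    (fun t ht => abs_seasonFn_le hT s hs (t := t - j) (by omega)) hi
  have h2 := h.abs_lagProd_regimeFn_le c μ hμ hi hj
  calc _ ≤ _ := abs_add_le _ _
    _ ≤ T * B * Q + 2 * c.m * B * Q := add_le_add h1 h2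
    _ = _ := by ring

lemma Spaced.abs_fitFn_le {T : ℕ} (hT : 0 < T) {c : Config} {N ρ : ℕ} (h : Spaced c N ρ)
    (s : Fin T → ℝ) (μ : Fin c.m → ℝ) {B : ℝ} (hB : 0 ≤ B)
    (hs : ∀ v, |s v| ≤ B) (hμ : ∀ k, |μ k| ≤ B) {t : ℕ} (h1 : 1 ≤ t) (h2 : t ≤ N) :
    |fitFn c N s μ t| ≤ 2 * B := by
  obtain ⟨r, hr, h3, h4⟩ := h.exists_regime h1 h2
  rw [fitFn, h.regimeFn_eq μ hr h3 h4]
  have h5 := abs_seasonFn_le hT s hs h1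
  have h6 := abs_regimeMean_le μ hB hμ r
  linarith [abs_add_le (seasonFn s t) (regimeMean μ r)]

/-! ### A missed changepoint -/

/-- If no fitted changepoint is within `δ` of a true one, the fitted regime mean is the same
constant on both sides of it. The seasonal difference is periodic, so at a fixed season the filtered
misfit takes two values, one on each side, that differ by `arOne φ` times the jump. They cannot both
be small, and each is repeated `n` times. -/
lemma Spaced.missed_changepoint {p T : ℕ} (hT : 0 < T) {c₀ c : Config} {N ρ n δ : ℕ}
    (h₀ : Spaced c₀ N ρ) (hδ : δ ≤ ρ) (hn : p + n * T ≤ δ) (φ : Fin p → ℝ)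
    (s₀ s : Fin T → ℝ) (μ₀ : Fin c₀.m → ℝ) (μ : Fin c.m → ℝ) {r : ℕ} (hr : r < c₀.m)
    (hmiss : ∀ k : Fin c.m, c.tau N ((k : ℕ) + 1) + δ ≤ c₀.tau N (r + 1) ∨
      c₀.tau N (r + 1) + δ ≤ c.tau N ((k : ℕ) + 1)) {ρ' : ℕ} (hc : Spaced c N ρ') :
    n * (arOne φ * (regimeMean μ₀ (r + 1) - regimeMean μ₀ r)) ^ 2
      ≤ 2 * ∑ t ∈ win p N, arFilter φ (fun t => fitFn c₀ N s₀ μ₀ t - fitFn c N s μ t) t ^ 2 := by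
  set τ := c₀.tau N (r + 1) with hτ
  have hl := h₀ r (by omega)
  have hrr := h₀ (r + 1) (by omega)
  have h1 := h₀.one_le_tau (j := r) (by omega)
  have h2 := h₀.tau_le_last (j := r + 1 + 1) (by omega)
  have hδ0 : n * T ≤ δ := by omega
  rcases Nat.eq_zero_or_pos n with rfl | hn0
  · simp only [Nat.cast_zero, zero_mul]
    exact mul_nonneg zero_le_two (Finset.sum_nonneg fun _ _ => sq_nonneg _)
  have hnT : 0 < n * T := Nat.mul_pos hn0 hT
  obtain ⟨b, hb, hb1, hb2⟩ := hc.exists_regime (t := τ) (by omega) (by omega)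
  have hbl : c.tau N b + δ ≤ τ ∨ c.tau N b = τ - δ ∨ b = 0 := by
    rcases Nat.eq_zero_or_pos b with h | h
    · exact Or.inr (Or.inr h)
    · have := hmiss ⟨b - 1, by omega⟩
      simp only [Nat.sub_add_cancel h] at this
      omega
  have hbl' : c.tau N b ≤ τ - δ := by
    rcases hbl with h | h | h
    · omega
    · omega
    · subst h; simp; omega
  have hbr : τ + δ ≤ c.tau N (b + 1) := by
    rcases Nat.lt_or_ge b c.m with h | h
    · have := hmiss ⟨b, h⟩
      simp only at this
      omega
    · have : b = c.m := le_antisymm hb h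
      subst this
      rw [Config.tau_last]; omega
  have hreg : ∀ t, τ - δ ≤ t → t < τ + δ → regimeFn c N μ t = regimeMean μ b := fun t h3 h4 =>
    hc.regimeFn_eq μ hb (by omega) (by omega)
  set y := arFilter φ (seasonFn (s₀ - s)) with hy
  have hyp : PeriodicFrom p T y := periodicFrom_arFilter_seasonFn hT φ _
  set G : ℕ → ℝ := arFilter φ (fun t => fitFn c₀ N s₀ μ₀ t - fitFn c N s μ t) with hG
  have val : ∀ (q lo hi : ℕ), q ≤ c₀.m → c₀.tau N q ≤ lo → hi ≤ c₀.tau N (q + 1) → τ - δ ≤ lo →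
      hi ≤ τ + δ → ∀ t ∈ Finset.Ico (lo + p) hi,
      (y t + arOne φ * (regimeMean μ₀ q - regimeMean μ b)) ^ 2 = G t ^ 2 := by
    intro q lo hi hq h3 h4 h5 h6 t ht
    obtain ⟨h7, h8⟩ := Finset.mem_Ico.1 ht
    rw [hG, arFilter_const_add φ _ (seasonFn (s₀ - s)) (regimeMean μ₀ q - regimeMean μ b)]
    intro i hi
    rw [fitFn, fitFn, h₀.regimeFn_eq μ₀ hq (by omega) (by omega), hreg _ (by omega) (by omega),
      seasonFn_sub]
    ring
  have sub : ∀ lo hi : ℕ, 1 ≤ lo → hi ≤ N + 1 →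
      Finset.Ico (lo + p) hi ⊆ win p N := by
    intro lo hi h3 h4 t ht
    obtain ⟨h7, h8⟩ := Finset.mem_Ico.1 ht
    exact mem_win.2 ⟨by omega, by omega⟩
  -- On either side the first `p` times are left out, so that the filter never reaches across the
  -- changepoint or out of the window of radius `δ`; the condition `p + n * T ≤ δ` leaves `n` full
  -- periods.
  have L := hyp.mul_sq_le_sum hT (a := τ - δ + p) (b := τ) (n := n) (by omega) (by omega)
    (arOne φ * (regimeMean μ₀ r - regimeMean μ b)) (le_refl (p + 1))
  have R := hyp.mul_sq_le_sum hT (a := τ + p) (b := τ + δ) (n := n) (by omega) (by omega)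
    (arOne φ * (regimeMean μ₀ (r + 1) - regimeMean μ b)) (le_refl (p + 1))
  rw [Finset.sum_congr rfl (val r (τ - δ) τ (by omega) (by omega) le_rfl le_rfl (by omega))] at L
  rw [Finset.sum_congr rfl (val (r + 1) τ (τ + δ) hr le_rfl (by omega) (by omega) le_rfl)] at R
  have hdisj : Disjoint (Finset.Ico (τ - δ + p) τ) (Finset.Ico (τ + p) (τ + δ)) := by
    rw [Finset.disjoint_left]
    intro t ht ht'
    rw [Finset.mem_Ico] at ht ht'
    omega
  have tot : ∑ t ∈ Finset.Ico (τ - δ + p) τ, G t ^ 2 + ∑ t ∈ Finset.Ico (τ + p) (τ + δ), G t ^ 2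
      ≤ ∑ t ∈ win p N, G t ^ 2 := by
    rw [← Finset.sum_union hdisj]
    refine Finset.sum_le_sum_of_subset_of_nonneg ?_ fun _ _ _ => sq_nonneg _
    exact Finset.union_subset (sub _ _ (by omega) (by omega)) (sub _ _ (by omega) (by omega))
  set a := y (p + 1) + arOne φ * (regimeMean μ₀ r - regimeMean μ b)
  set a' := y (p + 1) + arOne φ * (regimeMean μ₀ (r + 1) - regimeMean μ b)
  have e1 : arOne φ * (regimeMean μ₀ (r + 1) - regimeMean μ₀ r) = a' - a := by
    simp only [a, a']; ring
  rw [e1]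
  have hn' : (0 : ℝ) ≤ n := Nat.cast_nonneg n
  have : (n : ℝ) * (a' - a) ^ 2 ≤ 2 * (n * a ^ 2 + n * a' ^ 2) := by
    have : (a' - a) ^ 2 ≤ 2 * (a ^ 2 + a' ^ 2) := by nlinarith [sq_nonneg (a + a')]
    nlinarith
  linarith

/-! ### Least squares residuals and their autocovariances -/

lemma design_mulVec {T : ℕ} (N : ℕ) (c : Config) (w : Fin T ⊕ Fin c.m → ℝ) (i : Fin N) :
    (design T N c *ᵥ w) i = fitFn c N (w ∘ Sum.inl) (w ∘ Sum.inr) ((i : ℕ) + 1) := by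
  simp [Matrix.mulVec, dotProduct, design, Fintype.sum_sum_type, fitFn, seasonFn, regimeFn]

lemma sum_fin_succ_eq (N : ℕ) (F : ℕ → ℝ) :
    ∑ i : Fin N, F ((i : ℕ) + 1) = ∑ t ∈ Finset.Icc 1 N, F t := by
  rw [← Finset.Ico_add_one_right_eq_Icc, Finset.sum_Ico_eq_sum_range, Nat.add_sub_cancel,
    Finset.sum_range (fun i => F (1 + i))]
  exact Finset.sum_congr rfl fun i _ => by rw [add_comm]

/-- The two facts about the orthogonal projection that are used: the fit is a mean function of `c`,
and the residual is orthogonal to all mean functions of `c`. The coefficients need not be unique. -/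
lemma exists_olsResidual_eq (T N : ℕ) (c : Config) (x : ℕ → ℝ) :
    ∃ (s : Fin T → ℝ) (μ : Fin c.m → ℝ),
      (∀ i : Fin N, olsResidual T N c x i = x ((i : ℕ) + 1) - fitFn c N s μ ((i : ℕ) + 1)) ∧
      ∀ (s' : Fin T → ℝ) (μ' : Fin c.m → ℝ),
        ∑ t ∈ Finset.Icc 1 N, (x t - fitFn c N s μ t) * fitFn c N s' μ' t = 0 := by
  set y : EuclideanSpace ℝ (Fin N) := WithLp.toLp 2 fun i : Fin N => x ((i : ℕ) + 1) with hy
  set K := LinearMap.range (Matrix.toEuclideanLin (design T N c)) with hK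
  obtain ⟨w, hw⟩ := LinearMap.mem_range.1 (K.starProjection_apply_mem y)
  have hval : ∀ i, (K.starProjection y) i
      = fitFn c N (w ∘ Sum.inl) (w ∘ Sum.inr) ((i : ℕ) + 1) := by
    intro i
    rw [← hw, ← design_mulVec]
    rfl
  have hres : ∀ i : Fin N, olsResidual T N c x i
      = x ((i : ℕ) + 1) - fitFn c N (w ∘ Sum.inl) (w ∘ Sum.inr) ((i : ℕ) + 1) := by
    intro i
    rw [← hval]
    rfl
  refine ⟨w ∘ Sum.inl, w ∘ Sum.inr, hres, fun s' μ' => ?_⟩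
  have horth := K.sub_starProjection_mem_orthogonal y
  rw [Submodule.mem_orthogonal] at horth
  have h := horth (Matrix.toEuclideanLin (design T N c) (WithLp.toLp 2 (Sum.elim s' μ')))
    (LinearMap.mem_range_self _ _)
  rw [PiLp.inner_apply] at h
  rw [← sum_fin_succ_eq N fun t =>
    (x t - fitFn c N (w ∘ Sum.inl) (w ∘ Sum.inr) t) * fitFn c N s' μ' t, ← h]
  refine Finset.sum_congr rfl fun i _ => ?_
  rw [← hres i]
  have e1 : Matrix.toEuclideanLin (design T N c) (WithLp.toLp 2 (Sum.elim s' μ')) i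
      = fitFn c N s' μ' ((i : ℕ) + 1) := by
    have := design_mulVec N c (Sum.elim s' μ') i
    rw [Sum.elim_comp_inl, Sum.elim_comp_inr] at this
    rw [← this]; rfl
  rw [e1]
  simp only [RCLike.inner_apply, conj_trivial]
  rfl

/-- `∑_{u=1}^{N-h} E_{u+h} E_u`. -/
def acovSum (N : ℕ) (E : ℕ → ℝ) (h : ℕ) : ℝ := ∑ u ∈ Finset.Ico 1 (N + 1 - h), E (u + h) * E u

lemma sampleAcov_eq {T N : ℕ} {c : Config} {x E : ℕ → ℝ}
    (hE : ∀ i : Fin N, olsResidual T N c x i = E ((i : ℕ) + 1)) (h : ℕ) :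
    sampleAcov T N c x h = (N : ℝ)⁻¹ * acovSum N E h := by
  rw [sampleAcov, acovSum]
  congr 1
  simp only [hE]
  rw [Finset.sum_Ico_eq_sum_range, show N + 1 - h - 1 = N - h by omega,
    Finset.sum_range (fun i => E (1 + i + h) * E (1 + i))]
  refine Finset.sum_congr rfl fun i _ => ?_
  rw [show (i : ℕ) + h + 1 = 1 + i + h by omega, show (i : ℕ) + 1 = 1 + i by omega]

/-- The sample autocovariance sums all available products at a given lag, the lagged product only
those indexed by the window. The two sums differ in at most `p` products at each end, so only bounds
near the two edges are needed. -/
lemma abs_acovSum_sub_lagProd_le {p N : ℕ} (hN : 2 * p < N) {E : ℕ → ℝ} {B : ℝ}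
    (h1 : ∀ t, 1 ≤ t → t ≤ p → |E t| ≤ B) (h2 : ∀ t, N < t + p → t ≤ N → |E t| ≤ B) {i j : ℕ}
    (hi : i ≤ p) (hj : j ≤ p) :
    |acovSum N E ((i : ℤ) - j).natAbs - lagProd p N E E i j| ≤ 2 * p * B ^ 2 := by
  wlog hij : i ≤ j generalizing i j with H
  · have := H hj hi (by omega)
    rwa [lagProd_comm, ← Int.natAbs_neg, neg_sub] at this
  obtain ⟨h, rfl⟩ := Nat.exists_eq_add_of_le hij
  rw [show ((i : ℤ) - ((i + h : ℕ) : ℤ)).natAbs = h by push_cast; omega]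
  have e1 : lagProd p N E E i (i + h)
      = ∑ u ∈ Finset.Ico (p + 1 - (i + h)) (N + 1 - (i + h)), E (u + h) * E u := by
    rw [lagProd, win]
    refine Finset.sum_bij (fun t _ => t - (i + h)) ?_ ?_ ?_ ?_
    · intro t ht
      rw [Finset.mem_Ico] at ht ⊢
      omega
    · intro t ht t' ht' hh
      rw [Finset.mem_Ico] at ht ht'
      omega
    · intro u hu
      rw [Finset.mem_Ico] at hu
      exact ⟨u + (i + h), by rw [Finset.mem_Ico]; omega, by omega⟩
    · intro t ht
      rw [Finset.mem_Ico] at ht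
      rw [show t - (i + h) + h = t - i by omega]
  have e2 : acovSum N E h = ∑ u ∈ Finset.Ico 1 (p + 1 - (i + h)), E (u + h) * E u
      + lagProd p N E E i (i + h)
      + ∑ u ∈ Finset.Ico (N + 1 - (i + h)) (N + 1 - h), E (u + h) * E u := by
    rw [e1, acovSum, Finset.sum_Ico_consecutive _ (by omega) (by omega),
      Finset.sum_Ico_consecutive _ (by omega) (by omega)]
  have hB : ∀ a b : ℝ, |a| ≤ B → |b| ≤ B → |a * b| ≤ B ^ 2 := fun a b ha hb => by
    rw [abs_mul, sq]; exact mul_le_mul ha hb (abs_nonneg _) ((abs_nonneg _).trans ha)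
  have b1 : |∑ u ∈ Finset.Ico 1 (p + 1 - (i + h)), E (u + h) * E u| ≤ p * B ^ 2 := by
    refine (Finset.abs_sum_le_sum_abs _ _).trans ((Finset.sum_le_card_nsmul _ _ (B ^ 2) ?_).trans ?_)
    · intro u hu
      rw [Finset.mem_Ico] at hu
      exact hB _ _ (h1 _ (by omega) (by omega)) (h1 _ (by omega) (by omega))
    · rw [nsmul_eq_mul, Nat.card_Ico]
      exact mul_le_mul_of_nonneg_right (by exact_mod_cast (by omega)) (sq_nonneg B)
  have b2 : |∑ u ∈ Finset.Ico (N + 1 - (i + h)) (N + 1 - h), E (u + h) * E u| ≤ p * B ^ 2 := by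
    refine (Finset.abs_sum_le_sum_abs _ _).trans ((Finset.sum_le_card_nsmul _ _ (B ^ 2) ?_).trans ?_)
    · intro u hu
      rw [Finset.mem_Ico] at hu
      exact hB _ _ (h2 _ (by omega) (by omega)) (h2 _ (by omega) (by omega))
    · rw [nsmul_eq_mul, Nat.card_Ico]
      exact mul_le_mul_of_nonneg_right (by exact_mod_cast (by omega)) (sq_nonneg B)
  rw [e2]
  calc _ = |∑ u ∈ Finset.Ico 1 (p + 1 - (i + h)), E (u + h) * E u
        + ∑ u ∈ Finset.Ico (N + 1 - (i + h)) (N + 1 - h), E (u + h) * E u| := by congr 1; ring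
    _ ≤ _ := abs_add_le _ _
    _ ≤ _ := by linarith

/-! ### The determinant of the ridge Gram matrix -/

lemma pow_le_det_of_quad {m : ℕ} {R : Matrix (Fin m) (Fin m) ℝ} (hR : R.IsHermitian) {κ : ℝ}
    (hκ : 0 ≤ κ) (h : ∀ w, κ * (w ⬝ᵥ w) ≤ w ⬝ᵥ (R *ᵥ w)) : κ ^ m ≤ R.det := by
  have hev : ∀ i, κ ≤ hR.eigenvalues i := by
    intro i
    have h1 := h (hR.eigenvectorBasis i)
    rw [hR.mulVec_eigenvectorBasis, dotProduct_smul, smul_eq_mul] at h1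
    have h2 : (hR.eigenvectorBasis i : Fin m → ℝ) ⬝ᵥ (hR.eigenvectorBasis i : Fin m → ℝ) = 1 := by
      have h3 := hR.eigenvectorBasis.orthonormal.1 i
      rw [EuclideanSpace.norm_eq, Real.sqrt_eq_one] at h3
      rw [← h3, dotProduct]
      exact Finset.sum_congr rfl fun k _ => by rw [Real.norm_eq_abs, sq_abs, sq]
    rwa [h2, mul_one, mul_one] at h1
  rw [hR.det_eq_prod_eigenvalues]
  calc κ ^ m = ∏ _i : Fin m, κ := by simp
    _ ≤ ∏ i, hR.eigenvalues i := Finset.prod_le_prod (fun _ _ => hκ) fun i _ => hev i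
    _ = _ := by simp

lemma ridgeGram_eq {p : ℕ} (ν : ℝ) (N : ℕ) (c : Config) (φ : Fin p → ℝ) :
    ridgeGram ν N c φ = gramR ν (filtD N c φ) := rfl

lemma ridgeGram_quad {p : ℕ} (ν : ℝ) (N : ℕ) (c : Config) (φ : Fin p → ℝ) (w : Fin c.m → ℝ) :
    w ⬝ᵥ (ridgeGram ν N c φ *ᵥ w)
      = ∑ t ∈ win p N, arFilter φ (fitFn (T := 0) c N 0 w) t ^ 2 + ν⁻¹ * (w ⬝ᵥ w) := by
  rw [ridgeGram_eq, gramR_quad, ← dotProduct_filt_eq, Matrix.mulVec_zero, zero_add]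

lemma ridgeGram_isHermitian {p : ℕ} (ν : ℝ) (N : ℕ) (c : Config) (φ : Fin p → ℝ) :
    (ridgeGram ν N c φ).IsHermitian := by
  rw [Matrix.IsHermitian, Matrix.conjTranspose_eq_transpose_of_trivial, ridgeGram_eq,
    gramR_transpose]

lemma inv_pow_le_det_ridgeGram {p : ℕ} {ν : ℝ} (hν : 0 < ν) (N : ℕ) (c : Config)
    (φ : Fin p → ℝ) : ν⁻¹ ^ c.m ≤ (ridgeGram ν N c φ).det := by
  refine pow_le_det_of_quad (ridgeGram_isHermitian ν N c φ) (inv_pos.2 hν).le fun w => ?_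
  rw [ridgeGram_quad]
  linarith [Finset.sum_nonneg fun t (_ : t ∈ win p N) =>
    sq_nonneg (arFilter φ (fitFn (T := 0) c N 0 w) t)]

lemma fitFn_zero_congr {T T' : ℕ} (c : Config) (N : ℕ) (w : Fin c.m → ℝ) :
    fitFn (T := T) c N 0 w = fitFn (T := T') c N 0 w := by
  funext t; simp [fitFn, seasonFn]

/-- Every eigenvalue of the Gram matrix is at least of the order of the regime length. This is the
source of the cost (1/2) log n of a changepoint. -/
lemma Spaced.pow_le_det_ridgeGram {p : ℕ} {ν : ℝ} (hν : 0 < ν) {c : Config} {N ρ n : ℕ}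
    (h : Spaced c N ρ) (hn : p + n ≤ ρ) (φ : Fin p → ℝ) :
    (n * arOne φ ^ 2 / (4 * (c.m + 1))) ^ c.m ≤ (ridgeGram ν N c φ).det := by
  refine pow_le_det_of_quad (ridgeGram_isHermitian ν N c φ) (by positivity) fun w => ?_
  -- The seasonal part is absent, so any period may be chosen; period one makes `mean_sq_le_sum_win`
  -- applicable with `n` single times.
  rw [ridgeGram_quad, fitFn_zero_congr (T' := 1)]
  set S := ∑ t ∈ win p N, arFilter φ (fitFn (T := 1) c N 0 w) t ^ 2
  have h1 : ∀ k, n * (arOne φ * w k) ^ 2 ≤ 4 * S := fun k =>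
    h.mean_sq_le_sum_win one_pos (by omega) φ 0 w k
  have h2 : n * arOne φ ^ 2 * (w ⬝ᵥ w) ≤ c.m * (4 * S) := by
    calc n * arOne φ ^ 2 * (w ⬝ᵥ w) = ∑ k, n * (arOne φ * w k) ^ 2 := by
          rw [dotProduct, Finset.mul_sum]
          exact Finset.sum_congr rfl fun k _ => by ring
      _ ≤ ∑ _k : Fin c.m, 4 * S := Finset.sum_le_sum fun k _ => h1 k
      _ = _ := by simp
  have hS : 0 ≤ S := Finset.sum_nonneg fun _ _ => sq_nonneg _
  have h3 := mul_nonneg (inv_pos.2 hν).le (dotProduct_self_nonneg' w)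
  rw [div_mul_eq_mul_div, div_le_iff₀ (by positivity)]
  nlinarith

lemma abs_arFilter_le {p : ℕ} (φ : Fin p → ℝ) {F : ℕ → ℝ} {B : ℝ} {t : ℕ}
    (h : ∀ i ≤ p, |F (t - i)| ≤ B) : |arFilter φ F t| ≤ arNorm φ * B := by
  rw [arFilter_eq]
  exact abs_sum_arVec_mul_le φ fun i => h i (Nat.lt_succ_iff.1 i.2)

lemma abs_regimeInd_le (c : Config) (N t : ℕ) (k : Fin c.m) : |regimeInd c N t k| ≤ 1 := by
  rw [regimeInd]; split_ifs <;> simp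

/-- All entries are O(N) and the determinant has `m!` terms. The power of N matches that of the
lower bound `Spaced.pow_le_det_ridgeGram`. -/
lemma det_ridgeGram_le {p : ℕ} {ν : ℝ} (hν : 0 < ν) (N : ℕ) (c : Config) (φ : Fin p → ℝ) :
    (ridgeGram ν N c φ).det ≤ c.m.factorial * (N * arNorm φ ^ 2 + ν⁻¹) ^ c.m := by
  have h1 : ∀ k l, |ridgeGram ν N c φ k l| ≤ N * arNorm φ ^ 2 + ν⁻¹ := by
    intro k l
    rw [ridgeGram, Matrix.add_apply, Matrix.smul_apply, smul_eq_mul]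
    have hb : ∀ (i : Fin (N - p)) (k : Fin c.m), |filtD N c φ i k| ≤ arNorm φ := fun i k => by
      have := abs_arFilter_le φ (F := fun t => regimeInd c N t k) (B := 1) (t := p + 1 + i)
        fun _ _ => abs_regimeInd_le c N _ k
      rwa [mul_one] at this
    have h2 : |((filtD N c φ)ᵀ * filtD N c φ) k l| ≤ N * arNorm φ ^ 2 := by
      rw [Matrix.mul_apply]
      calc _ ≤ ∑ i, |(filtD N c φ)ᵀ k i * filtD N c φ i l| := Finset.abs_sum_le_sum_abs _ _
        _ ≤ ∑ _i : Fin (N - p), arNorm φ ^ 2 := Finset.sum_le_sum fun i _ => by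
            rw [abs_mul, sq]
            exact mul_le_mul (hb i k) (hb i l) (abs_nonneg _) ((abs_nonneg _).trans (hb i k))
        _ = ((N - p : ℕ) : ℝ) * arNorm φ ^ 2 := by simp
        _ ≤ _ := mul_le_mul_of_nonneg_right (by exact_mod_cast Nat.sub_le N p) (sq_nonneg _)
    have h3 : |ν⁻¹ * (1 : Matrix (Fin c.m) (Fin c.m) ℝ) k l| ≤ ν⁻¹ := by
      have := (inv_pos.2 hν).le
      rw [Matrix.one_apply]
      split_ifs
      · rw [mul_one, abs_of_nonneg this]
      · rw [mul_zero, abs_zero]; exact this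
    exact (abs_add_le _ _).trans (add_le_add h2 h3)
  have h2 := Matrix.det_le (A := ridgeGram ν N c φ) (abv := AbsoluteValue.abs) (x := N * arNorm φ ^ 2 + ν⁻¹)
    (fun i j => by simpa using h1 i j)
  simp only [AbsoluteValue.abs_apply, Fintype.card_fin, nsmul_eq_mul] at h2
  exact (le_abs_self _).trans h2

/-! ### The Beta-Binomial part of the penalty -/

/-- `log {Γ(a + m) Γ(b + n - m)}`. -/
def betaLog (a b : ℝ) (n m : ℕ) : ℝ := Real.log (Real.Gamma (a + m) * Real.Gamma (b + n - m))

lemma betaLog_sub_succ {a b : ℝ} (ha : 0 < a) (hb : 0 < b) {n m : ℕ} (h : m + 1 ≤ n) :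
    betaLog a b n m - betaLog a b n (m + 1)
      = Real.log ((b + (n - (m + 1) : ℕ)) / (a + m)) := by
  have hc : ((n - (m + 1) : ℕ) : ℝ) = n - (m + 1) := by push_cast [Nat.cast_sub h]; ring
  have h1 : (0 : ℝ) < a + m := by positivity
  have h2 : (0 : ℝ) < b + (n - (m + 1) : ℕ) := by positivity
  have e1 : Real.Gamma (a + (m + 1 : ℕ)) = (a + m) * Real.Gamma (a + m) := by
    rw [← Real.Gamma_add_one h1.ne']; push_cast; ring_nf
  have e2 : Real.Gamma (b + n - m)
      = (b + (n - (m + 1) : ℕ)) * Real.Gamma (b + n - (m + 1 : ℕ)) := by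
    have : b + n - (m + 1 : ℕ) = b + (n - (m + 1) : ℕ) := by rw [hc]; push_cast; ring
    rw [this, ← Real.Gamma_add_one h2.ne', hc]; ring_nf
  have g1 := Real.Gamma_pos_of_pos h1
  have g2 : 0 < Real.Gamma (b + n - (m + 1 : ℕ)) := by
    have : b + n - (m + 1 : ℕ) = b + (n - (m + 1) : ℕ) := by rw [hc]; push_cast; ring
    rw [this]; exact Real.Gamma_pos_of_pos h2
  rw [betaLog, betaLog, e1, e2, Real.log_mul g1.ne' (mul_pos h2 g2).ne', Real.log_mul h2.ne' g2.ne',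
    Real.log_mul (mul_pos h1 g1).ne' g2.ne', Real.log_mul h1.ne' g1.ne',
    Real.log_div h2.ne' h1.ne']
  ring

/-- Deleting one changepoint multiplies the Gamma product by a quotient whose numerator is at least
`b` and whose denominator is at most `a + M`. The loss is thus bounded uniformly in `n`, although
the gain may be of order log n. Only this direction is used against superfluous changepoints. -/
lemma neg_le_betaLog_sub {a b : ℝ} (ha : 0 < a) (hb : 0 < b) {n m m' M : ℕ} (h : m' ≤ m)
    (hm : m ≤ n) (hM : m ≤ M) :
    -(M * |Real.log (b / (a + M))|) ≤ betaLog a b n m' - betaLog a b n m := by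
  have key : ∀ j, m' + j ≤ m →
      -(j * |Real.log (b / (a + M))|) ≤ betaLog a b n m' - betaLog a b n (m' + j) := by
    intro j
    induction j with
    | zero => simp
    | succ j ih =>
      intro hj
      have h1 := ih (by omega)
      have h2 := betaLog_sub_succ ha hb (n := n) (m := m' + j) (by omega)
      have h3 : Real.log (b / (a + M))
          ≤ Real.log ((b + (n - (m' + j + 1) : ℕ)) / (a + (m' + j : ℕ))) := by
        refine Real.log_le_log (by positivity) ?_
        refine div_le_div₀ (by positivity) (le_add_of_nonneg_right (Nat.cast_nonneg _))
          (by positivity) ?_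
        have : ((m' + j : ℕ) : ℝ) ≤ M := by exact_mod_cast (by omega)
        linarith
      have h4 := neg_abs_le (Real.log (b / (a + M)))
      rw [← add_assoc]
      push_cast at *
      linarith
  have h5 := key (m - m') (by omega)
  rw [Nat.add_sub_cancel' h] at h5
  refine le_trans ?_ h5
  have : ((m - m' : ℕ) : ℝ) ≤ M := by exact_mod_cast (by omega)
  have := mul_le_mul_of_nonneg_right this (abs_nonneg (Real.log (b / (a + M))))
  linarith

lemma betaLog_sub_le {a b : ℝ} (ha : 0 < a) (hb : 0 < b) {n m M : ℕ}
    (hm : m ≤ n) (hM : m ≤ M) :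
    betaLog a b n 0 - betaLog a b n m ≤ M * |Real.log ((b + n) / a)| := by
  have key : ∀ j, j ≤ m →
      betaLog a b n 0 - betaLog a b n j ≤ j * |Real.log ((b + n) / a)| := by
    intro j
    induction j with
    | zero => simp
    | succ j ih =>
      intro hj
      have h1 := ih (by omega)
      have h2 := betaLog_sub_succ ha hb (n := n) (m := j) (by omega)
      have h3 : Real.log ((b + (n - (j + 1) : ℕ)) / (a + j)) ≤ Real.log ((b + n) / a) := by
        refine Real.log_le_log (by positivity) ?_
        refine div_le_div₀ (by positivity) ?_ ha (le_add_of_nonneg_right (Nat.cast_nonneg _))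
        have : ((n - (j + 1) : ℕ) : ℝ) ≤ n := by exact_mod_cast Nat.sub_le _ _
        linarith
      have h4 := le_abs_self (Real.log ((b + n) / a))
      push_cast at *
      linarith
  refine (key m le_rfl).trans ?_
  exact mul_le_mul_of_nonneg_right (by exact_mod_cast hM) (abs_nonneg _)

lemma abs_betaLog_sub_le {a b : ℝ} (ha : 0 < a) (hb : 0 < b) {n m m' M : ℕ}
    (hm : m ≤ n) (hM : m ≤ M) (hm' : m' ≤ n) (hM' : m' ≤ M) :
    |betaLog a b n m - betaLog a b n m'|
      ≤ M * |Real.log (b / (a + M))| + M * |Real.log ((b + n) / a)| := by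
  have h1 := neg_le_betaLog_sub ha hb (Nat.zero_le m) hm hM
  have h2 := neg_le_betaLog_sub ha hb (Nat.zero_le m') hm' hM'
  have h3 := betaLog_sub_le ha hb hm hM
  have h4 := betaLog_sub_le ha hb hm' hM'
  rw [abs_le]; constructor <;> linarith

lemma cpDoc_add_cpUndoc (N : ℕ) (doc : Finset ℕ) (c : Config) :
    cpDoc N doc c + cpUndoc N doc c = c.m := by
  rw [cpDoc, cpUndoc, Finset.card_filter_add_card_filter_not, Finset.card_univ, Fintype.card_fin]

lemma Spaced.tau_injective {c : Config} {N ρ : ℕ} (h : Spaced c N ρ) (hρ : 0 < ρ) :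
    Function.Injective fun k : Fin c.m => c.tau N ((k : ℕ) + 1) := by
  intro k l hkl
  have hk := k.2
  have hl := l.2
  by_contra hne
  have hne' : (k : ℕ) ≠ l := fun h => hne (Fin.ext h)
  rcases Nat.lt_or_gt_of_ne hne' with h1 | h1
  · have := h.mono (i := (k : ℕ) + 1) (j := (l : ℕ) + 1) (by omega) (by omega)
    simp only at hkl; omega
  · have := h.mono (i := (l : ℕ) + 1) (j := (k : ℕ) + 1) (by omega) (by omega)
    simp only at hkl; omega

lemma Spaced.tau_mem_Icc {p : ℕ} {c : Config} {N ρ : ℕ} (h : Spaced c N ρ) (hρ : p < ρ)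
    (k : Fin c.m) : c.tau N ((k : ℕ) + 1) ∈ Finset.Icc (p + 1) N := by
  have hk := k.2
  have h1 := h.mono (i := 0) (j := (k : ℕ) + 1) (by omega) (by omega)
  have h2 := h.mono (i := (k : ℕ) + 1) (j := c.m + 1) (by omega) (by omega)
  rw [Config.tau_zero] at h1
  rw [Config.tau_last] at h2
  exact Finset.mem_Icc.2 ⟨by omega, by omega⟩

/-- Well-spaced changepoints are distinct times inside the window, so the documented ones are at
most as many as the documented times. This keeps the arguments of the Gamma functions positive,
whatever the metadata. -/
lemma Spaced.cpDoc_le {p : ℕ} {c : Config} {N ρ : ℕ} (h : Spaced c N ρ) (hρ : p < ρ)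
    (doc : Finset ℕ) : cpDoc N doc c ≤ numDoc p N doc := by
  rw [cpDoc, numDoc, ← Finset.card_image_of_injective _ (h.tau_injective (by omega))]
  refine Finset.card_le_card fun t ht => ?_
  obtain ⟨k, hk, rfl⟩ := Finset.mem_image.1 ht
  exact Finset.mem_inter.2 ⟨(Finset.mem_filter.1 hk).2, h.tau_mem_Icc hρ k⟩

lemma numDoc_le (p N : ℕ) (doc : Finset ℕ) : numDoc p N doc ≤ N - p := by
  rw [numDoc]
  refine (Finset.card_le_card Finset.inter_subset_right).trans ?_
  simp

lemma Spaced.cpUndoc_le {p : ℕ} {c : Config} {N ρ : ℕ} (h : Spaced c N ρ) (hρ : p < ρ)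
    (doc : Finset ℕ) : cpUndoc N doc c ≤ N - p - numDoc p N doc := by
  have h1 : cpUndoc N doc c ≤ (Finset.Icc (p + 1) N \ doc).card := by
    rw [cpUndoc, ← Finset.card_image_of_injective _ (h.tau_injective (by omega))]
    refine Finset.card_le_card fun t ht => ?_
    obtain ⟨k, hk, rfl⟩ := Finset.mem_image.1 ht
    exact Finset.mem_sdiff.2 ⟨h.tau_mem_Icc hρ k, (Finset.mem_filter.1 hk).2⟩
  have h2 := Finset.card_inter_add_card_sdiff (Finset.Icc (p + 1) N) doc
  rw [Finset.inter_comm] at h2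
  rw [numDoc]
  simp only [Nat.card_Icc] at h2
  omega

/-- The Beta-Binomial part of the objective. -/
def gammaPart (p : ℕ) (a b₁ b₂ : ℝ) (N : ℕ) (doc : Finset ℕ) (c : Config) : ℝ :=
  betaLog a b₁ (N - p - numDoc p N doc) (cpUndoc N doc c)
    + betaLog a b₂ (numDoc p N doc) (cpDoc N doc c)

lemma bmdl_eq {p N : ℕ} (hN : p ≤ N) (T : ℕ) (a b₁ b₂ ν : ℝ) (doc : Finset ℕ) (x : ℕ → ℝ)
    (c : Config) :
    bmdl p T a b₁ b₂ ν N doc x c = ((N : ℝ) - p) / 2 * Real.log (varHat p ν T N c x)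
      + (c.m : ℝ) / 2 * Real.log ν
      + 1 / 2 * Real.log (ridgeGram ν N c (yuleWalker p T N c x)).det
      - gammaPart p a b₁ b₂ N doc c := by
  have h := numDoc_le p N doc
  have e : ((N - p - numDoc p N doc : ℕ) : ℝ) = (N : ℝ) - p - numDoc p N doc := by
    rw [Nat.cast_sub h, Nat.cast_sub hN]
  rw [gammaPart, betaLog, betaLog, e]
  rfl

/-! ### Spacing of admissible configurations -/

@[simp] lemma Config.edge_zero (c : Config) : c.edge 0 = 0 := by simp [Config.edge]

@[simp] lemma Config.edge_last (c : Config) : c.edge (c.m + 1) = 1 := by simp [Config.edge]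

lemma edge_add_le {M : ℕ} {d : ℝ} (hd : 0 < d) {c : Config} (hc : c ∈ admissible M d) {i j : ℕ}
    (hij : i < j) (hj : j ≤ c.m + 1) : c.edge i + d ≤ c.edge j := by
  induction j with
  | zero => omega
  | succ j ih =>
    have h1 := hc.2 j (by omega)
    rcases Nat.lt_succ_iff_lt_or_eq.1 hij with h2 | rfl
    · have := ih h2 (by omega); linarith
    · linarith

lemma edge_nonneg {M : ℕ} {d : ℝ} (hd : 0 < d) {c : Config} (hc : c ∈ admissible M d) {j : ℕ}
    (hj : j ≤ c.m + 1) : 0 ≤ c.edge j := by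
  rcases Nat.eq_zero_or_pos j with rfl | h
  · simp
  · have := edge_add_le hd hc h hj
    rw [Config.edge_zero] at this; linarith

lemma abs_tau_sub_edge_le {M : ℕ} {d : ℝ} (hd : 0 < d) {c : Config} (hc : c ∈ admissible M d)
    (N : ℕ) {r : ℕ} (hr : r ≤ c.m + 1) : |(c.tau N r : ℝ) - c.edge r * N| ≤ 1 := by
  rcases Nat.eq_zero_or_pos r with rfl | h
  · simp
  rcases Nat.lt_or_ge (r - 1) c.m with h1 | h1
  · have e : c.tau N r = ⌊c.edge r * N⌋₊ := by
      simp [Config.tau, Config.edge, h.ne', h1]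
    have h2 : 0 ≤ c.edge r * N := mul_nonneg (edge_nonneg hd hc hr) (Nat.cast_nonneg _)
    have h3 := Nat.floor_le h2
    have h4 := Nat.lt_floor_add_one (c.edge r * N)
    rw [e, abs_le]; constructor <;> linarith
  · obtain rfl : r = c.m + 1 := by omega
    simp

/-- Each boundary is within 1 of its unrounded position, including the conventional boundaries 1 and
`N + 1`; hence the summand 2. -/
lemma spaced_of_admissible {M : ℕ} {d : ℝ} (hd : 0 < d) {c : Config} (hc : c ∈ admissible M d)
    {N ρ : ℕ} (h : (ρ : ℝ) + 2 ≤ d * N) : Spaced c N ρ := by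
  intro r hr
  have h1 := abs_tau_sub_edge_le hd hc N (r := r) (by omega)
  have h2 := abs_tau_sub_edge_le hd hc N (r := r + 1) (by omega)
  have h3 := mul_le_mul_of_nonneg_right (hc.2 r hr) (Nat.cast_nonneg (α := ℝ) N)
  rw [abs_le] at h1 h2
  have : (c.tau N r : ℝ) + ρ ≤ c.tau N (r + 1) := by linarith [h1.2, h2.1]
  exact_mod_cast this

/-! ### Sub-configurations -/

/-- The configuration that keeps the changepoints with indices in the range of `k`. -/
abbrev Config.sub (c : Config) {m' : ℕ} (k : Fin m' → Fin c.m) : Config := ⟨m', fun r => c.loc (k r)⟩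

/-- The index in `c` of the `r`-th edge of a sub-configuration. -/
def subIdx (c : Config) {m' : ℕ} (k : Fin m' → Fin c.m) (r : ℕ) : ℕ :=
  if r = 0 then 0 else if h : r - 1 < m' then (k ⟨r - 1, h⟩ : ℕ) + 1 else c.m + 1

lemma subIdx_succ (c : Config) {m' : ℕ} (k : Fin m' → Fin c.m) (r : Fin m') :
    subIdx c k ((r : ℕ) + 1) = (k r : ℕ) + 1 := by
  simp [subIdx]

lemma subIdx_le (c : Config) {m' : ℕ} (k : Fin m' → Fin c.m) (r : ℕ) : subIdx c k r ≤ c.m + 1 := by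
  unfold subIdx
  split_ifs with h1 h2
  · omega
  · have := (k ⟨r - 1, h2⟩).2; omega
  · omega

lemma subIdx_lt {c : Config} {m' : ℕ} {k : Fin m' → Fin c.m} (hk : StrictMono k) {r : ℕ}
    (hr : r ≤ m') : subIdx c k r < subIdx c k (r + 1) := by
  have e : subIdx c k (r + 1) = if h : r < m' then (k ⟨r, h⟩ : ℕ) + 1 else c.m + 1 := by
    simp [subIdx]
  rw [e]
  unfold subIdx
  split_ifs with h1 h2 h3 h4 h5
  · omega
  · omega
  · have : k ⟨r - 1, h3⟩ < k ⟨r, h4⟩ := hk (by rw [Fin.lt_def]; simp only; omega)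
    rw [Fin.lt_def] at this; omega
  · have := (k ⟨r - 1, h3⟩).2; omega
  · omega
  · omega

lemma sub_edge (c : Config) {m' : ℕ} (k : Fin m' → Fin c.m) (r : ℕ) :
    (c.sub k).edge r = c.edge (subIdx c k r) := by
  simp only [Config.edge, subIdx, Config.sub]
  split_ifs <;> (simp_all; try omega)

lemma sub_tau (c : Config) {m' : ℕ} (k : Fin m' → Fin c.m) (N r : ℕ) :
    (c.sub k).tau N r = c.tau N (subIdx c k r) := by
  simp only [Config.tau, subIdx, Config.sub]
  split_ifs <;> (simp_all; try omega)

lemma sub_m_le {c : Config} {m' : ℕ} {k : Fin m' → Fin c.m} (hk : StrictMono k) : m' ≤ c.m := by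
  simpa using Fintype.card_le_of_injective k hk.injective

lemma sub_admissible {M : ℕ} {d : ℝ} (hd : 0 < d) {c : Config} (hc : c ∈ admissible M d) {m' : ℕ}
    {k : Fin m' → Fin c.m} (hk : StrictMono k) : c.sub k ∈ admissible M d := by
  refine ⟨(sub_m_le hk).trans hc.1, fun r hr => ?_⟩
  rw [sub_edge c k r, sub_edge c k (r + 1)]
  have := edge_add_le hd hc (subIdx_lt hk hr) (subIdx_le c k _)
  linarith

lemma cpDoc_sub_le {c : Config} {m' : ℕ} {k : Fin m' → Fin c.m} (hk : StrictMono k) (N : ℕ)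
    (doc : Finset ℕ) : cpDoc N doc (c.sub k) ≤ cpDoc N doc c := by
  refine Finset.card_le_card_of_injOn k (fun r hr => ?_) hk.injective.injOn
  have hr' := (Finset.mem_filter.1 (Finset.mem_coe.1 hr)).2
  rw [sub_tau c k N ((r : ℕ) + 1), subIdx_succ c k r] at hr'
  exact Finset.mem_coe.2 (Finset.mem_filter.2 ⟨Finset.mem_univ _, hr'⟩)

lemma cpUndoc_sub_le {c : Config} {m' : ℕ} {k : Fin m' → Fin c.m} (hk : StrictMono k) (N : ℕ)
    (doc : Finset ℕ) : cpUndoc N doc (c.sub k) ≤ cpUndoc N doc c := by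
  refine Finset.card_le_card_of_injOn k (fun r hr => ?_) hk.injective.injOn
  have hr' := (Finset.mem_filter.1 (Finset.mem_coe.1 hr)).2
  rw [sub_tau c k N ((r : ℕ) + 1), subIdx_succ c k r] at hr'
  exact Finset.mem_coe.2 (Finset.mem_filter.2 ⟨Finset.mem_univ _, hr'⟩)

/-- Mean functions of a sub-configuration are mean functions of the configuration. -/
lemma Spaced.exists_regimeFn_eq_sub {c : Config} {N ρ : ℕ} (h : Spaced c N ρ) (hρ : 0 < ρ) {m' : ℕ}
    {k : Fin m' → Fin c.m} (hk : StrictMono k) (μ' : Fin m' → ℝ) {B : ℝ} (hB : 0 ≤ B)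
    (hμ' : ∀ r, |μ' r| ≤ B) :
    ∃ μ : Fin c.m → ℝ, (∀ j, |μ j| ≤ B) ∧
      ∀ t, 1 ≤ t → t ≤ N → regimeFn c N μ t = regimeFn (c.sub k) N μ' t := by
  have hsub : Spaced (c.sub k) N ρ := fun r hr => by
    rw [sub_tau c k N r, sub_tau c k N (r + 1)]
    exact h.mono (subIdx_lt hk hr) (subIdx_le c k _)
  -- Every regime of `c` lies inside one regime of the sub-configuration, so the mean is read off at
  -- its left end. The first regime of `c` lies in the first regime of the sub-configuration, whose
  -- mean is zero as required.
  refine ⟨fun j => regimeFn (c.sub k) N μ' (c.tau N ((j : ℕ) + 1)), fun j => ?_, fun t h1 h2 => ?_⟩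
  · have hj := j.2
    have h3 := h.one_le_tau (j := (j : ℕ) + 1) (by omega)
    have h4 := h.mono (i := (j : ℕ) + 1) (j := c.m + 1) (by omega) le_rfl
    rw [Config.tau_last] at h4
    obtain ⟨r, hr, h5, h6⟩ := hsub.exists_regime h3 (by omega)
    simp only
    rw [hsub.regimeFn_eq μ' hr h5 h6]
    exact abs_regimeMean_le μ' hB hμ' r
  · obtain ⟨j, hj, h3, h4⟩ := h.exists_regime h1 h2
    rw [h.regimeFn_eq _ hj h3 h4]
    have cmp : ∀ i, i ≤ c.m + 1 → (c.tau N i ≤ t ↔ i ≤ j) := fun i hi => by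
      refine ⟨fun h5 => ?_, fun h5 => (h.tau_le h5 (by omega)).trans h3⟩
      by_contra h6
      have := h.tau_le (i := j + 1) (j := i) (by omega) hi
      omega
    rcases Nat.eq_zero_or_pos j with rfl | hj0
    · rw [regimeMean, if_pos rfl]
      symm
      refine Finset.sum_eq_zero fun r _ => ?_
      rw [regimeInd, if_neg, zero_mul]
      rintro ⟨h5, -⟩
      rw [sub_tau c k N ((r : ℕ) + 1), cmp _ (subIdx_le c k _), subIdx_succ c k r] at h5
      omega
    · have hj1 : j - 1 < c.m := by omega
      rw [regimeMean, if_neg hj0.ne', dif_pos hj1]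
      have hτ : c.tau N ((j - 1) + 1) = c.tau N j := by rw [Nat.sub_add_cancel hj0]
      simp only [hτ]
      refine Finset.sum_congr rfl fun r _ => ?_
      congr 1
      have cmp' : ∀ i, i ≤ c.m + 1 → (c.tau N i ≤ c.tau N j ↔ i ≤ j) := fun i hi => by
        refine ⟨fun h5 => ?_, fun h5 => h.tau_le h5 (by omega)⟩
        by_contra h6
        have := h.mono (i := j) (j := i) (by omega) hi
        omega
      rw [regimeInd, regimeInd]
      refine if_congr ?_ rfl rfl
      rw [sub_tau c k N ((r : ℕ) + 1), sub_tau c k N ((r : ℕ) + 2), ← not_le, ← not_le, cmp _ (subIdx_le c k _), cmp _ (subIdx_le c k _),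
        cmp' _ (subIdx_le c k _), cmp' _ (subIdx_le c k _)]

/-- If all changepoints of `c₀` have a changepoint of `c` within `δ`, they have so in order. -/
lemma Spaced.exists_strictMono {c₀ c : Config} {N ρ ρ' : ℕ} {δ : ℝ} (h₀ : Spaced c₀ N ρ)
    (hc : Spaced c N ρ') (hδ : 2 * δ < ρ)
    (hex : ∀ r : Fin c₀.m, ∃ k : Fin c.m,
      |(c.tau N ((k : ℕ) + 1) : ℝ) - c₀.tau N ((r : ℕ) + 1)| ≤ δ) :
    ∃ k : Fin c₀.m → Fin c.m, StrictMono k ∧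
      ∀ r : Fin c₀.m, |(c.tau N ((k r : ℕ) + 1) : ℝ) - c₀.tau N ((r : ℕ) + 1)| ≤ δ := by
  choose k hk using hex
  refine ⟨k, fun r r' hrr => ?_, hk⟩
  rw [Fin.lt_def] at hrr
  have h1 := h₀.mono (i := (r : ℕ) + 1) (j := (r' : ℕ) + 1) (by omega)
    (by have := r'.2; omega)
  have h1' : (c₀.tau N ((r : ℕ) + 1) : ℝ) + ρ ≤ c₀.tau N ((r' : ℕ) + 1) := by exact_mod_cast h1
  have h2 := abs_le.1 (hk r)
  have h3 := abs_le.1 (hk r')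
  -- True changepoints are `ρ > 2δ` apart, so changepoints within `δ` of two of them cannot coincide
  -- or change order.
  by_contra hlt
  rw [Fin.lt_def, not_lt] at hlt
  have h4 := hc.tau_le (i := (k r' : ℕ) + 1) (j := (k r : ℕ) + 1) (by omega)
    (by have := (k r).2; omega)
  have h4' : (c.tau N ((k r' : ℕ) + 1) : ℝ) ≤ c.tau N ((k r : ℕ) + 1) := by exact_mod_cast h4
  linarith [h2.1, h2.2, h3.1, h3.2]

lemma sum_abs_indicator_sub_le (N a a' : ℕ) :
    ∑ t ∈ Finset.Icc 1 N, |(if a ≤ t then (1 : ℝ) else 0) - if a' ≤ t then 1 else 0|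
      ≤ |(a : ℝ) - a'| := by
  wlog h : a ≤ a' generalizing a a' with H
  · rw [abs_sub_comm (a : ℝ)]
    refine le_trans (le_of_eq ?_) (H a' a (by omega))
    exact Finset.sum_congr rfl fun t _ => abs_sub_comm _ _
  have e : ∀ t, |(if a ≤ t then (1 : ℝ) else 0) - if a' ≤ t then 1 else 0|
      = if a ≤ t ∧ t < a' then 1 else 0 := fun t => by
    by_cases h1 : a ≤ t <;> by_cases h2 : a' ≤ t
    · simp [h1, h2]
    · simp [h1, h2]
    · exact absurd (h.trans h2) h1
    · simp [h1, h2]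
  simp only [e]
  rw [← Finset.sum_filter, Finset.sum_const, nsmul_eq_mul, mul_one]
  have h1 : ((Finset.Icc 1 N).filter fun t => a ≤ t ∧ t < a').card ≤ a' - a := by
    rw [← Nat.card_Ico]
    exact Finset.card_le_card fun t ht => Finset.mem_Ico.2 (Finset.mem_filter.1 ht).2
  have h2 : ((((Finset.Icc 1 N).filter fun t => a ≤ t ∧ t < a').card : ℕ) : ℝ)
      ≤ ((a' - a : ℕ) : ℝ) := by exact_mod_cast h1
  rw [Nat.cast_sub h] at h2
  rw [abs_sub_comm]
  exact h2.trans (le_abs_self _)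

/-- Moving one boundary by at most `δ` changes an indicator at no more than `δ` times, and each
regime has two boundaries. Both configurations carry literally the same number of changepoints, so
that no casts occur here. -/
lemma sum_abs_regimeFn_mk_sub_le {m N : ℕ} (loc loc₁ : Fin m → ℝ) (μ : Fin m → ℝ)
    {B δ : ℝ} (hB : ∀ k, |μ k| ≤ B)
    (hδ : ∀ r ≤ m + 1, |((Config.mk m loc₁).tau N r : ℝ) - (Config.mk m loc).tau N r| ≤ δ) :
    ∑ t ∈ Finset.Icc 1 N, |regimeFn ⟨m, loc⟩ N μ t - regimeFn ⟨m, loc₁⟩ N μ t|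
      ≤ 2 * m * B * δ := by
  have ind : ∀ (a b t : ℕ), (if a ≤ t ∧ t < b then (1 : ℝ) else 0)
      = (if a ≤ t then 1 else 0) * (1 - if b ≤ t then 1 else 0) := fun a b t => by
    by_cases h1 : a ≤ t <;> by_cases h2 : b ≤ t
    · simp [h2]
    · simp [h1, h2]
    · simp [h1]
    · simp [h1]
  have hind : ∀ a t : ℕ, |if a ≤ t then (1 : ℝ) else 0| ≤ 1 ∧
      |1 - if a ≤ t then (1 : ℝ) else 0| ≤ 1 := fun a t => by split_ifs <;> simp
  have key : ∀ k : Fin m, ∑ t ∈ Finset.Icc 1 N, |regimeInd (Config.mk m loc) N t k - regimeInd (Config.mk m loc₁) N t k|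
      ≤ 2 * δ := by
    intro k
    have h1 := hδ ((k : ℕ) + 1) (by have := k.2; omega)
    have h2 := hδ ((k : ℕ) + 2) (by have := k.2; omega)
    rw [abs_sub_comm] at h1 h2
    have h3 := sum_abs_indicator_sub_le N ((Config.mk m loc).tau N ((k : ℕ) + 1)) ((Config.mk m loc₁).tau N ((k : ℕ) + 1))
    have h4 := sum_abs_indicator_sub_le N ((Config.mk m loc).tau N ((k : ℕ) + 2)) ((Config.mk m loc₁).tau N ((k : ℕ) + 2))
    calc _ ≤ ∑ t ∈ Finset.Icc 1 N,
          (|(if (Config.mk m loc).tau N ((k : ℕ) + 1) ≤ t then (1 : ℝ) else 0)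
              - if (Config.mk m loc₁).tau N ((k : ℕ) + 1) ≤ t then 1 else 0|
            + |(if (Config.mk m loc).tau N ((k : ℕ) + 2) ≤ t then (1 : ℝ) else 0)
              - if (Config.mk m loc₁).tau N ((k : ℕ) + 2) ≤ t then 1 else 0|) := by
          refine Finset.sum_le_sum fun t _ => ?_
          rw [regimeInd, regimeInd, ind, ind]
          set a := (if (Config.mk m loc).tau N ((k : ℕ) + 1) ≤ t then (1 : ℝ) else 0) with ha
          set a' := (if (Config.mk m loc₁).tau N ((k : ℕ) + 1) ≤ t then (1 : ℝ) else 0)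
          set b := (if (Config.mk m loc).tau N ((k : ℕ) + 2) ≤ t then (1 : ℝ) else 0) with hb
          set b' := (if (Config.mk m loc₁).tau N ((k : ℕ) + 2) ≤ t then (1 : ℝ) else 0)
          have e : a * (1 - b) - a' * (1 - b') = (a - a') * (1 - b') + a * (b' - b) := by ring
          rw [e]
          refine (abs_add_le _ _).trans (add_le_add ?_ ?_)
          · rw [abs_mul]
            exact mul_le_of_le_one_right (abs_nonneg _) (hind _ t).2
          · rw [abs_mul, abs_sub_comm b']
            exact mul_le_of_le_one_left (abs_nonneg _) (hind _ t).1
      _ ≤ _ := by rw [Finset.sum_add_distrib]; linarith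
  calc _ ≤ ∑ t ∈ Finset.Icc 1 N, ∑ k : Fin m, B * |regimeInd (Config.mk m loc) N t k - regimeInd (Config.mk m loc₁) N t k| := by
        refine Finset.sum_le_sum fun t _ => ?_
        rw [regimeFn, regimeFn, ← Finset.sum_sub_distrib]
        refine (Finset.abs_sum_le_sum_abs _ _).trans (Finset.sum_le_sum fun k _ => ?_)
        rw [← sub_mul, abs_mul, mul_comm]
        exact mul_le_mul_of_nonneg_right (hB k) (abs_nonneg _)
    _ = ∑ k : Fin m, B * ∑ t ∈ Finset.Icc 1 N, |regimeInd (Config.mk m loc) N t k - regimeInd (Config.mk m loc₁) N t k| := by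
        rw [Finset.sum_comm]
        exact Finset.sum_congr rfl fun k _ => by rw [Finset.mul_sum]
    _ ≤ ∑ _k : Fin m, B * (2 * δ) := Finset.sum_le_sum fun k _ =>
        mul_le_mul_of_nonneg_left (key k) ((abs_nonneg _).trans (hB k))
    _ = _ := by simp; ring

/-- Mean functions with the same regime means and close changepoints are close. -/
lemma sum_abs_regimeFn_sub_le {c₀ c₁ : Config} {N : ℕ} (hm : c₁.m = c₀.m) (μ : Fin c₀.m → ℝ)
    {B δ : ℝ} (hB : ∀ k, |μ k| ≤ B)
    (hδ : ∀ r ≤ c₀.m + 1, |(c₁.tau N r : ℝ) - c₀.tau N r| ≤ δ) :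
    ∑ t ∈ Finset.Icc 1 N, |regimeFn c₀ N μ t - regimeFn c₁ N (fun k => μ (Fin.cast hm k)) t|
      ≤ 2 * c₀.m * B * δ := by
  obtain ⟨m, loc⟩ := c₀
  obtain ⟨m₁, loc₁⟩ := c₁
  obtain rfl : m₁ = m := hm
  exact sum_abs_regimeFn_mk_sub_le loc loc₁ μ hB hδ

/-! ### Scales -/

/-- `√(n log n)`. -/
def scA (n : ℕ) : ℝ := √(n * Real.log n)

/-- `√(log n / n)`. -/
def scB (n : ℕ) : ℝ := √(Real.log n / n)

lemma scA_nonneg (n : ℕ) : 0 ≤ scA n := Real.sqrt_nonneg _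

lemma scB_nonneg (n : ℕ) : 0 ≤ scB n := Real.sqrt_nonneg _

lemma log_nat_nonneg (n : ℕ) : 0 ≤ Real.log n := Real.log_natCast_nonneg n

/-- The scales are matched to the penalty. Linear sums of the noise are o(`scA`), coefficient errors
are o(`scB`), and their products, like `n` times products of two coefficient errors, are o(log n).
The factor √(log n) beyond √n turns stochastic boundedness into statements with little o. -/
lemma scA_mul_scB (n : ℕ) : scA n * scB n = Real.log n := by
  rcases Nat.eq_zero_or_pos n with rfl | h
  · simp [scA]
  rw [scA, scB, ← Real.sqrt_mul (mul_nonneg (Nat.cast_nonneg _) (log_nat_nonneg n))]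
  have : (n : ℝ) ≠ 0 := by positivity
  rw [show (n : ℝ) * Real.log n * (Real.log n / n) = Real.log n ^ 2 by field_simp,
    Real.sqrt_sq (log_nat_nonneg n)]

lemma scB_mul (n : ℕ) : n * scB n = scA n := by
  rcases Nat.eq_zero_or_pos n with rfl | h
  · simp [scA]
  have h0 : (n : ℝ) ≠ 0 := by positivity
  rw [scA, scB, show (n : ℝ) * Real.log n = n ^ 2 * (Real.log n / n) by field_simp,
    Real.sqrt_mul (sq_nonneg _), Real.sqrt_sq (Nat.cast_nonneg _)]

lemma mul_scB_sq (n : ℕ) : n * (scB n * scB n) = Real.log n := by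
  rw [← mul_assoc, scB_mul, scA_mul_scB]

lemma sq_scA (n : ℕ) : scA n ^ 2 = n * Real.log n :=
  Real.sq_sqrt (mul_nonneg (Nat.cast_nonneg _) (log_nat_nonneg n))

lemma scA_isLittleO_id : scA =o[atTop] fun n : ℕ => (n : ℝ) := by
  have h : (fun n : ℕ => Real.log n) =o[atTop] fun n : ℕ => (n : ℝ) :=
    Real.isLittleO_log_id_atTop.comp_tendsto tendsto_natCast_atTop_atTop
  rw [isLittleO_iff] at h ⊢
  intro ε hε
  filter_upwards [h (show 0 < ε ^ 2 by positivity)] with n hn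
  rw [Real.norm_of_nonneg (scA_nonneg n), Real.norm_of_nonneg (Nat.cast_nonneg _)]
  rw [Real.norm_of_nonneg (log_nat_nonneg n), Real.norm_of_nonneg (Nat.cast_nonneg _)] at hn
  refine Real.sqrt_le_iff.2 ⟨by positivity, ?_⟩
  have := mul_le_mul_of_nonneg_left hn (Nat.cast_nonneg (α := ℝ) n)
  nlinarith

lemma one_isLittleO_log : (fun _ : ℕ => (1 : ℝ)) =o[atTop] fun n : ℕ => Real.log n := by
  rw [isLittleO_const_left]
  right
  exact tendsto_norm_atTop_atTop.comp (Real.tendsto_log_atTop.comp tendsto_natCast_atTop_atTop)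

lemma log_isLittleO_scA : (fun n : ℕ => Real.log n) =o[atTop] scA := by
  have h : (fun n : ℕ => Real.log n) =o[atTop] fun n : ℕ => (n : ℝ) :=
    Real.isLittleO_log_id_atTop.comp_tendsto tendsto_natCast_atTop_atTop
  rw [isLittleO_iff] at h ⊢
  intro ε hε
  filter_upwards [h (show 0 < ε ^ 2 by positivity)] with n hn
  rw [Real.norm_of_nonneg (log_nat_nonneg n), Real.norm_of_nonneg (scA_nonneg n)]
  rw [Real.norm_of_nonneg (log_nat_nonneg n), Real.norm_of_nonneg (Nat.cast_nonneg _)] at hn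
  have h1 := mul_le_mul_of_nonneg_left hn (log_nat_nonneg n)
  refine abs_le_of_sq_le_sq' ?_ (mul_nonneg hε.le (scA_nonneg n)) |>.2
  rw [mul_pow, sq_scA]
  nlinarith

lemma scB_isLittleO_one : scB =o[atTop] fun _ : ℕ => (1 : ℝ) := by
  have h := scA_isLittleO_id
  rw [isLittleO_iff] at h ⊢
  intro ε hε
  filter_upwards [h hε, eventually_gt_atTop 0] with n hn hn0
  rw [Real.norm_of_nonneg (scA_nonneg n), Real.norm_of_nonneg (Nat.cast_nonneg _), ← scB_mul] at hn
  rw [Real.norm_of_nonneg (scB_nonneg n), norm_one]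
  have : (0 : ℝ) < n := by exact_mod_cast hn0
  nlinarith

section Asymp

variable {ι : Type*} {L : Filter ι} {n : ι → ℕ}

lemma littleO_of_abs_le {f h g : ι → ℝ} (hh : h =o[L] g) (H : ∀ᶠ x in L, |f x| ≤ h x) :
    f =o[L] g := by
  refine IsBigO.trans_isLittleO ?_ hh
  refine IsBigO.of_bound 1 ?_
  filter_upwards [H] with x hx
  rw [one_mul, Real.norm_eq_abs, Real.norm_eq_abs]
  exact hx.trans (le_abs_self _)

lemma scA_o_n (hn : Tendsto n L atTop) : (fun x => scA (n x)) =o[L] fun x => (n x : ℝ) :=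
  scA_isLittleO_id.comp_tendsto hn

lemma log_o_scA (hn : Tendsto n L atTop) :
    (fun x => Real.log (n x)) =o[L] fun x => scA (n x) :=
  log_isLittleO_scA.comp_tendsto hn

lemma one_o_log (hn : Tendsto n L atTop) :
    (fun _ => (1 : ℝ)) =o[L] fun x => Real.log (n x) :=
  one_isLittleO_log.comp_tendsto hn

lemma const_o_log (hn : Tendsto n L atTop) (C : ℝ) :
    (fun _ => C) =o[L] fun x => Real.log (n x) := by
  simpa using (one_o_log hn).const_mul_left C

lemma scB_o_one (hn : Tendsto n L atTop) : (fun x => scB (n x)) =o[L] fun _ => (1 : ℝ) :=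
  scB_isLittleO_one.comp_tendsto hn

lemma log_o_n (hn : Tendsto n L atTop) : (fun x => Real.log (n x)) =o[L] fun x => (n x : ℝ) :=
  (log_o_scA hn).trans (scA_o_n hn)

lemma mul_o_log {f g : ι → ℝ} (hf : f =o[L] fun x => scA (n x))
    (hg : g =o[L] fun x => scB (n x)) : (fun x => f x * g x) =o[L] fun x => Real.log (n x) := by
  have := hf.mul hg
  simpa only [scA_mul_scB] using this

lemma n_mul_mul_o_log {f g : ι → ℝ} (hf : f =o[L] fun x => scB (n x))
    (hg : g =o[L] fun x => scB (n x)) :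
    (fun x => (n x : ℝ) * (f x * g x)) =o[L] fun x => Real.log (n x) := by
  have := (isBigO_refl (fun x => (n x : ℝ)) L).mul_isLittleO (hf.mul hg)
  simpa only [mul_scB_sq] using this

lemma div_n_o_scB {f : ι → ℝ} (hf : f =o[L] fun x => scA (n x)) (hn : Tendsto n L atTop) :
    (fun x => (n x : ℝ)⁻¹ * f x) =o[L] fun x => scB (n x) := by
  have := (isBigO_refl (fun x => (n x : ℝ)⁻¹) L).mul_isLittleO hf
  refine this.congr' EventuallyEq.rfl ?_
  filter_upwards [hn.eventually_gt_atTop 0] with x hx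
  have : (n x : ℝ) ≠ 0 := by positivity
  rw [← scB_mul, ← mul_assoc, inv_mul_cancel₀ this, one_mul]

lemma tendsto_div_n_of_o {f : ι → ℝ} (hf : f =o[L] fun x => (n x : ℝ)) :
    Tendsto (fun x => f x / n x) L (𝓝 0) := hf.tendsto_div_nhds_zero

/-- A quadratic inequality `c n K² ≤ K A + C` with `A = o(√(n log n))`, `C = o(log n)` forces
`K = o(√(log n / n))`. -/
lemma o_scB_of_quad {K A C : ι → ℝ} {κ : ℝ} (hκ : 0 < κ) (hn : Tendsto n L atTop)
    (hA : A =o[L] fun x => scA (n x)) (hC : C =o[L] fun x => Real.log (n x))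
    (hK : ∀ᶠ x in L, 0 ≤ K x)
    (H : ∀ᶠ x in L, κ * n x * K x ^ 2 ≤ K x * A x + C x) : K =o[L] fun x => scB (n x) := by
  rw [isLittleO_iff]
  intro ε hε
  have h1 := isLittleO_iff.1 hA (show 0 < κ * ε / 2 by positivity)
  have h2 := isLittleO_iff.1 hC (show 0 < κ * ε ^ 2 / 2 by positivity)
  filter_upwards [h1, h2, hK, H, hn.eventually_gt_atTop 0] with x a1 a2 a3 a4 a5
  rw [Real.norm_of_nonneg (scA_nonneg _), Real.norm_eq_abs] at a1
  rw [Real.norm_of_nonneg (log_nat_nonneg _), Real.norm_eq_abs] at a2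
  rw [Real.norm_of_nonneg a3, Real.norm_of_nonneg (scB_nonneg _)]
  have b0 : (0 : ℝ) < n x := by exact_mod_cast a5
  -- If `K` exceeded `ε * scB`, each term on the right would be at most half of the left side, and
  -- the term linear in `K` strictly less than half.
  by_contra hlt
  push Not at hlt
  set b := scB (n x)
  have hb : 0 ≤ b := scB_nonneg _
  rw [← scB_mul] at a1
  rw [← mul_scB_sq] at a2
  have c1 := (le_abs_self _).trans a1
  have c2 := (le_abs_self _).trans a2
  have c3 : K x * A x ≤ K x * (κ * ε / 2 * (n x * b)) := mul_le_mul_of_nonneg_left c1 a3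
  have c4 : 0 ≤ ε * b := by positivity
  have c5 : K x * (ε * b) < K x * K x := mul_lt_mul_of_pos_left hlt (c4.trans_lt hlt)
  have c6 : (ε * b) * (ε * b) ≤ K x * (ε * b) := mul_le_mul_of_nonneg_right hlt.le c4
  have c7 : 0 < κ * n x := by positivity
  have e1 : K x * (κ * ε / 2 * (n x * b)) = (κ * n x) / 2 * (K x * (ε * b)) := by ring
  have e2 : κ * ε ^ 2 / 2 * (n x * (b * b)) = (κ * n x) / 2 * ((ε * b) * (ε * b)) := by ring
  rw [e1] at c3
  rw [e2] at c2
  nlinarith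

end Asymp

/-! ### Regular noise -/

/-- The asymptotic properties of the noise that the consistency proof uses, along a filter. -/
structure Regular {ι : Type*} (L : Filter ι) (p T : ℕ) (φ₀ : Fin p → ℝ) (σsq : ℝ)
    (Γ : Matrix (Fin (p + 1)) (Fin (p + 1)) ℝ) (n : ι → ℕ) (e : ι → ℕ → ℝ) : Prop where
  n_tendsto : Tendsto n L atTop
  gram : ∀ i j : Fin (p + 1),
    Tendsto (fun x => lagProd p (n x) (e x) (e x) i j / n x) L (𝓝 (Γ i j))
  posDef : ∃ γ > 0, ∀ β : Fin (p + 1) → ℝ,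
    γ * ∑ i, β i ^ 2 ≤ ∑ i, ∑ j, β i * β j * Γ i j
  orth : ∀ i : Fin p, (fun x => ∑ j : Fin (p + 1),
    arVec φ₀ j * lagProd p (n x) (e x) (e x) ((i : ℕ) + 1) j) =o[L] fun x => scA (n x)
  innov : Tendsto (fun x => (∑ t ∈ win p (n x), arFilter φ₀ (e x) t ^ 2) / n x) L (𝓝 σsq)
  noise : ∃ Q : ι → ℝ, (Q =o[L] fun x => scA (n x)) ∧
    ∀ᶠ x in L, NoiseBound p T (n x) (e x) (Q x)
  edge : ∃ R : ι → ℝ, ((fun x => R x ^ 2) =o[L] fun x => Real.log (n x)) ∧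
    ∀ᶠ x in L, 0 ≤ R x ∧ (∀ t, 1 ≤ t → t ≤ p → |e x t| ≤ R x) ∧
      ∀ t, n x < t + p → t ≤ n x → |e x t| ≤ R x

/-- The configurations along the filter have regimes of a length proportional to `n`. -/
def WellSpaced {ι : Type*} (L : Filter ι) (p T : ℕ) (n : ι → ℕ) (c : ι → Config) : Prop :=
  ∃ κ : ℝ, 0 < κ ∧ ∀ᶠ x in L, ∃ k : ℕ, 0 < k ∧ κ * n x ≤ k ∧ Spaced (c x) (n x) (p + k * T)

lemma wellSpaced_of_admissible {ι : Type*} {L : Filter ι} {p T M : ℕ} (hT : 0 < T) {d : ℝ}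
    (hd : 0 < d) {n : ι → ℕ} (hn : Tendsto n L atTop) {c : ι → Config}
    (hc : ∀ᶠ x in L, c x ∈ admissible M d) : WellSpaced L p T n c := by
  have hT' : (0 : ℝ) < T := by exact_mod_cast hT
  -- With about d n / (4T) periods a regime uses a quarter of its guaranteed length d n; the rest
  -- absorbs `p`, the rounding up and the two rounding errors once `n` is large.
  refine ⟨d / (4 * T), by positivity, ?_⟩
  have h1 : ∀ᶠ x in L, ((p : ℝ) + T + 2) * 4 / (3 * d) ≤ n x :=
    (tendsto_natCast_atTop_atTop.comp hn).eventually_ge_atTop _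
  filter_upwards [hc, h1, hn.eventually_gt_atTop 0] with x hx h2 h3
  have h3' : (0 : ℝ) < n x := by exact_mod_cast h3
  refine ⟨⌈d / (4 * T) * n x⌉₊, Nat.ceil_pos.2 (by positivity), Nat.le_ceil _,
    spaced_of_admissible hd hx ?_⟩
  have h4 := Nat.ceil_lt_add_one (show 0 ≤ d / (4 * T) * n x by positivity)
  push_cast
  have h5 : (⌈d / (4 * T) * n x⌉₊ : ℝ) * T ≤ (d / (4 * T) * n x + 1) * T :=
    mul_le_mul_of_nonneg_right h4.le hT'.le
  have h6 : (d / (4 * T) * n x + 1) * T = d * n x / 4 + T := by field_simp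
  rw [div_le_iff₀ (by positivity)] at h2
  nlinarith

/-- Ordinary least squares runs over all times from 1, whereas the noise bounds concern the window
from `p + 1`; the missing first `p` terms are paid for by the bound at the edge. -/
lemma NoiseBound.zero {p T N : ℕ} {e : ℕ → ℝ} {Q R : ℝ} (h : NoiseBound p T N e Q)
    (hR : ∀ t, 1 ≤ t → t ≤ p → |e t| ≤ R) (hR0 : 0 ≤ R) (hp : p ≤ N) :
    NoiseBound 0 T N e (Q + p * R) := by
  have hpR : 0 ≤ p * R := mul_nonneg (Nat.cast_nonneg _) hR0
  refine ⟨fun m hm => (h.partialSum m hm).trans (by linarith), fun i hi v => ?_⟩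
  obtain rfl : i = 0 := by omega
  simp only [win, Nat.sub_zero]
  rw [← Finset.sum_Ico_consecutive _ (show 0 + 1 ≤ p + 1 by omega) (show p + 1 ≤ N + 1 by omega)]
  have h1 := h.seasonal 0 (Nat.zero_le _) v
  simp only [win, Nat.sub_zero] at h1
  have h2 : |∑ t ∈ Finset.Ico (0 + 1) (p + 1), e t * seasonInd T t v| ≤ p * R := by
    refine (Finset.abs_sum_le_sum_abs _ _).trans ((Finset.sum_le_card_nsmul _ _ R ?_).trans ?_)
    · intro t ht
      rw [Finset.mem_Ico] at ht
      have h3 : |seasonInd T t v| ≤ 1 := by rw [seasonInd]; split_ifs <;> simp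
      rw [abs_mul]
      exact (mul_le_of_le_one_right (abs_nonneg _) h3).trans (hR t (by omega) (by omega))
    · simp [nsmul_eq_mul]
  exact (abs_add_le _ _).trans (by linarith)

/-! ### Bounds on coefficients from bounds on mean functions -/

/-- The filter of order 0 is the identity and has `arOne = 1`, so the identifiability bounds for
filtered mean functions specialize to unfiltered ones. -/
lemma Spaced.coef_sq_le {T : ℕ} (hT : 0 < T) {c : Config} {N ρ k : ℕ} (h : Spaced c N ρ)
    (hk : k * T ≤ ρ) (u : Fin T → ℝ) (w : Fin c.m → ℝ) :
    k * max ‖u‖ ‖w‖ ^ 2 ≤ 4 * ∑ t ∈ Finset.Icc 1 N, fitFn c N u w t ^ 2 := by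
  set φ : Fin 0 → ℝ := fun _ => 0
  have e1 : ∀ F : ℕ → ℝ, arFilter φ F = F := fun F => by funext t; simp [arFilter]
  have e2 : win 0 N = Finset.Icc 1 N := rfl
  have e3 : arOne φ = 1 := by simp [arOne]
  set S := ∑ t ∈ Finset.Icc 1 N, fitFn c N u w t ^ 2
  have hS : 0 ≤ S := Finset.sum_nonneg fun _ _ => sq_nonneg _
  have hk0 : (0 : ℝ) ≤ k := Nat.cast_nonneg k
  have h1 : ∀ v, k * |u v| ^ 2 ≤ 4 * S := fun v => by
    have := h.season_sq_le_sum_win hT (n := k) (by omega) φ u w (t₀ := (v : ℕ) + 1) (by omega)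
    rw [e1, e1, e2, seasonFn_eq hT u (by omega)] at this
    simp only [Nat.add_sub_cancel, Nat.mod_eq_of_lt v.2] at this
    rw [sq_abs]; linarith
  have h2 : ∀ j, k * |w j| ^ 2 ≤ 4 * S := fun j => by
    have := h.mean_sq_le_sum_win hT (n := k) (by omega) φ u w j
    rw [e1, e2, e3, one_mul] at this
    rw [sq_abs]; exact this
  rcases Nat.eq_zero_or_pos k with rfl | hkp
  · simpa using hS
  have hkp' : (0 : ℝ) < k := by exact_mod_cast hkp
  have hb : max ‖u‖ ‖w‖ ≤ √(4 * S / k) := by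
    refine max_le ((pi_norm_le_iff_of_nonneg (Real.sqrt_nonneg _)).2 fun v => ?_)
      ((pi_norm_le_iff_of_nonneg (Real.sqrt_nonneg _)).2 fun j => ?_)
    · exact Real.le_sqrt_of_sq_le (by rw [le_div_iff₀ hkp', mul_comm]; exact h1 v)
    · exact Real.le_sqrt_of_sq_le (by rw [le_div_iff₀ hkp', mul_comm]; exact h2 j)
  have hm : 0 ≤ max ‖u‖ ‖w‖ := le_max_of_le_left (norm_nonneg _)
  have := (Real.le_sqrt hm (by positivity)).1 hb
  rw [le_div_iff₀ hkp'] at this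
  linarith

/-! ### Yule-Walker equations -/

section YuleWalker

variable {p : ℕ}

/-- The solution of the Yule-Walker equations for the autocovariance matrix `V`. -/
def ywSol (V : Matrix (Fin (p + 1)) (Fin (p + 1)) ℝ) : Fin p → ℝ :=
  (V.submatrix Fin.succ Fin.succ)⁻¹ *ᵥ fun i => V i.succ 0

lemma sum_arVec_mul_eq (V : Matrix (Fin (p + 1)) (Fin (p + 1)) ℝ) (φ : Fin p → ℝ) (i : Fin p) :
    ∑ j, arVec φ j * V i.succ j = V i.succ 0 - (V.submatrix Fin.succ Fin.succ *ᵥ φ) i := by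
  simp only [Fin.sum_univ_succ, arVec_zero, arVec_succ, one_mul, Matrix.mulVec, dotProduct,
    Matrix.submatrix_apply, sub_eq_add_neg, neg_mul, Finset.sum_neg_distrib]
  congr 2
  exact Finset.sum_congr rfl fun j _ => mul_comm _ _

lemma ywSol_normal {V : Matrix (Fin (p + 1)) (Fin (p + 1)) ℝ}
    (hV : (V.submatrix Fin.succ Fin.succ).det ≠ 0) (i : Fin p) :
    ∑ j, arVec (ywSol V) j * V i.succ j = 0 := by
  rw [sum_arVec_mul_eq, ywSol, Matrix.mulVec_mulVec, Matrix.mul_nonsing_inv _ hV.isUnit,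
    Matrix.one_mulVec, sub_self]

/-- The error relative to any `φ` is the inverse matrix applied to the defect of `φ` in the
Yule-Walker equations. A rate for the defect is thereby a rate for the estimator. -/
lemma ywSol_sub {V : Matrix (Fin (p + 1)) (Fin (p + 1)) ℝ}
    (hV : (V.submatrix Fin.succ Fin.succ).det ≠ 0) (φ : Fin p → ℝ) :
    ywSol V - φ = (V.submatrix Fin.succ Fin.succ)⁻¹ *ᵥ fun i => ∑ j, arVec φ j * V i.succ j := by
  have h : (fun i => ∑ j, arVec φ j * V i.succ j)
      = (fun i => V i.succ 0) - V.submatrix Fin.succ Fin.succ *ᵥ φ := by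
    funext i; rw [sum_arVec_mul_eq]; rfl
  rw [h, Matrix.mulVec_sub, Matrix.mulVec_mulVec, Matrix.nonsing_inv_mul _ hV.isUnit,
    Matrix.one_mulVec, ywSol]

/-- The form is tested on vectors with first entry 0. -/
lemma submatrix_det_ne_zero {V : Matrix (Fin (p + 1)) (Fin (p + 1)) ℝ} {γ : ℝ} (hγ : 0 < γ)
    (h : ∀ β : Fin (p + 1) → ℝ, γ * ∑ i, β i ^ 2 ≤ ∑ i, ∑ j, β i * β j * V i j) :
    (V.submatrix Fin.succ Fin.succ).det ≠ 0 := by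
  rw [Ne, ← Matrix.exists_mulVec_eq_zero_iff]
  rintro ⟨v, hv, h0⟩
  have h1 := h (Fin.cons 0 v)
  simp only [Fin.sum_univ_succ, Fin.cons_zero, Fin.cons_succ, zero_mul, mul_zero, zero_add,
    Finset.sum_const_zero, ne_eq, OfNat.ofNat_ne_zero, not_false_eq_true, zero_pow] at h1
  have h2 : ∑ i : Fin p, ∑ j : Fin p, v i * v j * V i.succ j.succ = 0 := by
    have : ∀ i : Fin p, ∑ j : Fin p, v i * v j * V i.succ j.succ
        = v i * (V.submatrix Fin.succ Fin.succ *ᵥ v) i := fun i => by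
      rw [Matrix.mulVec, dotProduct, Finset.mul_sum]
      exact Finset.sum_congr rfl fun j _ => by rw [Matrix.submatrix_apply]; ring
    simp only [this, h0, Pi.zero_apply, mul_zero, Finset.sum_const_zero]
  rw [h2] at h1
  have h3 : ∑ i : Fin p, v i ^ 2 = 0 :=
    le_antisymm (by nlinarith) (Finset.sum_nonneg fun _ _ => sq_nonneg _)
  rw [Finset.sum_eq_zero_iff_of_nonneg fun _ _ => sq_nonneg _] at h3
  exact hv (funext fun i => by simpa using h3 i (Finset.mem_univ i))

variable {ι : Type*} {L : Filter ι}

lemma isLittleO_fun_sum {κ : Type*} {S : Finset κ} {f : κ → ι → ℝ} {r : ι → ℝ}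
    (h : ∀ j ∈ S, f j =o[L] r) : (fun x => ∑ j ∈ S, f j x) =o[L] r := by
  have := IsLittleO.sum h
  refine this.congr_left fun x => ?_
  rw [Finset.sum_apply]

lemma tendsto_submatrix_inv {V : ι → Matrix (Fin (p + 1)) (Fin (p + 1)) ℝ}
    {W : Matrix (Fin (p + 1)) (Fin (p + 1)) ℝ} (hV : Tendsto V L (𝓝 W))
    (hW : (W.submatrix Fin.succ Fin.succ).det ≠ 0) :
    Tendsto (fun x => ((V x).submatrix Fin.succ Fin.succ)⁻¹) L
        (𝓝 (W.submatrix Fin.succ Fin.succ)⁻¹) ∧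
      ∀ᶠ x in L, ((V x).submatrix Fin.succ Fin.succ).det ≠ 0 := by
  have hc : Continuous fun U : Matrix (Fin (p + 1)) (Fin (p + 1)) ℝ =>
      U.submatrix (Fin.succ : Fin p → _) (Fin.succ : Fin p → _) :=
    continuous_id.matrix_submatrix _ _
  have h1 : Tendsto (fun x => (V x).submatrix (Fin.succ : Fin p → _) (Fin.succ : Fin p → _)) L
      (𝓝 (W.submatrix Fin.succ Fin.succ)) := (hc.tendsto W).comp hV
  have h2 : Tendsto (fun x => ((V x).submatrix (Fin.succ : Fin p → _) (Fin.succ : Fin p → _)).det) L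
      (𝓝 (W.submatrix Fin.succ Fin.succ).det) :=
    ((continuous_id.matrix_det).tendsto _).comp h1
  refine ⟨?_, h2.eventually_ne hW⟩
  simp only [Matrix.inv_def, Ring.inverse_eq_inv']
  exact (h2.inv₀ hW).smul (((continuous_id.matrix_adjugate).tendsto _).comp h1)

lemma tendsto_ywSol {V : ι → Matrix (Fin (p + 1)) (Fin (p + 1)) ℝ}
    {W : Matrix (Fin (p + 1)) (Fin (p + 1)) ℝ} (hV : Tendsto V L (𝓝 W))
    (hW : (W.submatrix Fin.succ Fin.succ).det ≠ 0) :
    Tendsto (fun x => ywSol (V x)) L (𝓝 (ywSol W)) := by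
  have h1 := (tendsto_submatrix_inv hV hW).1
  have h2 : Tendsto (fun x => fun i : Fin p => V x i.succ 0) L (𝓝 fun i => W i.succ 0) :=
    tendsto_pi_nhds.2 fun i => tendsto_pi_nhds.1 (tendsto_pi_nhds.1 hV i.succ) 0
  refine tendsto_pi_nhds.2 fun i => ?_
  simp only [ywSol, Matrix.mulVec, dotProduct]
  exact tendsto_finsetSum _ fun k _ =>
    (tendsto_pi_nhds.1 (tendsto_pi_nhds.1 h1 i) k).mul (tendsto_pi_nhds.1 h2 k)

lemma ywSol_sub_isLittleO {V : ι → Matrix (Fin (p + 1)) (Fin (p + 1)) ℝ}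
    {W : Matrix (Fin (p + 1)) (Fin (p + 1)) ℝ} (hV : Tendsto V L (𝓝 W))
    (hW : (W.submatrix Fin.succ Fin.succ).det ≠ 0) {φ : Fin p → ℝ} {r : ι → ℝ}
    (h : ∀ i : Fin p, (fun x => ∑ j, arVec φ j * V x i.succ j) =o[L] r) (i : Fin p) :
    (fun x => ywSol (V x) i - φ i) =o[L] r := by
  obtain ⟨h1, h2⟩ := tendsto_submatrix_inv hV hW
  have h3 : (fun x => ∑ k, ((V x).submatrix Fin.succ Fin.succ)⁻¹ i k
      * ∑ j, arVec φ j * V x k.succ j) =o[L] r := by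
    refine isLittleO_fun_sum fun k _ => ?_
    have h4 : (fun x => ((V x).submatrix Fin.succ Fin.succ)⁻¹ i k) =O[L] fun _ => (1 : ℝ) :=
      (tendsto_pi_nhds.1 (tendsto_pi_nhds.1 h1 i) k).isBigO_one ℝ
    simpa using h4.mul_isLittleO (h k)
  refine h3.congr' ?_ EventuallyEq.rfl
  filter_upwards [h2] with x hx
  have := congrFun (ywSol_sub hx φ) i
  rw [Pi.sub_apply] at this
  rw [this]; rfl

/-- The matrix of sample autocovariances at lags up to `p`. -/
def acovMat (p T N : ℕ) (c : Config) (x : ℕ → ℝ) : Matrix (Fin (p + 1)) (Fin (p + 1)) ℝ :=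
  Matrix.of fun i j => sampleAcov T N c x (((i : ℕ) : ℤ) - (j : ℕ)).natAbs

lemma yuleWalker_eq (p T N : ℕ) (c : Config) (x : ℕ → ℝ) :
    yuleWalker p T N c x = ywSol (acovMat p T N c x) := by
  unfold yuleWalker ywSol acovMat
  have e1 : (Matrix.of fun i j : Fin p =>
      sampleAcov T N c x (((i : ℕ) : ℤ) - ((j : ℕ) : ℤ)).natAbs : Matrix (Fin p) (Fin p) ℝ)
      = (Matrix.of fun i j : Fin (p + 1) =>
        sampleAcov T N c x (((i : ℕ) : ℤ) - (j : ℕ)).natAbs).submatrix Fin.succ Fin.succ := by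
    ext i j
    simp only [Matrix.of_apply, Matrix.submatrix_apply, Fin.val_succ]
    congr 1; push_cast; congr 1; ring
  rw [e1]
  congr 1

end YuleWalker

/-! ### Estimation around a reference mean function -/

/-- The data `X` are a mean function of `c` with bounded regime means, plus the noise `e`, plus
a bounded misfit `g` with small total mass. -/
structure Ref {ι : Type*} (L : Filter ι) (p T M : ℕ) (B : ℝ) (n : ι → ℕ) (e g X : ι → ℕ → ℝ)
    (c : ι → Config) (s : ι → Fin T → ℝ) (μ : ∀ x, Fin (c x).m → ℝ) : Prop where
  m_le : ∀ᶠ x in L, (c x).m ≤ M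
  spaced : WellSpaced L p T n c
  close : (fun x => ∑ t ∈ Finset.Icc 1 (n x), |g x t|) =o[L] fun x => scA (n x)
  cross : ∃ Q : ι → ℝ, (Q =o[L] fun x => scA (n x)) ∧
    ∀ᶠ x in L, ∀ i ≤ p, ∀ j ≤ p, |lagProd p (n x) (e x) (g x) i j| ≤ Q x
  bdd : ∀ᶠ x in L, ∀ t, 1 ≤ t → t ≤ n x → |g x t| ≤ B
  mean_bdd : ∀ᶠ x in L, ∀ k, |μ x k| ≤ B
  data : ∀ x t, X x t = fitFn (c x) (n x) (s x) (μ x) t + (e x t + g x t)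

lemma abs_apply_le_max {T m : ℕ} (u : Fin T → ℝ) (w : Fin m → ℝ) :
    (∀ v, |u v| ≤ max ‖u‖ ‖w‖) ∧ ∀ k, |w k| ≤ max ‖u‖ ‖w‖ :=
  ⟨fun v => (norm_le_pi_norm u v).trans (le_max_left _ _),
    fun k => (norm_le_pi_norm w k).trans (le_max_right _ _)⟩

section RefSection

variable {ι : Type*} {L : Filter ι} {p T M : ℕ} {φ₀ : Fin p → ℝ} {σsq : ℝ}
  {Γ : Matrix (Fin (p + 1)) (Fin (p + 1)) ℝ} {n : ι → ℕ} {e g X : ι → ℕ → ℝ} {B : ℝ}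
  {c : ι → Config} {s : ι → Fin T → ℝ} {μ : ∀ x, Fin (c x).m → ℝ}

/-- Let `h` be the fitted minus the reference mean function and `K` the size of its coefficients.
The residual e + g - h is orthogonal to `h`, so ∑h² = ∑(e + g)h. The left side is at least of order
n K², the right side at most K o(√(n log n)), and `o_scB_of_quad` gives the rate. -/
lemma Ref.exists_ols (reg : Regular L p T φ₀ σsq Γ n e) (ref : Ref L p T M B n e g X c s μ)
    (hT : 0 < T) :
    ∃ (K : ι → ℝ) (h : ι → ℕ → ℝ), (K =o[L] fun x => scB (n x)) ∧ ∀ᶠ x in L, 0 ≤ K x ∧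
      (∀ i : Fin (n x), olsResidual T (n x) (c x) (X x) i
        = e x ((i : ℕ) + 1) + g x ((i : ℕ) + 1) - h x ((i : ℕ) + 1)) ∧
      ∃ (u : Fin T → ℝ) (w : Fin (c x).m → ℝ), (∀ v, |u v| ≤ K x) ∧ (∀ k, |w k| ≤ K x) ∧
        h x = fitFn (c x) (n x) u w := by
  have hn := reg.n_tendsto
  choose s₁ μ₁ hres horth using fun x => exists_olsResidual_eq T (n x) (c x) (X x)
  set K : ι → ℝ := fun x => max ‖s₁ x - s x‖ ‖μ₁ x - μ x‖ with hK
  set h : ι → ℕ → ℝ := fun x => fitFn (c x) (n x) (s₁ x - s x) (μ₁ x - μ x) with hh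
  have hXE : ∀ x t, X x t - fitFn (c x) (n x) (s₁ x) (μ₁ x) t = e x t + g x t - h x t := by
    intro x t
    rw [ref.data x t, hh]
    simp only
    rw [fitFn_sub]; ring
  have hK0 : ∀ x, 0 ≤ K x := fun x => le_max_of_le_left (norm_nonneg _)
  obtain ⟨Q, hQ, hQb⟩ := reg.noise
  obtain ⟨R, hR, hRb⟩ := reg.edge
  obtain ⟨κ, hκ, hsp⟩ := ref.spaced
  set D : ι → ℝ := fun x => ∑ t ∈ Finset.Icc 1 (n x), |g x t| with hD
  -- Only the square of the edge bound has a rate, so `R` is replaced by the larger `1 + R²`.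
  have hRo : (fun x => 1 + R x ^ 2) =o[L] fun x => scA (n x) :=
    ((one_o_log hn).add hR).trans (log_o_scA hn)
  have hA : (fun x => 4 * ((T + 2 * M) * (Q x + p * (1 + R x ^ 2)) + 2 * D x))
      =o[L] fun x => scA (n x) :=
    (((hQ.add (hRo.const_mul_left _)).const_mul_left _).add
      (ref.close.const_mul_left 2)).const_mul_left 4
  refine ⟨K, h, ?_, ?_⟩
  · refine o_scB_of_quad hκ hn hA (const_o_log hn 0) (Eventually.of_forall hK0) ?_
    filter_upwards [hQb, hRb, hsp, ref.m_le, hn.eventually_ge_atTop p] with x q r sp hm hp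
    obtain ⟨k, hk0, hk, hspc⟩ := sp
    obtain ⟨r0, r1, r2⟩ := r
    have hR1 : R x ≤ 1 + R x ^ 2 := by nlinarith [sq_nonneg (R x - 1)]
    have nb := q.zero (fun t h1 h2 => (r1 t h1 h2).trans hR1) (by positivity) hp
    obtain ⟨hu, hw⟩ := abs_apply_le_max (s₁ x - s x) (μ₁ x - μ x)
    have b1 := nb.abs_lagProd_fitFn_le hT (c x) _ _ hu hw le_rfl le_rfl
    have b2 : |∑ t ∈ Finset.Icc 1 (n x), g x t * h x t| ≤ 2 * K x * D x := by
      refine (Finset.abs_sum_le_sum_abs _ _).trans ?_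
      rw [hD, Finset.mul_sum]
      refine Finset.sum_le_sum fun t ht => ?_
      obtain ⟨t1, t2⟩ := Finset.mem_Icc.1 ht
      rw [abs_mul, mul_comm]
      exact mul_le_mul_of_nonneg_right
        (hspc.abs_fitFn_le hT _ _ (hK0 x) hu hw t1 t2) (abs_nonneg _)
    have e1 : ∑ t ∈ Finset.Icc 1 (n x), h x t ^ 2 = lagProd 0 (n x) (e x) (h x) 0 0
        + ∑ t ∈ Finset.Icc 1 (n x), g x t * h x t := by
      have h0 := horth x (s₁ x - s x) (μ₁ x - μ x)
      simp only [hXE] at h0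
      have e2 : lagProd 0 (n x) (e x) (h x) 0 0 = ∑ t ∈ Finset.Icc 1 (n x), e x t * h x t := rfl
      rw [e2, ← Finset.sum_add_distrib, ← sub_eq_zero, ← Finset.sum_sub_distrib, ← neg_eq_zero,
        ← Finset.sum_neg_distrib, ← h0]
      exact Finset.sum_congr rfl fun t _ => by simp only [hh]; ring
    have b3 := hspc.coef_sq_le hT (k := k) (by omega) (s₁ x - s x) (μ₁ x - μ x)
    have e3 : ∑ t ∈ Finset.Icc 1 (n x), fitFn (c x) (n x) (s₁ x - s x) (μ₁ x - μ x) t ^ 2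
        = ∑ t ∈ Finset.Icc 1 (n x), h x t ^ 2 := rfl
    rw [e3, e1] at b3
    have hmM : ((c x).m : ℝ) ≤ M := by exact_mod_cast hm
    have hQ' : 0 ≤ Q x + p * (1 + R x ^ 2) := nb.nonneg
    have b4 : (T + 2 * (c x).m : ℝ) * K x * (Q x + p * (1 + R x ^ 2))
        ≤ (T + 2 * M) * K x * (Q x + p * (1 + R x ^ 2)) := by
      refine mul_le_mul_of_nonneg_right (mul_le_mul_of_nonneg_right ?_ (hK0 x)) hQ'
      linarith
    have b5 : κ * n x * K x ^ 2 ≤ k * K x ^ 2 := mul_le_mul_of_nonneg_right hk (sq_nonneg _)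
    have b6 := (le_abs_self _).trans b1
    have b7 := (le_abs_self _).trans b2
    have b8 : (k : ℝ) * K x ^ 2 ≤ 4 * (lagProd 0 (n x) (e x) (h x) 0 0
        + ∑ t ∈ Finset.Icc 1 (n x), g x t * h x t) := b3
    have b9 : lagProd 0 (n x) (e x) (h x) 0 0
        ≤ (T + 2 * M) * K x * (Q x + p * (1 + R x ^ 2)) := b6.trans b4
    nlinarith
  · refine Eventually.of_forall fun x => ⟨hK0 x, fun i => ?_, s₁ x - s x, μ₁ x - μ x, ?_, ?_, rfl⟩
    · rw [hres x i, hXE]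
    · exact (abs_apply_le_max _ _).1
    · exact (abs_apply_le_max _ _).2

lemma lagProd_sub_sub (p N : ℕ) (E h : ℕ → ℝ) (i j : ℕ) :
    lagProd p N (fun t => E t - h t) (fun t => E t - h t) i j
      = lagProd p N E E i j - lagProd p N E h i j - lagProd p N h E i j + lagProd p N h h i j := by
  simp only [lagProd, ← Finset.sum_sub_distrib, ← Finset.sum_add_distrib]
  exact Finset.sum_congr rfl fun t _ => by ring

/-- The sample autocovariances agree with the lagged products of noise plus misfit. -/
lemma Ref.acov (reg : Regular L p T φ₀ σsq Γ n e) (ref : Ref L p T M B n e g X c s μ)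
    (hT : 0 < T) {i j : ℕ} (hi : i ≤ p) (hj : j ≤ p) :
    (fun x => n x * sampleAcov T (n x) (c x) (X x) ((i : ℤ) - j).natAbs
      - lagProd p (n x) (fun t => e x t + g x t) (fun t => e x t + g x t) i j)
      =o[L] fun x => Real.log (n x) := by
  have hn := reg.n_tendsto
  obtain ⟨K, h, hK, hKb⟩ := ref.exists_ols reg hT
  obtain ⟨Q, hQ, hQb⟩ := reg.noise
  obtain ⟨R, hR, hRb⟩ := reg.edge
  obtain ⟨κ, hκ, hsp⟩ := ref.spaced
  set D : ι → ℝ := fun x => ∑ t ∈ Finset.Icc 1 (n x), |g x t| with hD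
  have hKK := n_mul_mul_o_log hK hK
  have o1 := mul_o_log hQ hK
  have o2 := mul_o_log ref.close hK
  -- The error budget: products at the two edges, the products of the fit error with the noise and
  -- with the misfit, and the square of the fit error.
  have hbd : (fun x => 2 * p * (3 * (R x ^ 2 + B ^ 2 + 4 * (n x * (K x * K x))))
      + (2 * ((T + 2 * M) * (Q x * K x) + 2 * (D x * K x)) + 4 * (n x * (K x * K x))))
      =o[L] fun x => Real.log (n x) :=
    ((((hR.add (const_o_log hn _)).add (hKK.const_mul_left 4)).const_mul_left 3).const_mul_left
      _).add ((((o1.const_mul_left _).add (o2.const_mul_left 2)).const_mul_left 2).add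
        (hKK.const_mul_left 4))
  refine littleO_of_abs_le hbd ?_
  filter_upwards [hKb, hQb, hRb, hsp, ref.m_le, ref.bdd, hn.eventually_gt_atTop (2 * p)]
    with x hk q r sp hm hB hp
  obtain ⟨hK0, hres, u, w, hu, hw, hhx⟩ := hk
  obtain ⟨k, -, -, hspc⟩ := sp
  obtain ⟨r0, r1, r2⟩ := r
  have hn0 : (n x : ℝ) ≠ 0 := by
    have : n x ≠ 0 := by omega
    exact_mod_cast this
  have hhb : ∀ t, 1 ≤ t → t ≤ n x → |h x t| ≤ 2 * K x := fun t t1 t2 => by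
    rw [hhx]; exact hspc.abs_fitFn_le hT u w hK0 hu hw t1 t2
  set E : ℕ → ℝ := fun t => e x t + g x t with hE
  rw [sampleAcov_eq (E := fun t => E t - h x t) hres, ← mul_assoc, mul_inv_cancel₀ hn0, one_mul]
  have a1 := abs_acovSum_sub_lagProd_le (p := p) hp (E := fun t => E t - h x t)
    (B := R x + B + 2 * K x)
    (fun t t1 t2 => by
      have x1 := r1 t t1 t2
      have x2 := hB t t1 (by omega)
      have x3 := hhb t t1 (by omega)
      simp only [hE]
      calc |e x t + g x t - h x t| ≤ |e x t| + |g x t| + |h x t| :=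
            (abs_sub _ _).trans (add_le_add_left (abs_add_le _ _) _)
        _ ≤ _ := by linarith)
    (fun t t1 t2 => by
      have x1 := r2 t t1 t2
      have x2 := hB t (by omega) t2
      have x3 := hhb t (by omega) t2
      simp only [hE]
      calc |e x t + g x t - h x t| ≤ |e x t| + |g x t| + |h x t| :=
            (abs_sub _ _).trans (add_le_add_left (abs_add_le _ _) _)
        _ ≤ _ := by linarith) hi hj
  have hnp : (1 : ℝ) ≤ n x := by exact_mod_cast (by omega : 1 ≤ n x)
  have a2 : (R x + B + 2 * K x) ^ 2 ≤ 3 * (R x ^ 2 + B ^ 2 + 4 * (n x * (K x * K x))) := by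
    have : K x * K x ≤ n x * (K x * K x) := le_mul_of_one_le_left (mul_self_nonneg _) hnp
    nlinarith [sq_nonneg (R x - B), sq_nonneg (R x - 2 * K x), sq_nonneg (B - 2 * K x)]
  have hmM : ((c x).m : ℝ) ≤ M := by exact_mod_cast hm
  have cr : ∀ i ≤ p, ∀ j ≤ p, |lagProd p (n x) E (h x) i j|
      ≤ (T + 2 * M) * (Q x * K x) + 2 * (D x * K x) := by
    intro i hi j hj
    rw [hE, lagProd_add_left]
    refine (abs_add_le _ _).trans (add_le_add ?_ ?_)
    · rw [hhx]
      refine (q.abs_lagProd_fitFn_le hT (c x) u w hu hw hi hj).trans ?_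
      have : (T + 2 * (c x).m : ℝ) * K x * Q x ≤ (T + 2 * M) * K x * Q x :=
        mul_le_mul_of_nonneg_right (mul_le_mul_of_nonneg_right (by linarith) hK0) q.nonneg
      refine this.trans (le_of_eq (by ring))
    · rw [lagProd_comm]
      refine (abs_lagProd_le_sum hhb hj hi).trans (le_of_eq ?_)
      simp only [hD]; ring
  have hh2 : |lagProd p (n x) (h x) (h x) i j| ≤ 4 * (n x * (K x * K x)) := by
    refine (abs_lagProd_le_sum hhb hi hj).trans ?_
    have : ∑ t ∈ Finset.Icc 1 (n x), |h x t| ≤ n x * (2 * K x) := by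
      refine (Finset.sum_le_card_nsmul _ _ (2 * K x) fun t ht => ?_).trans ?_
      · exact hhb t (Finset.mem_Icc.1 ht).1 (Finset.mem_Icc.1 ht).2
      · rw [Nat.card_Icc, Nat.add_sub_cancel, nsmul_eq_mul]
    have := mul_le_mul_of_nonneg_left this (show 0 ≤ 2 * K x by linarith)
    linarith
  have c1 := cr i hi j hj
  have c2 := cr j hj i hi
  rw [lagProd_comm] at c2
  rw [lagProd_sub_sub] at a1
  have a3 := mul_le_mul_of_nonneg_left a2 (show (0 : ℝ) ≤ 2 * p by positivity)
  rw [abs_le] at *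
  constructor <;> linarith [a1.1, a1.2, c1.1, c1.2, c2.1, c2.2, hh2.1, hh2.2]

/-- Dropping the misfit costs o(√(n log n)), much more than the o(log n) of `Ref.acov`. It suffices
for the rate of the Yule-Walker estimator, but sums of squares are later compared with the misfit
kept in place. -/
lemma Ref.lagProd_sub (ref : Ref L p T M B n e g X c s μ) {i j : ℕ} (hi : i ≤ p) (hj : j ≤ p) :
    (fun x => lagProd p (n x) (fun t => e x t + g x t) (fun t => e x t + g x t) i j
      - lagProd p (n x) (e x) (e x) i j) =o[L] fun x => scA (n x) := by
  obtain ⟨Q, hQ, hQb⟩ := ref.cross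
  refine littleO_of_abs_le ((hQ.const_mul_left 2).add (ref.close.const_mul_left B)) ?_
  filter_upwards [hQb, ref.bdd] with x q hB
  have c1 := q i hi j hj
  have c2 := q j hj i hi
  rw [lagProd_comm] at c2
  have c3 := abs_lagProd_le_sum (g := g x) hB hi hj
  rw [lagProd_add_left, lagProd_add_right, lagProd_add_right]
  rw [abs_le] at *
  constructor <;> linarith [c1.1, c1.2, c2.1, c2.2, c3.1, c3.2]

lemma Ref.acov_sub (reg : Regular L p T φ₀ σsq Γ n e) (ref : Ref L p T M B n e g X c s μ)
    (hT : 0 < T) {i j : ℕ} (hi : i ≤ p) (hj : j ≤ p) :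
    (fun x => n x * sampleAcov T (n x) (c x) (X x) ((i : ℤ) - j).natAbs
      - lagProd p (n x) (e x) (e x) i j) =o[L] fun x => scA (n x) := by
  have := ((ref.acov reg hT hi hj).trans (log_o_scA reg.n_tendsto)).add (ref.lagProd_sub hi hj)
  refine this.congr_left fun x => ?_
  ring

lemma Ref.acovMat_tendsto (reg : Regular L p T φ₀ σsq Γ n e) (ref : Ref L p T M B n e g X c s μ)
    (hT : 0 < T) : Tendsto (fun x => acovMat p T (n x) (c x) (X x)) L (𝓝 Γ) := by
  refine tendsto_pi_nhds.2 fun i => tendsto_pi_nhds.2 fun j => ?_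
  have h1 := tendsto_div_n_of_o ((ref.acov_sub reg hT (Nat.lt_succ_iff.1 i.2)
    (Nat.lt_succ_iff.1 j.2)).trans (scA_o_n reg.n_tendsto))
  have h2 := h1.add (reg.gram i j)
  rw [zero_add] at h2
  refine h2.congr' ?_
  filter_upwards [reg.n_tendsto.eventually_gt_atTop 0] with x hx
  have : (n x : ℝ) ≠ 0 := by positivity
  rw [← add_div, sub_add_cancel, mul_div_assoc, mul_div_cancel₀ _ this]
  rfl

lemma Regular.det_ne_zero (reg : Regular L p T φ₀ σsq Γ n e) :
    (Γ.submatrix Fin.succ Fin.succ).det ≠ 0 := by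
  obtain ⟨γ, hγ, h⟩ := reg.posDef
  exact submatrix_det_ne_zero hγ h

/-- The rate of the Yule-Walker estimator. -/
lemma Ref.yuleWalker_sub (reg : Regular L p T φ₀ σsq Γ n e) (ref : Ref L p T M B n e g X c s μ)
    (hT : 0 < T) (i : Fin p) :
    (fun x => yuleWalker p T (n x) (c x) (X x) i - φ₀ i) =o[L] fun x => scB (n x) := by
  simp only [yuleWalker_eq]
  refine ywSol_sub_isLittleO (ref.acovMat_tendsto reg hT) reg.det_ne_zero (fun i => ?_) i
  have h1 : (fun x => ∑ j : Fin (p + 1), arVec φ₀ j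
      * (n x * sampleAcov T (n x) (c x) (X x) (((i : ℕ) + 1 : ℕ) - (j : ℕ) : ℤ).natAbs))
      =o[L] fun x => scA (n x) := by
    have h2 : (fun x => ∑ j : Fin (p + 1), arVec φ₀ j
        * (n x * sampleAcov T (n x) (c x) (X x) (((i : ℕ) + 1 : ℕ) - (j : ℕ) : ℤ).natAbs
          - lagProd p (n x) (e x) (e x) ((i : ℕ) + 1) j)) =o[L] fun x => scA (n x) :=
      isLittleO_fun_sum fun j _ => (ref.acov_sub reg hT (by have := i.2; omega)
        (Nat.lt_succ_iff.1 j.2)).const_mul_left _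
    refine (h2.add (reg.orth i)).congr_left fun x => ?_
    rw [← Finset.sum_add_distrib]
    exact Finset.sum_congr rfl fun j _ => by ring
  refine (div_n_o_scB h1 reg.n_tendsto).congr' ?_ EventuallyEq.rfl
  filter_upwards [reg.n_tendsto.eventually_gt_atTop 0] with x hx
  have : (n x : ℝ) ≠ 0 := by positivity
  rw [Finset.mul_sum]
  refine Finset.sum_congr rfl fun j _ => ?_
  simp only [acovMat, Matrix.of_apply, Fin.val_succ]
  field_simp

lemma Ref.yuleWalker_tendsto (reg : Regular L p T φ₀ σsq Γ n e)
    (ref : Ref L p T M B n e g X c s μ) (hT : 0 < T) :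
    Tendsto (fun x => yuleWalker p T (n x) (c x) (X x)) L (𝓝 φ₀) := by
  refine tendsto_pi_nhds.2 fun i => ?_
  have := ((ref.yuleWalker_sub reg hT i).trans (scB_o_one reg.n_tendsto))
  have h := (isLittleO_one_iff ℝ).1 this
  simpa using h.add_const (φ₀ i)

lemma continuous_arVec : Continuous (arVec : (Fin p → ℝ) → Fin (p + 1) → ℝ) := by
  refine continuous_pi fun i => ?_
  refine Fin.cases ?_ (fun j => ?_) i
  · exact continuous_const
  · exact (continuous_apply j).neg

lemma arVec_isBigO_one {φ : ι → Fin p → ℝ} {ψ : Fin p → ℝ} (h : Tendsto φ L (𝓝 ψ))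
    (i : Fin (p + 1)) : (fun x => arVec (φ x) i) =O[L] fun _ => (1 : ℝ) :=
  (tendsto_pi_nhds.1 ((continuous_arVec.tendsto ψ).comp h) i).isBigO_one ℝ

/-- The Yule-Walker equations hold approximately for the noise plus misfit. -/
lemma Ref.normal (reg : Regular L p T φ₀ σsq Γ n e) (ref : Ref L p T M B n e g X c s μ)
    (hT : 0 < T) (i : Fin p) :
    (fun x => ∑ j : Fin (p + 1), arVec (yuleWalker p T (n x) (c x) (X x)) j
      * lagProd p (n x) (fun t => e x t + g x t) (fun t => e x t + g x t) ((i : ℕ) + 1) j)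
      =o[L] fun x => Real.log (n x) := by
  have h1 : (fun x => ∑ j : Fin (p + 1), arVec (yuleWalker p T (n x) (c x) (X x)) j
      * (n x * sampleAcov T (n x) (c x) (X x) (((i : ℕ) + 1 : ℕ) - (j : ℕ) : ℤ).natAbs
        - lagProd p (n x) (fun t => e x t + g x t) (fun t => e x t + g x t) ((i : ℕ) + 1) j))
      =o[L] fun x => Real.log (n x) := by
    refine isLittleO_fun_sum fun j _ => ?_
    have := (arVec_isBigO_one (ref.yuleWalker_tendsto reg hT) j).mul_isLittleO
      (ref.acov reg hT (i := (i : ℕ) + 1) (by have := i.2; omega) (Nat.lt_succ_iff.1 j.2))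
    simpa using this
  refine h1.neg_left.congr' ?_ EventuallyEq.rfl
  -- The estimator solves its own equations exactly once the sample matrix is invertible, which it
  -- eventually is because its limit is.
  filter_upwards [(tendsto_submatrix_inv (ref.acovMat_tendsto reg hT) reg.det_ne_zero).2] with x hx
  have h2 := ywSol_normal hx i
  rw [← yuleWalker_eq] at h2
  have h3 : ∑ j : Fin (p + 1), arVec (yuleWalker p T (n x) (c x) (X x)) j
      * (n x * sampleAcov T (n x) (c x) (X x) (((i : ℕ) + 1 : ℕ) - (j : ℕ) : ℤ).natAbs) = 0 := by
    rw [← mul_zero (n x : ℝ), ← h2, Finset.mul_sum]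
    refine Finset.sum_congr rfl fun j _ => ?_
    simp only [acovMat, Matrix.of_apply, Fin.val_succ]
    ring
  simp only [mul_sub, Finset.sum_sub_distrib]
  rw [h3]; ring

end RefSection

/-! ### Generalized least squares around a reference mean function -/

/-- The autoregressive filter with coefficients `φ` is boundedly invertible on seasonal
functions. -/
def SeasonStable {p : ℕ} (T : ℕ) (φ : Fin p → ℝ) (Ψ : ℝ) : Prop :=
  ∀ (s : Fin T → ℝ) (Y : ℝ), (∀ t, p + 1 ≤ t → |arFilter φ (seasonFn s) t| ≤ Y) → ∀ v, |s v| ≤ Ψ * Y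

lemma abs_seasonFn_le_norm {T : ℕ} (hT : 0 < T) (s : Fin T → ℝ) {t : ℕ} (ht : 1 ≤ t) :
    |seasonFn s t| ≤ ‖s‖ := by
  rw [seasonFn_eq hT s ht]; exact norm_le_pi_norm s _

lemma abs_arFilter_sub_arFilter_le {p : ℕ} (φ φ' : Fin p → ℝ) {F : ℕ → ℝ} {B : ℝ} {t : ℕ}
    (h : ∀ j, 1 ≤ j → j ≤ p → |F (t - j)| ≤ B) :
    |arFilter φ F t - arFilter φ' F t| ≤ (∑ j, |φ j - φ' j|) * B := by
  have e : arFilter φ F t - arFilter φ' F t = -∑ j : Fin p, (φ j - φ' j) * F (t - ((j : ℕ) + 1)) := by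
    simp only [arFilter, sub_mul, Finset.sum_sub_distrib]; ring
  rw [e, abs_neg, Finset.sum_mul]
  refine (Finset.abs_sum_le_sum_abs _ _).trans (Finset.sum_le_sum fun j _ => ?_)
  rw [abs_mul]
  exact mul_le_mul_of_nonneg_left (h _ (by omega) (by have := j.2; omega)) (abs_nonneg _)

/-- Changing the filter changes its output by at most half of what stability controls, and this half
is absorbed on the left; hence the factor 2. -/
lemma SeasonStable.perturb {p T : ℕ} (hT : 0 < T) {φ₀ φ : Fin p → ℝ} {Ψ : ℝ} (hΨ : 0 < Ψ)
    (h : SeasonStable T φ₀ Ψ) (hφ : Ψ * ∑ j, |φ j - φ₀ j| ≤ 1 / 2) :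
    SeasonStable T φ (2 * Ψ) := by
  intro s Y hY v
  have hY0 : 0 ≤ Y := (abs_nonneg _).trans (hY (p + 1) le_rfl)
  have h1 := h s (Y + (∑ j, |φ j - φ₀ j|) * ‖s‖) fun t ht => by
    have h2 := abs_arFilter_sub_arFilter_le φ φ₀ (F := seasonFn s) (B := ‖s‖) (t := t)
      fun j _ hj => abs_seasonFn_le_norm hT s (by omega)
    have h3 := hY t ht
    rw [abs_le] at *
    constructor <;> linarith
  have h4 : ‖s‖ ≤ Ψ * (Y + (∑ j, |φ j - φ₀ j|) * ‖s‖) :=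
    (pi_norm_le_iff_of_nonneg (mul_nonneg hΨ.le (add_nonneg hY0 (mul_nonneg
      (Finset.sum_nonneg fun _ _ => abs_nonneg _) (norm_nonneg _))))).2 h1
  have h5 := mul_le_mul_of_nonneg_right hφ (norm_nonneg s)
  exact (norm_le_pi_norm s v).trans (by nlinarith)

/-- The sum of squares bounds the filtered seasonal part at every time, and stability inverts the
filter there; regime means are recovered through division by `arOne φ`. -/
lemma Spaced.coef_sq_le_arFilter {p T : ℕ} (hT : 0 < T) {c : Config} {N k : ℕ}
    (h : Spaced c N (p + k * T)) {φ : Fin p → ℝ} {Ψ q : ℝ} (hΨ : 0 < Ψ)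
    (hst : SeasonStable T φ Ψ) (hq : 0 < q) (h1 : q ≤ |arOne φ|) (u : Fin T → ℝ)
    (w : Fin c.m → ℝ) :
    k * max ‖u‖ ‖w‖ ^ 2
      ≤ (Ψ ^ 2 + 4 / q ^ 2) * ∑ t ∈ win p N, arFilter φ (fitFn c N u w) t ^ 2 := by
  set S := ∑ t ∈ win p N, arFilter φ (fitFn c N u w) t ^ 2
  have hS : 0 ≤ S := Finset.sum_nonneg fun _ _ => sq_nonneg _
  rcases Nat.eq_zero_or_pos k with rfl | hk
  · simp only [Nat.cast_zero, zero_mul]; positivity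
  have hk' : (0 : ℝ) < k := by exact_mod_cast hk
  have hu : ∀ v, |u v| ≤ Ψ * √(S / k) := hst u _ fun t ht => by
    refine Real.abs_le_sqrt ?_
    rw [le_div_iff₀ hk', mul_comm]
    exact h.season_sq_le_sum_win hT le_rfl φ u w ht
  have hw : ∀ j, |w j| ≤ 2 / q * √(S / k) := fun j => by
    have h2 := h.mean_sq_le_sum_win hT le_rfl φ u w j
    have h3 : |arOne φ * w j| ≤ 2 * √(S / k) := by
      have : |arOne φ * w j| ≤ √(2 ^ 2 * (S / k)) := by
        refine Real.abs_le_sqrt ?_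
        rw [← mul_div_assoc, le_div_iff₀ hk', mul_comm]
        linarith
      rwa [Real.sqrt_mul (by norm_num), Real.sqrt_sq (by norm_num)] at this
    rw [abs_mul] at h3
    rw [div_mul_eq_mul_div, le_div_iff₀ hq, mul_comm]
    exact (mul_le_mul_of_nonneg_right h1 (abs_nonneg _)).trans h3
  have h4 : max ‖u‖ ‖w‖ ≤ max Ψ (2 / q) * √(S / k) := by
    refine max_le ((pi_norm_le_iff_of_nonneg (by positivity)).2 fun v => (hu v).trans ?_)
      ((pi_norm_le_iff_of_nonneg (by positivity)).2 fun j => (hw j).trans ?_)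
    · exact mul_le_mul_of_nonneg_right (le_max_left _ _) (Real.sqrt_nonneg _)
    · exact mul_le_mul_of_nonneg_right (le_max_right _ _) (Real.sqrt_nonneg _)
  have h5 : max ‖u‖ ‖w‖ ^ 2 ≤ max Ψ (2 / q) ^ 2 * (S / k) := by
    have := pow_le_pow_left₀ (le_max_of_le_left (norm_nonneg _)) h4 2
    rwa [mul_pow, Real.sq_sqrt (by positivity)] at this
  have h6 : max Ψ (2 / q) ^ 2 ≤ Ψ ^ 2 + 4 / q ^ 2 := by
    have e : (2 / q) ^ 2 = 4 / q ^ 2 := by rw [div_pow]; norm_num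
    rcases max_cases Ψ (2 / q) with ⟨h, -⟩ | ⟨h, -⟩ <;> rw [h]
    · have : 0 ≤ 4 / q ^ 2 := by positivity
      linarith
    · rw [e]; nlinarith
  calc k * max ‖u‖ ‖w‖ ^ 2 ≤ k * (max Ψ (2 / q) ^ 2 * (S / k)) :=
        mul_le_mul_of_nonneg_left h5 hk'.le
    _ = max Ψ (2 / q) ^ 2 * S := by field_simp
    _ ≤ _ := mul_le_mul_of_nonneg_right h6 hS

lemma continuous_arOne {p : ℕ} : Continuous (arOne : (Fin p → ℝ) → ℝ) :=
  continuous_const.sub (continuous_finsetSum _ fun j _ => continuous_apply j)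

section GLS

variable {ι : Type*} {L : Filter ι} {p T M : ℕ} {φ₀ : Fin p → ℝ} {σsq : ℝ}
  {Γ : Matrix (Fin (p + 1)) (Fin (p + 1)) ℝ} {n : ι → ℕ} {e g X : ι → ℕ → ℝ} {B ν Ψ : ℝ}
  {c : ι → Config} {s : ι → Fin T → ℝ} {μ : ∀ x, Fin (c x).m → ℝ} {φ : ι → Fin p → ℝ}

/-- Uniform identifiability of the coefficients of a filtered mean function. -/
lemma WellSpaced.coef_sq_le (hT : 0 < T) (hc : WellSpaced L p T n c) (hΨ : 0 < Ψ)
    (hst : SeasonStable T φ₀ Ψ) (h1 : arOne φ₀ ≠ 0) (hφ : Tendsto φ L (𝓝 φ₀)) :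
    ∃ κ > 0, ∀ᶠ x in L, ∀ (u : Fin T → ℝ) (w : Fin (c x).m → ℝ),
      κ * n x * max ‖u‖ ‖w‖ ^ 2
        ≤ ∑ t ∈ win p (n x), arFilter (φ x) (fitFn (c x) (n x) u w) t ^ 2 := by
  obtain ⟨κ, hκ, hs⟩ := hc
  set q := |arOne φ₀| / 2 with hq
  have hq0 : 0 < q := by have := abs_pos.2 h1; positivity
  set C := (2 * Ψ) ^ 2 + 4 / q ^ 2 with hC
  have hC0 : 0 < C := by positivity
  have e1 : ∀ᶠ x in L, q ≤ |arOne (φ x)| := by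
    have := ((continuous_arOne.tendsto φ₀).comp hφ).abs
    exact (this.eventually_const_lt (show q < |arOne φ₀| by have := abs_pos.2 h1; linarith)).mono
      fun x hx => hx.le
  have e2 : ∀ᶠ x in L, Ψ * ∑ j, |φ x j - φ₀ j| ≤ 1 / 2 := by
    have : Tendsto (fun x => Ψ * ∑ j, |φ x j - φ₀ j|) L (𝓝 (Ψ * ∑ j : Fin p, |φ₀ j - φ₀ j|)) :=
      (tendsto_finsetSum _ fun j _ =>
        ((tendsto_pi_nhds.1 hφ j).sub_const (φ₀ j)).abs).const_mul Ψ
    simp only [sub_self, abs_zero, Finset.sum_const_zero, mul_zero] at this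
    exact (this.eventually_lt_const (show (0 : ℝ) < 1 / 2 by norm_num)).mono fun x hx => hx.le
  refine ⟨κ / C, by positivity, ?_⟩
  filter_upwards [e1, e2, hs] with x x1 x2 x3 u w
  obtain ⟨k, -, hk, hsp⟩ := x3
  have h2 := hsp.coef_sq_le_arFilter hT (by positivity) (hst.perturb hT hΨ x2) hq0 x1 u w
  have h3 : κ * n x * max ‖u‖ ‖w‖ ^ 2 ≤ k * max ‖u‖ ‖w‖ ^ 2 :=
    mul_le_mul_of_nonneg_right hk (sq_nonneg _)
  rw [div_mul_eq_mul_div, div_mul_eq_mul_div, div_le_iff₀ hC0, mul_comm _ C]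
  exact h3.trans h2

lemma seasonFn_eq_zero_of_coef {N : ℕ} {c : Config} {φ : Fin p → ℝ} {κ : ℝ} (hκ : 0 < κ)
    (h : ∀ (u : Fin T → ℝ) (w : Fin c.m → ℝ),
      κ * max ‖u‖ ‖w‖ ^ 2 ≤ ∑ t ∈ win p N, arFilter φ (fitFn c N u w) t ^ 2)
    (u : Fin T → ℝ) (hu : ∀ t ∈ win p N, arFilter φ (seasonFn u) t = 0) : u = 0 := by
  have e : fitFn c N u 0 = seasonFn u := by
    funext t; simp [fitFn, seasonFn, regimeFn]
  have h1 := h u 0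
  rw [e, Finset.sum_eq_zero fun t ht => by rw [hu t ht]; ring] at h1
  have h2 : max ‖u‖ ‖(0 : Fin c.m → ℝ)‖ ^ 2 ≤ 0 := by
    by_contra hlt
    push Not at hlt
    have := mul_pos hκ hlt
    linarith
  have h3 := pow_eq_zero_iff (two_ne_zero) |>.1 (le_antisymm h2 (sq_nonneg _))
  exact norm_le_zero_iff.1 ((le_max_left _ _).trans h3.le)

lemma arNorm_isBigO_one {φ' : Fin p → ℝ} (hφ : Tendsto φ L (𝓝 φ')) :
    (fun x => arNorm (φ x)) =O[L] fun _ => (1 : ℝ) := by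
  have : Tendsto (fun x => arNorm (φ x)) L (𝓝 (arNorm φ')) :=
    tendsto_finsetSum _ fun i _ =>
      (tendsto_pi_nhds.1 ((continuous_arVec.tendsto φ').comp hφ) i).abs
  exact this.isBigO_one ℝ

/-- The fitted season and regime means under the Yule-Walker estimator. -/
def regimeHat (p : ℕ) (ν : ℝ) (T N : ℕ) (c : Config) (x : ℕ → ℝ) : Fin c.m → ℝ :=
  ridgeMean ν N c (yuleWalker p T N c x) (seasonHat p ν T N c x) x

/-- Both conclusions follow from comparing the criterion at the fitted and at the reference
coefficients. Their difference is quadratic in the coefficient error `K` up to a cross term K o(√(n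
log n)) and a bounded penalty. First this gives the rate of `K`; inserted again, it shows that
fitting the mean changes the residual sum of squares by o(log n) only. -/
lemma Ref.gls (reg : Regular L p T φ₀ σsq Γ n e) (ref : Ref L p T M B n e g X c s μ)
    (hT : 0 < T) (hν : 0 < ν) (hΨ : 0 < Ψ) (hst : SeasonStable T φ₀ Ψ) (h1 : arOne φ₀ ≠ 0) :
    ((fun x => max ‖s x - seasonHat p ν T (n x) (c x) (X x)‖
        ‖μ x - regimeHat p ν T (n x) (c x) (X x)‖) =o[L] fun x => scB (n x)) ∧
      (fun x => ((n x : ℝ) - p) * varHat p ν T (n x) (c x) (X x)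
        - ∑ t ∈ win p (n x),
          arFilter (yuleWalker p T (n x) (c x) (X x)) (fun t => e x t + g x t) t ^ 2)
        =o[L] fun x => Real.log (n x) := by
  have hn := reg.n_tendsto
  have hφ := ref.yuleWalker_tendsto reg hT
  obtain ⟨κ, hκ, hk⟩ := ref.spaced.coef_sq_le hT hΨ hst h1 hφ
  set φ : ι → Fin p → ℝ := fun x => yuleWalker p T (n x) (c x) (X x) with hφd
  set sh : ι → Fin T → ℝ := fun x => seasonHat p ν T (n x) (c x) (X x) with hsh
  set mh : ∀ x, Fin (c x).m → ℝ := fun x => regimeHat p ν T (n x) (c x) (X x) with hmh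
  set K : ι → ℝ := fun x => max ‖s x - sh x‖ ‖μ x - mh x‖ with hK
  obtain ⟨Q, hQ, hQb⟩ := reg.noise
  set D : ι → ℝ := fun x => ∑ t ∈ Finset.Icc 1 (n x), |g x t| with hD
  set A : ι → ℝ := fun x => arNorm (φ x) * (arNorm (φ x) * ((T + 2 * M) * Q x + 2 * D x)) with hA
  have hAo : A =o[L] fun x => scA (n x) := by
    have h2 : (fun x => (T + 2 * M) * Q x + 2 * D x) =o[L] fun x => scA (n x) :=
      (hQ.const_mul_left _).add (ref.close.const_mul_left 2)
    have h3 := (arNorm_isBigO_one hφ).mul_isLittleO ((arNorm_isBigO_one hφ).mul_isLittleO h2)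
    simpa only [one_mul] using h3
  obtain ⟨κ', hκ', hsp⟩ := ref.spaced
  set C : ℝ := ν⁻¹ * (M * B ^ 2) with hC
  have hK0 : ∀ x, 0 ≤ K x := fun x => le_max_of_le_left (norm_nonneg _)
  set S : ι → ℝ := fun x =>
    ∑ t ∈ win p (n x), arFilter (φ x) (fitFn (c x) (n x) (s x - sh x) (μ x - mh x)) t ^ 2 with hS
  set E : ι → ℕ → ℝ := fun x t => e x t + g x t with hE
  have key : ∀ᶠ x in L, S x ≤ K x * A x + C ∧
      |((n x : ℝ) - p) * varHat p ν T (n x) (c x) (X x) - ∑ t ∈ win p (n x), arFilter (φ x) (E x) t ^ 2|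
        ≤ 2 * (A x * K x) + 2 * C := by
    filter_upwards [hk, hQb, hsp, ref.m_le, ref.mean_bdd, hn.eventually_gt_atTop p]
      with x hk q sp hm hμ hp
    obtain ⟨k, -, -, hspc⟩ := sp
    have hn0 : (0 : ℝ) < n x := by exact_mod_cast (by omega : 0 < n x)
    have hinj := seasonFn_eq_zero_of_coef (mul_pos hκ hn0) hk
    -- The criterion at the reference coefficients is computed twice: by the exact excess over the
    -- minimum (`c1`) and directly from the data (`d1`). The direct expansion at the fitted
    -- coefficients (`d2`) provides the reverse inequality.
    have c1 := crit_eq_add hν hp (c x) (φ x) (X x) hinj (s x) (μ x)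
    have c2 := varEst_mul_eq (T := T) hν hp (c x) (φ x) (X x)
    have d1 : crit ν (n x) (c x) (φ x) (X x) (s x) (μ x)
        = ∑ t ∈ win p (n x), arFilter (φ x) (E x) t ^ 2 + ν⁻¹ * ∑ k, μ x k ^ 2 := by
      unfold crit
      congr 1
      refine Finset.sum_congr rfl fun t _ => ?_
      congr 2
      funext t
      rw [ref.data]; ring
    have d2 : crit ν (n x) (c x) (φ x) (X x) (sh x) (mh x)
        = ∑ t ∈ win p (n x), arFilter (φ x) (E x) t ^ 2
          + 2 * ∑ t ∈ win p (n x), arFilter (φ x) (E x) t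
              * arFilter (φ x) (fitFn (c x) (n x) (s x - sh x) (μ x - mh x)) t
          + S x + ν⁻¹ * ∑ k, mh x k ^ 2 := by
      unfold crit
      congr 1
      simp only [hS]
      rw [Finset.mul_sum, ← Finset.sum_add_distrib, ← Finset.sum_add_distrib]
      refine Finset.sum_congr rfl fun t _ => ?_
      have : (fun t => X x t - fitFn (c x) (n x) (sh x) (mh x) t)
          = fun t => E x t + fitFn (c x) (n x) (s x - sh x) (μ x - mh x) t := by
        funext t
        rw [ref.data, fitFn_sub]; ring
      rw [this, arFilter_add]; ring
    have e1 : seasonEst ν T (n x) (c x) (φ x) (X x) = sh x := rfl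
    have e2 : ridgeMean ν (n x) (c x) (φ x) (sh x) (X x) = mh x := rfl
    have e3 : varEst ν T (n x) (c x) (φ x) (X x) = varHat p ν T (n x) (c x) (X x) := rfl
    rw [e1, e2, e3] at c1
    rw [e1, e2, e3] at c2
    have e4 : ∑ t ∈ win p (n x), arFilter (φ x) (fitFn (c x) (n x) (s x - sh x) (μ x - mh x)) t ^ 2
        = S x := rfl
    rw [e4] at c1
    obtain ⟨hu, hw⟩ := abs_apply_le_max (s x - sh x) (μ x - mh x)
    have hmM : ((c x).m : ℝ) ≤ M := by exact_mod_cast hm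
    have cross := abs_sum_arFilter_mul_le (N := n x) (φ x) (φ x) (f := E x)
      (g := fitFn (c x) (n x) (s x - sh x) (μ x - mh x))
      (B := ((T + 2 * M) * Q x + 2 * D x) * K x) fun i hi j hj => by
        rw [hE, lagProd_add_left]
        refine (abs_add_le _ _).trans ?_
        have b1 := q.abs_lagProd_fitFn_le hT (c x) _ _ hu hw hi hj
        have b2 := abs_lagProd_le_sum (g := g x)
          (fun t t1 t2 => hspc.abs_fitFn_le hT _ _ (hK0 x) hu hw t1 t2) hj hi
        rw [lagProd_comm] at b2
        have b3 : (T + 2 * (c x).m : ℝ) * K x * Q x ≤ (T + 2 * M) * K x * Q x :=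
          mul_le_mul_of_nonneg_right (mul_le_mul_of_nonneg_right (by linarith) (hK0 x)) q.nonneg
        have b4 : 2 * K x * ∑ t ∈ Finset.Icc 1 (n x), |g x t| = 2 * D x * K x := by
          simp only [hD]; ring
        have b5 : |lagProd p (n x) (e x) (fitFn (c x) (n x) (s x - sh x) (μ x - mh x)) i j|
          ≤ (T + 2 * (c x).m) * K x * Q x := b1
        have b6 : |lagProd p (n x) (g x) (fitFn (c x) (n x) (s x - sh x) (μ x - mh x)) i j|
          ≤ 2 * K x * ∑ t ∈ Finset.Icc 1 (n x), |g x t| := b2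
        linarith
    have hcr : |∑ t ∈ win p (n x), arFilter (φ x) (E x) t
              * arFilter (φ x) (fitFn (c x) (n x) (s x - sh x) (μ x - mh x)) t| ≤ A x * K x :=
      cross.trans (le_of_eq (by simp only [hA]; ring))
    have hμ2 : ν⁻¹ * ∑ k, μ x k ^ 2 ≤ C := by
      refine mul_le_mul_of_nonneg_left ?_ (inv_nonneg.2 hν.le)
      refine (Finset.sum_le_card_nsmul _ _ (B ^ 2) fun k _ => ?_).trans ?_
      · have := hμ k
        rw [← sq_abs]
        exact pow_le_pow_left₀ (abs_nonneg _) this 2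
      · rw [Finset.card_univ, Fintype.card_fin, nsmul_eq_mul]
        exact mul_le_mul_of_nonneg_right hmM (sq_nonneg _)
    have p1 : 0 ≤ ν⁻¹ * ∑ k, (μ x k - mh x k) ^ 2 :=
      mul_nonneg (inv_nonneg.2 hν.le) (Finset.sum_nonneg fun _ _ => sq_nonneg _)
    have p2 : 0 ≤ ν⁻¹ * ∑ k, mh x k ^ 2 :=
      mul_nonneg (inv_nonneg.2 hν.le) (Finset.sum_nonneg fun _ _ => sq_nonneg _)
    have p3 : 0 ≤ ν⁻¹ * ∑ k, μ x k ^ 2 :=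
      mul_nonneg (inv_nonneg.2 hν.le) (Finset.sum_nonneg fun _ _ => sq_nonneg _)
    have p4 : 0 ≤ S x := Finset.sum_nonneg fun _ _ => sq_nonneg _
    have p5 : K x * A x = A x * K x := mul_comm _ _
    rw [abs_le] at hcr
    refine ⟨by linarith [hcr.1], ?_⟩
    rw [abs_le]
    constructor <;> linarith [hcr.1]
  have hCo := const_o_log hn C
  have hKo : K =o[L] fun x => scB (n x) := by
    refine o_scB_of_quad hκ hn hAo hCo (Eventually.of_forall hK0) ?_
    filter_upwards [key, hk] with x k1 k2
    exact (k2 (s x - sh x) (μ x - mh x)).trans k1.1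
  refine ⟨hKo, ?_⟩
  refine littleO_of_abs_le (((mul_o_log hAo hKo).const_mul_left 2).add (hCo.const_mul_left 2)) ?_
  exact key.mono fun x hx => hx.2

/-- A difference of two values of a symmetric quadratic form is the product of the difference and
the sum of the arguments. The leading coefficients are both 1 and cancel, so only the defects in the
Yule-Walker equations occur. When both defects are small, the sums of squares agree to second order.
-/
lemma sum_sq_arFilter_sub (N : ℕ) (φ φ' : Fin p → ℝ) (f : ℕ → ℝ) :
    ∑ t ∈ win p N, arFilter φ f t ^ 2 - ∑ t ∈ win p N, arFilter φ' f t ^ 2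
      = ∑ i : Fin p, -(φ i - φ' i) * (∑ j, arVec φ j * lagProd p N f f ((i : ℕ) + 1) j
          + ∑ j, arVec φ' j * lagProd p N f f ((i : ℕ) + 1) j) := by
  have h1 : ∑ t ∈ win p N, arFilter φ f t ^ 2 - ∑ t ∈ win p N, arFilter φ' f t ^ 2
      = ∑ i : Fin (p + 1), (arVec φ i - arVec φ' i)
        * (∑ j, arVec φ j * lagProd p N f f i j + ∑ j, arVec φ' j * lagProd p N f f i j) := by
    have hs : ∑ i : Fin (p + 1), ∑ j : Fin (p + 1), arVec φ' i * arVec φ j * lagProd p N f f i j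
        = ∑ i : Fin (p + 1), ∑ j : Fin (p + 1), arVec φ i * arVec φ' j * lagProd p N f f i j := by
      rw [Finset.sum_comm]
      refine Finset.sum_congr rfl fun i _ => Finset.sum_congr rfl fun j _ => ?_
      rw [lagProd_comm]; ring
    have e : ∑ i : Fin (p + 1), (arVec φ i - arVec φ' i)
        * (∑ j, arVec φ j * lagProd p N f f i j + ∑ j, arVec φ' j * lagProd p N f f i j)
        = ∑ i : Fin (p + 1), ∑ j : Fin (p + 1), arVec φ i * arVec φ j * lagProd p N f f i j
          + ∑ i : Fin (p + 1), ∑ j : Fin (p + 1), arVec φ i * arVec φ' j * lagProd p N f f i j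
          - ∑ i : Fin (p + 1), ∑ j : Fin (p + 1), arVec φ' i * arVec φ j * lagProd p N f f i j
          - ∑ i : Fin (p + 1), ∑ j : Fin (p + 1), arVec φ' i * arVec φ' j * lagProd p N f f i j := by
      simp only [← Finset.sum_add_distrib, ← Finset.sum_sub_distrib, Finset.mul_sum]
      refine Finset.sum_congr rfl fun i _ => ?_
      refine Finset.sum_congr rfl fun j _ => ?_
      ring
    rw [e, hs, sum_arFilter_sq, sum_arFilter_sq]; ring
  rw [h1, Fin.sum_univ_succ]
  simp only [arVec_zero, sub_self, zero_mul, zero_add, arVec_succ, Fin.val_succ]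
  exact Finset.sum_congr rfl fun i _ => by ring

lemma sum_sq_arFilter_sub_isLittleO {φ' : ι → Fin p → ℝ} {E : ι → ℕ → ℝ}
    (hθ : ∀ i, (fun x => φ x i - φ' x i) =o[L] fun x => scB (n x))
    (h : ∀ i : Fin p, (fun x => ∑ j, arVec (φ x) j * lagProd p (n x) (E x) (E x) ((i : ℕ) + 1) j)
      =o[L] fun x => scA (n x))
    (h' : ∀ i : Fin p, (fun x => ∑ j, arVec (φ' x) j
      * lagProd p (n x) (E x) (E x) ((i : ℕ) + 1) j) =o[L] fun x => scA (n x)) :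
    (fun x => ∑ t ∈ win p (n x), arFilter (φ x) (E x) t ^ 2
      - ∑ t ∈ win p (n x), arFilter (φ' x) (E x) t ^ 2) =o[L] fun x => Real.log (n x) := by
  simp only [sum_sq_arFilter_sub]
  refine isLittleO_fun_sum fun i _ => ?_
  have := mul_o_log ((h i).add (h' i)) (hθ i).neg_left
  exact this.congr_left fun x => mul_comm _ _

/-- The residual sum of squares around a reference without misfit. -/
lemma Ref.ssr_sub_innov (reg : Regular L p T φ₀ σsq Γ n e)
    (ref : Ref L p T M B n e (fun _ _ => 0) X c s μ)
    (hT : 0 < T) (hν : 0 < ν) (hΨ : 0 < Ψ) (hst : SeasonStable T φ₀ Ψ) (h1 : arOne φ₀ ≠ 0) :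
    (fun x => ((n x : ℝ) - p) * varHat p ν T (n x) (c x) (X x)
        - ∑ t ∈ win p (n x), arFilter φ₀ (e x) t ^ 2) =o[L] fun x => Real.log (n x) := by
  have h2 := (ref.gls reg hT hν hΨ hst h1).2
  have h4 : ∀ i : Fin p, _ := fun i => (ref.normal reg hT i).trans (log_o_scA reg.n_tendsto)
  simp only [add_zero] at h2 h4
  have h3 := sum_sq_arFilter_sub_isLittleO (φ := fun x => yuleWalker p T (n x) (c x) (X x))
    (φ' := fun _ => φ₀) (E := e) (ref.yuleWalker_sub reg hT) h4 reg.orth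
  exact (h2.add h3).congr_left fun x => by ring

lemma lagProd_congr {N : ℕ} {f f' : ℕ → ℝ} (h : ∀ t, 1 ≤ t → t ≤ N → f t = f' t) {i j : ℕ}
    (hi : i ≤ p) (hj : j ≤ p) : lagProd p N f f i j = lagProd p N f' f' i j := by
  refine Finset.sum_congr rfl fun t ht => ?_
  obtain ⟨h1, h2⟩ := mem_win.1 ht
  rw [h _ (by omega) (by omega), h _ (by omega) (by omega)]

/-- Two references with the same misfit have nearly the same residual sum of squares. -/
lemma Ref.ssr_sub (reg : Regular L p T φ₀ σsq Γ n e) (ref : Ref L p T M B n e g X c s μ)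
    {M' : ℕ} {B' : ℝ} {g' : ι → ℕ → ℝ} {c' : ι → Config} {s' : ι → Fin T → ℝ}
    {μ' : ∀ x, Fin (c' x).m → ℝ} (ref' : Ref L p T M' B' n e g' X c' s' μ')
    (hg : ∀ᶠ x in L, ∀ t, 1 ≤ t → t ≤ n x → g x t = g' x t)
    (hT : 0 < T) (hν : 0 < ν) (hΨ : 0 < Ψ) (hst : SeasonStable T φ₀ Ψ) (h1 : arOne φ₀ ≠ 0) :
    (fun x => ((n x : ℝ) - p) * varHat p ν T (n x) (c x) (X x)
        - ((n x : ℝ) - p) * varHat p ν T (n x) (c' x) (X x)) =o[L] fun x => Real.log (n x) := by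
  have h2 := (ref.gls reg hT hν hΨ hst h1).2
  have h2' := (ref'.gls reg hT hν hΨ hst h1).2
  -- The two misfits agree only at the times 1, ..., n, so the comparison is made for lagged
  -- products rather than for the functions.
  have hlag : ∀ᶠ x in L, ∀ i ≤ p, ∀ j ≤ p,
      lagProd p (n x) (fun t => e x t + g x t) (fun t => e x t + g x t) i j
        = lagProd p (n x) (fun t => e x t + g' x t) (fun t => e x t + g' x t) i j :=
    hg.mono fun x hx i hi j hj => lagProd_congr (fun t t1 t2 => by rw [hx t t1 t2]) hi hj
  have h3 := sum_sq_arFilter_sub_isLittleO (φ := fun x => yuleWalker p T (n x) (c x) (X x))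
    (φ' := fun x => yuleWalker p T (n x) (c' x) (X x)) (E := fun x t => e x t + g x t)
    (L := L) (n := n)
    (fun i => ((ref.yuleWalker_sub reg hT i).sub (ref'.yuleWalker_sub reg hT i)).congr_left
      fun x => by ring)
    (fun i => (ref.normal reg hT i).trans (log_o_scA reg.n_tendsto))
    (fun i => ((ref'.normal reg hT i).trans (log_o_scA reg.n_tendsto)).congr'
      (hlag.mono fun x hx => Finset.sum_congr rfl fun j _ => by
        rw [hx _ (by have := i.2; omega) _ (Nat.lt_succ_iff.1 j.2)]) EventuallyEq.rfl)
  have h4 : (fun x => ∑ t ∈ win p (n x),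
        arFilter (yuleWalker p T (n x) (c' x) (X x)) (fun t => e x t + g x t) t ^ 2
      - ∑ t ∈ win p (n x), arFilter (yuleWalker p T (n x) (c' x) (X x))
          (fun t => e x t + g' x t) t ^ 2) =o[L] fun x => Real.log (n x) := by
    refine (isLittleO_zero _ L).congr' ?_ EventuallyEq.rfl
    filter_upwards [hlag] with x hx
    rw [sum_arFilter_sq, sum_arFilter_sq, eq_comm, sub_eq_zero]
    refine Finset.sum_congr rfl fun i _ => Finset.sum_congr rfl fun j _ => ?_
    rw [hx _ (Nat.lt_succ_iff.1 i.2) _ (Nat.lt_succ_iff.1 j.2)]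
  exact (((h2.add h3).add h4).sub h2').congr_left fun x => by ring

end GLS

/-! ### Toeplitz matrices and the Yule-Walker equations -/

/-- For a positive definite Toeplitz matrix, the Yule-Walker filter does not annihilate
constants. -/
lemma arOne_ywSol_ne_zero {p : ℕ} {V : Matrix (Fin (p + 1)) (Fin (p + 1)) ℝ} {γ : ℝ} (hγ : 0 < γ)
    (hV : ∀ β : Fin (p + 1) → ℝ, γ * ∑ i, β i ^ 2 ≤ ∑ i, ∑ j, β i * β j * V i j)
    (hsymm : ∀ i j, V i j = V j i)
    (htoep : ∀ i j : Fin p, V i.succ j.succ = V i.castSucc j.castSucc) :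
    arOne (ywSol V) ≠ 0 := by
  intro h0
  set α := arVec (ywSol V) with hα
  have hnorm : ∀ i : Fin p, ∑ j, α j * V i.succ j = 0 := ywSol_normal (submatrix_det_ne_zero hγ hV)
  have hsum : ∑ i, α i = 0 := by rw [hα, sum_arVec, h0]
  -- If the filter polynomial vanished at 1, it would be 1 - z times a polynomial whose coefficients
  -- are the partial sums `b`, and `b'` is `b` shifted by one place. Both have the same quadratic
  -- form, the matrix being Toeplitz. As `b'` has first entry 0, it is orthogonal to α by the
  -- Yule-Walker equations. So b = α + b' is a Pythagorean decomposition, and the form at α would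
  -- vanish.
  set b : Fin (p + 1) → ℝ := fun i => ∑ j, if j ≤ i then α j else 0 with hb
  set b' : Fin (p + 1) → ℝ := fun i => ∑ j, if j < i then α j else 0 with hb'
  have hbα : ∀ i, α i = b i - b' i := fun i => by
    simp only [hb, hb', ← Finset.sum_sub_distrib]
    rw [Finset.sum_eq_single i]
    · simp
    · intro j _ hj
      by_cases h : j < i
      · rw [if_pos h, if_pos h.le, sub_self]
      · rw [if_neg h, if_neg (fun h' => h (lt_of_le_of_ne h' hj)), sub_self]
    · simp
  have hblast : b (Fin.last p) = 0 := by
    rw [← hsum]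
    exact Finset.sum_congr rfl fun j _ => if_pos (Fin.le_last j)
  have hb0 : b' 0 = 0 := Finset.sum_eq_zero fun j _ => if_neg (Fin.not_lt_zero j)
  have hbs : ∀ k : Fin p, b' k.succ = b k.castSucc := fun k =>
    Finset.sum_congr rfl fun j _ => if_congr Fin.le_castSucc_iff.symm rfl rfl
  have h1 : ∑ i, ∑ j, b' i * b' j * V i j = ∑ i, ∑ j, b i * b j * V i j := by
    rw [Fin.sum_univ_succ, Fin.sum_univ_castSucc (fun i => ∑ j, b i * b j * V i j)]
    simp only [hb0, hblast, zero_mul, Finset.sum_const_zero, zero_add, add_zero]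
    refine Finset.sum_congr rfl fun i _ => ?_
    rw [Fin.sum_univ_succ, Fin.sum_univ_castSucc (fun j => b i.castSucc * b j * V i.castSucc j)]
    simp only [hb0, hblast, mul_zero, zero_mul, zero_add, add_zero, hbs, htoep]
  have h2 : ∑ i, ∑ j, b' i * α j * V i j = 0 := by
    rw [Fin.sum_univ_succ]
    simp only [hb0, zero_mul, Finset.sum_const_zero, zero_add]
    refine Finset.sum_eq_zero fun i _ => ?_
    rw [← mul_zero (b' i.succ), ← hnorm i, Finset.mul_sum]
    exact Finset.sum_congr rfl fun j _ => by ring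
  have h3 : ∑ i, ∑ j, α i * α j * V i j = ∑ i, ∑ j, b i * b j * V i j
      - ∑ i, ∑ j, b' i * b' j * V i j - 2 * ∑ i, ∑ j, b' i * α j * V i j := by
    have e1 : ∑ i, ∑ j, b i * b' j * V i j = ∑ i, ∑ j, b' i * b j * V i j := by
      rw [Finset.sum_comm]
      refine Finset.sum_congr rfl fun i _ => Finset.sum_congr rfl fun j _ => ?_
      rw [hsymm j i]; ring
    have e2 : ∑ i, ∑ j, α i * α j * V i j = ∑ i, ∑ j, b i * b j * V i j
        - ∑ i, ∑ j, b i * b' j * V i j - ∑ i, ∑ j, b' i * b j * V i j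
        + ∑ i, ∑ j, b' i * b' j * V i j := by
      simp only [← Finset.sum_sub_distrib, ← Finset.sum_add_distrib]
      refine Finset.sum_congr rfl fun i _ => Finset.sum_congr rfl fun j _ => ?_
      rw [hbα i, hbα j]; ring
    have e3 : ∑ i, ∑ j, b' i * α j * V i j = ∑ i, ∑ j, b' i * b j * V i j
        - ∑ i, ∑ j, b' i * b' j * V i j := by
      simp only [← Finset.sum_sub_distrib]
      refine Finset.sum_congr rfl fun i _ => Finset.sum_congr rfl fun j _ => ?_
      rw [hbα j]; ring
    rw [e2, e1, e3]; ring
  have h4 := hV α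
  rw [h3, h1, h2] at h4
  have h5 : (1 : ℝ) ≤ ∑ i, α i ^ 2 := by
    rw [Fin.sum_univ_succ, hα, arVec_zero, one_pow]
    linarith [Finset.sum_nonneg fun (i : Fin p) (_ : i ∈ Finset.univ) =>
      sq_nonneg (arVec (ywSol V) i.succ)]
  nlinarith

/-! ### Yule-Walker limits for arbitrary well-spaced configurations -/

section Fit

variable {ι : Type*} {L : Filter ι} {p T M : ℕ} {φ₀ : Fin p → ℝ} {σsq : ℝ}
  {Γ : Matrix (Fin (p + 1)) (Fin (p + 1)) ℝ} {n : ι → ℕ} {e X : ι → ℕ → ℝ}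
  {c₀ : Config} {s₀ : Fin T → ℝ} {μ₀ : Fin c₀.m → ℝ}
  {c : ι → Config}

lemma sum_Icc_eq_add_win (p : ℕ) {N : ℕ} (hp : p ≤ N) (F : ℕ → ℝ) :
    ∑ t ∈ Finset.Icc 1 N, F t = ∑ t ∈ Finset.Icc 1 p, F t + ∑ t ∈ win p N, F t := by
  have e1 : ∀ k, Finset.Icc 1 k = Finset.Ico 1 (k + 1) := fun k => rfl
  rw [e1, e1, win, Finset.sum_Ico_consecutive _ (by omega) (by omega)]

lemma Regular.sum_sq_le (reg : Regular L p T φ₀ σsq Γ n e) :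
    ∃ C, 0 ≤ C ∧ ∀ᶠ x in L, ∑ t ∈ Finset.Icc 1 (n x), e x t ^ 2 ≤ C * n x := by
  obtain ⟨R, hR, hRb⟩ := reg.edge
  have hn := reg.n_tendsto
  have h1 := (reg.gram 0 0).eventually_lt_const (lt_add_one (Γ 0 0))
  have h2 := (isLittleO_iff.1 (hR.trans (log_o_n hn))) one_pos
  refine ⟨max (Γ 0 0 + 1) 0 + p, by positivity, ?_⟩
  filter_upwards [h1, h2, hRb, hn.eventually_gt_atTop p] with x x1 x2 x3 hp
  have hn0 : (0 : ℝ) < n x := by exact_mod_cast (by omega : 0 < n x)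
  rw [sum_Icc_eq_add_win p hp.le]
  rw [div_lt_iff₀ hn0] at x1
  have e1 : lagProd p (n x) (e x) (e x) ((0 : Fin (p + 1)) : ℕ) ((0 : Fin (p + 1)) : ℕ)
      = ∑ t ∈ win p (n x), e x t ^ 2 :=
    Finset.sum_congr rfl fun t _ => by simp [sq]
  rw [e1] at x1
  rw [one_mul, Real.norm_of_nonneg (sq_nonneg _), Real.norm_of_nonneg hn0.le] at x2
  have x4 : ∑ t ∈ Finset.Icc 1 p, e x t ^ 2 ≤ p * (R x ^ 2) := by
    refine (Finset.sum_le_card_nsmul _ _ (R x ^ 2) fun t ht => ?_).trans_eq (by simp)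
    obtain ⟨t1, t2⟩ := Finset.mem_Icc.1 ht
    have := pow_le_pow_left₀ (abs_nonneg _) (x3.2.1 t t1 t2) 2
    rwa [sq_abs] at this
  have x5 : (p : ℝ) * R x ^ 2 ≤ p * n x := mul_le_mul_of_nonneg_left x2 (Nat.cast_nonneg _)
  have x6 : (Γ 0 0 + 1) * (n x : ℝ) ≤ max (Γ 0 0 + 1) 0 * n x :=
    mul_le_mul_of_nonneg_right (le_max_left _ _) hn0.le
  nlinarith

/-- A uniform bound on a fitted mean function. -/
lemma exists_abs_fitFn_le (hT : 0 < T) (hc : WellSpaced L p T n fun _ => c₀) (s₀ : Fin T → ℝ)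
    (μ₀ : Fin c₀.m → ℝ) :
    ∃ B, 0 ≤ B ∧ (∀ v, |s₀ v| ≤ B) ∧ (∀ k, |μ₀ k| ≤ B) ∧
      ∀ᶠ x in L, ∀ t, 1 ≤ t → t ≤ n x → |fitFn c₀ (n x) s₀ μ₀ t| ≤ 2 * B := by
  obtain ⟨h1, h2⟩ := abs_apply_le_max s₀ μ₀
  have h0 : 0 ≤ max ‖s₀‖ ‖μ₀‖ := le_max_of_le_left (norm_nonneg _)
  refine ⟨_, h0, h1, h2, ?_⟩
  obtain ⟨κ, -, hs⟩ := hc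
  filter_upwards [hs] with x hx t t1 t2
  obtain ⟨k, -, -, hk⟩ := hx
  exact hk.abs_fitFn_le hT _ _ h0 h1 h2 t1 t2

lemma sum_sq_data_le (reg : Regular L p T φ₀ σsq Γ n e) (hT : 0 < T)
    (hc₀ : WellSpaced L p T n fun _ => c₀)
    (hX : ∀ x t, X x t = fitFn c₀ (n x) s₀ μ₀ t + e x t) :
    ∃ C, 0 ≤ C ∧ ∀ᶠ x in L, ∑ t ∈ Finset.Icc 1 (n x), X x t ^ 2 ≤ C * n x := by
  obtain ⟨C, hC, h⟩ := reg.sum_sq_le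
  obtain ⟨B, hB, -, -, h'⟩ := exists_abs_fitFn_le hT hc₀ s₀ μ₀
  refine ⟨2 * C + 2 * (2 * B) ^ 2, by positivity, ?_⟩
  filter_upwards [h, h'] with x h1 h2
  have h3 : ∀ t ∈ Finset.Icc 1 (n x), X x t ^ 2 ≤ 2 * e x t ^ 2 + 2 * (2 * B) ^ 2 := fun t ht => by
    obtain ⟨t1, t2⟩ := Finset.mem_Icc.1 ht
    have h4 := pow_le_pow_left₀ (abs_nonneg _) (h2 t t1 t2) 2
    rw [sq_abs] at h4
    rw [hX]
    nlinarith [sq_nonneg (fitFn c₀ (n x) s₀ μ₀ t - e x t)]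
  refine (Finset.sum_le_sum h3).trans ?_
  rw [Finset.sum_add_distrib, ← Finset.mul_sum, Finset.sum_const, Nat.card_Icc,
    Nat.add_sub_cancel, nsmul_eq_mul]
  nlinarith

/-- The ordinary least squares fit has bounded coefficients. -/
lemma exists_ols_bdd (reg : Regular L p T φ₀ σsq Γ n e) (hT : 0 < T)
    (hc₀ : WellSpaced L p T n fun _ => c₀)
    (hX : ∀ x t, X x t = fitFn c₀ (n x) s₀ μ₀ t + e x t) (hc : WellSpaced L p T n c) :
    ∃ W, 0 ≤ W ∧ ∀ᶠ x in L, ∃ (u : Fin T → ℝ) (w : Fin (c x).m → ℝ),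
      (∀ v, |u v| ≤ W) ∧ (∀ k, |w k| ≤ W) ∧ ∀ i : Fin (n x), olsResidual T (n x) (c x) (X x) i
        = e x ((i : ℕ) + 1) + (fitFn c₀ (n x) s₀ μ₀ ((i : ℕ) + 1)
          - fitFn (c x) (n x) u w ((i : ℕ) + 1)) := by
  obtain ⟨C, hC, h⟩ := sum_sq_data_le reg hT hc₀ hX
  obtain ⟨κ, hκ, hs⟩ := hc
  refine ⟨√(4 * C / κ), Real.sqrt_nonneg _, ?_⟩
  filter_upwards [h, hs, reg.n_tendsto.eventually_gt_atTop 0] with x h1 h2 h3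
  obtain ⟨k, -, hk, hsp⟩ := h2
  obtain ⟨u, w, hres, horth⟩ := exists_olsResidual_eq T (n x) (c x) (X x)
  have hn0 : (0 : ℝ) < n x := by exact_mod_cast h3
  have e1 := horth u w
  -- By Pythagoras the fit has no more energy than the data, which is O(n); identifiability turns
  -- this into a bound on the coefficients.
  have e2 : ∑ t ∈ Finset.Icc 1 (n x), fitFn (c x) (n x) u w t ^ 2
      ≤ ∑ t ∈ Finset.Icc 1 (n x), X x t ^ 2 := by
    have : ∑ t ∈ Finset.Icc 1 (n x), X x t ^ 2
        = ∑ t ∈ Finset.Icc 1 (n x), fitFn (c x) (n x) u w t ^ 2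
          + ∑ t ∈ Finset.Icc 1 (n x), (X x t - fitFn (c x) (n x) u w t) ^ 2
          + 2 * ∑ t ∈ Finset.Icc 1 (n x), (X x t - fitFn (c x) (n x) u w t)
            * fitFn (c x) (n x) u w t := by
      rw [Finset.mul_sum, ← Finset.sum_add_distrib, ← Finset.sum_add_distrib]
      exact Finset.sum_congr rfl fun t _ => by ring
    rw [e1] at this
    have h4 : 0 ≤ ∑ t ∈ Finset.Icc 1 (n x), (X x t - fitFn (c x) (n x) u w t) ^ 2 :=
      Finset.sum_nonneg fun _ _ => sq_nonneg _
    linarith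
  have e3 := hsp.coef_sq_le hT (k := k) (by omega) u w
  have e4 : max ‖u‖ ‖w‖ ≤ √(4 * C / κ) := by
    refine Real.le_sqrt_of_sq_le ?_
    rw [le_div_iff₀ hκ]
    have h5 : κ * n x * max ‖u‖ ‖w‖ ^ 2 ≤ k * max ‖u‖ ‖w‖ ^ 2 :=
      mul_le_mul_of_nonneg_right hk (sq_nonneg _)
    have h6 : κ * n x * max ‖u‖ ‖w‖ ^ 2 ≤ 4 * (C * n x) := by linarith
    have h7 : (max ‖u‖ ‖w‖ ^ 2 * κ) * n x ≤ (4 * C) * n x := by linarith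
    exact le_of_mul_le_mul_right h7 hn0
  obtain ⟨a1, a2⟩ := abs_apply_le_max u w
  refine ⟨u, w, fun v => (a1 v).trans e4, fun k => (a2 k).trans e4, fun i => ?_⟩
  rw [hres, hX]; ring

lemma sum_mul_lagProd_eq {p : ℕ} (N : ℕ) (β : Fin (p + 1) → ℝ) (f : ℕ → ℝ) :
    ∑ i, ∑ j, β i * β j * lagProd p N f f (i : ℕ) (j : ℕ)
      = ∑ t ∈ win p N, (∑ i : Fin (p + 1), β i * f (t - (i : ℕ))) ^ 2 := by
  have h : ∀ t, (∑ i : Fin (p + 1), β i * f (t - (i : ℕ))) ^ 2 = ∑ i : Fin (p + 1),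
      ∑ j : Fin (p + 1), β i * β j * (f (t - (i : ℕ)) * f (t - (j : ℕ))) := fun t => by
    rw [sq, Finset.sum_mul_sum]
    exact Finset.sum_congr rfl fun i _ => Finset.sum_congr rfl fun j _ => by ring
  simp only [h, lagProd, Finset.mul_sum]
  rw [Finset.sum_comm (s := win p N)]
  refine Finset.sum_congr rfl fun i _ => ?_
  rw [Finset.sum_comm (s := win p N)]

lemma abs_lagProd_self_le {p N : ℕ} (f : ℕ → ℝ) {i j : ℕ} (hi : i ≤ p) (hj : j ≤ p) :
    |lagProd p N f f i j| ≤ ∑ t ∈ Finset.Icc 1 N, f t ^ 2 := by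
  have b1 : ∀ i ≤ p, ∑ t ∈ win p N, f (t - i) ^ 2 ≤ ∑ t ∈ Finset.Icc 1 N, f t ^ 2 := by
    intro i hi
    have hinj : Set.InjOn (fun t => t - i) (win p N : Set ℕ) := by
      intro t ht t' ht' h
      have h1 := (mem_win.1 (Finset.mem_coe.1 ht)).1
      have h2 := (mem_win.1 (Finset.mem_coe.1 ht')).1
      simp only at h
      omega
    rw [← Finset.sum_image (f := fun t => f t ^ 2) hinj]
    refine Finset.sum_le_sum_of_subset_of_nonneg ?_ fun _ _ _ => sq_nonneg _
    intro t ht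
    obtain ⟨t', ht', rfl⟩ := Finset.mem_image.1 ht
    have := mem_win.1 ht'
    exact Finset.mem_Icc.2 ⟨by omega, by omega⟩
  have b7 : |lagProd p N f f i j| ≤ ∑ t ∈ win p N, (f (t - i) ^ 2 + f (t - j) ^ 2) / 2 := by
    refine (Finset.abs_sum_le_sum_abs _ _).trans (Finset.sum_le_sum fun t _ => ?_)
    rw [abs_le]
    constructor
    · nlinarith [sq_nonneg (f (t - i) + f (t - j))]
    · nlinarith [sq_nonneg (f (t - i) - f (t - j))]
  rw [← Finset.sum_div, Finset.sum_add_distrib] at b7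
  linarith [b1 i hi, b1 j hj]

/-- The sample autocovariances under any well-spaced configuration are bounded, and dominate
those of the noise. -/
lemma acovMat_bounds (reg : Regular L p T φ₀ σsq Γ n e) (hT : 0 < T)
    (hc₀ : WellSpaced L p T n fun _ => c₀)
    (hX : ∀ x t, X x t = fitFn c₀ (n x) s₀ μ₀ t + e x t) (hc : WellSpaced L p T n c)
    (hm : ∀ᶠ x in L, (c x).m ≤ M) :
    (∃ C, ∀ᶠ x in L, ∀ i j, |acovMat p T (n x) (c x) (X x) i j| ≤ C) ∧
    ∀ β : Fin (p + 1) → ℝ, ∀ ε > 0, ∀ᶠ x in L, ∑ i, ∑ j, β i * β j * Γ i j - ε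
      ≤ ∑ i, ∑ j, β i * β j * acovMat p T (n x) (c x) (X x) i j := by
  have hn := reg.n_tendsto
  obtain ⟨W, hW, hols⟩ := exists_ols_bdd reg hT hc₀ hX hc
  obtain ⟨B, hB, hs₀, hμ₀, hF⟩ := exists_abs_fitFn_le hT hc₀ s₀ μ₀
  obtain ⟨Q, hQ, hQb⟩ := reg.noise
  obtain ⟨R, hR, hRb⟩ := reg.edge
  obtain ⟨κ, hκ, hsp⟩ := hc
  set G : ℝ := 2 * B + 2 * W with hG
  have hG0 : 0 ≤ G := by positivity
  set err : ι → ℝ := fun x => 2 * p * (2 * (R x ^ 2 + G ^ 2)) with herr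
  have herro : err =o[L] fun x => (n x : ℝ) :=
    ((((hR.add (const_o_log hn _)).const_mul_left 2).const_mul_left _).trans (log_o_n hn))
  set crs : ι → ℝ := fun x => ((T + 2 * c₀.m) * B + (T + 2 * M) * W) * Q x with hcrs
  have hcrso : crs =o[L] fun x => (n x : ℝ) := (hQ.const_mul_left _).trans (scA_o_n hn)
  obtain ⟨C, hC, hsq⟩ := reg.sum_sq_le
  -- the residuals decompose into noise and a bounded function with small cross products
  have key : ∀ᶠ x in L, ∃ g : ℕ → ℝ, (∀ t, 1 ≤ t → t ≤ n x → |g t| ≤ G) ∧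
      (∀ i ≤ p, ∀ j ≤ p, |lagProd p (n x) (e x) g i j| ≤ crs x) ∧
      ∀ i j : Fin (p + 1), |n x * acovMat p T (n x) (c x) (X x) i j
        - lagProd p (n x) (fun t => e x t + g t) (fun t => e x t + g t) i j| ≤ err x := by
    filter_upwards [hols, hF, hQb, hRb, hsp, hm, hn.eventually_gt_atTop (2 * p)]
      with x h1 h2 q r sp hm hp
    obtain ⟨u, w, hu, hw, hres⟩ := h1
    obtain ⟨k, -, -, hspc⟩ := sp
    obtain ⟨r0, r1, r2⟩ := r
    have hmM : ((c x).m : ℝ) ≤ M := by exact_mod_cast hm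
    have hg : ∀ t, 1 ≤ t → t ≤ n x → |fitFn c₀ (n x) s₀ μ₀ t - fitFn (c x) (n x) u w t| ≤ G :=
      fun t t1 t2 => (abs_sub _ _).trans
        (add_le_add (h2 t t1 t2) (hspc.abs_fitFn_le hT u w hW hu hw t1 t2))
    refine ⟨fun t => fitFn c₀ (n x) s₀ μ₀ t - fitFn (c x) (n x) u w t, hg, ?_, ?_⟩
    · intro i hi j hj
      have e1 : lagProd p (n x) (e x) (fun t => fitFn c₀ (n x) s₀ μ₀ t - fitFn (c x) (n x) u w t) i j
          = lagProd p (n x) (e x) (fitFn c₀ (n x) s₀ μ₀) i j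
            - lagProd p (n x) (e x) (fitFn (c x) (n x) u w) i j := by
        simp only [lagProd, ← Finset.sum_sub_distrib, mul_sub]
      rw [e1]
      have b1 := q.abs_lagProd_fitFn_le hT c₀ s₀ μ₀ hs₀ hμ₀ hi hj
      have b2 := q.abs_lagProd_fitFn_le hT (c x) u w hu hw hi hj
      have b3 : (T + 2 * (c x).m : ℝ) * W * Q x ≤ (T + 2 * M) * W * Q x :=
        mul_le_mul_of_nonneg_right (mul_le_mul_of_nonneg_right (by linarith) hW) q.nonneg
      refine (abs_sub _ _).trans ?_
      simp only [hcrs]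
      linarith
    · intro i j
      have hn0 : (n x : ℝ) ≠ 0 := by
        have : n x ≠ 0 := by omega
        exact_mod_cast this
      have a0 : acovMat p T (n x) (c x) (X x) i j
          = sampleAcov T (n x) (c x) (X x) (((i : ℕ) : ℤ) - (j : ℕ)).natAbs := rfl
      rw [a0, sampleAcov_eq (E := fun t => e x t + (fitFn c₀ (n x) s₀ μ₀ t
        - fitFn (c x) (n x) u w t)) hres, ← mul_assoc, mul_inv_cancel₀ hn0, one_mul]
      have a1 := abs_acovSum_sub_lagProd_le (p := p) hp
        (E := fun t => e x t + (fitFn c₀ (n x) s₀ μ₀ t - fitFn (c x) (n x) u w t)) (B := R x + G)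
        (fun t t1 t2 => (abs_add_le _ _).trans (add_le_add (r1 t t1 t2) (hg t t1 (by omega))))
        (fun t t1 t2 => (abs_add_le _ _).trans (add_le_add (r2 t t1 t2) (hg t (by omega) t2)))
        (Nat.lt_succ_iff.1 i.2) (Nat.lt_succ_iff.1 j.2)
      refine a1.trans ?_
      simp only [herr]
      refine mul_le_mul_of_nonneg_left ?_ (by positivity)
      nlinarith [sq_nonneg (R x - G)]
  constructor
  · refine ⟨1 + (2 * C + 2 * G ^ 2), ?_⟩
    filter_upwards [key, hsq, isLittleO_iff.1 herro one_pos, hn.eventually_gt_atTop 0]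
      with x ⟨g, hg, _, ha⟩ h2 h3 h4 i j
    have hn0 : (0 : ℝ) < n x := by exact_mod_cast h4
    rw [one_mul, Real.norm_eq_abs, Real.norm_of_nonneg hn0.le] at h3
    have b4 : |lagProd p (n x) (fun t => e x t + g t) (fun t => e x t + g t) i j|
        ≤ (2 * C + 2 * G ^ 2) * n x := by
      refine (abs_lagProd_self_le _ (Nat.lt_succ_iff.1 i.2) (Nat.lt_succ_iff.1 j.2)).trans ?_
      have b2 : ∀ t ∈ Finset.Icc 1 (n x), (e x t + g t) ^ 2 ≤ 2 * e x t ^ 2 + 2 * G ^ 2 := by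
        intro t ht
        obtain ⟨t1, t2⟩ := Finset.mem_Icc.1 ht
        have b3 := pow_le_pow_left₀ (abs_nonneg _) (hg t t1 t2) 2
        rw [sq_abs] at b3
        nlinarith [sq_nonneg (e x t - g t)]
      refine (Finset.sum_le_sum b2).trans ?_
      rw [Finset.sum_add_distrib, ← Finset.mul_sum, Finset.sum_const, Nat.card_Icc,
        Nat.add_sub_cancel, nsmul_eq_mul]
      nlinarith
    have b8 := ha i j
    have b9 : n x * |acovMat p T (n x) (c x) (X x) i j| ≤ n x * (1 + (2 * C + 2 * G ^ 2)) := by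
      rw [← abs_of_pos hn0, ← abs_mul, abs_of_pos hn0]
      have := abs_le.1 (b8.trans ((le_abs_self _).trans h3))
      have := abs_le.1 b4
      rw [abs_le]
      constructor <;> linarith
    exact le_of_mul_le_mul_left b9 hn0
  · intro β ε hε
    set S := ∑ i, ∑ j, |β i * β j| with hS
    have hS0 : 0 ≤ S := Finset.sum_nonneg fun _ _ => Finset.sum_nonneg fun _ _ => abs_nonneg _
    have h5 : (fun x => S * (err x + 2 * crs x)) =o[L] fun x => (n x : ℝ) :=
      (herro.add (hcrso.const_mul_left 2)).const_mul_left S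
    have h6 : Tendsto (fun x => (∑ i, ∑ j, β i * β j * (lagProd p (n x) (e x) (e x) i j / n x)))
        L (𝓝 (∑ i, ∑ j, β i * β j * Γ i j)) :=
      tendsto_finsetSum _ fun i _ => tendsto_finsetSum _ fun j _ => (reg.gram i j).const_mul _
    filter_upwards [key, isLittleO_iff.1 h5 (half_pos hε), hn.eventually_gt_atTop 0,
      h6.eventually_const_lt (show ∑ i, ∑ j, β i * β j * Γ i j - ε / 2
        < ∑ i, ∑ j, β i * β j * Γ i j by linarith)] with x ⟨g, hg, hcr, ha⟩ h7 h8 h9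
    have hn0 : (0 : ℝ) < n x := by exact_mod_cast h8
    rw [Real.norm_eq_abs, Real.norm_of_nonneg hn0.le] at h7
    have c1 : ∑ i, ∑ j, β i * β j * (lagProd p (n x) (e x) (e x) i j / n x)
        = (∑ i, ∑ j, β i * β j * lagProd p (n x) (e x) (e x) (i : ℕ) (j : ℕ)) / n x := by
      simp only [Finset.sum_div, mul_div_assoc]
    rw [c1, lt_div_iff₀ hn0] at h9
    -- The Gram form of the unexplained mean is nonnegative. It may be as large as n, but it can
    -- only increase the autocovariance form, and the cross terms with the noise are negligible.
    have c2 : 0 ≤ ∑ i, ∑ j, β i * β j * lagProd p (n x) g g (i : ℕ) (j : ℕ) := by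
      rw [sum_mul_lagProd_eq]
      exact Finset.sum_nonneg fun _ _ => sq_nonneg _
    have c3 : ∑ i : Fin (p + 1), ∑ j : Fin (p + 1), β i * β j
          * lagProd p (n x) (e x) (e x) (i : ℕ) (j : ℕ)
        + ∑ i : Fin (p + 1), ∑ j : Fin (p + 1), β i * β j * lagProd p (n x) g g (i : ℕ) (j : ℕ)
        - n x * ∑ i, ∑ j, β i * β j * acovMat p T (n x) (c x) (X x) i j
        ≤ S * (err x + 2 * crs x) := by
      simp only [Finset.mul_sum, hS, Finset.sum_mul, ← Finset.sum_add_distrib,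
        ← Finset.sum_sub_distrib]
      refine Finset.sum_le_sum fun i _ => Finset.sum_le_sum fun j _ => ?_
      have d1 := ha i j
      have d2 := hcr i (Nat.lt_succ_iff.1 i.2) j (Nat.lt_succ_iff.1 j.2)
      have d3 := hcr j (Nat.lt_succ_iff.1 j.2) i (Nat.lt_succ_iff.1 i.2)
      rw [lagProd_comm] at d3
      rw [lagProd_add_left, lagProd_add_right, lagProd_add_right] at d1
      have d4 : β i * β j * lagProd p (n x) (e x) (e x) (i : ℕ) (j : ℕ)
          + β i * β j * lagProd p (n x) g g (i : ℕ) (j : ℕ)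
          - n x * (β i * β j * acovMat p T (n x) (c x) (X x) i j)
          = β i * β j * (lagProd p (n x) (e x) (e x) (i : ℕ) (j : ℕ)
            + lagProd p (n x) g g (i : ℕ) (j : ℕ) - n x * acovMat p T (n x) (c x) (X x) i j) := by
        ring
      rw [d4]
      refine (le_abs_self _).trans ?_
      rw [abs_mul]
      refine mul_le_mul_of_nonneg_left ?_ (abs_nonneg _)
      rw [abs_le] at *
      constructor <;> linarith [d1.1, d1.2, d2.1, d2.2, d3.1, d3.2]
    have c4 := (le_abs_self _).trans h7
    have c5 : n x * (∑ i, ∑ j, β i * β j * Γ i j - ε)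
        ≤ n x * ∑ i, ∑ j, β i * β j * acovMat p T (n x) (c x) (X x) i j := by nlinarith
    exact le_of_mul_le_mul_left c5 hn0

/-- Along an ultrafilter, the Yule-Walker estimator has a limit, whose filter does not annihilate
constants. -/
lemma exists_yuleWalker_tendsto {U : Ultrafilter ι}
    (reg : Regular (U : Filter ι) p T φ₀ σsq Γ n e) (hT : 0 < T)
    (hc₀ : WellSpaced (U : Filter ι) p T n fun _ => c₀)
    (hX : ∀ x t, X x t = fitFn c₀ (n x) s₀ μ₀ t + e x t) (hc : WellSpaced (U : Filter ι) p T n c)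
    (hm : ∀ᶠ x in (U : Filter ι), (c x).m ≤ M) :
    ∃ φ : Fin p → ℝ, Tendsto (fun x => yuleWalker p T (n x) (c x) (X x)) U (𝓝 φ) ∧
      arOne φ ≠ 0 := by
  obtain ⟨⟨C, hC⟩, hlow⟩ := acovMat_bounds reg hT hc₀ hX hc hm
  -- Bounded quantities converge along an ultrafilter, by compactness of an interval.
  have hlim : ∀ i j, ∃ v, Tendsto (fun x => acovMat p T (n x) (c x) (X x) i j) U (𝓝 v) := by
    intro i j
    have : ∀ᶠ x in (U : Filter ι), acovMat p T (n x) (c x) (X x) i j ∈ Set.Icc (-C) C :=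
      hC.mono fun x hx => abs_le.1 (hx i j)
    obtain ⟨v, -, hv⟩ := (isCompact_Icc (a := -C) (b := C)).ultrafilter_le_nhds
      (U.map fun x => acovMat p T (n x) (c x) (X x) i j) (by
        rw [le_principal_iff]; exact this)
    exact ⟨v, hv⟩
  choose V hV using hlim
  have hVt : Tendsto (fun x => acovMat p T (n x) (c x) (X x)) U (𝓝 (Matrix.of V)) :=
    tendsto_pi_nhds.2 fun i => tendsto_pi_nhds.2 fun j => hV i j
  obtain ⟨γ, hγ, hpd⟩ := reg.posDef
  have hVpd : ∀ β : Fin (p + 1) → ℝ,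
      γ * ∑ i, β i ^ 2 ≤ ∑ i, ∑ j, β i * β j * (Matrix.of V) i j := by
    intro β
    refine (hpd β).trans (le_of_forall_pos_le_add fun ε hε => ?_)
    have h1 : Tendsto (fun x => ∑ i, ∑ j, β i * β j * acovMat p T (n x) (c x) (X x) i j) U
        (𝓝 (∑ i, ∑ j, β i * β j * (Matrix.of V) i j)) :=
      tendsto_finsetSum _ fun i _ => tendsto_finsetSum _ fun j _ => (hV i j).const_mul _
    have := ge_of_tendsto h1 (hlow β ε hε)
    linarith
  -- Entries depend on the lag only, so the limit matrix is symmetric and Toeplitz.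
  have hlag : ∀ i j i' j' : Fin (p + 1), (((i : ℕ) : ℤ) - (j : ℕ)).natAbs
      = (((i' : ℕ) : ℤ) - (j' : ℕ)).natAbs → Matrix.of V i j = Matrix.of V i' j' := by
    intro i j i' j' h
    refine tendsto_nhds_unique (hV i j) ((hV i' j').congr fun x => ?_)
    simp only [acovMat, Matrix.of_apply, h]
  refine ⟨ywSol (Matrix.of V), ?_, arOne_ywSol_ne_zero hγ hVpd (fun i j => hlag _ _ _ _ (by omega))
    fun i j => hlag _ _ _ _ (by simp)⟩
  simp only [yuleWalker_eq]
  exact tendsto_ywSol hVt (submatrix_det_ne_zero hγ hVpd)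

end Fit

/-! ### The residual sum of squares of a well-fitting configuration -/

section WellFitting

variable {ι : Type*} {L : Filter ι} {p T M : ℕ} {φ₀ φs : Fin p → ℝ} {σsq ν : ℝ}
  {Γ : Matrix (Fin (p + 1)) (Fin (p + 1)) ℝ} {n : ι → ℕ} {e X : ι → ℕ → ℝ}
  {c₀ : Config} {s₀ : Fin T → ℝ} {μ₀ : Fin c₀.m → ℝ}
  {c : ι → Config}

/-- The sum of squared filtered residuals. -/
def ssr (p : ℕ) (ν : ℝ) (T N : ℕ) (c : Config) (x : ℕ → ℝ) : ℝ :=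
  ((N : ℝ) - p) * varHat p ν T N c x

lemma ssr_eq_crit (p : ℕ) (hν : 0 < ν) {N : ℕ} (hN : p < N) (c : Config) (x : ℕ → ℝ) :
    ssr p ν T N c x = crit ν N c (yuleWalker p T N c x) x (seasonHat p ν T N c x)
      (regimeHat p ν T N c x) :=
  varEst_mul_eq hν hN c _ x

/-- If the residual sum of squares is at most linear, then the filtered fit is bounded. -/
lemma exists_gls_bdd (reg : Regular L p T φ₀ σsq Γ n e) (hT : 0 < T) (hν : 0 < ν)
    (hc₀ : WellSpaced L p T n fun _ => c₀)
    (hX : ∀ x t, X x t = fitFn c₀ (n x) s₀ μ₀ t + e x t) (hc : WellSpaced L p T n c)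
    (hφ : Tendsto (fun x => yuleWalker p T (n x) (c x) (X x)) L (𝓝 φs)) (h1 : arOne φs ≠ 0)
    {C : ℝ} (hssr : ∀ᶠ x in L, ssr p ν T (n x) (c x) (X x) ≤ C * n x) :
    ∃ W, 0 ≤ W ∧ ∀ᶠ x in L,
      (∀ t, p + 1 ≤ t → |arFilter (yuleWalker p T (n x) (c x) (X x))
        (seasonFn (seasonHat p ν T (n x) (c x) (X x))) t| ≤ W) ∧
      ∀ k, |regimeHat p ν T (n x) (c x) (X x) k| ≤ W := by
  obtain ⟨C', hC', hsq⟩ := sum_sq_data_le reg hT hc₀ hX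
  obtain ⟨κ, hκ, hs⟩ := hc
  set q := |arOne φs| / 2 with hq
  have hq0 : 0 < q := by have := abs_pos.2 h1; positivity
  have e1 : ∀ᶠ x in L, q ≤ |arOne (yuleWalker p T (n x) (c x) (X x))| := by
    have := ((continuous_arOne.tendsto φs).comp hφ).abs
    exact (this.eventually_const_lt (show q < |arOne φs| by have := abs_pos.2 h1; linarith)).mono
      fun x hx => hx.le
  obtain ⟨K, hK⟩ := (arNorm_isBigO_one hφ).bound
  set D : ℝ := 2 * (K * (K * C')) + 2 * C with hD
  refine ⟨max (√(D / κ)) (√(4 * D / κ) / q), by positivity, ?_⟩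
  filter_upwards [hsq, hs, e1, hK, hssr, reg.n_tendsto.eventually_gt_atTop p]
    with x x1 x2 x3 x4 x5 hp
  obtain ⟨k, hk0, hk, hsp⟩ := x2
  have hn0 : (0 : ℝ) < n x := by exact_mod_cast (by omega : 0 < n x)
  have hk' : (0 : ℝ) < k := by exact_mod_cast hk0
  set φ := yuleWalker p T (n x) (c x) (X x)
  set sh := seasonHat p ν T (n x) (c x) (X x)
  set mh := regimeHat p ν T (n x) (c x) (X x)
  have hA0 : 0 ≤ arNorm φ := zero_le_one.trans (one_le_arNorm φ)
  rw [norm_one, mul_one, Real.norm_of_nonneg hA0] at x4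
  set S := ∑ t ∈ win p (n x), arFilter φ (fitFn (c x) (n x) sh mh) t ^ 2 with hS
  have a1 : ∑ t ∈ win p (n x), arFilter φ (X x) t ^ 2 ≤ K * (K * (C' * n x)) := by
    have := abs_sum_arFilter_mul_le (N := n x) φ φ (f := X x) (g := X x)
      (B := ∑ t ∈ Finset.Icc 1 (n x), X x t ^ 2) fun i hi j hj => abs_lagProd_self_le _ hi hj
    simp only [← sq] at this
    refine ((le_abs_self _).trans this).trans ?_
    have hs0 : 0 ≤ ∑ t ∈ Finset.Icc 1 (n x), X x t ^ 2 := Finset.sum_nonneg fun _ _ => sq_nonneg _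
    exact mul_le_mul x4 (mul_le_mul x4 x1 hs0 (hA0.trans x4)) (mul_nonneg hA0 hs0) (hA0.trans x4)
  have a2 : ∑ t ∈ win p (n x), arFilter φ (fun t => X x t - fitFn (c x) (n x) sh mh t) t ^ 2
      ≤ C * n x := by
    refine le_trans ?_ x5
    rw [ssr_eq_crit p hν hp]
    exact le_add_of_nonneg_right (mul_nonneg (inv_nonneg.2 hν.le)
      (Finset.sum_nonneg fun _ _ => sq_nonneg _))
  -- The filtered fit is filtered data minus filtered residuals, both with energy O(n).
  have a3 : S ≤ D * n x := by
    have : S ≤ ∑ t ∈ win p (n x), (2 * arFilter φ (X x) t ^ 2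
        + 2 * arFilter φ (fun t => X x t - fitFn (c x) (n x) sh mh t) t ^ 2) := by
      refine Finset.sum_le_sum fun t _ => ?_
      rw [arFilter_sub]
      nlinarith [sq_nonneg (arFilter φ (X x) t
        + (arFilter φ (X x) t - arFilter φ (fitFn (c x) (n x) sh mh) t))]
    rw [Finset.sum_add_distrib, ← Finset.mul_sum, ← Finset.mul_sum] at this
    rw [hD]; nlinarith
  have a4 : ∀ y : ℝ, k * y ^ 2 ≤ S → y ^ 2 ≤ D / κ := fun y hy => by
    rw [le_div_iff₀ hκ]
    have h5 : κ * n x * y ^ 2 ≤ k * y ^ 2 := mul_le_mul_of_nonneg_right hk (sq_nonneg _)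
    have h7 : (y ^ 2 * κ) * n x ≤ D * n x := by linarith
    exact le_of_mul_le_mul_right h7 hn0
  constructor
  · intro t ht
    refine le_max_of_le_left (Real.abs_le_sqrt (a4 _ ?_))
    exact hsp.season_sq_le_sum_win hT le_rfl φ sh mh ht
  · intro j
    refine le_max_of_le_right ?_
    rw [le_div_iff₀ hq0]
    refine (mul_le_mul_of_nonneg_left x3 (abs_nonneg _)).trans ?_
    rw [← abs_mul]
    refine Real.abs_le_sqrt ?_
    have h6 := hsp.mean_sq_le_sum_win hT le_rfl φ sh mh j
    have h7 := a4 (arOne φ * mh j / 2) (by rw [div_pow]; linarith)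
    rw [mul_comm, mul_div_assoc]
    rw [div_pow] at h7
    linarith

/-- The misfit between the true and the fitted mean function. -/
def misfit {T : ℕ} (p : ℕ) (ν : ℝ) (N : ℕ) (c₀ : Config) (s₀ : Fin T → ℝ) (μ₀ : Fin c₀.m → ℝ)
    (c : Config) (x : ℕ → ℝ) (t : ℕ) : ℝ :=
  fitFn c₀ N s₀ μ₀ t - fitFn c N (seasonHat p ν T N c x) (regimeHat p ν T N c x) t

lemma abs_sum_arFilter_mul_periodic_le {N : ℕ} (hT : 0 < T) {e : ℕ → ℝ} {Q : ℝ}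
    (h : NoiseBound p T N e Q) (φ : Fin p → ℝ) {y : ℕ → ℝ} (hy : PeriodicFrom p T y) {Y : ℝ}
    (hY : ∀ t, p + 1 ≤ t → |y t| ≤ Y) :
    |∑ t ∈ win p N, arFilter φ e t * y t| ≤ arNorm φ * (T * Y * Q) := by
  have e1 : ∑ t ∈ win p N, arFilter φ e t * y t
      = ∑ i : Fin (p + 1), arVec φ i * ∑ t ∈ win p N, e (t - (i : ℕ)) * y t := by
    simp only [arFilter_eq, Finset.sum_mul, Finset.mul_sum]
    rw [Finset.sum_comm]
    exact Finset.sum_congr rfl fun i _ => Finset.sum_congr rfl fun t _ => by ring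
  rw [e1]
  exact abs_sum_arVec_mul_le φ fun i =>
    h.abs_sum_mul_periodic_le hT hy hY (Nat.lt_succ_iff.1 i.2)

/-- The residual is noise minus the fit error of the mean, so it suffices that the filtered noise
and the filtered misfit are nearly orthogonal. The fitted seasonal part is paired only after
filtering: `φs` is not yet known to be `φ₀`, and stability on seasonal functions is not available
for it, so the seasonal coefficients themselves have no bound at this stage. -/
lemma ssr_lower (reg : Regular L p T φ₀ σsq Γ n e) (hT : 0 < T) (hν : 0 < ν)
    (hc₀ : WellSpaced L p T n fun _ => c₀)
    (hX : ∀ x t, X x t = fitFn c₀ (n x) s₀ μ₀ t + e x t) (hc : WellSpaced L p T n c)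
    (hm : ∀ᶠ x in L, (c x).m ≤ M)
    (hφ : Tendsto (fun x => yuleWalker p T (n x) (c x) (X x)) L (𝓝 φs)) (h1 : arOne φs ≠ 0)
    {C : ℝ} (hssr : ∀ᶠ x in L, ssr p ν T (n x) (c x) (X x) ≤ C * n x) :
    ∃ E : ι → ℝ, (E =o[L] fun x => scA (n x)) ∧ ∀ᶠ x in L,
      ∑ t ∈ win p (n x), arFilter (yuleWalker p T (n x) (c x) (X x)) (e x) t ^ 2
      + ∑ t ∈ win p (n x), arFilter (yuleWalker p T (n x) (c x) (X x))
          (misfit p ν (n x) c₀ s₀ μ₀ (c x) (X x)) t ^ 2 - E x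
      ≤ ssr p ν T (n x) (c x) (X x) := by
  obtain ⟨W, hW, hbd⟩ := exists_gls_bdd reg hT hν hc₀ hX hc hφ h1 hssr
  obtain ⟨B, hB, hs₀, hμ₀, -⟩ := exists_abs_fitFn_le hT hc₀ s₀ μ₀
  obtain ⟨Q, hQ, hQb⟩ := reg.noise
  have hA := arNorm_isBigO_one hφ
  set A : ι → ℝ := fun x => arNorm (yuleWalker p T (n x) (c x) (X x)) with hAd
  refine ⟨fun x => 2 * (A x * (A x * ((T + 2 * c₀.m) * B * Q x)) + A x * (T * W * Q x)
    + A x * (A x * (2 * M * W * Q x))), ?_, ?_⟩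
  · have t0 : ∀ f : ι → ℝ, (f =o[L] fun x => scA (n x)) →
        (fun x => A x * f x) =o[L] fun x => scA (n x) := fun f hf => by
      simpa only [one_mul] using hA.mul_isLittleO hf
    exact (((t0 _ (t0 _ (hQ.const_mul_left _))).add (t0 _ (hQ.const_mul_left _))).add
      (t0 _ (t0 _ (hQ.const_mul_left _)))).const_mul_left 2
  · filter_upwards [hbd, hQb, hm, reg.n_tendsto.eventually_gt_atTop p] with x ⟨b1, b2⟩ q hm hp
    set φ := yuleWalker p T (n x) (c x) (X x)
    set sh := seasonHat p ν T (n x) (c x) (X x) with hsh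
    set mh := regimeHat p ν T (n x) (c x) (X x) with hmh
    set g := misfit p ν (n x) c₀ s₀ μ₀ (c x) (X x) with hg
    have hmM : ((c x).m : ℝ) ≤ M := by exact_mod_cast hm
    have k1 : ssr p ν T (n x) (c x) (X x) ≥ ∑ t ∈ win p (n x), (arFilter φ (e x) t
        + arFilter φ g t) ^ 2 := by
      rw [ssr_eq_crit p hν hp, crit]
      refine le_add_of_le_of_nonneg (le_of_eq ?_) (mul_nonneg (inv_nonneg.2 hν.le)
        (Finset.sum_nonneg fun _ _ => sq_nonneg _))
      refine Finset.sum_congr rfl fun t _ => ?_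
      rw [← arFilter_add]
      congr 2
      funext t
      rw [hX, hg, misfit]; ring
    have k2 : ∑ t ∈ win p (n x), (arFilter φ (e x) t + arFilter φ g t) ^ 2
        = ∑ t ∈ win p (n x), arFilter φ (e x) t ^ 2 + ∑ t ∈ win p (n x), arFilter φ g t ^ 2
          + 2 * ∑ t ∈ win p (n x), arFilter φ (e x) t * arFilter φ g t := by
      rw [Finset.mul_sum, ← Finset.sum_add_distrib, ← Finset.sum_add_distrib]
      exact Finset.sum_congr rfl fun t _ => by ring
    have k3 : ∑ t ∈ win p (n x), arFilter φ (e x) t * arFilter φ g t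
        = ∑ t ∈ win p (n x), arFilter φ (e x) t * arFilter φ (fitFn c₀ (n x) s₀ μ₀) t
          - ∑ t ∈ win p (n x), arFilter φ (e x) t * arFilter φ (seasonFn sh) t
          - ∑ t ∈ win p (n x), arFilter φ (e x) t * arFilter φ (regimeFn (c x) (n x) mh) t := by
      rw [← Finset.sum_sub_distrib, ← Finset.sum_sub_distrib]
      refine Finset.sum_congr rfl fun t _ => ?_
      have : arFilter φ g t = arFilter φ (fitFn c₀ (n x) s₀ μ₀) t
          - (arFilter φ (seasonFn sh) t + arFilter φ (regimeFn (c x) (n x) mh) t) := by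
        rw [← arFilter_add, ← arFilter_sub]; rfl
      rw [this]; ring
    have j1 := abs_sum_arFilter_mul_le (N := n x) φ φ (f := e x) (g := fitFn c₀ (n x) s₀ μ₀)
      fun i hi j hj => q.abs_lagProd_fitFn_le hT c₀ s₀ μ₀ hs₀ hμ₀ hi hj
    have j2 := abs_sum_arFilter_mul_periodic_le hT q φ (periodicFrom_arFilter_seasonFn hT φ sh) b1
    have j3 := abs_sum_arFilter_mul_le (N := n x) φ φ (f := e x) (g := regimeFn (c x) (n x) mh)
      (B := 2 * M * W * Q x) fun i hi j hj =>
        (q.abs_lagProd_regimeFn_le (c x) mh b2 hi hj).trans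
          (mul_le_mul_of_nonneg_right (mul_le_mul_of_nonneg_right (by linarith) hW) q.nonneg)
    have hAx : arNorm φ = A x := rfl
    rw [hAx] at j1 j2 j3
    rw [abs_le] at j1 j2 j3
    linarith [j1.1, j2.2, j3.2]

/-- The second order expansion around `φ'`. The linear term is the defect of `φ'` in the Yule-Walker
equations, and the quadratic term is a sum of squares. -/
lemma sum_arFilter_sq_sub (N : ℕ) (φ φ' : Fin p → ℝ) (f : ℕ → ℝ) :
    ∑ t ∈ win p N, arFilter φ f t ^ 2 = ∑ t ∈ win p N, arFilter φ' f t ^ 2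
      - 2 * ∑ i : Fin p, (φ i - φ' i) * ∑ j, arVec φ' j * lagProd p N f f ((i : ℕ) + 1) j
      + ∑ i, ∑ j, (arVec φ i - arVec φ' i) * (arVec φ j - arVec φ' j)
          * lagProd p N f f (i : ℕ) (j : ℕ) := by
  have h1 := sum_sq_arFilter_sub N φ φ' f
  have h2 : ∑ i, ∑ j, (arVec φ i - arVec φ' i) * (arVec φ j - arVec φ' j)
      * lagProd p N f f (i : ℕ) (j : ℕ) = ∑ i : Fin p, -(φ i - φ' i)
        * (∑ j, arVec φ j * lagProd p N f f ((i : ℕ) + 1) j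
          - ∑ j, arVec φ' j * lagProd p N f f ((i : ℕ) + 1) j) := by
    rw [Fin.sum_univ_succ]
    simp only [arVec_zero, sub_self, zero_mul, Finset.sum_const_zero, zero_add, arVec_succ,
      Fin.val_succ]
    refine Finset.sum_congr rfl fun i _ => ?_
    rw [← Finset.sum_sub_distrib, Finset.mul_sum]
    exact Finset.sum_congr rfl fun j _ => by ring
  rw [h2, ← sub_eq_zero]
  have h3 : ∑ t ∈ win p N, arFilter φ f t ^ 2 = ∑ t ∈ win p N, arFilter φ' f t ^ 2
      + ∑ i : Fin p, -(φ i - φ' i) * (∑ j, arVec φ j * lagProd p N f f ((i : ℕ) + 1) j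
          + ∑ j, arVec φ' j * lagProd p N f f ((i : ℕ) + 1) j) := by linarith
  rw [h3, Finset.mul_sum]
  have h4 : ∀ a b c d : ℝ, a + b - (a - c + d) = b + c - d := fun a b c d => by ring
  rw [h4, ← Finset.sum_add_distrib, ← Finset.sum_sub_distrib]
  exact Finset.sum_eq_zero fun i _ => by ring

/-- A configuration whose residual sum of squares does not exceed that of the noise has a
consistent Yule-Walker estimator and a small misfit. -/
lemma wellFitting_consistent (reg : Regular L p T φ₀ σsq Γ n e) [L.NeBot] (hT : 0 < T) (hν : 0 < ν)
    (hc₀ : WellSpaced L p T n fun _ => c₀)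
    (hX : ∀ x t, X x t = fitFn c₀ (n x) s₀ μ₀ t + e x t) (hc : WellSpaced L p T n c)
    (hm : ∀ᶠ x in L, (c x).m ≤ M)
    (hφ : Tendsto (fun x => yuleWalker p T (n x) (c x) (X x)) L (𝓝 φs)) (h1 : arOne φs ≠ 0)
    {E : ι → ℝ} (hE : E =o[L] fun x => scA (n x))
    (hssr : ∀ᶠ x in L, ssr p ν T (n x) (c x) (X x)
      ≤ ∑ t ∈ win p (n x), arFilter φ₀ (e x) t ^ 2 + E x) :
    φs = φ₀ ∧
      ((fun x => ∑ t ∈ win p (n x), arFilter (yuleWalker p T (n x) (c x) (X x))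
          (misfit p ν (n x) c₀ s₀ μ₀ (c x) (X x)) t ^ 2) =o[L] fun x => scA (n x)) ∧
      (fun x => ssr p ν T (n x) (c x) (X x) - ∑ t ∈ win p (n x), arFilter φ₀ (e x) t ^ 2)
        =o[L] fun x => scA (n x) := by
  have hn := reg.n_tendsto
  have hlin : ∀ᶠ x in L, ssr p ν T (n x) (c x) (X x) ≤ (σsq + 2) * n x := by
    filter_upwards [hssr, reg.innov.eventually_lt_const (lt_add_one σsq),
      isLittleO_iff.1 (hE.trans (scA_o_n hn)) one_pos, hn.eventually_gt_atTop 0] with x x1 x2 x3 x4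
    have hn0 : (0 : ℝ) < n x := by exact_mod_cast x4
    rw [div_lt_iff₀ hn0] at x2
    rw [one_mul, Real.norm_eq_abs, Real.norm_of_nonneg hn0.le] at x3
    linarith [le_abs_self (E x)]
  obtain ⟨E', hE', hlow⟩ := ssr_lower reg hT hν hc₀ hX hc hm hφ h1 hlin
  set φ : ι → Fin p → ℝ := fun x => yuleWalker p T (n x) (c x) (X x) with hφd
  set θo : ι → ℝ := fun x => ∑ i : Fin p, (φ x i - φ₀ i)
    * ∑ j, arVec φ₀ j * lagProd p (n x) (e x) (e x) ((i : ℕ) + 1) j with hθo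
  have hθ : θo =o[L] fun x => scA (n x) := by
    refine isLittleO_fun_sum fun i _ => ?_
    have : (fun x => φ x i - φ₀ i) =O[L] fun _ => (1 : ℝ) :=
      ((tendsto_pi_nhds.1 hφ i).sub_const (φ₀ i)).isBigO_one ℝ
    simpa only [one_mul] using this.mul_isLittleO (reg.orth i)
  set q : ι → ℝ := fun x => ∑ i, ∑ j, (arVec (φ x) i - arVec φ₀ i) * (arVec (φ x) j - arVec φ₀ j)
    * lagProd p (n x) (e x) (e x) (i : ℕ) (j : ℕ) with hq
  have hq0 : ∀ x, 0 ≤ q x := fun x => by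
    simp only [hq]
    rw [sum_mul_lagProd_eq (n x) (fun i => arVec (φ x) i - arVec φ₀ i)]
    exact Finset.sum_nonneg fun _ _ => sq_nonneg _
  set G : ι → ℝ := fun x => ∑ t ∈ win p (n x), arFilter (φ x)
    (misfit p ν (n x) c₀ s₀ μ₀ (c x) (X x)) t ^ 2 with hG
  have hG0 : ∀ x, 0 ≤ G x := fun x => Finset.sum_nonneg fun _ _ => sq_nonneg _
  -- The upper bound for the residual sum of squares and the lower bound of `ssr_lower` leave o(√(n
  -- log n)) for two nonnegative quantities: the excess `q` due to a wrong filter and the misfit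
  -- `G`.
  have hsum : ∀ᶠ x in L, q x + G x ≤ E' x + E x + 2 * θo x ∧
      |ssr p ν T (n x) (c x) (X x) - ∑ t ∈ win p (n x), arFilter φ₀ (e x) t ^ 2|
        ≤ |E x| + |E' x| + 2 * |θo x| := by
    filter_upwards [hssr, hlow] with x x1 x2
    have x3 := sum_arFilter_sq_sub (n x) (φ x) φ₀ (e x)
    have x4 : ∑ t ∈ win p (n x), arFilter (φ x) (e x) t ^ 2
        = ∑ t ∈ win p (n x), arFilter φ₀ (e x) t ^ 2 - 2 * θo x + q x := x3
    have x5 : ∑ t ∈ win p (n x), arFilter (φ x) (e x) t ^ 2 + G x - E' x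
        ≤ ssr p ν T (n x) (c x) (X x) := x2
    have y1 := hq0 x
    have y2 := hG0 x
    refine ⟨by linarith, ?_⟩
    rw [abs_le]
    constructor <;> linarith [le_abs_self (E x), le_abs_self (E' x), le_abs_self (θo x),
      abs_nonneg (E x), abs_nonneg (E' x), abs_nonneg (θo x)]
  have ho := (hE'.add hE).add (hθ.const_mul_left 2)
  have hqo : q =o[L] fun x => scA (n x) := littleO_of_abs_le ho (hsum.mono fun x hx => by
    rw [abs_of_nonneg (hq0 x)]; linarith [hx.1, hG0 x])
  refine ⟨?_, littleO_of_abs_le ho (hsum.mono fun x hx => ?_), ?_⟩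
  -- Divided by n, the excess tends to the form of Γ at the difference of the two filters, and also
  -- to 0; positive definiteness identifies the limit.
  · have h2 : Tendsto (fun x => q x / n x) L (𝓝 (∑ i, ∑ j, (arVec φs i - arVec φ₀ i)
        * (arVec φs j - arVec φ₀ j) * Γ i j)) := by
      have h3 : ∀ i, Tendsto (fun x => arVec (φ x) i - arVec φ₀ i) L
          (𝓝 (arVec φs i - arVec φ₀ i)) := fun i =>
        (tendsto_pi_nhds.1 ((continuous_arVec.tendsto φs).comp hφ) i).sub_const _
      have h4 : Tendsto (fun x => ∑ i, ∑ j, (arVec (φ x) i - arVec φ₀ i)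
          * (arVec (φ x) j - arVec φ₀ j) * (lagProd p (n x) (e x) (e x) i j / n x)) L
          (𝓝 (∑ i, ∑ j, (arVec φs i - arVec φ₀ i) * (arVec φs j - arVec φ₀ j) * Γ i j)) :=
        tendsto_finsetSum _ fun i _ => tendsto_finsetSum _ fun j _ =>
          ((h3 i).mul (h3 j)).mul (reg.gram i j)
      refine h4.congr fun x => ?_
      simp only [hq, Finset.sum_div, mul_div_assoc]
    have h5 := tendsto_nhds_unique h2 (tendsto_div_n_of_o (hqo.trans (scA_o_n hn)))
    obtain ⟨γ, hγ, hpd⟩ := reg.posDef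
    have h6 := hpd fun i => arVec φs i - arVec φ₀ i
    rw [h5] at h6
    have h7 : ∑ i, (arVec φs i - arVec φ₀ i) ^ 2 = 0 :=
      le_antisymm (by nlinarith) (Finset.sum_nonneg fun _ _ => sq_nonneg _)
    rw [Finset.sum_eq_zero_iff_of_nonneg fun _ _ => sq_nonneg _] at h7
    funext i
    have := h7 i.succ (Finset.mem_univ _)
    rw [sq_eq_zero_iff, arVec_succ, arVec_succ] at this
    linarith
  · rw [abs_of_nonneg (hG0 x)]; linarith [hx.1, hq0 x]
  · refine littleO_of_abs_le ?_ (hsum.mono fun x hx => hx.2)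
    exact (hE.norm_left.add hE'.norm_left).add (hθ.norm_left.const_mul_left 2)

end WellFitting

/-! ### The penalty of a configuration -/

section Penalty

variable {ι : Type*} {L : Filter ι} {p T M : ℕ} {φs : Fin p → ℝ} {a b₁ b₂ ν : ℝ}
  {n : ι → ℕ} {X : ι → ℕ → ℝ} {c : ι → Config}

/-- The part of the BMDL which comes from the prior of the regime means. -/
def meanPenalty (p : ℕ) (ν : ℝ) (T N : ℕ) (x : ℕ → ℝ) (c : Config) : ℝ :=
  (c.m : ℝ) / 2 * Real.log ν + 1 / 2 * Real.log (ridgeGram ν N c (yuleWalker p T N c x)).det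

lemma bmdl_eq_add {N : ℕ} (hN : p ≤ N) (T : ℕ) (a b₁ b₂ ν : ℝ) (doc : Finset ℕ) (x : ℕ → ℝ)
    (c : Config) :
    bmdl p T a b₁ b₂ ν N doc x c = ((N : ℝ) - p) / 2 * Real.log (varHat p ν T N c x)
      + meanPenalty p ν T N x c - gammaPart p a b₁ b₂ N doc c := by
  rw [bmdl_eq hN, meanPenalty]; ring

lemma det_ridgeGram_pos (hν : 0 < ν) (N : ℕ) (c : Config) (φ : Fin p → ℝ) :
    0 < (ridgeGram ν N c φ).det :=
  (pow_pos (inv_pos.2 hν) _).trans_le (inv_pow_le_det_ridgeGram hν N c φ)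

/-- The eigenvalues of the ridge matrix are at least ν⁻¹, which exactly compensates the term with
log ν. -/
lemma meanPenalty_nonneg (p : ℕ) (hν : 0 < ν) (T N : ℕ) (x : ℕ → ℝ) (c : Config) :
    0 ≤ meanPenalty p ν T N x c := by
  have h := Real.log_le_log (pow_pos (inv_pos.2 hν) _)
    (inv_pow_le_det_ridgeGram hν N c (yuleWalker p T N c x))
  rw [Real.log_pow, Real.log_inv] at h
  rw [meanPenalty]; linarith

lemma meanPenalty_le (hν : 0 < ν) (hn : Tendsto n L atTop) (hm : ∀ᶠ x in L, (c x).m ≤ M)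
    (hφ : Tendsto (fun x => yuleWalker p T (n x) (c x) (X x)) L (𝓝 φs)) :
    ∃ C, ∀ᶠ x in L, meanPenalty p ν T (n x) (X x) (c x)
      ≤ C + (c x).m / 2 * Real.log (n x) := by
  obtain ⟨K, hK⟩ := (arNorm_isBigO_one hφ).bound
  set K₂ := K ^ 2 + ν⁻¹ with hK₂
  have hK0 : 0 < K₂ := by have := inv_pos.2 hν; positivity
  refine ⟨M * |Real.log ν| + (Real.log M.factorial + M * |Real.log K₂|), ?_⟩
  filter_upwards [hm, hK, hn.eventually_ge_atTop 1] with x x1 x2 x3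
  set φ := yuleWalker p T (n x) (c x) (X x) with hφd
  have hA0 : 0 ≤ arNorm φ := zero_le_one.trans (one_le_arNorm φ)
  rw [norm_one, mul_one, Real.norm_of_nonneg hA0] at x2
  have hn1 : (1 : ℝ) ≤ n x := by exact_mod_cast x3
  have hn0 : (0 : ℝ) < n x := by linarith
  have hmM : ((c x).m : ℝ) ≤ M := by exact_mod_cast x1
  have hm0 : (0 : ℝ) ≤ (c x).m := Nat.cast_nonneg _
  have d1 : (ridgeGram ν (n x) (c x) φ).det ≤ M.factorial * (K₂ * n x) ^ (c x).m := by
    refine (det_ridgeGram_le hν (n x) (c x) φ).trans ?_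
    refine mul_le_mul (by exact_mod_cast Nat.factorial_le x1) ?_ (by
      have := inv_pos.2 hν; positivity) (by positivity)
    refine pow_le_pow_left₀ (by have := inv_pos.2 hν; positivity) ?_ _
    have y1 := pow_le_pow_left₀ hA0 x2 2
    have y2 : ν⁻¹ ≤ ν⁻¹ * n x := le_mul_of_one_le_right (inv_pos.2 hν).le hn1
    rw [hK₂]; nlinarith
  have d2 := Real.log_le_log (det_ridgeGram_pos hν (n x) (c x) φ) d1
  rw [Real.log_mul (by positivity) (by positivity), Real.log_pow,
    Real.log_mul hK0.ne' hn0.ne'] at d2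
  have d3 : (c x).m * Real.log K₂ ≤ M * |Real.log K₂| :=
    (mul_le_mul_of_nonneg_left (le_abs_self _) hm0).trans
      (mul_le_mul_of_nonneg_right hmM (abs_nonneg _))
  have d4 : (c x).m * Real.log ν ≤ M * |Real.log ν| :=
    (mul_le_mul_of_nonneg_left (le_abs_self _) hm0).trans
      (mul_le_mul_of_nonneg_right hmM (abs_nonneg _))
  have d5 : 0 ≤ (M : ℝ) * |Real.log ν| := by positivity
  have d6 : 0 ≤ (M : ℝ) * |Real.log K₂| := by positivity
  have d7 : 0 ≤ Real.log M.factorial := Real.log_natCast_nonneg _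
  rw [meanPenalty, ← hφd]
  nlinarith

/-- Together with `meanPenalty_le` this puts the price of a changepoint at (1/2) log n up to
constants. The lower bound needs `arOne φs ≠ 0`, since otherwise the filtered regime indicators
could be too small. -/
lemma le_meanPenalty (hT : 0 < T) (hν : 0 < ν) (hn : Tendsto n L atTop)
    (hm : ∀ᶠ x in L, (c x).m ≤ M)
    (hc : WellSpaced L p T n c)
    (hφ : Tendsto (fun x => yuleWalker p T (n x) (c x) (X x)) L (𝓝 φs)) (h1 : arOne φs ≠ 0) :
    ∃ C, ∀ᶠ x in L, (c x).m / 2 * Real.log (n x) - C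
      ≤ meanPenalty p ν T (n x) (X x) (c x) := by
  obtain ⟨κ, hκ, hs⟩ := hc
  set q := |arOne φs| / 2 with hq
  have hq0 : 0 < q := by have := abs_pos.2 h1; positivity
  have e1 : ∀ᶠ x in L, q ≤ |arOne (yuleWalker p T (n x) (c x) (X x))| := by
    have := ((continuous_arOne.tendsto φs).comp hφ).abs
    exact (this.eventually_const_lt (show q < |arOne φs| by have := abs_pos.2 h1; linarith)).mono
      fun x hx => hx.le
  set κ₁ := κ * q ^ 2 / (4 * (M + 1)) with hκ₁
  have hκ₁0 : 0 < κ₁ := by positivity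
  refine ⟨M * |Real.log ν| + M * |Real.log κ₁|, ?_⟩
  filter_upwards [hm, e1, hs, hn.eventually_ge_atTop 1] with x x1 x2 x3 x4
  obtain ⟨k, hk0, hk, hsp⟩ := x3
  set φ := yuleWalker p T (n x) (c x) (X x) with hφd
  have hn0 : (0 : ℝ) < n x := by exact_mod_cast x4
  have hmM : ((c x).m : ℝ) ≤ M := by exact_mod_cast x1
  have hm0 : (0 : ℝ) ≤ (c x).m := Nat.cast_nonneg _
  have d1 : (κ₁ * n x) ^ (c x).m ≤ (ridgeGram ν (n x) (c x) φ).det := by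
    refine le_trans ?_ (hsp.pow_le_det_ridgeGram hν (n := k) (by
      have := Nat.le_mul_of_pos_right k hT; omega) φ)
    refine pow_le_pow_left₀ (by positivity) ?_ _
    rw [hκ₁, div_mul_eq_mul_div]
    have y1 : q ^ 2 ≤ arOne φ ^ 2 := by
      have := pow_le_pow_left₀ hq0.le x2 2
      rwa [sq_abs] at this
    refine div_le_div₀ (by positivity) ?_ (by positivity) (by linarith)
    calc κ * q ^ 2 * n x = κ * n x * q ^ 2 := by ring
      _ ≤ k * arOne φ ^ 2 := mul_le_mul hk y1 (sq_nonneg _) (Nat.cast_nonneg _)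
  have d2 := Real.log_le_log (by positivity) d1
  rw [Real.log_pow, Real.log_mul hκ₁0.ne' hn0.ne'] at d2
  have d3 : (c x).m * (-Real.log κ₁) ≤ M * |Real.log κ₁| :=
    (mul_le_mul_of_nonneg_left (neg_le_abs _) hm0).trans
      (mul_le_mul_of_nonneg_right hmM (abs_nonneg _))
  have d4 : (c x).m * (-Real.log ν) ≤ M * |Real.log ν| :=
    (mul_le_mul_of_nonneg_left (neg_le_abs _) hm0).trans
      (mul_le_mul_of_nonneg_right hmM (abs_nonneg _))
  have d5 : 0 ≤ (M : ℝ) * |Real.log ν| := by positivity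
  have d6 : 0 ≤ (M : ℝ) * |Real.log κ₁| := by positivity
  rw [meanPenalty, ← hφd]
  nlinarith

lemma betaLog_sub_le_log {a b : ℝ} (ha : 0 < a) (hb : 0 < b) {k m m' M N : ℕ}
    (hm : m ≤ k) (hM : m ≤ M) (hm' : m' ≤ k) (hM' : m' ≤ M) (hk : k ≤ N) (hN : 1 ≤ N) :
    betaLog a b k m - betaLog a b k m' ≤ M * (|Real.log (b / (a + M))|
      + |Real.log (b / a)| + Real.log (1 + b⁻¹)) + M * Real.log N := by
  have h1 := (le_abs_self _).trans (abs_betaLog_sub_le ha hb hm hM hm' hM')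
  have hN1 : (1 : ℝ) ≤ N := by exact_mod_cast hN
  have hkN : (k : ℝ) ≤ N := by exact_mod_cast hk
  have hb' := inv_pos.2 hb
  have h2 : |Real.log ((b + k) / a)| ≤ |Real.log (b / a)| + (Real.log (1 + b⁻¹) + Real.log N) := by
    have e : (b + k) / a = b / a * (1 + b⁻¹ * k) := by field_simp
    have hpos : (1 : ℝ) ≤ 1 + b⁻¹ * k := by
      have : 0 ≤ b⁻¹ * (k : ℝ) := by positivity
      linarith
    rw [e, Real.log_mul (by positivity) (by positivity)]
    refine (abs_add_le _ _).trans (add_le_add_right ?_ _)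
    rw [abs_of_nonneg (Real.log_nonneg hpos), ← Real.log_mul (by positivity) (by positivity)]
    refine Real.log_le_log (by positivity) ?_
    nlinarith [mul_le_mul_of_nonneg_left hkN hb'.le]
  have h3 := mul_le_mul_of_nonneg_left h2 (Nat.cast_nonneg (α := ℝ) M)
  nlinarith

lemma cpDoc_le_m (N : ℕ) (doc : Finset ℕ) (c : Config) : cpDoc N doc c ≤ c.m := by
  have := cpDoc_add_cpUndoc N doc c; omega

lemma cpUndoc_le_m (N : ℕ) (doc : Finset ℕ) (c : Config) : cpUndoc N doc c ≤ c.m := by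
  have := cpDoc_add_cpUndoc N doc c; omega

/-- A crude bound without any relation between the configurations. A loss of order log n is harmless
at the stage where only o(√(n log n)) is claimed. -/
lemma exists_gammaPart_sub_le (p M : ℕ) (ha : 0 < a) (hb₁ : 0 < b₁) (hb₂ : 0 < b₂) :
    ∃ C, ∀ {N ρ : ℕ} {c c' : Config} (doc : Finset ℕ), 1 ≤ N → p < ρ → Spaced c N ρ →
      Spaced c' N ρ → c.m ≤ M → c'.m ≤ M →
      gammaPart p a b₁ b₂ N doc c - gammaPart p a b₁ b₂ N doc c' ≤ C + 2 * M * Real.log N := by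
  refine ⟨M * (|Real.log (b₁ / (a + M))| + |Real.log (b₁ / a)| + Real.log (1 + b₁⁻¹))
    + M * (|Real.log (b₂ / (a + M))| + |Real.log (b₂ / a)| + Real.log (1 + b₂⁻¹)), ?_⟩
  intro N ρ c c' doc hN hρ hc hc' hm hm'
  have h1 := betaLog_sub_le_log ha hb₁ (N := N) (hc.cpUndoc_le hρ doc)
    ((cpUndoc_le_m N doc c).trans hm) (hc'.cpUndoc_le hρ doc)
    ((cpUndoc_le_m N doc c').trans hm') (by omega) hN
  have h2 := betaLog_sub_le_log ha hb₂ (N := N) (hc.cpDoc_le hρ doc)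
    ((cpDoc_le_m N doc c).trans hm) (hc'.cpDoc_le hρ doc)
    ((cpDoc_le_m N doc c').trans hm') ((numDoc_le p N doc).trans (by omega)) hN
  rw [gammaPart, gammaPart]
  linarith

/-- The sharper bound for deleting changepoints: no log n is lost, so the Gamma part cannot offset
the saving of (1/2) log n in the determinant. -/
lemma exists_neg_le_gammaPart_sub (p M : ℕ) (ha : 0 < a) (hb₁ : 0 < b₁) (hb₂ : 0 < b₂) :
    ∃ C, ∀ {N ρ : ℕ} {c c' : Config} (doc : Finset ℕ), p < ρ → Spaced c N ρ → c.m ≤ M →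
      cpDoc N doc c' ≤ cpDoc N doc c → cpUndoc N doc c' ≤ cpUndoc N doc c →
      -C ≤ gammaPart p a b₁ b₂ N doc c' - gammaPart p a b₁ b₂ N doc c := by
  refine ⟨M * |Real.log (b₁ / (a + M))| + M * |Real.log (b₂ / (a + M))|, ?_⟩
  intro N ρ c c' doc hρ hc hm h1 h2
  have h3 := neg_le_betaLog_sub ha hb₁ h2 (hc.cpUndoc_le hρ doc) ((cpUndoc_le_m N doc c).trans hm)
  have h4 := neg_le_betaLog_sub ha hb₂ h1 (hc.cpDoc_le hρ doc) ((cpDoc_le_m N doc c).trans hm)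
  rw [gammaPart, gammaPart]
  linarith

end Penalty

/-! ### Comparison of a minimizer with the true configuration -/

section Compare

variable {ι : Type*} {L : Filter ι} {p T M : ℕ} {φ₀ φs : Fin p → ℝ} {σsq a b₁ b₂ ν : ℝ}
  {Γ : Matrix (Fin (p + 1)) (Fin (p + 1)) ℝ} {n : ι → ℕ} {e X : ι → ℕ → ℝ} {Ψ : ℝ}
  {c₀ : Config} {s₀ : Fin T → ℝ} {μ₀ : Fin c₀.m → ℝ} {c : ι → Config} {doc : ι → Finset ℕ}

lemma varHat_nonneg (p : ℕ) (hν : 0 < ν) {N : ℕ} (hN : p < N) (T : ℕ) (c : Config) (x : ℕ → ℝ) :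
    0 ≤ varHat p ν T N c x := by
  have h1 := ssr_eq_crit (T := T) p hν hN c x
  have h2 := crit_nonneg hν N c (yuleWalker p T N c x) x (seasonHat p ν T N c x)
    (regimeHat p ν T N c x)
  rw [← h1, ssr] at h2
  have h3 : (0 : ℝ) < (N : ℝ) - p := sub_pos.2 (by exact_mod_cast hN)
  exact nonneg_of_mul_nonneg_right h2 h3

lemma varHat_tendsto_of_ssr (reg : Regular L p T φ₀ σsq Γ n e)
    (h : (fun x => ssr p ν T (n x) (c x) (X x) - ∑ t ∈ win p (n x), arFilter φ₀ (e x) t ^ 2)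
      =o[L] fun x => (n x : ℝ)) :
    Tendsto (fun x => varHat p ν T (n x) (c x) (X x)) L (𝓝 σsq) := by
  have hn := reg.n_tendsto
  have h1 := (tendsto_div_n_of_o h).add reg.innov
  rw [zero_add] at h1
  have h2 : Tendsto (fun x => ((n x : ℝ) - p) / n x) L (𝓝 1) := by
    have h3 : Tendsto (fun x => (p : ℝ) / n x) L (𝓝 0) :=
      (tendsto_const_nhds (x := (p : ℝ))).div_atTop (tendsto_natCast_atTop_atTop.comp hn)
    have h4 := h3.const_sub 1
    rw [sub_zero] at h4
    refine h4.congr' ?_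
    filter_upwards [hn.eventually_gt_atTop 0] with x hx
    have : (n x : ℝ) ≠ 0 := by positivity
    field_simp
  have h5 := h1.div h2 one_ne_zero
  rw [div_one] at h5
  refine h5.congr' ?_
  filter_upwards [hn.eventually_gt_atTop p] with x hx
  have hn0 : (n x : ℝ) ≠ 0 := by
    have : n x ≠ 0 := by omega
    exact_mod_cast this
  have hp0 : (n x : ℝ) - p ≠ 0 := (sub_pos.2 (by exact_mod_cast hx)).ne'
  simp only [Pi.div_apply]
  rw [← add_div, sub_add_cancel, ssr]
  field_simp

/-- The true configuration is a reference without misfit. -/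
lemma ref_true (hc₀ : WellSpaced L p T n fun _ => c₀)
    (hm₀ : c₀.m ≤ M) (hX : ∀ x t, X x t = fitFn c₀ (n x) s₀ μ₀ t + e x t) :
    Ref L p T M ‖μ₀‖ n e (fun _ _ => 0) X (fun _ => c₀) (fun _ => s₀) fun _ => μ₀ where
  m_le := Eventually.of_forall fun _ => hm₀
  spaced := hc₀
  close := by simp
  cross := ⟨fun _ => 0, isLittleO_zero _ L, Eventually.of_forall fun x i _ j _ => by
    simp [lagProd]⟩
  bdd := Eventually.of_forall fun x t _ _ => by simp
  mean_bdd := Eventually.of_forall fun x k => norm_le_pi_norm μ₀ k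
  data := fun x t => by rw [hX, add_zero]

/-- A minimizer of the BMDL has a residual sum of squares which hardly exceeds that of the
noise. -/
lemma ssr_minimizer_le (reg : Regular L p T φ₀ σsq Γ n e) (hσ : 0 < σsq) (hT : 0 < T) (hν : 0 < ν)
    (ha : 0 < a) (hb₁ : 0 < b₁) (hb₂ : 0 < b₂)
    (hΨ : 0 < Ψ) (hst : SeasonStable T φ₀ Ψ) (h1 : arOne φ₀ ≠ 0)
    {d : ℝ} (hd : 0 < d) (hc₀ : c₀ ∈ admissible M d)
    (hX : ∀ x t, X x t = fitFn c₀ (n x) s₀ μ₀ t + e x t)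
    (hc : ∀ᶠ x in L, IsBMDLMin p T a b₁ b₂ ν M d (n x) (doc x) (X x) (c x)) :
    ∃ E : ι → ℝ, (E =o[L] fun x => scA (n x)) ∧ ∀ᶠ x in L, ssr p ν T (n x) (c x) (X x)
      ≤ ∑ t ∈ win p (n x), arFilter φ₀ (e x) t ^ 2 + E x := by
  have hn := reg.n_tendsto
  have hw₀ : WellSpaced L p T n fun _ => c₀ :=
    wellSpaced_of_admissible hT hd hn (Eventually.of_forall fun _ => hc₀)
  have ref := ref_true hw₀ hc₀.1 hX
  have hssr := ref.ssr_sub_innov reg hT hν hΨ hst h1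
  have hv := varHat_tendsto_of_ssr (ν := ν) (c := fun _ => c₀) (X := X) reg
    (hssr.trans (log_o_n hn))
  obtain ⟨C₁, hC₁⟩ := meanPenalty_le (M := M) (X := X) hν hn (c := fun _ => c₀)
    (Eventually.of_forall fun _ => hc₀.1) (ref.yuleWalker_tendsto reg hT)
  obtain ⟨C₂, hC₂⟩ := exists_gammaPart_sub_le p M ha hb₁ hb₂
  set C : ℝ := |C₁| + M + |C₂| + 2 * M with hCd
  have hC0 : 0 ≤ C := by positivity
  refine ⟨fun x => (ssr p ν T (n x) c₀ (X x) - ∑ t ∈ win p (n x), arFilter φ₀ (e x) t ^ 2)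
    + 4 * C * (σsq + 1) * Real.log (n x), ?_, ?_⟩
  · exact (hssr.trans (log_o_scA hn)).add ((log_o_scA hn).const_mul_left _)
  have hlog1 := isLittleO_iff.1 (one_o_log hn) one_pos
  have hu : Tendsto (fun x => 2 * C * Real.log (n x) / ((n x : ℝ) - p)) L (𝓝 0) := by
    refine IsLittleO.tendsto_div_nhds_zero ?_
    refine ((log_o_n hn).const_mul_left (2 * C)).trans_isBigO ?_
    refine IsBigO.of_bound 2 ?_
    filter_upwards [hn.eventually_ge_atTop (2 * p)] with x hx
    have hx' : (2 : ℝ) * p ≤ n x := by exact_mod_cast hx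
    have hp0 : (0 : ℝ) ≤ p := Nat.cast_nonneg _
    rw [Real.norm_of_nonneg (Nat.cast_nonneg _), Real.norm_of_nonneg (by linarith)]
    linarith
  have hspc : ∀ᶠ x in L, (((p + 1 : ℕ) : ℝ) + 2) ≤ d * n x :=
    ((tendsto_natCast_atTop_atTop.comp hn).const_mul_atTop hd).eventually_ge_atTop _
  filter_upwards [hc, hC₁, hlog1, hspc, hv.eventually_lt_const (lt_add_one σsq),
    hv.eventually_const_lt hσ, hu.eventually_lt_const one_pos, hn.eventually_gt_atTop p]
    with x x1 x2 x3 x4 x5 x6 x7 hp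
  have hp0 : (0 : ℝ) < (n x : ℝ) - p := sub_pos.2 (by exact_mod_cast hp)
  have hlog0 := log_nat_nonneg (n x)
  rw [norm_one, one_mul, Real.norm_of_nonneg hlog0] at x3
  suffices h : ssr p ν T (n x) (c x) (X x)
      ≤ ssr p ν T (n x) c₀ (X x) + 4 * C * (σsq + 1) * Real.log (n x) by linarith
  have hrhs : 0 ≤ ssr p ν T (n x) c₀ (X x) + 4 * C * (σsq + 1) * Real.log (n x) := by
    have := mul_pos hp0 x6
    rw [ssr]
    positivity
  -- If the variance estimate vanishes, its logarithm is 0 by convention and minimality says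
  -- nothing; but then the residual sum of squares is 0 and the bound is trivial.
  rcases (varHat_nonneg p hν hp T (c x) (X x)).eq_or_lt with h0 | h0
  · rw [ssr, ← h0, mul_zero]; exact hrhs
  have k1 := x1.2 c₀ hc₀
  rw [bmdl_eq_add hp.le, bmdl_eq_add hp.le] at k1
  have k2 := meanPenalty_nonneg p hν T (n x) (X x) (c x)
  have k3 := hC₂ (doc x) (by omega) (lt_add_one p) (spaced_of_admissible hd x1.1 x4)
    (spaced_of_admissible hd hc₀ x4) x1.1.1 hc₀.1
  have hmM : (c₀.m : ℝ) ≤ M := by exact_mod_cast hc₀.1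
  have k4 : (c₀.m : ℝ) / 2 * Real.log (n x) ≤ M * Real.log (n x) :=
    mul_le_mul_of_nonneg_right (by linarith [Nat.cast_nonneg (α := ℝ) M]) hlog0
  have k5 : C₁ ≤ |C₁| * Real.log (n x) :=
    (le_abs_self _).trans (le_mul_of_one_le_right (abs_nonneg _) x3)
  have k6 : C₂ ≤ |C₂| * Real.log (n x) :=
    (le_abs_self _).trans (le_mul_of_one_le_right (abs_nonneg _) x3)
  have k7 : ((n x : ℝ) - p) / 2 * Real.log (varHat p ν T (n x) (c x) (X x))
      ≤ ((n x : ℝ) - p) / 2 * Real.log (varHat p ν T (n x) c₀ (X x)) + C * Real.log (n x) := by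
    rw [hCd]; linarith
  set v := varHat p ν T (n x) (c x) (X x)
  set v₀ := varHat p ν T (n x) c₀ (X x)
  set u := 2 * C * Real.log (n x) / ((n x : ℝ) - p) with hud
  have hu0 : 0 ≤ u := by positivity
  have k8 : Real.log v ≤ Real.log v₀ + u := by
    have : ((n x : ℝ) - p) / 2 * u = C * Real.log (n x) := by rw [hud]; field_simp
    rw [← this, ← mul_add] at k7
    exact le_of_mul_le_mul_left k7 (by positivity)
  have k9 : v ≤ v₀ * Real.exp u := by
    rw [Real.log_le_iff_le_exp h0, Real.exp_add, Real.exp_log x6] at k8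
    exact k8
  -- Since `u` tends to 0, exponentiating the bound on the logarithms costs a factor 2 only, and the
  -- multiplicative error becomes an additive one of order log n.
  have k10 : Real.exp u - 1 ≤ 2 * u := by
    have := Real.abs_exp_sub_one_le (x := u) (by rw [abs_of_nonneg hu0]; exact x7.le)
    rw [abs_of_nonneg hu0] at this
    exact (le_abs_self _).trans this
  rw [ssr, ssr]
  have k11 : v ≤ v₀ + v₀ * (2 * u) := by nlinarith
  have k12 : ((n x : ℝ) - p) * (v₀ * (2 * u)) = v₀ * (4 * C * Real.log (n x)) := by
    rw [hud]; field_simp; ring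
  calc ((n x : ℝ) - p) * v ≤ ((n x : ℝ) - p) * (v₀ + v₀ * (2 * u)) :=
        mul_le_mul_of_nonneg_left k11 hp0.le
    _ = ((n x : ℝ) - p) * v₀ + v₀ * (4 * C * Real.log (n x)) := by rw [mul_add, k12]
    _ ≤ ((n x : ℝ) - p) * v₀ + (σsq + 1) * (4 * C * Real.log (n x)) :=
        add_le_add_right (mul_le_mul_of_nonneg_right x5.le (by positivity)) _
    _ = _ := by ring

lemma exists_pos_forall_le {m : ℕ} {f : ℕ → ℝ} (h : ∀ r < m, 0 < f r) :
    ∃ J > 0, ∀ r < m, J ≤ f r := by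
  induction m with
  | zero => exact ⟨1, one_pos, fun r hr => absurd hr (Nat.not_lt_zero r)⟩
  | succ m ih =>
    obtain ⟨J, hJ, hJm⟩ := ih fun r hr => h r (by omega)
    refine ⟨min J (f m), lt_min hJ (h m (by omega)), fun r hr => ?_⟩
    rcases Nat.lt_succ_iff_lt_or_eq.1 hr with h1 | rfl
    · exact (min_le_left _ _).trans (hJm r h1)
    · exact min_le_right _ _

/-- A small misfit forces every true changepoint to be close to a fitted one. -/
lemma exists_near_changepoint (reg : Regular L p T φ₀ σsq Γ n e) (hT : 0 < T)
    (hc₀ : WellSpaced L p T n fun _ => c₀)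
    (hμ₀ : ∀ r < c₀.m, regimeMean μ₀ r ≠ regimeMean μ₀ (r + 1))
    (hc : WellSpaced L p T n c)
    (hφ : Tendsto (fun x => yuleWalker p T (n x) (c x) (X x)) L (𝓝 φs)) (h1 : arOne φs ≠ 0)
    (hG : (fun x => ∑ t ∈ win p (n x), arFilter (yuleWalker p T (n x) (c x) (X x))
          (misfit p ν (n x) c₀ s₀ μ₀ (c x) (X x)) t ^ 2) =o[L] fun x => scA (n x)) :
    ∃ δ : ι → ℕ, ((fun x => (δ x : ℝ)) =o[L] fun x => scA (n x)) ∧ ∀ᶠ x in L, ∀ r : Fin c₀.m,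
      ∃ k : Fin (c x).m,
        |((c x).tau (n x) ((k : ℕ) + 1) : ℝ) - c₀.tau (n x) ((r : ℕ) + 1)| ≤ δ x := by
  have hn := reg.n_tendsto
  obtain ⟨J, hJ, hJr⟩ := exists_pos_forall_le
    (f := fun r => |regimeMean μ₀ (r + 1) - regimeMean μ₀ r|)
    fun r hr => abs_pos.2 (sub_ne_zero.2 (hμ₀ r hr).symm)
  set q := |arOne φs| / 2 with hq
  have hq0 : 0 < q := by have := abs_pos.2 h1; positivity
  have e1 : ∀ᶠ x in L, q ≤ |arOne (yuleWalker p T (n x) (c x) (X x))| := by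
    have := ((continuous_arOne.tendsto φs).comp hφ).abs
    exact (this.eventually_const_lt (show q < |arOne φs| by have := abs_pos.2 h1; linarith)).mono
      fun x hx => hx.le
  set G : ι → ℝ := fun x => ∑ t ∈ win p (n x), arFilter (yuleWalker p T (n x) (c x) (X x))
          (misfit p ν (n x) c₀ s₀ μ₀ (c x) (X x)) t ^ 2 with hGd
  have hG0 : ∀ x, 0 ≤ G x := fun x => Finset.sum_nonneg fun _ _ => sq_nonneg _
  -- The least integer above the number of periods that a squared misfit `G` allows next to a missed
  -- jump; the distance `p + k T` inherits the rate of `G`.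
  set k : ι → ℕ := fun x => ⌊2 * G x / (q * J) ^ 2⌋₊ + 1 with hk
  have hko : (fun x => ((p + k x * T : ℕ) : ℝ)) =o[L] fun x => scA (n x) := by
    refine littleO_of_abs_le (h := fun x => p + (2 * G x / (q * J) ^ 2 + 1) * T) ?_
      (Eventually.of_forall fun x => ?_)
    · have hone : ∀ C : ℝ, (fun _ => C) =o[L] fun x => scA (n x) := fun C =>
        (const_o_log hn C).trans (log_o_scA hn)
      have h2 : (fun x => 2 * G x / (q * J) ^ 2) =o[L] fun x => scA (n x) := by
        refine (hG.const_mul_left (2 / (q * J) ^ 2)).congr_left fun x => ?_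
        simp only [hGd]; ring
      refine (hone p).add ?_
      refine ((h2.add (hone 1)).const_mul_left (T : ℝ)).congr_left fun x => mul_comm _ _
    · rw [abs_of_nonneg (Nat.cast_nonneg _)]
      push_cast
      have : (⌊2 * G x / (q * J) ^ 2⌋₊ : ℝ) ≤ 2 * G x / (q * J) ^ 2 :=
        Nat.floor_le (by have := hG0 x; positivity)
      have hT' : (0 : ℝ) ≤ T := Nat.cast_nonneg _
      simp only [hk]
      push_cast
      nlinarith [mul_le_mul_of_nonneg_right this hT']
  refine ⟨fun x => p + k x * T, hko, ?_⟩
  obtain ⟨κ, hκ, hs⟩ := hc₀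
  obtain ⟨κ', -, hs'⟩ := hc
  filter_upwards [e1, hs, hs', isLittleO_iff.1 (hko.trans (scA_o_n hn)) hκ]
    with x x1 ⟨k₀, hk₀, hk₀', hsp⟩ ⟨k₁, _, _, hsp'⟩ x4 r
  by_contra! hmiss
  rw [Real.norm_of_nonneg (Nat.cast_nonneg _), Real.norm_of_nonneg (Nat.cast_nonneg _)] at x4
  -- The distance is o(n), hence below the length of the true regimes.
  have hδ : p + k x * T ≤ p + k₀ * T := by
    have h2 : p + k x * T ≤ k₀ := by exact_mod_cast x4.trans hk₀'
    have := Nat.le_mul_of_pos_right k₀ hT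
    omega
  have h3 := hsp.missed_changepoint (n := k x) (c := c x) hT hδ le_rfl
    (yuleWalker p T (n x) (c x) (X x)) s₀
    (seasonHat p ν T (n x) (c x) (X x)) μ₀ (regimeHat p ν T (n x) (c x) (X x)) r.2
    (fun j => by
      have h4 := hmiss j
      rcases le_total (c₀.tau (n x) ((r : ℕ) + 1)) ((c x).tau (n x) ((j : ℕ) + 1)) with h5 | h5
      · right
        have h6 : (c₀.tau (n x) ((r : ℕ) + 1) : ℝ) ≤ (c x).tau (n x) ((j : ℕ) + 1) := by
          exact_mod_cast h5
        rw [abs_of_nonneg (by linarith)] at h4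
        have h7 : ((c₀.tau (n x) ((r : ℕ) + 1) + (p + k x * T) : ℕ) : ℝ)
            < (c x).tau (n x) ((j : ℕ) + 1) := by push_cast at h4 ⊢; linarith
        exact le_of_lt (by exact_mod_cast h7)
      · left
        have h6 : ((c x).tau (n x) ((j : ℕ) + 1) : ℝ) ≤ c₀.tau (n x) ((r : ℕ) + 1) := by
          exact_mod_cast h5
        rw [abs_of_nonpos (by linarith)] at h4
        have h7 : (((c x).tau (n x) ((j : ℕ) + 1) + (p + k x * T) : ℕ) : ℝ)
            < c₀.tau (n x) ((r : ℕ) + 1) := by push_cast at h4 ⊢; linarith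
        exact le_of_lt (by exact_mod_cast h7)) hsp'
  have h4 : (k x : ℝ) * (arOne (yuleWalker p T (n x) (c x) (X x))
      * (regimeMean μ₀ ((r : ℕ) + 1) - regimeMean μ₀ r)) ^ 2 ≤ 2 * G x := h3
  have h5 : (q * J) ^ 2 ≤ (arOne (yuleWalker p T (n x) (c x) (X x))
      * (regimeMean μ₀ ((r : ℕ) + 1) - regimeMean μ₀ r)) ^ 2 := by
    rw [← sq_abs (arOne _ * _), abs_mul]
    exact pow_le_pow_left₀ (by positivity)
      (mul_le_mul x1 (hJr r r.2) hJ.le (abs_nonneg _)) 2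
  have h6 : 2 * G x / (q * J) ^ 2 < k x := by
    simp only [hk]; push_cast; exact Nat.lt_floor_add_one _
  rw [div_lt_iff₀ (by positivity)] at h6
  have h7 := mul_le_mul_of_nonneg_left h5 (Nat.cast_nonneg (α := ℝ) (k x))
  linarith

end Compare

/-! ### Consistency along an ultrafilter -/

/-- A strictly increasing self-map of a finite ordinal is the identity. -/
lemma sub_eq_self {c : Config} {m' : ℕ} {k : Fin m' → Fin c.m} (hk : StrictMono k)
    (h : c.m = m') : c.sub k = c := by
  obtain ⟨m, loc⟩ := c
  simp only at h
  subst h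
  have hk' : k = id := (StrictMono.range_inj hk strictMono_id).1 (by
    rw [Set.range_id, (Finite.injective_iff_surjective.1 hk.injective).range_eq])
  subst hk'
  rfl

section Consistency

variable {ι : Type*} {L : Filter ι} {p T M : ℕ} {φ₀ φs : Fin p → ℝ} {σsq a b₁ b₂ ν : ℝ}
  {Γ : Matrix (Fin (p + 1)) (Fin (p + 1)) ℝ} {n : ι → ℕ} {e X : ι → ℕ → ℝ} {Ψ : ℝ}
  {c₀ : Config} {s₀ : Fin T → ℝ} {μ₀ : Fin c₀.m → ℝ} {c : ι → Config} {doc : ι → Finset ℕ}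

/-- A configuration `c'` whose changepoints are those of `c` that are close to the changepoints
of `c₀`. -/
structure NearSub (M : ℕ) (d : ℝ) (N : ℕ) (doc : Finset ℕ) {c₀ : Config} (μ₀ : Fin c₀.m → ℝ)
    (B δ : ℝ) (c c' : Config) (hm : c'.m = c₀.m) (μ : Fin c.m → ℝ) : Prop where
  mem : c' ∈ admissible M d
  near : ∀ r ≤ c₀.m + 1, |(c'.tau N r : ℝ) - c₀.tau N r| ≤ δ
  m_le : c₀.m ≤ c.m
  eq_of_m_eq : c.m = c₀.m → c' = c
  doc_le : cpDoc N doc c' ≤ cpDoc N doc c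
  undoc_le : cpUndoc N doc c' ≤ cpUndoc N doc c
  mean_le : ∀ j, |μ j| ≤ B
  regimeFn_eq : ∀ t, 1 ≤ t → t ≤ N →
    regimeFn c N μ t = regimeFn c' N (fun k => μ₀ (Fin.cast hm k)) t

lemma exists_nearSub {d : ℝ} (hd : 0 < d) {N ρ ρ' : ℕ} {doc : Finset ℕ} {B δ : ℝ} (hB : 0 ≤ B)
    (hμ : ∀ k, |μ₀ k| ≤ B) {c : Config} (hc : c ∈ admissible M d) (h₀ : Spaced c₀ N ρ)
    (hsp : Spaced c N ρ') (hρ' : 0 < ρ') (hδ0 : 0 ≤ δ) (hδ : 2 * δ < ρ)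
    (hex : ∀ r : Fin c₀.m, ∃ k : Fin c.m,
      |(c.tau N ((k : ℕ) + 1) : ℝ) - c₀.tau N ((r : ℕ) + 1)| ≤ δ) :
    ∃ (c' : Config) (hm : c'.m = c₀.m) (μ : Fin c.m → ℝ),
      NearSub M d N doc μ₀ B δ c c' hm μ := by
  obtain ⟨k, hk, hkδ⟩ := h₀.exists_strictMono hsp hδ hex
  obtain ⟨μ, hμB, hμe⟩ := hsp.exists_regimeFn_eq_sub hρ' hk μ₀ hB hμ
  refine ⟨c.sub k, rfl, μ, sub_admissible hd hc hk, fun r hr => ?_, sub_m_le hk,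
    fun h => sub_eq_self hk h, cpDoc_sub_le hk N doc, cpUndoc_sub_le hk N doc, hμB, hμe⟩
  rcases Nat.eq_zero_or_pos r with rfl | hr0
  · simpa using hδ0
  rcases Nat.lt_or_ge r (c₀.m + 1) with h1 | h1
  · obtain ⟨r, rfl⟩ : ∃ r', r = r' + 1 := ⟨r - 1, by omega⟩
    have h2 := hkδ ⟨r, by omega⟩
    rw [sub_tau, show r + 1 = ((⟨r, by omega⟩ : Fin c₀.m) : ℕ) + 1 from rfl, subIdx_succ]
    exact h2
  · obtain rfl : r = c₀.m + 1 := by omega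
    have e : (c.sub k).tau N (c₀.m + 1) = N + 1 := Config.tau_last (c.sub k) N
    rw [e, Config.tau_last]
    simpa using hδ0

lemma Spaced.abs_regimeFn_le {c : Config} {N ρ : ℕ} (h : Spaced c N ρ) {μ : Fin c.m → ℝ} {B : ℝ}
    (hB : 0 ≤ B) (hμ : ∀ k, |μ k| ≤ B) {t : ℕ} (h1 : 1 ≤ t) (h2 : t ≤ N) :
    |regimeFn c N μ t| ≤ B := by
  obtain ⟨r, hr, t1, t2⟩ := h.exists_regime h1 h2
  rw [h.regimeFn_eq μ hr t1 t2]
  exact abs_regimeMean_le μ hB hμ r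

lemma lagProd_congr_right {p N : ℕ} {f g g' : ℕ → ℝ} (h : ∀ t, 1 ≤ t → t ≤ N → g t = g' t)
    {i j : ℕ} (hj : j ≤ p) : lagProd p N f g i j = lagProd p N f g' i j := by
  refine Finset.sum_congr rfl fun t ht => ?_
  obtain ⟨h1, h2⟩ := mem_win.1 ht
  rw [h _ (by omega) (by omega)]

/-- Apart from the data equation, a reference constrains only the noise, the misfit on the sample,
the spacing and the size of the regime means. A second description of the same data with the same
misfit is again a reference. -/
lemma Ref.congr {B : ℝ} {g g' : ι → ℕ → ℝ} {s : ι → Fin T → ℝ} {μ : ∀ x, Fin (c x).m → ℝ}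
    (ref : Ref L p T M B n e g X c s μ) {c' : ι → Config} {s' : ι → Fin T → ℝ}
    {μ' : ∀ x, Fin (c' x).m → ℝ} (hm : ∀ᶠ x in L, (c' x).m ≤ M) (hc : WellSpaced L p T n c')
    (hg : ∀ᶠ x in L, ∀ t, 1 ≤ t → t ≤ n x → g x t = g' x t)
    (hμ : ∀ᶠ x in L, ∀ k, |μ' x k| ≤ B)
    (hX : ∀ x t, X x t = fitFn (c' x) (n x) (s' x) (μ' x) t + (e x t + g' x t)) :
    Ref L p T M B n e g' X c' s' μ' where
  m_le := hm
  spaced := hc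
  close := ref.close.congr' (hg.mono fun x hx => Finset.sum_congr rfl fun t ht => by
    rw [hx t (Finset.mem_Icc.1 ht).1 (Finset.mem_Icc.1 ht).2]) EventuallyEq.rfl
  cross := by
    obtain ⟨Q, hQ, h⟩ := ref.cross
    refine ⟨Q, hQ, ?_⟩
    filter_upwards [h, hg] with x h1 h2 i hi j hj
    rw [← lagProd_congr_right h2 hj]
    exact h1 i hi j hj
  bdd := by
    filter_upwards [ref.bdd, hg] with x h1 h2 t t1 t2
    rw [← h2 t t1 t2]
    exact h1 t t1 t2
  mean_bdd := hμ
  data := hX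

/-- Consistency of the BMDL estimators for regular noise. -/
theorem consistency {U : Ultrafilter ι} (reg : Regular (U : Filter ι) p T φ₀ σsq Γ n e)
    (hσ : 0 < σsq) (hT : 0 < T) (hν : 0 < ν) (ha : 0 < a) (hb₁ : 0 < b₁) (hb₂ : 0 < b₂)
    (hΨ : 0 < Ψ) (hst : SeasonStable T φ₀ Ψ) (h1 : arOne φ₀ ≠ 0)
    {d : ℝ} (hd : 0 < d) (hc₀ : c₀ ∈ admissible M d)
    (hμ₀ : ∀ r < c₀.m, regimeMean μ₀ r ≠ regimeMean μ₀ (r + 1))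
    (hX : ∀ x t, X x t = fitFn c₀ (n x) s₀ μ₀ t + e x t)
    (hc : ∀ᶠ x in (U : Filter ι), IsBMDLMin p T a b₁ b₂ ν M d (n x) (doc x) (X x) (c x)) :
    (∀ δ > 0, ∀ᶠ x in (U : Filter ι), ∃ h : c₀.m = (c x).m, ∀ k : Fin c₀.m,
      |regimeHat p ν T (n x) (c x) (X x) (Fin.cast h k) - μ₀ k| < δ) ∧
    Tendsto (fun x => seasonHat p ν T (n x) (c x) (X x)) U (𝓝 s₀) ∧
    Tendsto (fun x => varHat p ν T (n x) (c x) (X x)) U (𝓝 σsq) ∧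
    Tendsto (fun x => yuleWalker p T (n x) (c x) (X x)) U (𝓝 φ₀) := by
  have hn := reg.n_tendsto
  have hw₀ : WellSpaced (U : Filter ι) p T n fun _ => c₀ :=
    wellSpaced_of_admissible hT hd hn (Eventually.of_forall fun _ => hc₀)
  have hadm : ∀ᶠ x in (U : Filter ι), c x ∈ admissible M d := hc.mono fun x hx => hx.1
  have hw := wellSpaced_of_admissible (p := p) hT hd hn hadm
  have hm : ∀ᶠ x in (U : Filter ι), (c x).m ≤ M := hadm.mono fun x hx => hx.1
  -- the Yule-Walker estimator and the misfit
  obtain ⟨E, hE, hssr⟩ := ssr_minimizer_le reg hσ hT hν ha hb₁ hb₂ hΨ hst h1 hd hc₀ hX hc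
  obtain ⟨φs, hφ, hφ1⟩ := exists_yuleWalker_tendsto reg hT hw₀ hX hw hm
  obtain ⟨rfl, hG, hvar⟩ := wellFitting_consistent reg hT hν hw₀ hX hw hm hφ hφ1 hE hssr
  have hv := varHat_tendsto_of_ssr reg (hvar.trans (scA_o_n hn))
  -- the changepoints
  obtain ⟨δ, hδ, hnear⟩ := exists_near_changepoint reg hT hw₀ hμ₀ hw hφ h1 hG
  obtain ⟨B, hB, -, hμB, -⟩ := exists_abs_fitFn_le hT hw₀ s₀ μ₀
  -- The sub-configuration exists only eventually; the true configuration is a default value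
  -- elsewhere, so that `c'` is defined everywhere.
  have hsub : ∀ x, ∃ (c' : Config) (hm : c'.m = c₀.m) (μ : Fin (c x).m → ℝ),
      (∃ (c' : Config) (hm : c'.m = c₀.m) (μ : Fin (c x).m → ℝ),
        NearSub M d (n x) (doc x) μ₀ B (δ x) (c x) c' hm μ) →
      NearSub M d (n x) (doc x) μ₀ B (δ x) (c x) c' hm μ := fun x => by
    by_cases h : ∃ (c' : Config) (hm : c'.m = c₀.m) (μ : Fin (c x).m → ℝ),
        NearSub M d (n x) (doc x) μ₀ B (δ x) (c x) c' hm μ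
    · obtain ⟨c', hm, μ, h⟩ := h
      exact ⟨c', hm, μ, fun _ => h⟩
    · exact ⟨c₀, rfl, 0, fun h' => absurd h' h⟩
  choose c' hm' μ' hc' using hsub
  have hns : ∀ᶠ x in (U : Filter ι),
      NearSub M d (n x) (doc x) μ₀ B (δ x) (c x) (c' x) (hm' x) (μ' x) := by
    obtain ⟨κ, hκ, hs₀⟩ := hw₀
    obtain ⟨κ', -, hs⟩ := hw
    filter_upwards [hnear, hadm, hs₀, hs,
      isLittleO_iff.1 (hδ.trans (scA_o_n hn)) (show 0 < κ / 4 by positivity)]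
      with x x1 x2 ⟨k₀, hk₀, hk₀', hsp₀⟩ ⟨k₁, hk₁, _, hsp₁⟩ x5
    rw [Real.norm_of_nonneg (Nat.cast_nonneg _), Real.norm_of_nonneg (Nat.cast_nonneg _)] at x5
    refine hc' x (exists_nearSub hd hB hμB x2 hsp₀ hsp₁ (by positivity) (Nat.cast_nonneg _) ?_ x1)
    have y1 : (k₀ : ℝ) ≤ k₀ * T := le_mul_of_one_le_right (Nat.cast_nonneg _) (by exact_mod_cast hT)
    have y2 : (0 : ℝ) < k₀ := by exact_mod_cast hk₀
    push_cast
    nlinarith [Nat.cast_nonneg (α := ℝ) p]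
  -- the reference configuration
  set μ'' : ∀ x, Fin (c' x).m → ℝ := fun x k => μ₀ (Fin.cast (hm' x) k) with hμ''
  -- The misfit created by moving the true regime means to the nearby fitted changepoints. It is
  -- bounded and lives between true and moved changepoints, so its total mass is o(√(n log n)).
  set g : ι → ℕ → ℝ := fun x t => regimeFn c₀ (n x) μ₀ t - regimeFn (c' x) (n x) (μ'' x) t with hg
  have hadm' : ∀ᶠ x in (U : Filter ι), c' x ∈ admissible M d := hns.mono fun x hx => hx.mem
  have hw' := wellSpaced_of_admissible (p := p) hT hd hn hadm'
  have hm0M : (c₀.m : ℝ) ≤ M := by exact_mod_cast hc₀.1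
  obtain ⟨Q, hQ, hQb⟩ := reg.noise
  have ref' : Ref (U : Filter ι) p T M (2 * B) n e g X c' (fun _ => s₀) μ'' :=
    { m_le := hadm'.mono fun x hx => hx.1
      spaced := hw'
      close := by
        refine littleO_of_abs_le (hδ.const_mul_left (2 * c₀.m * B)) ?_
        filter_upwards [hns] with x hx
        rw [abs_of_nonneg (Finset.sum_nonneg fun _ _ => abs_nonneg _)]
        exact sum_abs_regimeFn_sub_le (hm' x) μ₀ hμB hx.near
      cross := by
        refine ⟨fun x => 4 * M * B * Q x, hQ.const_mul_left _, ?_⟩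
        filter_upwards [hQb] with x q i hi j hj
        have e1 : lagProd p (n x) (e x) (g x) i j = lagProd p (n x) (e x) (regimeFn c₀ (n x) μ₀) i j
            - lagProd p (n x) (e x) (regimeFn (c' x) (n x) (μ'' x)) i j := by
          simp only [lagProd, hg, ← Finset.sum_sub_distrib, mul_sub]
        have e2 := q.abs_lagProd_regimeFn_le c₀ μ₀ hμB hi hj
        have e3 := q.abs_lagProd_regimeFn_le (c' x) (μ'' x) (fun k => hμB _) hi hj
        rw [hm' x] at e3
        have e4 : (2 * c₀.m * B * Q x : ℝ) ≤ 2 * M * B * Q x :=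
          mul_le_mul_of_nonneg_right (mul_le_mul_of_nonneg_right (by linarith) hB) q.nonneg
        rw [e1]
        refine (abs_sub _ _).trans ?_
        linarith
      bdd := by
        obtain ⟨κ, -, hs₀⟩ := hw₀
        obtain ⟨κ', -, hs⟩ := hw'
        filter_upwards [hs₀, hs] with x ⟨k₀, _, _, hsp₀⟩ ⟨k₁, _, _, hsp₁⟩ t t1 t2
        refine (abs_sub _ _).trans ?_
        have := hsp₀.abs_regimeFn_le hB hμB t1 t2
        have := hsp₁.abs_regimeFn_le hB (μ := μ'' x) (fun k => hμB _) t1 t2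
        linarith
      mean_bdd := Eventually.of_forall fun x k => (hμB _).trans (by linarith)
      data := fun x t => by
        have e1 : ∀ (c : Config) (μ : Fin c.m → ℝ), fitFn c (n x) s₀ μ t
          = seasonFn s₀ t + regimeFn c (n x) μ t := fun _ _ => rfl
        rw [hX, e1, e1]
        simp only [hg]; ring }
  -- Mean functions of `c'` are mean functions of `c`, so the same misfit, at the times of the
  -- sample, serves as reference for the full configuration.
  set g₂ : ι → ℕ → ℝ := fun x t => regimeFn c₀ (n x) μ₀ t - regimeFn (c x) (n x) (μ' x) t with hg₂
  have hgg : ∀ᶠ x in (U : Filter ι), ∀ t, 1 ≤ t → t ≤ n x → g x t = g₂ x t :=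
    hns.mono fun x hx t t1 t2 => by
      simp only [hg, hg₂]
      rw [hx.regimeFn_eq t t1 t2]
  have ref : Ref (U : Filter ι) p T M (2 * B) n e g₂ X c (fun _ => s₀) μ' :=
    ref'.congr hm hw hgg (hns.mono fun x hx k => (hx.mean_le k).trans (by linarith))
      fun x t => by
        have e1 : ∀ (c : Config) (μ : Fin c.m → ℝ), fitFn c (n x) s₀ μ t
          = seasonFn s₀ t + regimeFn c (n x) μ t := fun _ _ => rfl
        rw [hX, e1, e1]
        simp only [hg₂]; ring
  have hdiff := ref.ssr_sub reg ref' (hgg.mono fun x hx t t1 t2 => (hx t t1 t2).symm)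
    hT hν hΨ hst h1
  have hv' : Tendsto (fun x => varHat p ν T (n x) (c' x) (X x)) U (𝓝 σsq) := by
    refine varHat_tendsto_of_ssr reg ?_
    refine ((hvar.trans (scA_o_n hn)).sub (hdiff.trans (log_o_n hn))).congr_left fun x => ?_
    simp only [ssr]; ring
  -- the number of changepoints
  have hmeq : ∀ᶠ x in (U : Filter ι), (c x).m = c₀.m := by
    by_contra hne
    -- For an ultrafilter, failing to hold eventually means eventually failing; one index with all
    -- the estimates then suffices for a contradiction.
    rw [← Ultrafilter.eventually_not] at hne
    obtain ⟨C₁, hC₁⟩ := meanPenalty_le (M := M) hν hn (hadm'.mono fun x hx => hx.1)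
      (ref'.yuleWalker_tendsto reg hT)
    obtain ⟨C₂, hC₂⟩ := le_meanPenalty hT hν hn hm hw hφ h1
    obtain ⟨C₃, hC₃⟩ := exists_neg_le_gammaPart_sub p M ha hb₁ hb₂
    have hspc : ∀ᶠ x in (U : Filter ι), (((p + 1 : ℕ) : ℝ) + 2) ≤ d * n x :=
      ((tendsto_natCast_atTop_atTop.comp hn).const_mul_atTop hd).eventually_ge_atTop _
    have hlogpos : ∀ᶠ x in (U : Filter ι), 0 < Real.log (n x) :=
      (Real.tendsto_log_atTop.comp (tendsto_natCast_atTop_atTop.comp hn)).eventually_gt_atTop 0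
    obtain ⟨x, x1, x2, x3, x4, x5, x6, x7, x8, x9, x10, x11, x12, x13⟩ := (hne.and (hC₁.and
      (hC₂.and (hns.and (hspc.and (hlogpos.and
      ((isLittleO_iff.1 hdiff (show 0 < σsq / 8 by positivity)).and
      ((isLittleO_iff.1 (const_o_log hn (|C₁| + |C₂| + |C₃|)) (show (0 : ℝ) < 1 / 8 by norm_num)).and
      ((hv.eventually_const_lt (show σsq / 2 < σsq by linarith)).and
      ((hv'.eventually_const_lt hσ).and (hc.and ((hn.eventually_gt_atTop p).and
        hm)))))))))))).exists
    rw [Real.norm_eq_abs, Real.norm_of_nonneg x6.le] at x7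
    rw [Real.norm_of_nonneg (by positivity), Real.norm_of_nonneg x6.le] at x8
    have hp0 : (0 : ℝ) < (n x : ℝ) - p := sub_pos.2 (by exact_mod_cast x12)
    set v := varHat p ν T (n x) (c x) (X x)
    set v' := varHat p ν T (n x) (c' x) (X x)
    have y0 : 0 < v := by linarith
    have y1 := x11.2 (c' x) x4.mem
    rw [bmdl_eq_add x12.le, bmdl_eq_add x12.le] at y1
    have y2 := hC₃ (c' := c' x) (doc x) (lt_add_one p) (spaced_of_admissible hd x11.1 x5) x13
      x4.doc_le x4.undoc_le
    have y3 : Real.log v' - Real.log v ≤ (v' - v) / v := by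
      rw [← Real.log_div x10.ne' y0.ne', sub_div, div_self y0.ne']
      exact Real.log_le_sub_one_of_pos (by positivity)
    -- The residual sums differ by at most (σ²/8) log n and `v` exceeds σ²/2, so deleting
    -- changepoints raises the likelihood part by at most (1/8) log n. The constants take at most
    -- another (1/8) log n, against a saving of (1/2) log n.
    have y4 : ((n x : ℝ) - p) / 2 * (Real.log v' - Real.log v) ≤ 1 / 8 * Real.log (n x) := by
      calc ((n x : ℝ) - p) / 2 * (Real.log v' - Real.log v)
          ≤ ((n x : ℝ) - p) / 2 * ((v' - v) / v) := mul_le_mul_of_nonneg_left y3 (by positivity)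
        _ = -(((n x : ℝ) - p) * v - ((n x : ℝ) - p) * v') / (2 * v) := by field_simp; ring
        _ ≤ (σsq / 8 * Real.log (n x)) / σsq := by
            refine div_le_div₀ (by positivity) ((neg_le_abs _).trans x7) hσ (by linarith)
        _ = _ := by field_simp
    -- Too few changepoints are already excluded, as distinct true changepoints have distinct nearby
    -- fitted ones; a wrong number is therefore a larger one.
    have y5 : ((c' x).m : ℝ) + 1 ≤ (c x).m := by
      have := x4.m_le
      have h2 := hm' x
      exact_mod_cast (by omega : (c' x).m + 1 ≤ (c x).m)
    have y6 : ((c' x).m : ℝ) / 2 * Real.log (n x) + 1 / 2 * Real.log (n x)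
        ≤ (c x).m / 2 * Real.log (n x) := by nlinarith
    have := le_abs_self C₁
    have := le_abs_self C₂
    have := le_abs_self C₃
    nlinarith
  -- the coefficients
  have heq : ∀ᶠ x in (U : Filter ι), c' x = c x := by
    filter_upwards [hns, hmeq] with x h2 h3
    exact h2.eq_of_m_eq h3
  have hgls := (ref'.gls reg hT hν hΨ hst h1).1
  have hcoef : Tendsto (fun x => max ‖s₀ - seasonHat p ν T (n x) (c' x) (X x)‖
      ‖μ'' x - regimeHat p ν T (n x) (c' x) (X x)‖) U (𝓝 0) :=
    (isLittleO_one_iff ℝ).1 (hgls.trans (scB_o_one hn))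
  refine ⟨fun δ hδ => ?_, ?_, hv, hφ⟩
  · filter_upwards [heq, hcoef.eventually_lt_const hδ] with x h2 h3
    have h4 := hm' x
    have h5 : ∀ k : Fin c₀.m,
        |regimeHat p ν T (n x) (c' x) (X x) (Fin.cast h4.symm k) - μ₀ k| < δ := fun k => by
      have h6 := (norm_le_pi_norm (μ'' x - regimeHat p ν T (n x) (c' x) (X x))
        (Fin.cast h4.symm k)).trans_lt ((le_max_right _ _).trans_lt h3)
      rw [Pi.sub_apply, Real.norm_eq_abs, abs_sub_comm] at h6
      simpa [hμ''] using h6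
    -- The index type of the regime means depends on the configuration, so `c' x` becomes a variable
    -- before it is identified with `c x`.
    generalize c' x = c'' at h2 h4 h5
    subst h2
    exact ⟨h4.symm, h5⟩
  · have h2 : Tendsto (fun x => s₀ - seasonHat p ν T (n x) (c' x) (X x)) U (𝓝 0) :=
      squeeze_zero_norm (fun x => le_max_left _ _) hcoef
    have h3 := h2.const_sub s₀
    simp only [sub_sub_cancel, sub_zero] at h3
    refine h3.congr' (heq.mono fun x hx => ?_)
    rw [hx]

end Consistency

/-! ### Convergence in probability as convergence along a filter -/

section ProbFilter

variable {Ω : Type*} [MeasurableSpace Ω] {P : Measure Ω}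

/-- The filter of the events, indexed by the sample size, whose probability tends to one. -/
def probFilter (P : Measure Ω) : Filter (ℕ × Ω) where
  sets := {S | Tendsto (fun N => P {ω | (N, ω) ∉ S}) atTop (𝓝 0)}
  univ_sets := by simp
  sets_of_superset {S S'} hS h := by
    refine tendsto_of_tendsto_of_tendsto_of_le_of_le tendsto_const_nhds hS (fun _ => zero_le)
      fun N => measure_mono fun ω hω hS' => hω (h hS')
  inter_sets {S S'} hS hS' := by
    have h := hS.add hS'
    rw [add_zero] at h
    refine tendsto_of_tendsto_of_tendsto_of_le_of_le tendsto_const_nhds h (fun _ => zero_le)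
      fun N => (measure_mono fun ω hω => ?_).trans (measure_union_le _ _)
    by_contra h'
    simp only [Set.mem_union, Set.mem_ofPred_eq, not_or, not_not] at h'
    exact hω h'

lemma eventually_probFilter {q : ℕ × Ω → Prop} :
    (∀ᶠ x in probFilter P, q x) ↔ Tendsto (fun N => P {ω | ¬ q (N, ω)}) atTop (𝓝 0) := Iff.rfl

lemma tendsto_fst_probFilter : Tendsto Prod.fst (probFilter P) atTop := by
  refine tendsto_atTop.2 fun b => eventually_probFilter.2 ?_
  refine tendsto_const_nhds.congr' ?_
  filter_upwards [eventually_ge_atTop b] with N hN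
  simp [hN]

lemma eventually_probFilter_of_ae {q : ℕ × Ω → Prop} (h : ∀ N, ∀ᵐ ω ∂P, q (N, ω)) :
    ∀ᶠ x in probFilter P, q x :=
  eventually_probFilter.2 (tendsto_const_nhds.congr fun N => (ae_iff.1 (h N)).symm)

lemma tendstoInMeasure_of_tendsto_probFilter {E : Type*} [PseudoEMetricSpace E] {f : ℕ → Ω → E}
    {c : E} (h : Tendsto (fun x : ℕ × Ω => f x.1 x.2) (probFilter P) (𝓝 c)) :
    TendstoInMeasure P f atTop fun _ => c := by
  intro ε hε
  have := eventually_probFilter.1 (EMetric.tendsto_nhds.1 h ε hε)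
  simpa only [not_lt] using this

/-- Markov's inequality, the bridge from bounds in mean to the filter. Where `r N = 0`, the
hypothesis makes `f N` vanish almost everywhere. -/
lemma isLittleO_of_integral [IsFiniteMeasure P] {f : ℕ → Ω → ℝ} {r : ℕ → ℝ}
    (hf : ∀ N, Integrable (f N) P) (h : (fun N => ∫ ω, |f N ω| ∂P) =o[atTop] r) :
    (fun x : ℕ × Ω => f x.1 x.2) =o[probFilter P] fun x => r x.1 := by
  rw [isLittleO_iff]
  intro ε hε
  rw [eventually_probFilter, ENNReal.tendsto_nhds_zero]
  intro δ hδ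
  obtain ⟨δ', hδ'0, hδ'⟩ : ∃ δ' : ℝ, 0 < δ' ∧ ENNReal.ofReal δ' ≤ δ := by
    rcases eq_or_ne δ ⊤ with rfl | hne
    · exact ⟨1, one_pos, le_top⟩
    · exact ⟨δ.toReal, ENNReal.toReal_pos hδ.ne' hne, (ENNReal.ofReal_toReal hne).le⟩
  filter_upwards [isLittleO_iff.1 h (mul_pos hδ'0 hε)] with N hN
  have h0 : 0 ≤ ∫ ω, |f N ω| ∂P := integral_nonneg fun _ => abs_nonneg _
  rw [Real.norm_of_nonneg h0] at hN
  rcases eq_or_lt_of_le (norm_nonneg (r N)) with hr | hr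
  · rw [← hr, mul_zero] at hN
    have h1 : (fun ω => |f N ω|) =ᵐ[P] 0 :=
      (integral_eq_zero_iff_of_nonneg (fun _ => abs_nonneg _) (hf N).abs).1 (le_antisymm hN h0)
    have h2 : P {ω | ¬ ‖f N ω‖ ≤ ε * ‖r N‖} = 0 := by
      refine ae_iff.1 (h1.mono fun ω hω => ?_)
      have : |f N ω| = 0 := hω
      rw [Real.norm_eq_abs, this, ← hr, mul_zero]
    rw [h2]; exact zero_le
  · have h1 := mul_meas_ge_le_integral_of_nonneg (μ := P) (f := fun ω => |f N ω|)
      (Eventually.of_forall fun _ => abs_nonneg _) (hf N).abs (ε * ‖r N‖)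
    have hpos : 0 < ε * ‖r N‖ := mul_pos hε hr
    have h2 : P.real {ω | ε * ‖r N‖ ≤ |f N ω|} ≤ δ' := by
      have h3 : ε * ‖r N‖ * P.real {ω | ε * ‖r N‖ ≤ |f N ω|} ≤ ε * ‖r N‖ * δ' := by linarith
      exact le_of_mul_le_mul_left h3 hpos
    calc P {ω | ¬ ‖f N ω‖ ≤ ε * ‖r N‖} ≤ P {ω | ε * ‖r N‖ ≤ |f N ω|} :=
          measure_mono fun ω hω => (not_le.1 hω).le
      _ = ENNReal.ofReal (P.real {ω | ε * ‖r N‖ ≤ |f N ω|}) :=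
          (ofReal_measureReal (measure_ne_top _ _)).symm
      _ ≤ ENNReal.ofReal δ' := ENNReal.ofReal_le_ofReal h2
      _ ≤ δ := hδ'

end ProbFilter

/-! ### Random series -/

section RandomSeries

variable {Ω : Type*} [MeasurableSpace Ω] {P : Measure Ω}

/-- The interface between moving averages and the noise: a bound in mean for each shifted copy,
weighted by summable coefficients, passes to the series. Measurability of the sum is obtained as
that of an almost sure limit, since none is assumed for the process. -/
lemma integral_of_hasSum {κ : Type*} [Countable κ] {w b : κ → ℝ} {g : κ → Ω → ℝ} {f : Ω → ℝ}
    (hf : ∀ᵐ ω ∂P, HasSum (fun k => w k * g k ω) (f ω)) (hg : ∀ k, Integrable (g k) P)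
    (hb : ∀ k, ∫ ω, |g k ω| ∂P ≤ b k) (hs : Summable fun k => |w k| * b k) :
    Integrable f P ∧ ∫ ω, |f ω| ∂P ≤ ∑' k, |w k| * b k ∧
      HasSum (fun k => w k * ∫ ω, g k ω ∂P) (∫ ω, f ω ∂P) := by
  have hint : ∀ k, ∫ ω, ‖w k * g k ω‖ ∂P = |w k| * ∫ ω, |g k ω| ∂P := fun k => by
    simp only [norm_mul, Real.norm_eq_abs]
    exact integral_const_mul _ _
  have hle : ∀ k, |w k| * ∫ ω, |g k ω| ∂P ≤ |w k| * b k := fun k =>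
    mul_le_mul_of_nonneg_left (hb k) (abs_nonneg _)
  have hs' : Summable fun k => |w k| * ∫ ω, |g k ω| ∂P :=
    Summable.of_nonneg_of_le (fun k => mul_nonneg (abs_nonneg _)
      (integral_nonneg fun _ => abs_nonneg _)) hle hs
  have hm : AEStronglyMeasurable f P := by
    refine aestronglyMeasurable_of_tendsto_ae (u := (atTop : Filter (Finset κ)))
      (f := fun s ω => ∑ k ∈ s, w k * g k ω) (fun s => ?_) hf
    exact Finset.aestronglyMeasurable_fun_sum s fun k _ => ((hg k).const_mul (w k)).1
  have hlin : ∫⁻ ω, ‖f ω‖ₑ ∂P ≤ ENNReal.ofReal (∑' k, |w k| * ∫ ω, |g k ω| ∂P) := by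
    calc ∫⁻ ω, ‖f ω‖ₑ ∂P ≤ ∫⁻ ω, ∑' k, ‖w k * g k ω‖ₑ ∂P := by
          refine lintegral_mono_ae (hf.mono fun ω hω => ?_)
          rw [← hω.tsum_eq]
          exact enorm_tsum_le_tsum_enorm
      _ = ∑' k, ∫⁻ ω, ‖w k * g k ω‖ₑ ∂P :=
          lintegral_tsum fun k => ((hg k).const_mul (w k)).1.enorm
      _ = ∑' k, ENNReal.ofReal (|w k| * ∫ ω, |g k ω| ∂P) := by
          refine tsum_congr fun k => ?_
          rw [← hint, ofReal_integral_norm_eq_lintegral_enorm ((hg k).const_mul (w k))]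
      _ = _ := (ENNReal.ofReal_tsum_of_nonneg (fun k => mul_nonneg (abs_nonneg _)
          (integral_nonneg fun _ => abs_nonneg _)) hs').symm
  have hfi : Integrable f P := ⟨hm, hlin.trans_lt ENNReal.ofReal_lt_top⟩
  refine ⟨hfi, ?_, ?_⟩
  · have h1 := ofReal_integral_norm_eq_lintegral_enorm hfi
    rw [← h1] at hlin
    have h2 := (ENNReal.ofReal_le_ofReal_iff (tsum_nonneg fun k => mul_nonneg (abs_nonneg _)
      (integral_nonneg fun _ => abs_nonneg _))).1 hlin
    exact h2.trans (hs'.tsum_le_tsum hle hs)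
  · have h1 := hasSum_integral_of_summable_integral_norm (μ := P) (F := fun k ω => w k * g k ω)
      (fun k => (hg k).const_mul (w k)) (by simpa only [hint] using hs')
    have h2 : ∫ ω, ∑' k, w k * g k ω ∂P = ∫ ω, f ω ∂P :=
      integral_congr_ae (hf.mono fun ω hω => hω.tsum_eq)
    rw [h2] at h1
    simpa only [integral_const_mul] using h1

/-- `E |f| ≤ (E f²)^{1/2}`. -/
lemma integral_abs_le_sqrt [IsProbabilityMeasure P] {f : Ω → ℝ} (hf : MemLp f 2 P) {V : ℝ}
    (hV : ∫ ω, f ω ^ 2 ∂P ≤ V) : ∫ ω, |f ω| ∂P ≤ √V := by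
  refine Real.le_sqrt_of_sq_le (le_trans ?_ hV)
  have h1 : MemLp (fun ω => |f ω|) 2 P := hf.norm
  have h2 := variance_nonneg (fun ω => |f ω|) P
  rw [variance_eq_sub h1] at h2
  have h3 : ∫ ω, ((fun ω => |f ω|) ^ 2) ω ∂P = ∫ ω, f ω ^ 2 ∂P :=
    integral_congr_ae (Eventually.of_forall fun ω => by simp [sq_abs])
  rw [h3] at h2
  linarith

/-- The mean absolute value of a linear combination of orthogonal random variables. -/
lemma integral_abs_sum_orthogonal_le [IsProbabilityMeasure P] {τ : Type*} [DecidableEq τ]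
    (A : Finset τ) (a : τ → ℝ)
    {D : τ → Ω → ℝ} (hD : ∀ t ∈ A, MemLp (D t) 2 P) {v : ℝ}
    (hv : ∀ t ∈ A, ∫ ω, D t ω * D t ω ∂P = v)
    (ho : ∀ t ∈ A, ∀ t' ∈ A, t ≠ t' → ∫ ω, D t ω * D t' ω ∂P = 0) :
    MemLp (fun ω => ∑ t ∈ A, a t * D t ω) 2 P ∧
      ∫ ω, (∑ t ∈ A, a t * D t ω) ^ 2 ∂P = v * ∑ t ∈ A, a t ^ 2 ∧
      ∫ ω, |∑ t ∈ A, a t * D t ω| ∂P ≤ √(v * ∑ t ∈ A, a t ^ 2) := by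
  have hm : MemLp (fun ω => ∑ t ∈ A, a t * D t ω) 2 P :=
    memLp_finsetSum A fun t ht => (hD t ht).const_mul (a t)
  have he : ∫ ω, (∑ t ∈ A, a t * D t ω) ^ 2 ∂P = v * ∑ t ∈ A, a t ^ 2 := by
    have h1 : ∀ ω, (∑ t ∈ A, a t * D t ω) ^ 2
        = ∑ t ∈ A, ∑ t' ∈ A, a t * a t' * (D t ω * D t' ω) := fun ω => by
      rw [sq, Finset.sum_mul_sum]
      exact Finset.sum_congr rfl fun t _ => Finset.sum_congr rfl fun t' _ => by ring
    have hi : ∀ t ∈ A, ∀ t' ∈ A, Integrable (fun ω => a t * a t' * (D t ω * D t' ω)) P :=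
      fun t ht t' ht' => ((hD t ht).integrable_mul (hD t' ht')).const_mul _
    simp only [h1]
    rw [integral_finsetSum _ fun t ht => integrable_finsetSum _ fun t' ht' => hi t ht t' ht',
      Finset.mul_sum]
    refine Finset.sum_congr rfl fun t ht => ?_
    rw [integral_finsetSum _ fun t' ht' => hi t ht t' ht', Finset.sum_eq_single t]
    · rw [integral_const_mul, hv t ht]; ring
    · intro t' ht' hne
      rw [integral_const_mul, ho t ht t' ht' hne.symm, mul_zero]
    · exact fun h => absurd ht h
  exact ⟨hm, he, integral_abs_le_sqrt hm he.le⟩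

end RandomSeries

/-! ### Independent noise -/

section Noise

variable {Ω : Type*} [MeasurableSpace Ω] {P : Measure Ω} [IsProbabilityMeasure P] {Z : ℤ → Ω → ℝ}
  {σsq : ℝ}

lemma IsIIDNoise.memLp' (hZ : IsIIDNoise P Z σsq) (t : ℤ) : MemLp (Z t) 2 P :=
  (hZ.identDistrib t).memLp_iff.2 hZ.memLp

lemma IsIIDNoise.integrable (hZ : IsIIDNoise P Z σsq) (t : ℤ) : Integrable (Z t) P :=
  (hZ.memLp' t).integrable one_le_two

lemma IsIIDNoise.integral_eq (hZ : IsIIDNoise P Z σsq) (t : ℤ) : ∫ ω, Z t ω ∂P = 0 :=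
  (hZ.identDistrib t).integral_eq.trans hZ.mean

lemma IsIIDNoise.integral_mul_self (hZ : IsIIDNoise P Z σsq) (t : ℤ) :
    ∫ ω, Z t ω * Z t ω ∂P = σsq := by
  have h1 := (hZ.identDistrib t).variance_eq
  rw [hZ.variance, variance_eq_sub (hZ.memLp' t), hZ.integral_eq] at h1
  rw [← h1]
  simp [sq]

lemma IsIIDNoise.integral_mul_of_ne (hZ : IsIIDNoise P Z σsq) {s t : ℤ} (h : s ≠ t) :
    ∫ ω, Z s ω * Z t ω ∂P = 0 := by
  rw [(hZ.indep.indepFun h).integral_fun_mul_eq_mul_integral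
    (hZ.integrable s).1 (hZ.integrable t).1, hZ.integral_eq, zero_mul]

lemma IsIIDNoise.integral_mul (hZ : IsIIDNoise P Z σsq) (s t : ℤ) :
    ∫ ω, Z s ω * Z t ω ∂P = if s = t then σsq else 0 := by
  split_ifs with h
  · rw [h, hZ.integral_mul_self]
  · exact hZ.integral_mul_of_ne h

lemma IsIIDNoise.integrable_mul (hZ : IsIIDNoise P Z σsq) (s t : ℤ) :
    Integrable (fun ω => Z s ω * Z t ω) P :=
  (hZ.memLp' s).integrable_mul (hZ.memLp' t)

lemma IsIIDNoise.integral_abs_mul_le (hZ : IsIIDNoise P Z σsq) (s t : ℤ) :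
    ∫ ω, |Z s ω * Z t ω| ∂P ≤ σsq := by
  have h1 : ∀ ω, |Z s ω * Z t ω| ≤ (Z s ω * Z s ω + Z t ω * Z t ω) / 2 := fun ω => by
    rw [abs_le]
    constructor <;> nlinarith [sq_nonneg (Z s ω - Z t ω), sq_nonneg (Z s ω + Z t ω)]
  refine (integral_mono (hZ.integrable_mul s t).abs
    (((hZ.integrable_mul s s).add (hZ.integrable_mul t t)).div_const 2) h1).trans ?_
  have : ∫ ω, (Z s ω * Z s ω + Z t ω * Z t ω) / 2 ∂P = (σsq + σsq) / 2 := by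
    rw [integral_div, integral_add (hZ.integrable_mul s s) (hZ.integrable_mul t t),
      hZ.integral_mul_self, hZ.integral_mul_self]
  refine (le_of_eq this).trans (by linarith)

lemma IsIIDNoise.nonneg (hZ : IsIIDNoise P Z σsq) : 0 ≤ σsq := by
  rw [← hZ.variance]; exact variance_nonneg _ _

/-- Independence of the two squares gives a second moment of the product, so fourth moments of the
noise are not needed for distinct times. -/
lemma IsIIDNoise.memLp_mul (hZ : IsIIDNoise P Z σsq) {s t : ℤ} (h : s ≠ t) :
    MemLp (fun ω => Z s ω * Z t ω) 2 P ∧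
      ∫ ω, (Z s ω * Z t ω) * (Z s ω * Z t ω) ∂P = σsq * σsq := by
  have hi : IndepFun (fun ω => Z s ω * Z s ω) (fun ω => Z t ω * Z t ω) P :=
    (hZ.indep.indepFun h).comp (φ := fun z : ℝ => z * z) (ψ := fun z : ℝ => z * z)
      (measurable_id.mul measurable_id) (measurable_id.mul measurable_id)
  have e : ∀ ω, (Z s ω * Z t ω) * (Z s ω * Z t ω) = (Z s ω * Z s ω) * (Z t ω * Z t ω) :=
    fun ω => by ring
  constructor
  · rw [memLp_two_iff_integrable_sq (hZ.integrable_mul s t).1]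
    have := hi.integrable_mul (hZ.integrable_mul s s) (hZ.integrable_mul t t)
    refine this.congr (Eventually.of_forall fun ω => ?_)
    simp only [Pi.mul_apply]; ring
  · simp only [e]
    rw [hi.integral_fun_mul_eq_mul_integral (hZ.integrable_mul s s).1 (hZ.integrable_mul t t).1,
      hZ.integral_mul_self, hZ.integral_mul_self]

/-- The factor at time `i` is independent of the other three jointly and has mean zero. The product
formula requires no integrability of the triple product. -/
lemma IsIIDNoise.integral_mul_four (hZ : IsIIDNoise P Z σsq) {i j k l : ℤ} (h1 : i ≠ j)
    (h2 : i ≠ k) (h3 : i ≠ l) : ∫ ω, (Z i ω * Z j ω) * (Z k ω * Z l ω) ∂P = 0 := by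
  have h := hZ.indep.indepFun_finset {i} {j, k, l} (by simp [h1, h2, h3]) hZ.measurable
  have hi : i ∈ ({i} : Finset ℤ) := by simp
  have hj : j ∈ ({j, k, l} : Finset ℤ) := by simp
  have hk : k ∈ ({j, k, l} : Finset ℤ) := by simp
  have hl : l ∈ ({j, k, l} : Finset ℤ) := by simp
  have h' := h.comp (measurable_pi_apply (⟨i, hi⟩ : ({i} : Finset ℤ)))
    ((measurable_pi_apply (⟨j, hj⟩ : ({j, k, l} : Finset ℤ))).mul
      ((measurable_pi_apply (⟨k, hk⟩ : ({j, k, l} : Finset ℤ))).mul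
        (measurable_pi_apply (⟨l, hl⟩ : ({j, k, l} : Finset ℤ)))))
  have h'' : IndepFun (Z i) (fun ω => Z j ω * (Z k ω * Z l ω)) P := h'
  have h4 := h''.integral_fun_mul_eq_mul_integral (hZ.integrable i).1
    ((hZ.measurable j).mul ((hZ.measurable k).mul (hZ.measurable l))).aestronglyMeasurable
  rw [hZ.integral_eq, zero_mul] at h4
  rw [← h4]
  exact integral_congr_ae (Eventually.of_forall fun ω => by simp only; ring)

/-- The mean absolute value of a weighted sum of the noise. -/
lemma IsIIDNoise.integral_abs_sum_le (hZ : IsIIDNoise P Z σsq) (A : Finset ℕ) (a : ℕ → ℝ) (m : ℤ) :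
    ∫ ω, |∑ t ∈ A, a t * Z ((t : ℤ) - m) ω| ∂P ≤ √(σsq * ∑ t ∈ A, a t ^ 2) :=
  (integral_abs_sum_orthogonal_le A a (fun t _ => hZ.memLp' _) (fun t _ => hZ.integral_mul_self _)
    fun t _ t' _ h => hZ.integral_mul_of_ne fun h' => h (by omega)).2.2

/-- The mean absolute value of a sum of lagged products of the noise. -/
lemma IsIIDNoise.integral_abs_sum_mul_le (hZ : IsIIDNoise P Z σsq) (A : Finset ℕ) {k l : ℤ}
    (h : k ≠ l) :
    ∫ ω, |∑ t ∈ A, Z ((t : ℤ) - k) ω * Z ((t : ℤ) - l) ω| ∂P ≤ σsq * √A.card := by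
  have key := (integral_abs_sum_orthogonal_le (P := P) A (fun _ => 1)
    (D := fun t ω => Z ((t : ℤ) - k) ω * Z ((t : ℤ) - l) ω) (v := σsq * σsq)
    (fun t _ => (hZ.memLp_mul (by omega)).1) (fun t _ => (hZ.memLp_mul (by omega)).2)
    (fun t _ t' _ hne => by
      -- In each of the four cases the latest of the four times occurs once, and its factor has mean
      -- zero given the others.
      rcases lt_or_gt_of_ne h with hkl | hkl <;> rcases lt_or_gt_of_ne hne with ht | ht
      · rw [← hZ.integral_mul_four (i := (t' : ℤ) - k) (j := t' - l) (k := t - k) (l := t - l)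
          (by omega) (by omega) (by omega)]
        exact integral_congr_ae (Eventually.of_forall fun ω => by simp only; ring)
      · exact hZ.integral_mul_four (by omega) (by omega) (by omega)
      · rw [← hZ.integral_mul_four (i := (t' : ℤ) - l) (j := t' - k) (k := t - k) (l := t - l)
          (by omega) (by omega) (by omega)]
        exact integral_congr_ae (Eventually.of_forall fun ω => by simp only; ring)
      · rw [← hZ.integral_mul_four (i := (t : ℤ) - l) (j := t - k) (k := t' - k) (l := t' - l)
          (by omega) (by omega) (by omega)]
        exact integral_congr_ae (Eventually.of_forall fun ω => by simp only; ring))).2.2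
  simp only [one_mul, one_pow, Finset.sum_const, nsmul_eq_mul, mul_one] at key
  rwa [Real.sqrt_mul (mul_self_nonneg _), Real.sqrt_mul_self hZ.nonneg] at key

end Noise

/-! ### Causal moving averages -/

section MovingAverage

variable {Ω : Type*} [MeasurableSpace Ω] {P : Measure Ω} [IsProbabilityMeasure P]
  {Z ε : ℤ → Ω → ℝ} {σsq : ℝ} {w : ℤ → ℝ} {p : ℕ} {φ : Fin p → ℝ}

/-- `ε` is a causal moving average of `Z` with absolutely summable weights `w`. -/
structure IsMovingAverage (P : Measure Ω) (Z ε : ℤ → Ω → ℝ) (w : ℤ → ℝ) : Prop where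
  summable : Summable fun m => |w m|
  causal : ∀ m < 0, w m = 0
  hasSum : ∀ t, ∀ᵐ ω ∂P, HasSum (fun m => w m * Z (t - m) ω) (ε t ω)

/-- The weights are extended by zero to negative indices, so that later shifts of the summation
index need no boundary terms. -/
lemma IsCausalAR.exists_isMovingAverage (hε : IsCausalAR P φ Z ε) :
    ∃ w, IsMovingAverage P Z ε w := by
  obtain ⟨ψ, hψ, hs⟩ := hε.causal
  have hinj : Function.Injective (fun j : ℕ => (j : ℤ)) := Nat.cast_injective
  have hout : ∀ m : ℤ, m ∉ Set.range (fun j : ℕ => (j : ℤ)) → m < 0 := fun m hm => by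
    by_contra h
    exact hm ⟨m.toNat, Int.toNat_of_nonneg (not_lt.1 h)⟩
  refine ⟨fun m => if m < 0 then 0 else ψ m.toNat, ?_, fun m hm => if_pos hm, fun t => ?_⟩
  · rw [← hinj.summable_iff]
    · refine hψ.congr fun j => ?_
      simp only [Function.comp, Int.toNat_natCast]
      rw [if_neg (by omega)]
    · intro m hm
      rw [if_pos (hout m hm), abs_zero]
  · filter_upwards [hs t] with ω hω
    rw [← hinj.hasSum_iff]
    · convert hω using 2 with j
      simp
    · intro m hm
      rw [if_pos (hout m hm), zero_mul]

lemma IsMovingAverage.integral_mul_noise (hw : IsMovingAverage P Z ε w) (hZ : IsIIDNoise P Z σsq)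
    (s u : ℤ) : Integrable (fun ω => ε s ω * Z u ω) P ∧
      ∫ ω, ε s ω * Z u ω ∂P = w (s - u) * σsq := by
  obtain ⟨h1, -, h3⟩ := integral_of_hasSum (P := P) (w := w) (b := fun _ => σsq)
    (g := fun m ω => Z (s - m) ω * Z u ω) (f := fun ω => ε s ω * Z u ω)
    ((hw.hasSum s).mono fun ω hω => by simpa only [mul_assoc] using hω.mul_right (Z u ω))
    (fun m => hZ.integrable_mul _ _) (fun m => hZ.integral_abs_mul_le _ _)
    (hw.summable.mul_right σsq)
  refine ⟨h1, h3.unique ?_⟩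
  simp only [hZ.integral_mul]
  convert hasSum_single (f := fun m => w m * if s - m = u then σsq else 0) (s - u) ?_ using 1
  · rw [if_pos (by ring)]
  · intro m hm
    rw [if_neg (fun h => hm (by omega)), mul_zero]

lemma IsMovingAverage.hasSum_mul (hw : IsMovingAverage P Z ε w) (s t : ℤ) :
    ∀ᵐ ω ∂P, HasSum (fun k : ℤ × ℤ => w k.1 * w k.2 * (Z (s - k.1) ω * Z (t - k.2) ω))
      (ε s ω * ε t ω) := by
  filter_upwards [hw.hasSum s, hw.hasSum t] with ω h1 h2
  have h3 := h1.mul h2 (summable_mul_of_summable_norm h1.summable.norm h2.summable.norm)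
  refine h3.congr_fun fun k => ?_
  ring

lemma IsMovingAverage.summable_mul (hw : IsMovingAverage P Z ε w) :
    Summable fun k : ℤ × ℤ => |w k.1 * w k.2| := by
  have := summable_mul_of_summable_norm (f := fun m => |w m|) (g := fun m => |w m|)
    hw.summable.norm hw.summable.norm
  simpa only [abs_mul] using this

lemma IsMovingAverage.integral_mul (hw : IsMovingAverage P Z ε w) (hZ : IsIIDNoise P Z σsq)
    (s t : ℤ) : Integrable (fun ω => ε s ω * ε t ω) P ∧
      HasSum (fun k : ℤ × ℤ => w k.1 * w k.2 * ∫ ω, Z (s - k.1) ω * Z (t - k.2) ω ∂P)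
        (∫ ω, ε s ω * ε t ω ∂P) := by
  obtain ⟨h1, -, h3⟩ := integral_of_hasSum (P := P) (b := fun _ => σsq) (hw.hasSum_mul s t)
    (fun k => hZ.integrable_mul _ _) (fun k => hZ.integral_abs_mul_le _ _)
    (hw.summable_mul.mul_right σsq)
  exact ⟨h1, h3⟩

lemma IsMovingAverage.integrable (hw : IsMovingAverage P Z ε w) (hZ : IsIIDNoise P Z σsq)
    (t : ℤ) : Integrable (ε t) P :=
  (integral_of_hasSum (P := P) (w := w) (b := fun _ => ∫ ω, |Z 0 ω| ∂P) (hw.hasSum t)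
    (fun _ => hZ.integrable _)
    (fun m => ((hZ.identDistrib (t - m)).comp measurable_abs).integral_eq.le)
    (hw.summable.mul_right _)).1

lemma IsMovingAverage.memLp (hw : IsMovingAverage P Z ε w) (hZ : IsIIDNoise P Z σsq)
    (t : ℤ) : MemLp (ε t) 2 P := by
  rw [memLp_two_iff_integrable_sq (hw.integrable hZ t).1]
  simpa only [sq] using (hw.integral_mul hZ t t).1

/-- The process is weakly stationary. -/
lemma IsMovingAverage.integral_mul_add (hw : IsMovingAverage P Z ε w) (hZ : IsIIDNoise P Z σsq)
    (s t h : ℤ) : ∫ ω, ε (s + h) ω * ε (t + h) ω ∂P = ∫ ω, ε s ω * ε t ω ∂P := by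
  refine (hw.integral_mul hZ (s + h) (t + h)).2.unique ?_
  convert (hw.integral_mul hZ s t).2 using 2 with k
  rw [hZ.integral_mul, hZ.integral_mul]
  congr 1
  refine if_congr ⟨fun h => by omega, fun h => by omega⟩ rfl rfl

/-- The weights invert the autoregressive filter. -/
lemma IsMovingAverage.sum_arVec_mul (hw : IsMovingAverage P Z ε w) (hZ : IsIIDNoise P Z σsq)
    (hσ : 0 < σsq) (hε : IsCausalAR P φ Z ε) (m : ℤ) :
    ∑ j : Fin (p + 1), arVec φ j * w (m - (j : ℕ)) = if m = 0 then 1 else 0 := by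
  -- The autoregressive equation at time 0 is tested against the noise at time `-m`; covariances
  -- with the noise read off the weights.
  have h1 : ∫ ω, (∑ j : Fin (p + 1), arVec φ j * (ε (0 - ((j : ℕ) : ℤ)) ω * Z (-m) ω)) ∂P
      = ∫ ω, Z 0 ω * Z (-m) ω ∂P := by
    refine integral_congr_ae ((hε.autoregression 0).mono fun ω hω => ?_)
    simp only [Fin.sum_univ_succ, arVec_zero, arVec_succ, Fin.val_zero, Fin.val_succ, sub_zero,
      Nat.cast_zero, one_mul, Nat.cast_add, Nat.cast_one] at hω ⊢
    rw [hω, add_mul, Finset.sum_mul, add_right_comm, ← Finset.sum_add_distrib]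
    simp only [neg_mul, mul_assoc, add_neg_cancel, Finset.sum_const_zero, zero_add]
  rw [integral_finsetSum _ fun j _ => (hw.integral_mul_noise hZ _ _).1.const_mul _,
    hZ.integral_mul] at h1
  simp only [integral_const_mul, (hw.integral_mul_noise hZ _ _).2] at h1
  have h2 : ∀ j : Fin (p + 1), arVec φ j * (w (0 - ((j : ℕ) : ℤ) - -m) * σsq)
      = arVec φ j * w (m - (j : ℕ)) * σsq := fun j => by
    rw [show (0 - ((j : ℕ) : ℤ) - -m) = m - (j : ℕ) by ring]; ring
  rw [Finset.sum_congr rfl fun j _ => h2 j, ← Finset.sum_mul] at h1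
  split_ifs with hm
  · rw [if_pos (by omega)] at h1
    exact mul_right_cancel₀ hσ.ne' (by rw [h1, one_mul])
  · rw [if_neg (by omega)] at h1
    exact (mul_eq_zero.1 h1).resolve_right hσ.ne'

/-- Inversion of the autoregressive filter on bounded sequences. -/
lemma hasSum_inverse (hs : Summable fun m => |w m|)
    (hw : ∀ m : ℤ, ∑ j : Fin (p + 1), arVec φ j * w (m - (j : ℕ)) = if m = 0 then 1 else 0)
    {F : ℤ → ℝ} {B : ℝ} (hF : ∀ t, |F t| ≤ B) (t : ℤ) :
    HasSum (fun m => w m * ∑ j : Fin (p + 1), arVec φ j * F (t - m - (j : ℕ))) (F t) := by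
  have hsum : ∀ u : ℤ → ℤ, Summable fun m => w m * F (u m) := fun u => by
    refine Summable.of_norm_bounded (hs.mul_right B) fun m => ?_
    rw [Real.norm_eq_abs, abs_mul]
    exact mul_le_mul_of_nonneg_left (hF _) (abs_nonneg _)
  have h1 : HasSum (fun m => ∑ j : Fin (p + 1), arVec φ j * (w m * F (t - m - (j : ℕ))))
      (∑ j : Fin (p + 1), arVec φ j * ∑' m, w m * F (t - m - (j : ℕ))) :=
    hasSum_sum fun j _ => (hsum fun m => t - m - (j : ℕ)).hasSum.mul_left _
  -- Each lag is moved from `F` to the weights by a shift of the summation index; there the filter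
  -- collapses the weights to a point mass.
  have h2 : HasSum (fun m => ∑ j : Fin (p + 1), arVec φ j * (w (m - (j : ℕ)) * F (t - m)))
      (∑ j : Fin (p + 1), arVec φ j * ∑' m, w m * F (t - m - (j : ℕ))) := by
    refine hasSum_sum fun j _ => HasSum.mul_left _ ?_
    have h3 := (hsum fun m => t - m - (j : ℕ)).hasSum
    rw [← (Equiv.subRight (((j : ℕ) : ℤ))).hasSum_iff] at h3
    refine h3.congr_fun fun m => ?_
    simp only [Function.comp, Equiv.subRight_apply, sub_sub, sub_add_cancel]
  have h4 : HasSum (fun m => ∑ j : Fin (p + 1), arVec φ j * (w (m - (j : ℕ)) * F (t - m)))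
      (F t) := by
    have h5 : (fun m => ∑ j : Fin (p + 1), arVec φ j * (w (m - (j : ℕ)) * F (t - m)))
        = fun m => (if m = 0 then 1 else 0) * F (t - m) := by
      funext m
      rw [← hw m, Finset.sum_mul]
      exact Finset.sum_congr rfl fun j _ => by ring
    rw [h5]
    convert hasSum_single (f := fun m : ℤ => (if m = 0 then (1 : ℝ) else 0) * F (t - m)) 0 ?_ using 1
    · simp
    · intro m hm
      rw [if_neg hm, zero_mul]
  rw [h2.unique h4] at h1
  convert h1 using 2 with m
  rw [Finset.mul_sum]
  exact Finset.sum_congr rfl fun j _ => by ring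

/-- A filter with `arOne φ = 0` would map the constant 1 to 0, and inversion would return 0 instead
of 1. -/
lemma arOne_ne_zero_of_inverse (hs : Summable fun m => |w m|)
    (hw : ∀ m : ℤ, ∑ j : Fin (p + 1), arVec φ j * w (m - (j : ℕ)) = if m = 0 then 1 else 0) :
    arOne φ ≠ 0 := by
  intro h0
  have h1 := hasSum_inverse hs hw (F := fun _ => 1) (B := 1) (fun _ => by simp) 0
  simp only [mul_one, sum_arVec, h0, mul_zero] at h1
  exact zero_ne_one (hasSum_zero.unique h1)

/-- A seasonal function extends to a bounded periodic function on all integers. Inversion writes it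
as a convolution of its filtered version with the weights, so the stability constant is the sum of
their absolute values. -/
lemma seasonStable_of_inverse {T : ℕ} (hT : 0 < T) (hs : Summable fun m => |w m|)
    (hw : ∀ m : ℤ, ∑ j : Fin (p + 1), arVec φ j * w (m - (j : ℕ)) = if m = 0 then 1 else 0) :
    SeasonStable T φ (∑' m, |w m|) := by
  intro s Y hY v
  have hT' : (0 : ℤ) < T := by exact_mod_cast hT
  have hlt : ∀ t : ℤ, ((t - 1) % T).toNat < T := fun t => by
    have h1 := Int.emod_nonneg (t - 1) hT'.ne'
    have h2 := Int.emod_lt_of_pos (t - 1) hT'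
    omega
  set F : ℤ → ℝ := fun t => s ⟨((t - 1) % T).toNat, hlt t⟩ with hF
  have hper : ∀ (t : ℤ) (k : ℤ), F (t + k * T) = F t := fun t k => by
    simp only [hF]
    congr 2
    rw [show t + k * T - 1 = t - 1 + k * T by ring, Int.add_mul_emod_self_right]
  have hnat : ∀ t : ℕ, 1 ≤ t → seasonFn s t = F t := fun t ht => by
    rw [seasonFn_eq hT s ht]
    simp only [hF]
    congr 2
    rw [show ((t : ℤ) - 1) % T = (((t - 1) % T : ℕ) : ℤ) by push_cast [ht]; rfl, Int.toNat_natCast]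
  have hbd : ∀ t, |F t| ≤ ‖s‖ := fun t => norm_le_pi_norm s _
  have hG : ∀ t : ℤ, |∑ j : Fin (p + 1), arVec φ j * F (t - (j : ℕ))| ≤ Y := fun t => by
    -- By periodicity every integer time is moved beyond `p` by a large multiple of the period,
    -- where the hypothesis applies.
    obtain ⟨n, k, hn, hk⟩ : ∃ (n : ℕ) (k : ℤ), p + 1 ≤ n ∧ (n : ℤ) = t + k * T := by
      refine ⟨(t + (|t| + p + 1) * T).toNat, |t| + p + 1, ?_, ?_⟩
      · have h1 : (|t| + p + 1) * 1 ≤ (|t| + p + 1) * T :=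
          mul_le_mul_of_nonneg_left (by omega) (by positivity)
        have := neg_abs_le t
        omega
      · have h1 : (|t| + p + 1) * 1 ≤ (|t| + p + 1) * T :=
          mul_le_mul_of_nonneg_left (by omega) (by positivity)
        have := neg_abs_le t
        rw [Int.toNat_of_nonneg (by omega)]
    have h2 := hY n hn
    rw [arFilter_eq] at h2
    convert h2 using 2
    refine Finset.sum_congr rfl fun j _ => ?_
    have hj := Nat.lt_succ_iff.1 j.2
    rw [hnat _ (by omega), Nat.cast_sub (by omega), hk,
      show t + k * T - (j : ℕ) = t - (j : ℕ) + k * T by ring, hper]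
  have h1 := hasSum_inverse hs hw hbd ((v : ℕ) + 1 : ℕ)
  have h2 : F (((v : ℕ) + 1 : ℕ) : ℤ) = s v := by
    rw [← hnat _ (by omega), seasonFn_eq hT s (by omega)]
    congr 1; ext
    simp [Nat.mod_eq_of_lt v.2]
  rw [← h2, ← h1.tsum_eq, ← tsum_mul_right, ← Real.norm_eq_abs]
  refine tsum_of_norm_bounded (hs.mul_right Y).hasSum fun m => ?_
  rw [Real.norm_eq_abs, abs_mul]
  exact mul_le_mul_of_nonneg_left (hG _) (abs_nonneg _)

lemma tsum_abs_pos_of_inverse (hs : Summable fun m => |w m|)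
    (hw : ∀ m : ℤ, ∑ j : Fin (p + 1), arVec φ j * w (m - (j : ℕ)) = if m = 0 then 1 else 0) :
    0 < ∑' m, |w m| := by
  by_contra! h
  have h0 : ∀ m, w m = 0 := fun m => by
    have := hs.le_tsum m fun _ _ => abs_nonneg _
    exact abs_eq_zero.1 (le_antisymm (this.trans h) (abs_nonneg _))
  have := hw 0
  simp [h0] at this

/-- The covariance matrix of `(ε_0, ε_{-1}, ..., ε_{-p})`. -/
def covMat (P : Measure Ω) (p : ℕ) (ε : ℤ → Ω → ℝ) : Matrix (Fin (p + 1)) (Fin (p + 1)) ℝ :=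
  Matrix.of fun i j => ∫ ω, ε (-((i : ℕ) : ℤ)) ω * ε (-((j : ℕ) : ℤ)) ω ∂P

/-- The combination `f` of process values with coefficients β has covariance a_m σ² with the noise
at time -m. Projection onto one noise variable gives a_m² σ² ≤ E f². The autoregressive filter
recovers each β_i from finitely many a_m, so E f² controls β. -/
lemma IsMovingAverage.covMat_posDef (hw : IsMovingAverage P Z ε w) (hZ : IsIIDNoise P Z σsq)
    (hσ : 0 < σsq)
    (hinv : ∀ m : ℤ, ∑ j : Fin (p + 1), arVec φ j * w (m - (j : ℕ)) = if m = 0 then 1 else 0) :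
    ∃ γ > 0, ∀ β : Fin (p + 1) → ℝ,
      γ * ∑ i, β i ^ 2 ≤ ∑ i, ∑ j, β i * β j * covMat P p ε i j := by
  set A := arNorm φ with hA
  have hA1 : 1 ≤ A := one_le_arNorm φ
  refine ⟨σsq / ((p + 1) * A ^ 2), by positivity, fun β => ?_⟩
  set f : Ω → ℝ := fun ω => ∑ i : Fin (p + 1), β i * ε (-((i : ℕ) : ℤ)) ω with hf
  have hfm : MemLp f 2 P := memLp_finsetSum _ fun i _ => (hw.memLp hZ _).const_mul _
  have hq : ∫ ω, f ω ^ 2 ∂P = ∑ i, ∑ j, β i * β j * covMat P p ε i j := by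
    have h1 : ∀ ω, f ω ^ 2 = ∑ i : Fin (p + 1), ∑ j : Fin (p + 1),
        β i * β j * (ε (-((i : ℕ) : ℤ)) ω * ε (-((j : ℕ) : ℤ)) ω) := fun ω => by
      rw [sq, hf, Finset.sum_mul_sum]
      exact Finset.sum_congr rfl fun i _ => Finset.sum_congr rfl fun j _ => by ring
    have hi : ∀ i j : Fin (p + 1), Integrable (fun ω =>
        β i * β j * (ε (-((i : ℕ) : ℤ)) ω * ε (-((j : ℕ) : ℤ)) ω)) P := fun i j =>
      (hw.integral_mul hZ _ _).1.const_mul _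
    simp only [h1]
    rw [integral_finsetSum _ fun i _ => integrable_finsetSum _ fun j _ => hi i j]
    refine Finset.sum_congr rfl fun i _ => ?_
    rw [integral_finsetSum _ fun j _ => hi i j]
    exact Finset.sum_congr rfl fun j _ => integral_const_mul _ _
  rw [← hq]
  set V := ∫ ω, f ω ^ 2 ∂P with hV
  have hV0 : 0 ≤ V := integral_nonneg fun _ => sq_nonneg _
  -- the moving average coefficients of `f`
  set a : ℤ → ℝ := fun m => ∑ i : Fin (p + 1), β i * w (m - (i : ℕ)) with ha
  have hcov : ∀ m, ∫ ω, f ω * Z (-m) ω ∂P = a m * σsq := fun m => by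
    simp only [hf, Finset.sum_mul, mul_assoc]
    rw [integral_finsetSum _ fun i _ => (hw.integral_mul_noise hZ _ _).1.const_mul _, ha,
      Finset.sum_mul]
    refine Finset.sum_congr rfl fun i _ => ?_
    rw [integral_const_mul, (hw.integral_mul_noise hZ _ _).2,
      show (-((i : ℕ) : ℤ) - -m) = m - (i : ℕ) by ring]
    ring
  have hCS : ∀ m, a m ^ 2 * σsq ≤ V := fun m => by
    have h1 : 0 ≤ ∫ ω, (f ω - a m * Z (-m) ω) ^ 2 ∂P := integral_nonneg fun _ => sq_nonneg _
    have h2 : ∫ ω, (f ω - a m * Z (-m) ω) ^ 2 ∂P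
        = V - 2 * a m * (a m * σsq) + a m ^ 2 * σsq := by
      have e1 : ∀ ω, (f ω - a m * Z (-m) ω) ^ 2 = f ω ^ 2 - 2 * a m * (f ω * Z (-m) ω)
          + a m ^ 2 * (Z (-m) ω * Z (-m) ω) := fun ω => by ring
      simp only [e1]
      have i1 : Integrable (fun ω => f ω ^ 2) P := hfm.integrable_sq
      have i2 : Integrable (fun ω => 2 * a m * (f ω * Z (-m) ω)) P :=
        (hfm.integrable_mul (hZ.memLp' _)).const_mul _
      have i3 : Integrable (fun ω => a m ^ 2 * (Z (-m) ω * Z (-m) ω)) P :=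
        (hZ.integrable_mul _ _).const_mul _
      rw [show ∫ ω, f ω ^ 2 - 2 * a m * (f ω * Z (-m) ω) + a m ^ 2 * (Z (-m) ω * Z (-m) ω) ∂P
        = ∫ ω, (f ω ^ 2 - 2 * a m * (f ω * Z (-m) ω)) ∂P
          + ∫ ω, a m ^ 2 * (Z (-m) ω * Z (-m) ω) ∂P from integral_add (i1.sub i2) i3, integral_sub i1 i2, integral_const_mul, integral_const_mul,
        hcov, hZ.integral_mul_self]
    rw [h2] at h1
    nlinarith
  have hconv : ∀ m : ℤ, ∑ j : Fin (p + 1), arVec φ j * a (m - (j : ℕ))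
      = ∑ i : Fin (p + 1), if m - (i : ℕ) = 0 then β i else 0 := fun m => by
    simp only [ha, Finset.mul_sum]
    rw [Finset.sum_comm]
    refine Finset.sum_congr rfl fun i _ => ?_
    have := hinv (m - (i : ℕ))
    calc ∑ j : Fin (p + 1), arVec φ j * (β i * w (m - (j : ℕ) - (i : ℕ)))
        = β i * ∑ j : Fin (p + 1), arVec φ j * w (m - (i : ℕ) - (j : ℕ)) := by
          rw [Finset.mul_sum]
          refine Finset.sum_congr rfl fun j _ => ?_
          rw [show m - ((j : ℕ) : ℤ) - (i : ℕ) = m - (i : ℕ) - (j : ℕ) by ring]; ring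
      _ = _ := by rw [this, mul_ite, mul_one, mul_zero]
  have hβ : ∀ i, β i ^ 2 ≤ A ^ 2 * (V / σsq) := fun i => by
    have h1 : ∑ j : Fin (p + 1), arVec φ j * a (((i : ℕ) : ℤ) - (j : ℕ)) = β i := by
      rw [hconv, Finset.sum_eq_single i]
      · rw [if_pos (sub_self _)]
      · intro j _ hj
        rw [if_neg]
        intro h
        exact hj (Fin.ext (by omega))
      · simp
    have h2 : |β i| ≤ A * √(V / σsq) := by
      rw [← h1]
      refine abs_sum_arVec_mul_le φ fun j => Real.abs_le_sqrt ?_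
      rw [le_div_iff₀ hσ]
      exact hCS _
    have h3 := pow_le_pow_left₀ (abs_nonneg _) h2 2
    rwa [sq_abs, mul_pow, Real.sq_sqrt (by positivity)] at h3
  have hsum : ∑ i, β i ^ 2 ≤ (p + 1) * (A ^ 2 * (V / σsq)) := by
    refine (Finset.sum_le_card_nsmul _ _ _ fun i _ => hβ i).trans_eq ?_
    simp
  rw [div_mul_eq_mul_div, div_le_iff₀ (by positivity)]
  calc σsq * ∑ i, β i ^ 2 ≤ σsq * ((p + 1) * (A ^ 2 * (V / σsq))) :=
        mul_le_mul_of_nonneg_left hsum hσ.le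
    _ = V * ((p + 1) * A ^ 2) := by field_simp

end MovingAverage

/-! ### Laws of large numbers for lagged products -/

section LargeNumbers

variable {Ω : Type*} [MeasurableSpace Ω] {P : Measure Ω} [IsProbabilityMeasure P]
  {Z ε : ℤ → Ω → ℝ} {σsq : ℝ} {w : ℤ → ℝ} {p : ℕ} {φ : Fin p → ℝ}

lemma card_win (p N : ℕ) : (win p N).card = N - p := by
  rw [win, Nat.card_Ico]; omega

lemma IsIIDNoise.tendsto_integral_abs_mean_sq (hZ : IsIIDNoise P Z σsq) (a : ℤ) :
    Tendsto (fun n : ℕ => ∫ ω, |(n : ℝ)⁻¹ * (∑ i ∈ Finset.range n,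
      Z (i + a) ω * Z (i + a) ω) - σsq| ∂P) atTop (𝓝 0) := by
  have hi : iIndepFun (fun (i : ℕ) ω => Z (i + a) ω * Z (i + a) ω) P := by
    have h1 := hZ.indep.precomp (g := fun i : ℕ => (i : ℤ) + a) (fun i j h => by
      simpa using h)
    exact h1.comp (fun _ z => z * z) fun _ => measurable_id.mul measurable_id
  have h := strong_law_Lp (μ := P) le_rfl ENNReal.one_ne_top
    (fun (i : ℕ) ω => Z (i + a) ω * Z (i + a) ω)
    (memLp_one_iff_integrable.2 (hZ.integrable_mul _ _)) (fun i j hij => hi.indepFun hij)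
    (fun i => (((hZ.identDistrib _).trans (hZ.identDistrib _).symm).comp
      (measurable_id.mul measurable_id)))
  simp only [hZ.integral_mul_self, smul_eq_mul] at h
  have hint : ∀ n : ℕ, Integrable (fun ω => (n : ℝ)⁻¹ * (∑ i ∈ Finset.range n,
      Z (i + a) ω * Z (i + a) ω) - σsq) P := fun n =>
    ((integrable_finsetSum _ fun i _ => hZ.integrable_mul _ _).const_mul _).sub
      (integrable_const _)
  have h2 := (ENNReal.tendsto_toReal ENNReal.zero_ne_top).comp h
  refine h2.congr fun n => ?_
  simp only [Function.comp]
  rw [eLpNorm_one_eq_lintegral_enorm, ← ofReal_integral_norm_eq_lintegral_enorm (hint n),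
    ENNReal.toReal_ofReal (integral_nonneg fun _ => norm_nonneg _)]
  rfl

lemma IsIIDNoise.integrable_sum_mul (hZ : IsIIDNoise P Z σsq) (A : Finset ℕ) (a c : ℤ) :
    Integrable (fun ω => ∑ t ∈ A, Z ((t : ℤ) - a) ω * Z ((t : ℤ) - c) ω) P :=
  integrable_finsetSum _ fun _ _ => hZ.integrable_mul _ _

lemma IsIIDNoise.integrable_lag_error (hZ : IsIIDNoise P Z σsq) (A : Finset ℕ) (a c : ℤ)
    (N : ℕ) (v : ℝ) : Integrable (fun ω => (∑ t ∈ A,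
      Z ((t : ℤ) - a) ω * Z ((t : ℤ) - c) ω) / N - v) P :=
  ((hZ.integrable_sum_mul A a c).div_const _).sub (integrable_const _)

/-- The law of large numbers for the lagged products of the noise, in mean. -/
lemma IsIIDNoise.tendsto_integral_abs_sum_mul (hZ : IsIIDNoise P Z σsq) (p : ℕ) (a c : ℤ) :
    Tendsto (fun N : ℕ => ∫ ω, |(∑ t ∈ win p N, Z ((t : ℤ) - a) ω * Z ((t : ℤ) - c) ω) / N
      - if a = c then σsq else 0| ∂P) atTop (𝓝 0) := by
  split_ifs with h
  · subst h
    have h1 := (hZ.tendsto_integral_abs_mean_sq ((p : ℤ) + 1 - a)).comp (tendsto_sub_atTop_nat p)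
    have h2 : Tendsto (fun N : ℕ => (p : ℝ) / N * σsq) atTop (𝓝 0) := by
      simpa using (tendsto_const_div_atTop_nhds_zero_nat (p : ℝ)).mul_const σsq
    have h3 := h1.add h2
    rw [add_zero] at h3
    refine squeeze_zero' (Eventually.of_forall fun N => integral_nonneg fun _ => abs_nonneg _) ?_ h3
    filter_upwards [eventually_gt_atTop p] with N hN
    have hN0 : (0 : ℝ) < N := by exact_mod_cast (Nat.zero_le p).trans_lt hN
    have hNp : (0 : ℝ) < ((N - p : ℕ) : ℝ) := by exact_mod_cast Nat.sub_pos_of_lt hN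
    have hcast : ((N - p : ℕ) : ℝ) = N - p := Nat.cast_sub hN.le
    set G : Ω → ℝ := fun ω => ((N - p : ℕ) : ℝ)⁻¹ * (∑ i ∈ Finset.range (N - p),
      Z (i + ((p : ℤ) + 1 - a)) ω * Z (i + ((p : ℤ) + 1 - a)) ω) - σsq with hG
    have hGi : Integrable G P :=
      ((integrable_finsetSum _ fun i _ => hZ.integrable_mul _ _).const_mul _).sub
        (integrable_const _)
    have hpt : ∀ ω, |(∑ t ∈ win p N, Z ((t : ℤ) - a) ω * Z ((t : ℤ) - a) ω) / N - σsq|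
        ≤ |G ω| + (p : ℝ) / N * σsq := fun ω => by
      have e1 : ∑ t ∈ win p N, Z ((t : ℤ) - a) ω * Z ((t : ℤ) - a) ω
          = (N - p : ℕ) * (G ω + σsq) := by
        simp only [hG]
        rw [← sum_fin_eq_sum_win, Finset.sum_range, sub_add_cancel]
        rw [mul_inv_cancel_left₀ hNp.ne']
        refine Finset.sum_congr rfl fun i _ => ?_
        rw [show ((p + 1 + (i : ℕ) : ℕ) : ℤ) - a = (i : ℕ) + ((p : ℤ) + 1 - a) by push_cast; ring]
      have e2 : (∑ t ∈ win p N, Z ((t : ℤ) - a) ω * Z ((t : ℤ) - a) ω) / N - σsq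
          = ((N - p : ℕ) : ℝ) / N * G ω - p / N * σsq := by
        rw [e1, hcast]; field_simp; ring
      rw [e2]
      refine (abs_sub _ _).trans (add_le_add ?_ ?_)
      · rw [abs_mul, abs_of_nonneg (by positivity)]
        refine mul_le_of_le_one_left (abs_nonneg _) ((div_le_one hN0).2 ?_)
        exact_mod_cast Nat.sub_le N p
      · rw [abs_of_nonneg (mul_nonneg (by positivity) hZ.nonneg)]
    calc ∫ ω, |(∑ t ∈ win p N, Z ((t : ℤ) - a) ω * Z ((t : ℤ) - a) ω) / N - σsq| ∂P
        ≤ ∫ ω, (|G ω| + (p : ℝ) / N * σsq) ∂P :=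
          integral_mono (hZ.integrable_lag_error _ _ _ _ _).abs
            (hGi.abs.add (integrable_const _)) hpt
      _ = ∫ ω, |G ω| ∂P + (p : ℝ) / N * σsq := by
          rw [integral_add hGi.abs (integrable_const _)]; simp
  · have h1 : Tendsto (fun N : ℕ => σsq * (√N / N)) atTop (𝓝 0) := by
      have h2 : Tendsto (fun N : ℕ => (√(N : ℝ))⁻¹) atTop (𝓝 0) :=
        tendsto_inv_atTop_zero.comp (Real.tendsto_sqrt_atTop.comp tendsto_natCast_atTop_atTop)
      simpa [Real.sqrt_div_self] using h2.const_mul σsq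
    refine squeeze_zero (fun N => integral_nonneg fun _ => abs_nonneg _) (fun N => ?_) h1
    simp only [sub_zero, abs_div, Nat.abs_cast]
    rw [integral_div, ← mul_div_assoc]
    refine div_le_div_of_nonneg_right ((hZ.integral_abs_sum_mul_le _ h).trans ?_) (Nat.cast_nonneg N)
    refine mul_le_mul_of_nonneg_left (Real.sqrt_le_sqrt ?_) hZ.nonneg
    rw [card_win]
    exact_mod_cast Nat.sub_le N p

lemma IsIIDNoise.integral_abs_lag_error_le (hZ : IsIIDNoise P Z σsq) (p N : ℕ) (a c : ℤ) :
    ∫ ω, |(∑ t ∈ win p N, Z ((t : ℤ) - a) ω * Z ((t : ℤ) - c) ω) / N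
      - if a = c then σsq else 0| ∂P ≤ 2 * σsq := by
  have h0 := hZ.nonneg
  have hv : |if a = c then σsq else 0| ≤ σsq := by
    split_ifs
    · rw [abs_of_nonneg h0]
    · rwa [abs_zero]
  have hi := fun t : ℕ => (hZ.integrable_mul ((t : ℤ) - a) ((t : ℤ) - c)).abs
  have h1 : ∫ ω, ((∑ t ∈ win p N, |Z ((t : ℤ) - a) ω * Z ((t : ℤ) - c) ω|) / N + σsq) ∂P
      ≤ 2 * σsq := by
    rw [integral_add ((integrable_finsetSum _ fun t _ => hi t).div_const _) (integrable_const _),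
      integral_div, integral_finsetSum _ fun t _ => hi t]
    have h2 : ∑ t ∈ win p N, ∫ ω, |Z ((t : ℤ) - a) ω * Z ((t : ℤ) - c) ω| ∂P ≤ N * σsq := by
      refine (Finset.sum_le_card_nsmul _ _ _ fun t _ => hZ.integral_abs_mul_le _ _).trans ?_
      rw [nsmul_eq_mul, card_win]
      exact mul_le_mul_of_nonneg_right (by exact_mod_cast Nat.sub_le N p) h0
    have h3 : (∑ t ∈ win p N, ∫ ω, |Z ((t : ℤ) - a) ω * Z ((t : ℤ) - c) ω| ∂P) / N ≤ σsq :=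
      div_le_of_le_mul₀ (Nat.cast_nonneg N) h0 (by rwa [mul_comm])
    simp only [integral_const, probReal_univ, smul_eq_mul, one_mul]
    linarith
  refine le_trans (integral_mono (hZ.integrable_lag_error _ _ _ _ _).abs
    (((integrable_finsetSum _ fun t _ => hi t).div_const _).add (integrable_const _))
    fun ω => ?_) h1
  refine (abs_sub _ _).trans (add_le_add ?_ hv)
  rw [abs_div, Nat.abs_cast]
  exact div_le_div_of_nonneg_right (Finset.abs_sum_le_sum_abs _ _) (Nat.cast_nonneg N)

/-- The law of large numbers for the lagged products of a moving average, in mean. -/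
lemma IsMovingAverage.tendsto_integral_abs_lagProd (hw : IsMovingAverage P Z ε w)
    (hZ : IsIIDNoise P Z σsq) (i j : Fin (p + 1)) :
    (∀ N : ℕ, Integrable (fun ω => lagProd p N (fun t => ε t ω) (fun t => ε t ω) i j / N
      - covMat P p ε i j) P) ∧
    Tendsto (fun N : ℕ => ∫ ω, |lagProd p N (fun t => ε t ω) (fun t => ε t ω) i j / N
      - covMat P p ε i j| ∂P) atTop (𝓝 0) := by
  have hi := Nat.lt_succ_iff.1 i.2
  have hj := Nat.lt_succ_iff.1 j.2
  -- The error in the law of large numbers for one pair of shifts of the noise; the error for the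
  -- process is a weighted series of these.
  set g : ℕ → ℤ × ℤ → Ω → ℝ := fun N k ω =>
    (∑ t ∈ win p N, Z ((t : ℤ) - ((i : ℕ) + k.1)) ω * Z ((t : ℤ) - ((j : ℕ) + k.2)) ω) / N
      - if (i : ℕ) + k.1 = (j : ℕ) + k.2 then σsq else 0 with hg
  have hall : ∀ᵐ ω ∂P, ∀ t : ℕ, HasSum (fun k : ℤ × ℤ => w k.1 * w k.2 *
      (Z ((t : ℤ) - (i : ℕ) - k.1) ω * Z ((t : ℤ) - (j : ℕ) - k.2) ω))
      (ε ((t : ℤ) - (i : ℕ)) ω * ε ((t : ℤ) - (j : ℕ)) ω) :=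
    ae_all_iff.2 fun t => hw.hasSum_mul _ _
  have hcov : HasSum (fun k : ℤ × ℤ => w k.1 * w k.2 *
      if (i : ℕ) + k.1 = (j : ℕ) + k.2 then σsq else 0) (covMat P p ε i j) := by
    refine (hw.integral_mul hZ (-((i : ℕ) : ℤ)) (-((j : ℕ) : ℤ))).2.congr_fun fun k => ?_
    rw [hZ.integral_mul]
    congr 1
    exact if_congr ⟨fun h => by omega, fun h => by omega⟩ rfl rfl
  have key := fun N : ℕ => integral_of_hasSum (P := P) (κ := ℤ × ℤ)
    (w := fun k => w k.1 * w k.2) (b := fun k => ∫ ω, |g N k ω| ∂P) (g := g N)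
    (f := fun ω => lagProd p N (fun t => ε t ω) (fun t => ε t ω) i j / N - covMat P p ε i j)
    (hall.mono fun ω hω => by
      have h1 := ((hasSum_sum (s := win p N) fun t _ => hω t).div_const (N : ℝ)).sub hcov
      have h2 : lagProd p N (fun t => ε t ω) (fun t => ε t ω) i j
          = ∑ t ∈ win p N, ε ((t : ℤ) - (i : ℕ)) ω * ε ((t : ℤ) - (j : ℕ)) ω := by
        refine Finset.sum_congr rfl fun t ht => ?_
        have := (mem_win.1 ht).1
        simp only
        rw [Nat.cast_sub (by omega), Nat.cast_sub (by omega)]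
      rw [h2]
      refine h1.congr_fun fun k => ?_
      simp only [hg]
      rw [← Finset.mul_sum, mul_div_assoc, ← mul_sub]
      simp only [sub_sub])
    (fun k => hZ.integrable_lag_error _ _ _ _ _) (fun k => le_rfl)
    (Summable.of_nonneg_of_le (fun k => mul_nonneg (abs_nonneg _)
      (integral_nonneg fun _ => abs_nonneg _))
      (fun k => mul_le_mul_of_nonneg_left (hZ.integral_abs_lag_error_le p N _ _) (abs_nonneg _))
      (hw.summable_mul.mul_right (2 * σsq)))
  refine ⟨fun N => (key N).1, ?_⟩
  -- Each pair tends to 0 in mean, and all are bounded by 2σ² times a summable weight.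
  have h1 := tendsto_tsum_of_dominated_convergence (𝓕 := atTop)
    (f := fun (N : ℕ) (k : ℤ × ℤ) => |w k.1 * w k.2| * ∫ ω, |g N k ω| ∂P) (g := fun _ => (0 : ℝ))
    (hw.summable_mul.mul_right (2 * σsq))
    (fun k => by simpa using (hZ.tendsto_integral_abs_sum_mul p _ _).const_mul |w k.1 * w k.2|)
    (Eventually.of_forall fun N k => by
      rw [Real.norm_of_nonneg (mul_nonneg (abs_nonneg _) (integral_nonneg fun _ => abs_nonneg _))]
      exact mul_le_mul_of_nonneg_left (hZ.integral_abs_lag_error_le p N _ _) (abs_nonneg _))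
  rw [tsum_zero] at h1
  exact squeeze_zero (fun N => integral_nonneg fun _ => abs_nonneg _) (fun N => (key N).2.1) h1

lemma IsMovingAverage.integral_abs_le (hw : IsMovingAverage P Z ε w) (hZ : IsIIDNoise P Z σsq)
    (t : ℤ) : ∫ ω, |ε t ω| ∂P ≤ ∑' m, |w m| * ∫ ω, |Z 0 ω| ∂P :=
  (integral_of_hasSum (P := P) (w := w) (b := fun _ => ∫ ω, |Z 0 ω| ∂P) (hw.hasSum t)
    (fun _ => hZ.integrable _)
    (fun m => ((hZ.identDistrib (t - m)).comp measurable_abs).integral_eq.le)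
    (hw.summable.mul_right _)).2.1

/-- Weighted sums of a moving average are of the order of the square root of their length. -/
lemma IsMovingAverage.integral_abs_sum_le (hw : IsMovingAverage P Z ε w)
    (hZ : IsIIDNoise P Z σsq) {i : ℕ} (hi : i ≤ p) (N : ℕ) {a : ℕ → ℝ} (ha : ∀ t, |a t| ≤ 1) :
    Integrable (fun ω => ∑ t ∈ win p N, ε ((t - i : ℕ) : ℤ) ω * a t) P ∧
      ∫ ω, |∑ t ∈ win p N, ε ((t - i : ℕ) : ℤ) ω * a t| ∂P
        ≤ (∑' m, |w m| * √σsq) * √N := by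
  have hall : ∀ᵐ ω ∂P, ∀ t : ℕ, HasSum (fun m => w m * Z ((t : ℤ) - (i : ℕ) - m) ω)
      (ε ((t : ℤ) - (i : ℕ)) ω) := ae_all_iff.2 fun t => hw.hasSum _
  have key := integral_of_hasSum (P := P) (w := w) (b := fun _ => √σsq * √N)
    (g := fun m ω => ∑ t ∈ win p N, a t * Z ((t : ℤ) - ((i : ℕ) + m)) ω)
    (f := fun ω => ∑ t ∈ win p N, ε ((t - i : ℕ) : ℤ) ω * a t)
    (hall.mono fun ω hω => by
      have h1 := hasSum_sum (s := win p N) fun t _ => (hω t).mul_right (a t)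
      have h2 : ∑ t ∈ win p N, ε ((t - i : ℕ) : ℤ) ω * a t
          = ∑ t ∈ win p N, ε ((t : ℤ) - (i : ℕ)) ω * a t := by
        refine Finset.sum_congr rfl fun t ht => ?_
        have := (mem_win.1 ht).1
        rw [Nat.cast_sub (by omega)]
      rw [h2]
      refine h1.congr_fun fun m => ?_
      rw [Finset.mul_sum]
      refine Finset.sum_congr rfl fun t _ => ?_
      rw [sub_sub]; ring)
    (fun m => integrable_finsetSum _ fun t _ => (hZ.integrable _).const_mul _)
    (fun m => (hZ.integral_abs_sum_le _ _ _).trans (by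
      rw [Real.sqrt_mul hZ.nonneg]
      refine mul_le_mul_of_nonneg_left (Real.sqrt_le_sqrt ?_) (Real.sqrt_nonneg _)
      refine (Finset.sum_le_card_nsmul _ _ 1 fun t _ => ?_).trans ?_
      · rw [← sq_abs]; exact pow_le_one₀ (abs_nonneg _) (ha t)
      · rw [card_win, nsmul_eq_mul, mul_one]; exact_mod_cast Nat.sub_le N p))
    (hw.summable.mul_right _)
  refine ⟨key.1, key.2.1.trans_eq ?_⟩
  rw [← tsum_mul_right]
  exact tsum_congr fun m => (mul_assoc _ _ _).symm

/-- The past of a causal moving average is nearly orthogonal to the noise. -/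
lemma IsMovingAverage.integral_abs_sum_mul_noise_le (hw : IsMovingAverage P Z ε w)
    (hZ : IsIIDNoise P Z σsq) {i : ℕ} (hi : i < p) (N : ℕ) :
    Integrable (fun ω => ∑ t ∈ win p N, ε ((t - (i + 1) : ℕ) : ℤ) ω * Z t ω) P ∧
      ∫ ω, |∑ t ∈ win p N, ε ((t - (i + 1) : ℕ) : ℤ) ω * Z t ω| ∂P
        ≤ (∑' m, |w m| * σsq) * √N := by
  have hall : ∀ᵐ ω ∂P, ∀ t : ℕ, HasSum (fun m => w m * Z ((t : ℤ) - (i + 1 : ℕ) - m) ω)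
      (ε ((t : ℤ) - (i + 1 : ℕ)) ω) := ae_all_iff.2 fun t => hw.hasSum _
  have key := integral_of_hasSum (P := P) (w := w) (b := fun _ => σsq * √N)
    -- Weights with negative index vanish. These terms are cut off because `m = -(i + 1)` would pair
    -- the noise with itself, where there is no square root bound.
    (g := fun m ω => if m < 0 then 0 else
      ∑ t ∈ win p N, Z ((t : ℤ) - ((i + 1 : ℕ) + m)) ω * Z ((t : ℤ) - 0) ω)
    (f := fun ω => ∑ t ∈ win p N, ε ((t - (i + 1) : ℕ) : ℤ) ω * Z t ω)
    (hall.mono fun ω hω => by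
      have h1 := hasSum_sum (s := win p N) fun t _ => (hω t).mul_right (Z t ω)
      have h2 : ∑ t ∈ win p N, ε ((t - (i + 1) : ℕ) : ℤ) ω * Z t ω
          = ∑ t ∈ win p N, ε ((t : ℤ) - (i + 1 : ℕ)) ω * Z t ω := by
        refine Finset.sum_congr rfl fun t ht => ?_
        have := (mem_win.1 ht).1
        rw [Nat.cast_sub (by omega)]
      rw [h2]
      refine h1.congr_fun fun m => ?_
      split_ifs with hm
      · simp [hw.causal m hm]
      rw [Finset.mul_sum]
      refine Finset.sum_congr rfl fun t _ => ?_
      rw [sub_sub, sub_zero]; ring)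
    (fun m => by
      split_ifs
      · exact integrable_const _
      · exact hZ.integrable_sum_mul _ _ _)
    (fun m => by
      split_ifs with hm
      · simpa using mul_nonneg hZ.nonneg (Real.sqrt_nonneg _)
      · refine (hZ.integral_abs_sum_mul_le _ (by omega)).trans ?_
        refine mul_le_mul_of_nonneg_left (Real.sqrt_le_sqrt ?_) hZ.nonneg
        rw [card_win]; exact_mod_cast Nat.sub_le N p)
    (hw.summable.mul_right _)
  refine ⟨key.1, key.2.1.trans_eq ?_⟩
  rw [← tsum_mul_right]
  exact tsum_congr fun m => (mul_assoc _ _ _).symm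

end LargeNumbers

/-! ### Partial sums of an autoregression -/

section PartialSums

/-- Each unit shift changes a sum over consecutive times by two boundary terms. -/
lemma abs_sum_shift_sub_le {F : ℤ → ℝ} {p N n : ℕ} {m : ℝ}
    (hF : ∀ t : ℤ, -p ≤ t → t ≤ N → |F t| ≤ m) (hn : n ≤ N) :
    ∀ j ≤ p, |∑ u ∈ Finset.Ico 1 (n + 1), F ((u : ℤ) - (j : ℕ))
      - ∑ u ∈ Finset.Ico 1 (n + 1), F u| ≤ 2 * j * m
  | 0, _ => by simp
  | j + 1, hj => by
    have ih := abs_sum_shift_sub_le hF hn j (by omega)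
    have htel : ∀ n : ℕ, ∑ u ∈ Finset.Ico 1 (n + 1), F ((u : ℤ) - (j + 1 : ℕ))
        = ∑ u ∈ Finset.Ico 1 (n + 1), F ((u : ℤ) - (j : ℕ)) + (F (-(j : ℕ)) - F (n - (j : ℕ))) := by
      intro n
      induction n with
      | zero => simp
      | succ n ih =>
        rw [Finset.sum_Ico_succ_top (show 1 ≤ n + 1 by omega),
          Finset.sum_Ico_succ_top (show 1 ≤ n + 1 by omega), ih]
        rw [show ((n + 1 : ℕ) : ℤ) - (j + 1 : ℕ) = n - (j : ℕ) by push_cast; ring]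
        ring
    have h1 := abs_le.1 (hF (-(j : ℕ)) (by omega) (by omega))
    have h2 := abs_le.1 (hF (n - (j : ℕ)) (by omega) (by omega))
    rw [htel]
    rw [abs_le] at ih ⊢
    push_cast
    constructor <;> linarith [h1.1, h1.2, h2.1, h2.2, ih.1, ih.2]

/-- The partial sums of a sequence are controlled by those of its autoregressive filter. -/
lemma abs_arOne_mul_sum_le {F : ℤ → ℝ} {p N n : ℕ} {m : ℝ} (φ : Fin p → ℝ)
    (hF : ∀ t : ℤ, -p ≤ t → t ≤ N → |F t| ≤ m) (hn : n ≤ N) :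
    |arOne φ| * |∑ u ∈ Finset.Ico 1 (n + 1), F u|
      ≤ |∑ u ∈ Finset.Ico 1 (n + 1), ∑ j : Fin (p + 1), arVec φ j * F ((u : ℤ) - (j : ℕ))|
        + arNorm φ * (2 * p * m) := by
  have hm : 0 ≤ m := (abs_nonneg _).trans (hF 0 (by omega) (by omega))
  have h1 : |∑ j : Fin (p + 1), arVec φ j * (∑ u ∈ Finset.Ico 1 (n + 1), F ((u : ℤ) - (j : ℕ))
      - ∑ u ∈ Finset.Ico 1 (n + 1), F u)| ≤ arNorm φ * (2 * p * m) := by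
    refine abs_sum_arVec_mul_le φ fun j => ?_
    have hj := Nat.lt_succ_iff.1 j.2
    refine (abs_sum_shift_sub_le hF hn _ hj).trans ?_
    have : ((j : ℕ) : ℝ) ≤ p := by exact_mod_cast hj
    gcongr
  have h2 : ∑ j : Fin (p + 1), arVec φ j * (∑ u ∈ Finset.Ico 1 (n + 1), F ((u : ℤ) - (j : ℕ))
      - ∑ u ∈ Finset.Ico 1 (n + 1), F u)
      = ∑ u ∈ Finset.Ico 1 (n + 1), ∑ j : Fin (p + 1), arVec φ j * F ((u : ℤ) - (j : ℕ))
        - arOne φ * ∑ u ∈ Finset.Ico 1 (n + 1), F u := by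
    rw [Finset.sum_comm, ← sum_arVec, Finset.sum_mul, ← Finset.sum_sub_distrib]
    exact Finset.sum_congr rfl fun j _ => by rw [mul_sub, Finset.mul_sum]
  rw [h2] at h1
  rw [← abs_mul]
  rw [abs_le] at h1
  have h3 := neg_abs_le (∑ u ∈ Finset.Ico 1 (n + 1), ∑ j : Fin (p + 1),
    arVec φ j * F ((u : ℤ) - (j : ℕ)))
  have h4 := le_abs_self (∑ u ∈ Finset.Ico 1 (n + 1), ∑ j : Fin (p + 1),
    arVec φ j * F ((u : ℤ) - (j : ℕ)))
  rw [abs_le]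
  constructor <;> linarith [h1.1, h1.2]

variable {Ω : Type*} [MeasurableSpace Ω] {P : Measure Ω} [IsProbabilityMeasure P]
  {Z ε : ℤ → Ω → ℝ} {σsq : ℝ} {w : ℤ → ℝ} {p : ℕ} {φ : Fin p → ℝ}

lemma IsIIDNoise.martingale (hZ : IsIIDNoise P Z σsq) :
    ∃ 𝒢 : Filtration ℕ (inferInstance : MeasurableSpace Ω),
      Martingale (fun (n : ℕ) ω => ∑ u ∈ Finset.Ico 1 (n + 1), Z (u : ℤ) ω) 𝒢 P := by
  have hm : ∀ i : ℕ, StronglyMeasurable (Z (i : ℤ)) := fun i => (hZ.measurable i).stronglyMeasurable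
  have hi : iIndepFun (fun i : ℕ => Z (i : ℤ)) P := hZ.indep.precomp Nat.cast_injective
  set 𝒢 := Filtration.natural (fun i : ℕ => Z (i : ℤ)) hm with h𝒢
  refine ⟨𝒢, martingale_of_condExp_sub_eq_zero_nat (fun n => ?_) (fun n => ?_) fun n => ?_⟩
  · refine Finset.stronglyMeasurable_fun_sum _ fun u hu => ?_
    exact (Filtration.stronglyAdapted_natural hm u).mono
      (𝒢.mono (Nat.lt_succ_iff.1 (Finset.mem_Ico.1 hu).2))
  · exact integrable_finsetSum _ fun u _ => hZ.integrable _
  · have h1 : ((fun ω => ∑ u ∈ Finset.Ico 1 (n + 1 + 1), Z (u : ℤ) ω)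
        - fun ω => ∑ u ∈ Finset.Ico 1 (n + 1), Z (u : ℤ) ω) = Z ((n + 1 : ℕ) : ℤ) := by
      funext ω
      simp [Finset.sum_Ico_succ_top]
    rw [h1]
    refine (hi.condExp_natural_ae_eq_of_lt hm (Nat.lt_succ_self n)).trans ?_
    rw [hZ.integral_eq]; rfl

/-- The maximal partial sum of the noise. -/
def maxNoise (Z : ℤ → Ω → ℝ) (x : ℕ × Ω) : ℝ :=
  (Finset.range (x.1 + 1)).sup' Finset.nonempty_range_add_one
    fun k => |∑ u ∈ Finset.Ico 1 (k + 1), Z (u : ℤ) x.2|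

lemma le_maxNoise (Z : ℤ → Ω → ℝ) {N n : ℕ} (hn : n ≤ N) (ω : Ω) :
    |∑ u ∈ Finset.Ico 1 (n + 1), Z (u : ℤ) ω| ≤ maxNoise Z (N, ω) :=
  Finset.le_sup' (fun k : ℕ => |∑ u ∈ Finset.Ico 1 (k + 1), Z (u : ℤ) ω|)
    (Finset.mem_range.2 (Nat.lt_succ_of_le hn))

/-- Doob's maximal inequality for the absolute value of the martingale of partial sums. A bound for
the final sum in mean is enough. -/
lemma IsIIDNoise.measure_maxNoise_le (hZ : IsIIDNoise P Z σsq) (N : ℕ) {c : ℝ} (hc : 0 < c) :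
    P {ω | c ≤ maxNoise Z (N, ω)} ≤ ENNReal.ofReal (√(σsq * N) / c) := by
  obtain ⟨𝒢, h𝒢⟩ := hZ.martingale
  have hsub : Submartingale (fun (n : ℕ) ω => |∑ u ∈ Finset.Ico 1 (n + 1), Z (u : ℤ) ω|) 𝒢 P :=
    h𝒢.submartingale.sup h𝒢.neg.submartingale
  have h1 := maximal_ineq hsub (fun _ _ => abs_nonneg _) (ε := c.toNNReal) N
  rw [Real.coe_toNNReal _ hc.le] at h1
  have h2 : ∫ ω in {ω | c ≤ maxNoise Z (N, ω)}, |∑ u ∈ Finset.Ico 1 (N + 1), Z (u : ℤ) ω| ∂P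
      ≤ √(σsq * N) := by
    have h3 := hZ.integral_abs_sum_le (Finset.Ico 1 (N + 1)) (fun _ => 1) 0
    simp only [one_mul, sub_zero, one_pow, Finset.sum_const, Nat.card_Ico, nsmul_eq_mul, mul_one,
      Nat.add_sub_cancel] at h3
    exact (setIntegral_le_integral (hsub.integrable N)
      (Eventually.of_forall fun _ => abs_nonneg _)).trans h3
  rw [ENNReal.ofReal_div_of_pos hc,
    ENNReal.le_div_iff_mul_le (Or.inl (ENNReal.ofReal_pos.2 hc).ne') (Or.inl ENNReal.ofReal_ne_top),
    mul_comm]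
  exact h1.trans (ENNReal.ofReal_le_ofReal h2)

lemma const_isLittleO_log : (fun _ : ℕ => (1 : ℝ)) =o[atTop] fun n : ℕ => Real.log n :=
  (Real.isLittleO_const_log_atTop (c := 1)).comp_tendsto tendsto_natCast_atTop_atTop

lemma id_isLittleO_mul_log :
    (fun n : ℕ => (n : ℝ)) =o[atTop] fun n : ℕ => (n : ℝ) * Real.log n := by
  simpa using (isBigO_refl (fun n : ℕ => (n : ℝ)) atTop).mul_isLittleO const_isLittleO_log

lemma mul_log_nonneg (n : ℕ) : 0 ≤ (n : ℝ) * Real.log n :=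
  mul_nonneg (Nat.cast_nonneg n) (Real.log_natCast_nonneg n)

lemma sqrt_isLittleO_scA : (fun n : ℕ => √(n : ℝ)) =o[atTop] scA :=
  id_isLittleO_mul_log.sqrt (Eventually.of_forall mul_log_nonneg)

lemma IsIIDNoise.maxNoise_isLittleO (hZ : IsIIDNoise P Z σsq) :
    maxNoise Z =o[probFilter P] fun x => scA x.1 := by
  rw [isLittleO_iff]
  intro c hc
  rw [eventually_probFilter]
  have h1 : Tendsto (fun N : ℕ => ENNReal.ofReal (√σsq / c * (√N / scA N))) atTop (𝓝 0) := by
    have h2 := sqrt_isLittleO_scA.tendsto_div_nhds_zero.const_mul (√σsq / c)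
    rw [mul_zero] at h2
    simpa using ENNReal.tendsto_ofReal h2
  refine tendsto_of_tendsto_of_tendsto_of_le_of_le' tendsto_const_nhds h1
    (Eventually.of_forall fun _ => zero_le) ?_
  filter_upwards [eventually_gt_atTop 1] with N hN
  have hs : 0 < scA N := by
    refine Real.sqrt_pos.2 (mul_pos (by positivity) (Real.log_pos (by exact_mod_cast hN)))
  refine (measure_mono fun ω hω => ?_).trans
    ((hZ.measure_maxNoise_le N (mul_pos hc hs)).trans_eq ?_)
  · have h0 : 0 ≤ maxNoise Z (N, ω) := (abs_nonneg _).trans (le_maxNoise Z (Nat.zero_le N) ω)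
    have h3 : ¬ ‖maxNoise Z (N, ω)‖ ≤ c * ‖scA N‖ := hω
    rw [Real.norm_of_nonneg h0, Real.norm_of_nonneg hs.le] at h3
    exact (not_le.1 h3).le
  · rw [Real.sqrt_mul hZ.nonneg, mul_div_mul_comm]

/-- An upper bound for the process on `[-p, N]`. -/
def maxProcess (p : ℕ) (ε : ℤ → Ω → ℝ) (x : ℕ × Ω) : ℝ :=
  √(∑ t ∈ Finset.Icc (-(p : ℤ)) x.1, ε t x.2 * ε t x.2)

lemma abs_le_maxProcess (ε : ℤ → Ω → ℝ) {N : ℕ} {t : ℤ} (h1 : -p ≤ t) (h2 : t ≤ N) (ω : Ω) :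
    |ε t ω| ≤ maxProcess p ε (N, ω) := by
  refine Real.abs_le_sqrt ?_
  rw [sq]
  exact Finset.single_le_sum (f := fun t => ε t ω * ε t ω) (fun _ _ => mul_self_nonneg _)
    (Finset.mem_Icc.2 ⟨h1, h2⟩)

/-- The maximum over a stretch of N times is at most the root of the sum of squares, whose mean is
linear in N by stationarity. This crude order √N already lies below √(N log N). -/
lemma IsMovingAverage.maxProcess_isLittleO (hw : IsMovingAverage P Z ε w)
    (hZ : IsIIDNoise P Z σsq) :
    maxProcess p ε =o[probFilter P] fun x => scA x.1 := by
  have hint : ∀ N : ℕ, Integrable (fun ω => ∑ t ∈ Finset.Icc (-(p : ℤ)) N, ε t ω * ε t ω) P :=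
    fun N => integrable_finsetSum _ fun t _ => (hw.integral_mul hZ t t).1
  have hval : ∀ N : ℕ, ∫ ω, |∑ t ∈ Finset.Icc (-(p : ℤ)) N, ε t ω * ε t ω| ∂P
      = (∫ ω, ε 0 ω * ε 0 ω ∂P) * (N + (p + 1)) := fun N => by
    have h0 : ∀ ω, |∑ t ∈ Finset.Icc (-(p : ℤ)) N, ε t ω * ε t ω|
        = ∑ t ∈ Finset.Icc (-(p : ℤ)) N, ε t ω * ε t ω := fun ω =>
      abs_of_nonneg (Finset.sum_nonneg fun _ _ => mul_self_nonneg _)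
    simp only [h0]
    rw [integral_finsetSum _ fun t _ => (hw.integral_mul hZ t t).1]
    have h1 : ∀ t : ℤ, ∫ ω, ε t ω * ε t ω ∂P = ∫ ω, ε 0 ω * ε 0 ω ∂P := fun t => by
      simpa using hw.integral_mul_add hZ 0 0 t
    have h2 : ((N : ℤ) + 1 - -(p : ℤ)).toNat = N + (p + 1) := by omega
    simp only [h1, Finset.sum_const, Int.card_Icc, h2, nsmul_eq_mul]
    push_cast; ring
  have hO : (fun N : ℕ => ∫ ω, |∑ t ∈ Finset.Icc (-(p : ℤ)) N, ε t ω * ε t ω| ∂P)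
      =o[atTop] fun N : ℕ => (N : ℝ) * Real.log N := by
    simp only [hval]
    refine IsLittleO.const_mul_left (id_isLittleO_mul_log.add ?_) _
    refine IsBigO.trans_isLittleO ?_ id_isLittleO_mul_log
    refine (isLittleO_const_left.2 (Or.inr ?_)).isBigO
    exact tendsto_norm_atTop_atTop.comp tendsto_natCast_atTop_atTop
  exact (isLittleO_of_integral hint hO).sqrt (Eventually.of_forall fun x => mul_log_nonneg x.1)

end PartialSums

/-! ### Regularity of an autoregression -/

section AR

variable {Ω : Type*} [MeasurableSpace Ω] {P : Measure Ω} [IsProbabilityMeasure P]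
  {Z ε : ℤ → Ω → ℝ} {σsq : ℝ} {w : ℤ → ℝ} {p T : ℕ} {φ : Fin p → ℝ}

lemma IsCausalAR.ae_sum_arVec (hε : IsCausalAR P φ Z ε) :
    ∀ᵐ ω ∂P, ∀ t : ℤ, ∑ j : Fin (p + 1), arVec φ j * ε (t - (j : ℕ)) ω = Z t ω := by
  refine ae_all_iff.2 fun t => (hε.autoregression t).mono fun ω hω => ?_
  simp only [Fin.sum_univ_succ, arVec_zero, arVec_succ, Fin.val_zero, Fin.val_succ,
    Nat.cast_zero, sub_zero, one_mul, Nat.cast_add, Nat.cast_one, neg_mul,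
    Finset.sum_neg_distrib]
  rw [hω]; ring

lemma arFilter_process {ω : Ω}
    (h : ∀ t : ℤ, ∑ j : Fin (p + 1), arVec φ j * ε (t - (j : ℕ)) ω = Z t ω) {t : ℕ} (ht : p ≤ t) :
    arFilter φ (fun t => ε (t : ℤ) ω) t = Z t ω := by
  rw [arFilter_eq, ← h]
  refine Finset.sum_congr rfl fun j _ => ?_
  rw [Nat.cast_sub ((Nat.lt_succ_iff.1 j.2).trans ht)]

lemma isLittleO_scA_of_integral {f : ℕ → Ω → ℝ} {C : ℝ}
    (hf : ∀ N, Integrable (f N) P ∧ ∫ ω, |f N ω| ∂P ≤ C * √N) :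
    (fun x : ℕ × Ω => f x.1 x.2) =o[probFilter P] fun x => scA x.1 := by
  refine isLittleO_of_integral (fun N => (hf N).1) (IsBigO.trans_isLittleO ?_ sqrt_isLittleO_scA)
  refine IsBigO.of_bound C (Eventually.of_forall fun N => ?_)
  rw [Real.norm_of_nonneg (integral_nonneg fun _ => abs_nonneg _),
    Real.norm_of_nonneg (Real.sqrt_nonneg _)]
  exact (hf N).2

lemma tendsto_probFilter_of_integral {f : ℕ → Ω → ℝ} {c : ℝ}
    (hf : ∀ N, Integrable (fun ω => f N ω - c) P)
    (h : Tendsto (fun N => ∫ ω, |f N ω - c| ∂P) atTop (𝓝 0)) :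
    Tendsto (fun x : ℕ × Ω => f x.1 x.2) (probFilter P) (𝓝 c) :=
  tendsto_sub_nhds_zero_iff.1 ((isLittleO_one_iff ℝ).1
    (isLittleO_of_integral (f := fun N ω => f N ω - c) hf ((isLittleO_one_iff ℝ).2 h)))

/-- The maximal inequality is available for the independent noise, not for the process. Filtering
turns partial sums of the process into those of the noise, up to `arOne φ` and boundary terms. The
finitely many seasonal sums are bounded in mean. -/
lemma IsMovingAverage.exists_noiseBound (hw : IsMovingAverage P Z ε w) (hZ : IsIIDNoise P Z σsq)
    (hε : IsCausalAR P φ Z ε) (h1 : arOne φ ≠ 0) (T : ℕ) :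
    ∃ Q : ℕ × Ω → ℝ, (Q =o[probFilter P] fun x => scA x.1) ∧
      ∀ᶠ x in probFilter P, NoiseBound p T x.1 (fun t => ε (t : ℤ) x.2) (Q x) := by
  set Q₁ : ℕ × Ω → ℝ := fun x =>
    |arOne φ|⁻¹ * (maxNoise Z x + arNorm φ * (2 * p) * maxProcess p ε x) with hQ₁
  set Q₂ : ℕ × Ω → ℝ := fun x => ∑ i ∈ Finset.range (p + 1), ∑ v : Fin T,
    |∑ t ∈ win p x.1, ε ((t - i : ℕ) : ℤ) x.2 * seasonInd T t v| with hQ₂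
  refine ⟨fun x => Q₁ x + Q₂ x, IsLittleO.add ?_ ?_, ?_⟩
  · exact (hZ.maxNoise_isLittleO.add ((hw.maxProcess_isLittleO hZ).const_mul_left _)).const_mul_left _
  · refine IsLittleO.fun_sum fun i hi => IsLittleO.fun_sum fun v _ => ?_
    refine isLittleO_abs_left.2 ?_
    exact isLittleO_scA_of_integral
      (f := fun N ω => ∑ t ∈ win p N, ε ((t - i : ℕ) : ℤ) ω * seasonInd T t v) fun N =>
        hw.integral_abs_sum_le hZ (Nat.lt_succ_iff.1 (Finset.mem_range.1 hi)) N fun t => by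
          rw [seasonInd]; split_ifs <;> simp
  · refine eventually_probFilter_of_ae fun N => hε.ae_sum_arVec.mono fun ω hω => ?_
    have hQ₂0 : 0 ≤ Q₂ (N, ω) :=
      Finset.sum_nonneg fun _ _ => Finset.sum_nonneg fun _ _ => abs_nonneg _
    have hps : ∀ n ≤ N, |∑ u ∈ Finset.Ico 1 (n + 1), ε (u : ℤ) ω| ≤ Q₁ (N, ω) := fun n hn => by
      have h2 := abs_arOne_mul_sum_le (F := fun t => ε t ω) (m := maxProcess p ε (N, ω)) φ
        (fun t ht ht' => abs_le_maxProcess ε ht ht' ω) hn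
      simp only [hω] at h2
      have h3 := le_maxNoise Z hn ω
      simp only [hQ₁]
      rw [← div_eq_inv_mul, le_div_iff₀ (abs_pos.2 h1)]
      linarith
    refine ⟨fun n hn => (hps n hn).trans (le_add_of_nonneg_right hQ₂0), fun i hi v => ?_⟩
    have hQ₁0 : 0 ≤ Q₁ (N, ω) := (abs_nonneg _).trans (hps 0 (Nat.zero_le N))
    refine le_trans ?_ (le_add_of_nonneg_left hQ₁0)
    refine le_trans ?_ (Finset.single_le_sum (f := fun i => ∑ v : Fin T,
      |∑ t ∈ win p N, ε ((t - i : ℕ) : ℤ) ω * seasonInd T t v|)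
      (fun _ _ => Finset.sum_nonneg fun _ _ => abs_nonneg _)
      (Finset.mem_range.2 (Nat.lt_succ_of_le hi)))
    exact Finset.single_le_sum (f := fun v : Fin T =>
      |∑ t ∈ win p N, ε ((t - i : ℕ) : ℤ) ω * seasonInd T t v|)
      (fun _ _ => abs_nonneg _) (Finset.mem_univ v)

/-- A fixed number of process values is bounded in mean, hence o(√(log N)) in probability. -/
lemma IsMovingAverage.exists_edgeBound (hw : IsMovingAverage P Z ε w) (hZ : IsIIDNoise P Z σsq)
    (p : ℕ) :
    ∃ R : ℕ × Ω → ℝ, ((fun x => R x ^ 2) =o[probFilter P] fun x => Real.log x.1) ∧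
      ∀ x, 0 ≤ R x ∧ (∀ t : ℕ, 1 ≤ t → t ≤ p → |ε (t : ℤ) x.2| ≤ R x) ∧
        ∀ t : ℕ, x.1 < t + p → t ≤ x.1 → |ε (t : ℤ) x.2| ≤ R x := by
  set R : ℕ → Ω → ℝ := fun N ω => ∑ t ∈ Finset.range (p + 1), |ε (t : ℤ) ω|
    + ∑ s ∈ Finset.range p, |ε ((N - s : ℕ) : ℤ) ω| with hR
  have hR0 : ∀ N ω, 0 ≤ R N ω := fun N ω =>
    add_nonneg (Finset.sum_nonneg fun _ _ => abs_nonneg _) (Finset.sum_nonneg fun _ _ => abs_nonneg _)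
  have hi1 : ∀ ω' : ℕ, Integrable (fun ω => |ε (ω' : ℤ) ω|) P := fun t => (hw.integrable hZ t).abs
  have hint : ∀ N, Integrable (R N) P := fun N =>
    (integrable_finsetSum _ fun t _ => hi1 t).add (integrable_finsetSum _ fun s _ => hi1 (N - s))
  set B := ∑' m, |w m| * ∫ ω, |Z 0 ω| ∂P with hB
  have hbd : ∀ N, ∫ ω, |R N ω| ∂P ≤ (p + 1) * B + p * B := fun N => by
    simp only [abs_of_nonneg (hR0 N _)]
    rw [hR, integral_add (integrable_finsetSum _ fun t _ => hi1 t)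
      (integrable_finsetSum _ fun s _ => hi1 (N - s)), integral_finsetSum _ fun t _ => hi1 t,
      integral_finsetSum _ fun s _ => hi1 (N - s)]
    refine add_le_add ?_ ?_
    · refine (Finset.sum_le_card_nsmul _ (fun t : ℕ => ∫ ω, |ε (t : ℤ) ω| ∂P) B
        fun t _ => hw.integral_abs_le hZ t).trans_eq ?_
      simp [hB]
    · refine (Finset.sum_le_card_nsmul _ (fun s : ℕ => ∫ ω, |ε ((N - s : ℕ) : ℤ) ω| ∂P) B
        fun s _ => hw.integral_abs_le hZ _).trans_eq ?_
      simp [hB]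
  have hsl : (fun _ : ℕ => (1 : ℝ)) =o[atTop] fun n : ℕ => √(Real.log n) := by
    simpa using const_isLittleO_log.sqrt (Eventually.of_forall Real.log_natCast_nonneg)
  have hO : (fun N => ∫ ω, |R N ω| ∂P) =o[atTop] fun n : ℕ => √(Real.log n) := by
    refine IsBigO.trans_isLittleO ?_ hsl
    refine IsBigO.of_bound ((p + 1) * B + p * B) (Eventually.of_forall fun N => ?_)
    rw [Real.norm_of_nonneg (integral_nonneg fun _ => abs_nonneg _), norm_one, mul_one]
    exact hbd N
  refine ⟨fun x => R x.1 x.2, ?_, fun x => ⟨hR0 _ _, fun t ht1 htp => ?_, fun t htp htN => ?_⟩⟩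
  · have h := (isLittleO_of_integral hint hO).pow two_pos
    simpa only [Real.sq_sqrt (Real.log_natCast_nonneg _)] using h
  · refine le_trans ?_ (le_add_of_nonneg_right (Finset.sum_nonneg fun _ _ => abs_nonneg _))
    exact Finset.single_le_sum (f := fun t : ℕ => |ε (t : ℤ) x.2|) (fun _ _ => abs_nonneg _)
      (Finset.mem_range.2 (Nat.lt_succ_of_le htp))
  · refine le_trans ?_ (le_add_of_nonneg_left (Finset.sum_nonneg fun _ _ => abs_nonneg _))
    have h := Finset.single_le_sum (f := fun s : ℕ => |ε ((x.1 - s : ℕ) : ℤ) x.2|)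
      (fun _ _ => abs_nonneg _) (Finset.mem_range.2 (show x.1 - t < p by omega))
    simpa only [Nat.sub_sub_self htN] using h

/-- With the true coefficients the filtered process is the noise, so the sum pairs the noise at time
`t` with values of the process strictly before `t`. -/
lemma IsMovingAverage.orth (hw : IsMovingAverage P Z ε w) (hZ : IsIIDNoise P Z σsq)
    (hε : IsCausalAR P φ Z ε) (i : Fin p) :
    (fun x : ℕ × Ω => ∑ j : Fin (p + 1), arVec φ j *
      lagProd p x.1 (fun t => ε (t : ℤ) x.2) (fun t => ε (t : ℤ) x.2) ((i : ℕ) + 1) j)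
      =o[probFilter P] fun x => scA x.1 := by
  have h := isLittleO_scA_of_integral
    (f := fun N ω => ∑ t ∈ win p N, ε ((t - ((i : ℕ) + 1) : ℕ) : ℤ) ω * Z t ω)
    fun N => hw.integral_abs_sum_mul_noise_le hZ i.2 N
  refine h.congr' ?_ EventuallyEq.rfl
  refine eventually_probFilter_of_ae fun N => hε.ae_sum_arVec.mono fun ω hω => ?_
  simp only [lagProd, Finset.mul_sum]
  rw [Finset.sum_comm]
  refine Finset.sum_congr rfl fun t ht => ?_
  have := (mem_win.1 ht).1
  rw [← arFilter_process (ε := ε) hω (show p ≤ t by omega), arFilter_eq, Finset.mul_sum]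
  exact Finset.sum_congr rfl fun j _ => by ring

lemma IsCausalAR.innov (hε : IsCausalAR P φ Z ε) (hZ : IsIIDNoise P Z σsq) :
    Tendsto (fun x : ℕ × Ω => (∑ t ∈ win p x.1, arFilter φ (fun t => ε (t : ℤ) x.2) t ^ 2) / x.1)
      (probFilter P) (𝓝 σsq) := by
  have h1 := hZ.tendsto_integral_abs_sum_mul p 0 0
  simp only [if_true] at h1
  have h2 := tendsto_probFilter_of_integral
    (f := fun N ω => (∑ t ∈ win p N, Z ((t : ℤ) - 0) ω * Z ((t : ℤ) - 0) ω) / N)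
    (fun N => hZ.integrable_lag_error (win p N) 0 0 N σsq) h1
  refine h2.congr' (eventually_probFilter_of_ae fun N => hε.ae_sum_arVec.mono fun ω hω => ?_)
  simp only [sub_zero]
  congr 1
  refine Finset.sum_congr rfl fun t ht => ?_
  have := (mem_win.1 ht).1
  rw [arFilter_process (ε := ε) hω (show p ≤ t by omega), sq]

/-- The trajectories of a causal autoregression are regular with probability tending to one. -/
theorem IsMovingAverage.regular (hw : IsMovingAverage P Z ε w) (hZ : IsIIDNoise P Z σsq)
    (hσ : 0 < σsq) (hε : IsCausalAR P φ Z ε) (T : ℕ) :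
    Regular (probFilter P) p T φ σsq (covMat P p ε) (fun x : ℕ × Ω => x.1)
      (fun (x : ℕ × Ω) (t : ℕ) => ε (t : ℤ) x.2) where
  n_tendsto := tendsto_fst_probFilter
  gram i j := tendsto_probFilter_of_integral
    (f := fun N ω => lagProd p N (fun t => ε t ω) (fun t => ε t ω) i j / N)
    (hw.tendsto_integral_abs_lagProd hZ i j).1 (hw.tendsto_integral_abs_lagProd hZ i j).2
  posDef := hw.covMat_posDef hZ hσ (hw.sum_arVec_mul hZ hσ hε)
  orth i := hw.orth hZ hε i
  innov := hε.innov hZ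
  noise := hw.exists_noiseBound hZ hε
    (arOne_ne_zero_of_inverse hw.summable (hw.sum_arVec_mul hZ hσ hε)) T
  edge := by
    obtain ⟨R, hR, h⟩ := hw.exists_edgeBound (ε := ε) hZ p
    exact ⟨R, hR, Eventually.of_forall h⟩

end AR

lemma Regular.mono {ι : Type*} {L L' : Filter ι} {p T : ℕ} {φ₀ : Fin p → ℝ} {σsq : ℝ}
    {Γ : Matrix (Fin (p + 1)) (Fin (p + 1)) ℝ} {n : ι → ℕ} {e : ι → ℕ → ℝ}
    (h : Regular L p T φ₀ σsq Γ n e) (hL : L' ≤ L) : Regular L' p T φ₀ σsq Γ n e where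
  n_tendsto := h.n_tendsto.mono_left hL
  gram i j := (h.gram i j).mono_left hL
  posDef := h.posDef
  orth i := (h.orth i).mono hL
  innov := h.innov.mono_left hL
  noise := h.noise.imp fun _ hQ => ⟨hQ.1.mono hL, hL hQ.2⟩
  edge := h.edge.imp fun _ hR => ⟨hR.1.mono hL, hL hR.2⟩

end BMDL

end

/-! ### Conclusion: consistency in probability for causal autoregressions -/

theorem theorem2 {Ω : Type*} [MeasurableSpace Ω] (P : Measure Ω) [IsProbabilityMeasure P]
    -- autoregression order, period, hyper-parameters, and metadata for each sample size
    (p T : ℕ) (hT : 0 < T) (a b₁ b₂ ν : ℝ) (ha : 0 < a) (hb₁ : 0 < b₁) (hb₂ : 0 < b₂)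
    (hν : 0 < ν) (doc : ℕ → Finset ℕ)
    -- the candidate set
    (M : ℕ) (d : ℝ) (hd : 0 < d) (hMd : (M : ℝ) ≤ 1 / d)
    -- the true configuration and the true parameters
    (lam0 : BMDL.Config) (hm0 : lam0.m ≤ M)
    (hgap : ∀ r ≤ lam0.m, d < lam0.edge (r + 1) - lam0.edge r)
    (μ0 : Fin lam0.m → ℝ)
    (hμ0 : ∀ r < lam0.m, BMDL.regimeMean μ0 r ≠ BMDL.regimeMean μ0 (r + 1))
    (s0 : Fin T → ℝ) (σsq0 : ℝ) (hσ : 0 < σsq0) (φ0 : Fin p → ℝ)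
    -- the errors and the observations
    (Z ε : ℤ → Ω → ℝ) (hZ : BMDL.IsIIDNoise P Z σsq0) (hε : BMDL.IsCausalAR P φ0 Z ε)
    (X : ℕ → Ω → ℕ → ℝ)
    (hX : ∀ N ω, X N ω = BMDL.obs lam0 s0 μ0 (fun t => ε (t : ℤ) ω) N)
    -- the estimated configuration
    (lamHat : ℕ → Ω → BMDL.Config)
    (hlam : ∀ N, ∀ᵐ ω ∂P,
      BMDL.IsBMDLMin p T a b₁ b₂ ν M d N (doc N) (X N ω) (lamHat N ω)) :
    -- the posterior mean has the stated closed form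
    (∀ N ω, 0 < BMDL.varHat p ν T N (lamHat N ω) (X N ω) →
      BMDL.meanHat p ν T N (lamHat N ω) (X N ω) =
        BMDL.ridgeMean ν N (lamHat N ω) (BMDL.yuleWalker p T N (lamHat N ω) (X N ω))
          (BMDL.seasonHat p ν T N (lamHat N ω) (X N ω)) (X N ω)) ∧
    -- regime means: the dimension is right and the entries are close, with probability to 1
    (∀ δ : ℝ, 0 < δ → Tendsto
      (fun N => P {ω | ¬ ∃ h : lam0.m = (lamHat N ω).m, ∀ k : Fin lam0.m,
        |BMDL.meanHat p ν T N (lamHat N ω) (X N ω) (Fin.cast h k) - μ0 k| < δ})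
      atTop (𝓝 0)) ∧
    TendstoInMeasure P (fun N ω => BMDL.seasonHat p ν T N (lamHat N ω) (X N ω))
      atTop (fun _ => s0) ∧
    TendstoInMeasure P (fun N ω => BMDL.varHat p ν T N (lamHat N ω) (X N ω))
      atTop (fun _ => σsq0) ∧
    TendstoInMeasure P (fun N ω => BMDL.yuleWalker p T N (lamHat N ω) (X N ω))
      atTop (fun _ => φ0) := by
  obtain ⟨w, hw⟩ := hε.exists_isMovingAverage
  have hinv := hw.sum_arVec_mul hZ hσ hε
  have hreg := hw.regular hZ hσ hε T
  have hadm : lam0 ∈ BMDL.admissible M d := ⟨hm0, fun r hr => (hgap r hr).le⟩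
  have hmin := BMDL.eventually_probFilter_of_ae (q := fun x : ℕ × Ω =>
    BMDL.IsBMDLMin p T a b₁ b₂ ν M d x.1 (doc x.1) (X x.1 x.2) (lamHat x.1 x.2)) hlam
  have hobs : ∀ (x : ℕ × Ω) (t : ℕ),
      X x.1 x.2 t = BMDL.fitFn lam0 x.1 s0 μ0 t + ε (t : ℤ) x.2 := fun x t => by
    rw [hX, BMDL.obs_eq]
  have hΨ := BMDL.tsum_abs_pos_of_inverse hw.summable hinv
  have hst := BMDL.seasonStable_of_inverse hT hw.summable hinv
  have h1 := BMDL.arOne_ne_zero_of_inverse hw.summable hinv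
  -- A property holds with probability tending to one exactly if it holds along every ultrafilter
  -- finer than `probFilter P`; regularity and minimality are inherited by these.
  have key := fun (U : Ultrafilter (ℕ × Ω)) (hU : (U : Filter (ℕ × Ω)) ≤ BMDL.probFilter P) =>
    BMDL.consistency (n := fun x : ℕ × Ω => x.1) (e := fun x t => ε (t : ℤ) x.2)
      (X := fun x => X x.1 x.2) (c := fun x => lamHat x.1 x.2) (doc := fun x => doc x.1)
      (hreg.mono hU) hσ hT hν ha hb₁ hb₂ hΨ hst h1 hd hadm hμ0 hobs (hU hmin)
  have hvar : Tendsto (fun x : ℕ × Ω => BMDL.varHat p ν T x.1 (lamHat x.1 x.2) (X x.1 x.2))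
      (BMDL.probFilter P) (𝓝 σsq0) := (tendsto_iff_ultrafilter _ _ _).2 fun U hU => (key U hU).2.2.1
  refine ⟨fun N ω h => BMDL.posteriorMean_eq_ridgeMean hν _ _ _ _ h _, fun δ hδ => ?_,
    BMDL.tendstoInMeasure_of_tendsto_probFilter
      ((tendsto_iff_ultrafilter _ _ _).2 fun U hU => (key U hU).2.1),
    BMDL.tendstoInMeasure_of_tendsto_probFilter hvar,
    BMDL.tendstoInMeasure_of_tendsto_probFilter
      ((tendsto_iff_ultrafilter _ _ _).2 fun U hU => (key U hU).2.2.2)⟩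
  have hmean : ∀ᶠ x in BMDL.probFilter P, ∃ h : lam0.m = (lamHat x.1 x.2).m, ∀ k : Fin lam0.m,
      |BMDL.regimeHat p ν T x.1 (lamHat x.1 x.2) (X x.1 x.2) (Fin.cast h k) - μ0 k| < δ :=
    mem_iff_ultrafilter.2 fun U hU => (key U hU).1 δ hδ
  refine (BMDL.eventually_probFilter (q := fun x : ℕ × Ω => ∃ h : lam0.m = (lamHat x.1 x.2).m,
    ∀ k : Fin lam0.m,
      |BMDL.meanHat p ν T x.1 (lamHat x.1 x.2) (X x.1 x.2) (Fin.cast h k) - μ0 k| < δ)).1 ?_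
  -- The posterior mean has its closed form only for a positive variance estimate; consistency of
  -- that estimate makes it positive with probability tending to one.
  filter_upwards [hmean, hvar.eventually_const_lt hσ] with x hx hx'
  obtain ⟨h, hk⟩ := hx
  refine ⟨h, fun k => ?_⟩
  rw [show BMDL.meanHat p ν T x.1 (lamHat x.1 x.2) (X x.1 x.2)
    = BMDL.regimeHat p ν T x.1 (lamHat x.1 x.2) (X x.1 x.2) from
      BMDL.posteriorMean_eq_ridgeMean hν _ _ _ _ hx' _]
  exact hk k
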